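/- **Setting.** Let $d\ge 1$, let $\mathbb M$ be either the flat torus $\mathbb T^d=\mathbb R^d/\mathbb Z^d$ or $\mathbb R^d$, write $z=(x,v)\in\mathbb M\times\mathbb R^d$, and let $s\ge d+2$ be an integer. For $t\ge0$ let $\gamma_j=\partial_{x_j}$ and $\gamma_{d+j}=\gamma_{d+j}(t)=t\,\partial_{x_j}+\partial_{v_j}$ ($1\le j\le d$), $\gamma^\beta(t)=\gamma_1^{\beta_1}\cdots\gamma_{2d}^{\beta_{2d}}$ for $\beta\in\mathbb N^{2d}$, and, for $k\in\mathbb N$, $$\|f\|_{\Gamma^k(t)}^2=\|f\|_{L^2_z}^2+\sum_{|\beta|=k}\|\gamma^\beta(t)f\|_{L^2_z}^2,\qquad \|f\|_{H^k_z}^2=\|f\|_{L^2_z}^2+\sum_{|\beta|=k}\|\partial_z^\beta f\|_{L^2_z}^2 ,$$ where derivatives are weak. For vector-valued functions the squared norms are summed over the components. For $T>0$ put $$\|f\|_{L^2_t\Gamma^k_z}^2=\int_0^T\|f(t)\|_{\Gamma^k(t)}^2\,dt,\qquad \|f\|_{L^\infty_t\Gamma^k_z}=\operatorname*{ess\,sup}_{t\in[0,T]}\|f(t)\|_{\Gamma^k(t)},$$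 and similarly for $L^2_tH^k_z$ and $L^\infty_tH^k_z$. Intersections and tuples are given the usual norms; in particular $\|f\|_{X\cap Y}=\|f\|_X+\|f\|_Y$. **Assumption on $H$** (with $T>0$ and a non-decreasing $\Phi_H:[0,\infty)\to[0,\infty)$). $H:[0,T]\times(\mathbb M\times\mathbb R^d)\times\mathbb R\times\mathbb R^d\to\mathbb R$, $(t,z,m,p)\mapsto H(t,z,m,p)$, is continuous, and is $C^{s+2}$ in $(z,m,p)$ for each $t$. For all $r>0$ and $t\in[0,T]$, $\|H(t,\cdot)\|_{C^{s+2}(\mathbb M\times\mathbb R^d\times B_r(0))}\le\Phi_H(r)$. For all $|\alpha|\le s$ and all $(m,p)\in (L^2\cap L^\infty)(\mathbb M\times\mathbb R^d;\mathbb R\times\mathbb R^d)$, $$\sup_{t\in[0,T]}\|(\partial_z^\alpha H)(t,\cdot,m,p)\|_{L^2_z}\le\Phi_H\big(\|(m,p)\|_{L^2_z\cap L^\infty_z}\big).$$ **Assumption on $g$** (with a non-decreasing $\Phi_g:[0,\infty)\to[0,\infty)$). $g:(\mathbb M\times\mathbb R^d)\times\mathbb R\to\mathbb R$ is $C^{s+1}$.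 For all $r>0$, $\|g\|_{C^{s+1}(\mathbb M\times\mathbb R^d\times B_r(0))}\le\Phi_g(r)$. For all $|\alpha|\le s$ and $m\in(L^2\cap L^\infty)(\mathbb M\times\mathbb R^d)$, $\|(\partial_z^\alpha g)(\cdot,m)\|_{L^2_z}\le\Phi_g(\|m\|_{L^2_z\cap L^\infty_z})$. **Operators.** $\mathcal H[m,p](t,z)=H(t,z,m(t,z),p(t,z))$, $\mathcal J[m,p](t,z)=m(t,z)\,D_pH(t,z,m(t,z),p(t,z))$, $\mathcal G[\mu](z)=g(z,\mu(z))$. **Proposition 2.5.** (i) Let $H$ satisfy its assumption. Then $\mathcal H$ and $\mathcal J$ are well defined as maps from $(L^2_tH^s_z\cap L^\infty_tH^{s-1}_z)^{d+1}$ into $L^2_tH^s_z$ and $(L^2_tH^s_z)^d$ respectively, and they are bounded and Lipschitz continuous on bounded sets. More precisely, there is a non-decreasing $F:[0,\infty)\to[0,\infty)$, depending only on $d,\mathbb M,s,\Phi_H$ (not on $T$, and on $H$ only through $\Phi_H$), such that for all $(m,p)\in(L^2_tH^s_z\cap L^\infty_tH^{s-1}_z)^{d+1}$ $$\|\mathcal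 H[m,p]\|_{L^2_t\Gamma^s_z}^2+\|\mathcal J[m,p]\|_{L^2_t\Gamma^s_z}^2\le\big(T+\|(m,p)\|_{L^2_t\Gamma^s_z}^2\big)(1+T)^{2s}F\big(\|(m,p)\|_{L^\infty_t\Gamma^{s-1}_z}^2\big),$$ and for all $(m_1,p_1),(m_2,p_2)$ in this space $$\|\mathcal H[m_1,p_1]-\mathcal H[m_2,p_2]\|_{L^2_t\Gamma^s_z}^2+\|\mathcal J[m_1,p_1]-\mathcal J[m_2,p_2]\|_{L^2_t\Gamma^s_z}^2\le(1+T)^{2s}F\Big(\max_i\|(m_i,p_i)\|_{L^\infty_t\Gamma^{s-1}_z}^2\Big)$$ $$\times\Big(\|(m_1-m_2,p_1-p_2)\|_{L^2_t\Gamma^s_z}^2+\|(m_1-m_2,p_1-p_2)\|_{L^\infty_t\Gamma^{s-1}_z}^2\big(T+\max_i\|(m_i,p_i)\|_{L^2_t\Gamma^s_z}^2\big)\Big).$$ (ii) Let $g$ satisfy its assumption. Then $\mathcal G$ is well defined as a map from $H^s_z$ into $H^s_z$, and it is bounded and Lipschitz continuous on bounded subsets of $H^s_z$. More precisely, there is a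 non-decreasing $G:[0,\infty)\to[0,\infty)$, depending only on $d,\mathbb M,s,\Phi_g$, such that for all $T>0$ and $\mu,\mu_1,\mu_2\in H^s_z$ $$\|\mathcal G[\mu]\|_{\Gamma^s(T)}^2\le(1+T)^{2s}\,G\big(\|\mu\|_{\Gamma^s(T)}^2\big),$$ $$\|\mathcal G[\mu_1]-\mathcal G[\mu_2]\|_{\Gamma^s(T)}^2\le(1+T)^{2s}\,G\Big(\max_i\|\mu_i\|_{\Gamma^s(T)}^2\Big)\|\mu_1-\mu_2\|_{\Gamma^s(T)}^2 .$$ -/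

import Mathlib

open MeasureTheory Set
open scoped NNReal ENNReal ContDiff

namespace KineticMFG

noncomputable section

/-! ### The phase space -/

/-- The spatial domain `𝕄`: the flat torus `𝕋^d = ℝ^d / ℤ^d` or the whole space `ℝ^d`. -/
inductive SpatialDomain
  | torus
  | euclidean

/-- Velocities, and momenta `p`, live in `ℝ^d`. -/
abbrev Vel (d : ℕ) : Type := EuclideanSpace ℝ (Fin d)

/-- Points `z = (x, v)` of `ℝ^d × ℝ^d`: the coordinates `Sum.inl j` are the `x_j`, and the
coordinates `Sum.inr j` are the `v_j`.  Functions on `𝕋^d × ℝ^d` are represented by functions on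
`ℝ^d × ℝ^d` which are `ℤ^d`-periodic in `x`. -/
abbrev Phase (d : ℕ) : Type := EuclideanSpace ℝ (Fin d ⊕ Fin d)

/-- The lattice translation vector `(k, 0)`, with `k ∈ ℤ^d`. -/
def latticeVec {d : ℕ} (k : Fin d → ℤ) : Phase d :=
  WithLp.toLp 2 (Sum.elim (fun j => (k j : ℝ)) (fun _ => 0))

/-- `f` is a function on `𝕄 × ℝ^d`: no condition if `𝕄 = ℝ^d`, and `ℤ^d`-periodicity in `x` if
`𝕄 = 𝕋^d`. -/
def IsFunOn {d : ℕ} {α : Type*} (M : SpatialDomain) (f : Phase d → α) : Prop :=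
  match M with
  | .torus => ∀ (k : Fin d → ℤ) (z : Phase d), f (z + latticeVec k) = f z
  | .euclidean => True

/-- A fundamental domain for `𝕄 × ℝ^d`: the set `[0,1)^d × ℝ^d` if `𝕄 = 𝕋^d`, everything if
`𝕄 = ℝ^d`. -/
def cell (d : ℕ) (M : SpatialDomain) : Set (Phase d) :=
  match M with
  | .torus => {z | ∀ j : Fin d, z (Sum.inl j) ∈ Ico (0 : ℝ) 1}
  | .euclidean => univ

/-- Lebesgue measure `dz = dx dv` on `𝕄 × ℝ^d`. -/
def phaseVol (d : ℕ) (M : SpatialDomain) : Measure (Phase d) := volume.restrict (cell d M)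

/-! ### Multi-indices, classical and weak derivatives along a frame of constant vector fields -/

/-- Multi-indices `β ∈ ℕ^{2d}`. -/
abbrev MultiIndex (d : ℕ) : Type := Fin d ⊕ Fin d → ℕ

/-- The order `|β|`. -/
def MultiIndex.order {d : ℕ} (β : MultiIndex d) : ℕ := ∑ i, β i

/-- `β` as the list of indices `1, …, 1, 2, …, 2, …`, the index `i` being repeated `β_i` times. -/
def MultiIndex.toIndexList {d : ℕ} (β : MultiIndex d) : List (Fin d ⊕ Fin d) :=
  (List.finRange d).flatMap (fun j => List.replicate (β (Sum.inl j)) (Sum.inl j)) ++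
    (List.finRange d).flatMap (fun j => List.replicate (β (Sum.inr j)) (Sum.inr j))

/-- A family of `2d` constant vector fields. -/
abbrev Frame (d : ℕ) : Type := Fin d ⊕ Fin d → Phase d

/-- The coordinate fields `∂_{x_j}`, `∂_{v_j}`, which make up `D_z`. -/
def coordFrame (d : ℕ) : Frame d := fun i => EuclideanSpace.single i 1

/-- The vector fields `γ(t)`: `γ_j = ∂_{x_j}` and `γ_{d+j} = t ∂_{x_j} + ∂_{v_j}`. -/
def gammaFrame (d : ℕ) (t : ℝ) : Frame d
  | Sum.inl j => EuclideanSpace.single (Sum.inl j) 1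
  | Sum.inr j => t • EuclideanSpace.single (Sum.inl j) 1 + EuclideanSpace.single (Sum.inr j) 1

/-- Iterated directional derivatives along the fields of the frame `e` listed in `L`. -/
def listDeriv {d : ℕ} (e : Frame d) : List (Fin d ⊕ Fin d) → (Phase d → ℝ) → Phase d → ℝ
  | [], f => f
  | i :: L, f => fun z => fderiv ℝ (listDeriv e L f) z (e i)

/-- The classical derivative `e^β f = e_1^{β_1} ⋯ e_{2d}^{β_{2d}} f` along a frame `e`;
for `e = coordFrame d` this is `∂_z^β f`, for `e = gammaFrame d t` it is `γ^β(t) f`. -/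
def multiDeriv {d : ℕ} (e : Frame d) (β : MultiIndex d) (f : Phase d → ℝ) : Phase d → ℝ :=
  listDeriv e β.toIndexList f

/-- `g` is an `L²(𝕄 × ℝ^d)` function which is the weak derivative `e^β f`.  (For periodic `f`, `g`
testing against `C_c^∞(ℝ^{2d})` is the same as testing against `C_c^∞(𝕋^d × ℝ^d)`, by
periodisation of the test function.) -/
structure IsL2WeakDeriv {d : ℕ} (M : SpatialDomain) (e : Frame d) (β : MultiIndex d)
    (f g : Phase d → ℝ) : Prop where
  isFunOn : IsFunOn M g
  memLp : MemLp g 2 (phaseVol d M)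
  weak : ∀ φ : Phase d → ℝ, ContDiff ℝ ∞ φ → HasCompactSupport φ →
    ∫ z, f z * multiDeriv e β φ z = (-1 : ℝ) ^ β.order * ∫ z, g z * φ z

/-! ### Sobolev spaces and norms in `z` -/

/-- `f ∈ H^s(𝕄 × ℝ^d)`: all weak derivatives `∂_z^β f` with `|β| ≤ s` are in `L²`. -/
structure MemHs {d : ℕ} (M : SpatialDomain) (s : ℕ) (f : Phase d → ℝ) : Prop where
  isFunOn : IsFunOn M f
  memLp : MemLp f 2 (phaseVol d M)
  weakDeriv : ∀ β : MultiIndex d, β.order ≤ s → ∃ g, IsL2WeakDeriv M (coordFrame d) β f g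

/-- `‖e^β f‖_{L²_z}^2`, where `e^β f` is the weak derivative (unique almost everywhere); it is `∞` if
`f` has no such weak derivative in `L²`. -/
def weakDerivSq {d : ℕ} (M : SpatialDomain) (e : Frame d) (β : MultiIndex d)
    (f : Phase d → ℝ) : ℝ≥0∞ :=
  ⨅ (g : Phase d → ℝ) (_ : IsL2WeakDeriv M e β f g), eLpNorm g 2 (phaseVol d M) ^ 2

/-- `∑_{|β| = s} ‖e^β f‖_{L²_z}^2 + ‖f‖_{L²_z}^2`. -/
def sobolevSq {d : ℕ} (M : SpatialDomain) (e : Frame d) (s : ℕ) (f : Phase d → ℝ) : ℝ≥0∞ :=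
  (∑ β ∈ Finset.piAntidiag (Finset.univ : Finset (Fin d ⊕ Fin d)) s, weakDerivSq M e β f) +
    eLpNorm f 2 (phaseVol d M) ^ 2

/-- The same for functions with values in `ℝ^d`, summing over components. -/
def sobolevSqVec {d : ℕ} (M : SpatialDomain) (e : Frame d) (s : ℕ) (p : Phase d → Vel d) : ℝ≥0∞ :=
  ∑ i, sobolevSq M e s (fun z => p z i)

/-- `‖f‖_{H^s_z}^2`. -/
def hsSq {d : ℕ} (M : SpatialDomain) (s : ℕ) (f : Phase d → ℝ) : ℝ≥0∞ :=
  sobolevSq M (coordFrame d) s f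

/-- `‖p‖_{H^s_z}^2` for `p` with values in `ℝ^d`. -/
def hsSqVec {d : ℕ} (M : SpatialDomain) (s : ℕ) (p : Phase d → Vel d) : ℝ≥0∞ :=
  sobolevSqVec M (coordFrame d) s p

/-- `‖f‖_{Γ^s(t)}^2`. -/
def gammaSq {d : ℕ} (M : SpatialDomain) (s : ℕ) (t : ℝ) (f : Phase d → ℝ) : ℝ≥0∞ :=
  sobolevSq M (gammaFrame d t) s f

/-- `‖p‖_{Γ^s(t)}^2` for `p` with values in `ℝ^d`. -/
def gammaSqVec {d : ℕ} (M : SpatialDomain) (s : ℕ) (t : ℝ) (p : Phase d → Vel d) : ℝ≥0∞ :=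
  sobolevSqVec M (gammaFrame d t) s p

/-! ### Spaces and norms in `(t, z)` -/

/-- Given `N t = ‖f(t)‖^2`, the squared `L²_t` norm over `[0,T]`. -/
def timeL2Sq (T : ℝ) (N : ℝ → ℝ≥0∞) : ℝ≥0∞ := ∫⁻ t in Icc 0 T, N t

/-- Given `N t = ‖f(t)‖^2`, the squared `L^∞_t` norm over `[0,T]`. -/
def timeLinfSq (T : ℝ) (N : ℝ → ℝ≥0∞) : ℝ≥0∞ := essSup N (volume.restrict (Icc 0 T))

/-- Measurability of a function of `(t, z) ∈ [0,T] × 𝕄 × ℝ^d`. -/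
def IsMeasFun {d : ℕ} (M : SpatialDomain) (T : ℝ) (f : ℝ → Phase d → ℝ) : Prop :=
  AEStronglyMeasurable (Function.uncurry f) ((volume.restrict (Icc 0 T)).prod (phaseVol d M))

/-- `f ∈ L²_t H^s_z`. -/
structure MemL2Hs {d : ℕ} (M : SpatialDomain) (s : ℕ) (T : ℝ) (f : ℝ → Phase d → ℝ) : Prop where
  meas : IsMeasFun M T f
  memHs : ∀ᵐ t ∂(volume.restrict (Icc 0 T)), MemHs M s (f t)
  finite : timeL2Sq T (fun t => hsSq M s (f t)) < ⊤

/-- `f ∈ L^∞_t H^s_z`. -/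
structure MemLinfHs {d : ℕ} (M : SpatialDomain) (s : ℕ) (T : ℝ) (f : ℝ → Phase d → ℝ) : Prop where
  meas : IsMeasFun M T f
  memHs : ∀ᵐ t ∂(volume.restrict (Icc 0 T)), MemHs M s (f t)
  finite : timeLinfSq T (fun t => hsSq M s (f t)) < ⊤

/-- `p ∈ (L²_t H^s_z)^d`. -/
def MemL2HsVec {d : ℕ} (M : SpatialDomain) (s : ℕ) (T : ℝ) (p : ℝ → Phase d → Vel d) : Prop :=
  ∀ i, MemL2Hs M s T (fun t z => p t z i)

/-- `(m, p) ∈ (L²_t H^s_z ∩ L^∞_t H^{s-1}_z)^{d+1}`. -/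
structure MemX {d : ℕ} (M : SpatialDomain) (s : ℕ) (T : ℝ)
    (m : ℝ → Phase d → ℝ) (p : ℝ → Phase d → Vel d) : Prop where
  m_L2 : MemL2Hs M s T m
  m_Linf : MemLinfHs M (s - 1) T m
  p_L2 : ∀ i, MemL2Hs M s T (fun t z => p t z i)
  p_Linf : ∀ i, MemLinfHs M (s - 1) T (fun t z => p t z i)

/-- The norm of `(m, p)` in `L²_t H^s_z ∩ L^∞_t H^{s-1}_z`. -/
def normX {d : ℕ} (M : SpatialDomain) (s : ℕ) (T : ℝ)
    (m : ℝ → Phase d → ℝ) (p : ℝ → Phase d → Vel d) : ℝ≥0∞ :=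
  timeL2Sq T (fun t => hsSq M s (m t) + hsSqVec M s (p t)) ^ (1 / 2 : ℝ) +
    timeLinfSq T (fun t => hsSq M (s - 1) (m t) + hsSqVec M (s - 1) (p t)) ^ (1 / 2 : ℝ)

/-- `‖(m, p)‖_{L²_t Γ^s_z}^2`. -/
def pairL2GammaSq {d : ℕ} (M : SpatialDomain) (s : ℕ) (T : ℝ)
    (m : ℝ → Phase d → ℝ) (p : ℝ → Phase d → Vel d) : ℝ≥0∞ :=
  timeL2Sq T (fun t => gammaSq M s t (m t) + gammaSqVec M s t (p t))

/-- `‖(m, p)‖_{L^∞_t Γ^s_z}^2`. -/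
def pairLinfGammaSq {d : ℕ} (M : SpatialDomain) (s : ℕ) (T : ℝ)
    (m : ℝ → Phase d → ℝ) (p : ℝ → Phase d → Vel d) : ℝ≥0∞ :=
  timeLinfSq T (fun t => gammaSq M s t (m t) + gammaSqVec M s t (p t))

/-! ### The data and the composition operators -/

/-- The critical exponent `s_* = d + 1`. -/
def sCrit (d : ℕ) : ℕ := d + 1

/-- The standing assumption on the Hamiltonian `H(t, z, m, p)`, with regularity index `s`, time
horizon `T` and bounding function `Φ`.  The `C^{s+2}` norm is the largest of the suprema of the
derivatives of order at most `s + 2`, and `|(m, p)|` is the Euclidean norm on `ℝ × ℝ^d`. -/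
structure HamiltonianAssumption {d : ℕ} (M : SpatialDomain) (s : ℕ) (T : ℝ) (Φ : ℝ≥0 → ℝ≥0)
    (H : ℝ → Phase d → ℝ → Vel d → ℝ) : Prop where
  isFunOn : ∀ t ∈ Icc 0 T, IsFunOn M (H t)
  continuous : ContinuousOn
    (fun y : ℝ × Phase d × ℝ × Vel d => H y.1 y.2.1 y.2.2.1 y.2.2.2) (Icc 0 T ×ˢ univ)
  contDiff : ∀ t ∈ Icc 0 T,
    ContDiff ℝ (s + 2 : ℕ) (fun y : Phase d × ℝ × Vel d => H t y.1 y.2.1 y.2.2)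
  mono : Monotone Φ
  bound : ∀ t ∈ Icc 0 T, ∀ r : ℝ≥0, ∀ (z : Phase d) (m : ℝ) (p : Vel d),
    ‖WithLp.toLp 2 (m, p)‖ < r → ∀ n ≤ s + 2,
      ‖iteratedFDeriv ℝ n (fun y : Phase d × ℝ × Vel d => H t y.1 y.2.1 y.2.2) (z, m, p)‖ ≤ Φ r
  l2Bound : ∀ α : MultiIndex d, α.order ≤ s → ∀ (m : Phase d → ℝ) (p : Phase d → Vel d),
    IsFunOn M m → IsFunOn M p →
    MemLp (fun z => WithLp.toLp 2 (m z, p z)) 2 (phaseVol d M) →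
    MemLp (fun z => WithLp.toLp 2 (m z, p z)) ∞ (phaseVol d M) →
    ∀ t ∈ Icc 0 T,
      eLpNorm (fun z => multiDeriv (coordFrame d) α (fun z' => H t z' (m z) (p z)) z) 2
          (phaseVol d M) ≤
        Φ (eLpNorm (fun z => WithLp.toLp 2 (m z, p z)) 2 (phaseVol d M) +
            eLpNorm (fun z => WithLp.toLp 2 (m z, p z)) ∞ (phaseVol d M)).toNNReal

/-- The standing assumption on the terminal coupling `g(z, m)`. -/
structure TerminalAssumption {d : ℕ} (M : SpatialDomain) (s : ℕ) (Φ : ℝ≥0 → ℝ≥0)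
    (g : Phase d → ℝ → ℝ) : Prop where
  isFunOn : IsFunOn M g
  contDiff : ContDiff ℝ (s + 1 : ℕ) (fun y : Phase d × ℝ => g y.1 y.2)
  mono : Monotone Φ
  bound : ∀ r : ℝ≥0, ∀ (z : Phase d) (m : ℝ), |m| < r → ∀ n ≤ s + 1,
    ‖iteratedFDeriv ℝ n (fun y : Phase d × ℝ => g y.1 y.2) (z, m)‖ ≤ Φ r
  l2Bound : ∀ α : MultiIndex d, α.order ≤ s → ∀ m : Phase d → ℝ, IsFunOn M m →
    MemLp m 2 (phaseVol d M) → MemLp m ∞ (phaseVol d M) →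
      eLpNorm (fun z => multiDeriv (coordFrame d) α (fun z' => g z' (m z)) z) 2 (phaseVol d M) ≤
        Φ (eLpNorm m 2 (phaseVol d M) + eLpNorm m ∞ (phaseVol d M)).toNNReal

/-- `J(t, z, m, p) = m D_p H(t, z, m, p)`. -/
def fluxJ {d : ℕ} (H : ℝ → Phase d → ℝ → Vel d → ℝ) (t : ℝ) (z : Phase d) (m : ℝ) (p : Vel d) :
    Vel d :=
  m • gradient (fun q : Vel d => H t z m q) p

/-- The operator `𝓗[m, p](t, z) = H(t, z, m(t, z), p(t, z))`. -/
def opH {d : ℕ} (H : ℝ → Phase d → ℝ → Vel d → ℝ)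
    (m : ℝ → Phase d → ℝ) (p : ℝ → Phase d → Vel d) : ℝ → Phase d → ℝ :=
  fun t z => H t z (m t z) (p t z)

/-- The operator `𝓙[m, p](t, z) = J(t, z, m(t, z), p(t, z))`. -/
def opJ {d : ℕ} (H : ℝ → Phase d → ℝ → Vel d → ℝ)
    (m : ℝ → Phase d → ℝ) (p : ℝ → Phase d → Vel d) : ℝ → Phase d → Vel d :=
  fun t z => fluxJ H t z (m t z) (p t z)

/-- The operator `𝓖[μ](z) = g(z, μ(z))`. -/
def opG {d : ℕ} (g : Phase d → ℝ → ℝ) (μ : Phase d → ℝ) : Phase d → ℝ :=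
  fun z => g z (μ z)

end

end KineticMFG

namespace KineticMFG

noncomputable section

/-! ### Periodicity, the fundamental domain, and the shear -/

/-! The moving frame is straightened by the shear `(x, v) ↦ (x + τ v, v)`. This linear map preserves
Lebesgue measure, fixes the lattice of periods and carries `coordFrame` to `gammaFrame`, so the
`Γ^k(τ)` norm of `f` is exactly the `H^k` norm of `f ∘ shear` (`gammaSq_eq`). A composition `G(z,
u(z))` becomes the composition of the sheared `u` with `G(shear z, ·)`, whose derivatives up to
order `s` are larger by at most `(1 + τ)^s` (`nonlinBound_shear`). This is the only source of the
factor `(1 + T)^{2s}`. What remains is a composition estimate in `H^s` in which the squared `H^s`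
norm enters linearly and the nonlinear constant sees only the `H^{s-1}` norm.

That estimate (`energy_comp_sub_le`, `hsSq_comp_sub_le`) is of Moser type. Faà di Bruno's formula
expresses the derivatives of `h(z, u₁) - h(z, u₂)` as sums over partitions, and each difference
splits into a change of the outer derivative and a change of one inner derivative
(`norm_iteratedFDeriv_comp_sub_le`). Products of inner derivatives of total order `m` are bounded,
by weighted AM-GM, by the powers `|D^j f|^{m/j}` (`prod_one_add_sub_one_le`). The `L²` norms of
these powers are controlled by the Gagliardo–Nirenberg inequality, provided `|f| ≤ 1`. Hence `u₁`
and `u₂` are divided by a sup bound `R`, and `u₁ - u₂` by a sup bound `lam`. Both bounds come from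
the embedding of `H^{s-1}` into `L^∞`, which in dimension `2d` uses `s - 1 ≥ d + 1`. The choice of
`lam` produces the product of the `H^{s-1}` difference with the `H^s` norms. The plain bound is the
case `u₂ = 0` after adding `h(z, 0)`, which the hypotheses place in `H^s`.

The analytic inequalities are first proved for smooth functions: Gagliardo–Nirenberg by integration
by parts on the cell, and Sobolev by Taylor's formula averaged over a ball. They pass to Sobolev
functions by mollification: mollification commutes with weak derivatives, does not increase `L²`
norms on the cell, and converges almost everywhere together with all derivatives, so Fatou's lemma
suffices (`memHs_of_tendsto_of_le`).

The fixed-time estimates are then integrated in time (`hamiltonian_estimates`) with a shear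
parameter `c t`: `c = 0` gives the `H^s` statements and `c t = t` the `Γ^s` statements. Integration
requires measurability in time of norms defined as infima (`aemeasurable_gammaSq`). The components
of the flux are nonlinearities of the same kind as `H`, with one derivative fewer. The terminal
coupling is the scalar case at a fixed `τ`, the lower norm being absorbed by `hsSq_le_hsSq`. -/

/-- The translation `ℤ^d → ℝ^d × ℝ^d` as a homomorphism. -/
def latticeHom (d : ℕ) : (Fin d → ℤ) →+ Phase d where
  toFun := latticeVec
  map_zero' := by ext i; rcases i with i | i <;> simp [latticeVec]
  map_add' a b := by ext i; rcases i with i | i <;> simp [latticeVec]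

/-- The group of periods of functions on `𝕄 × ℝ^d`. -/
def lattice (d : ℕ) (M : SpatialDomain) : AddSubgroup (Phase d) :=
  match M with
  | .torus => (latticeHom d).range
  | .euclidean => ⊥

instance (d : ℕ) (M : SpatialDomain) : Countable (lattice d M) := by
  cases M
  · exact (Set.countable_range (latticeHom d)).to_subtype
  · change Countable (⊥ : AddSubgroup (Phase d))
    infer_instance

/-- Invariance under a subgroup covers the torus and the whole space at once, the subgroup being
trivial in the second case. Later arguments rarely distinguish the two domains. -/
theorem isFunOn_iff {d : ℕ} {α : Type*} {M : SpatialDomain} {f : Phase d → α} :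
    IsFunOn M f ↔ ∀ g ∈ lattice d M, ∀ z, f (g + z) = f z := by
  cases M
  · constructor
    · rintro h _ ⟨k, rfl⟩ z
      rw [add_comm]; exact h k z
    · intro h k z
      rw [add_comm]; exact h _ ⟨k, rfl⟩ z
  · simp [IsFunOn, lattice]

theorem measurableSet_cell (d : ℕ) (M : SpatialDomain) : MeasurableSet (cell d M) := by
  cases M
  · have : cell d .torus = ⋂ j : Fin d, (fun z : Phase d => z (Sum.inl j)) ⁻¹' Ico (0 : ℝ) 1 := by
      ext z; simp [cell]
    rw [this]
    exact MeasurableSet.iInter fun j =>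
      (by fun_prop : Measurable fun z : Phase d => z (Sum.inl j)) measurableSet_Ico
  · exact MeasurableSet.univ

/-- The representative in the cell of a point. -/
def toCell {d : ℕ} (M : SpatialDomain) (z : Phase d) : Phase d :=
  match M with
  | .torus => latticeVec (fun j => -⌊z (Sum.inl j)⌋) + z
  | .euclidean => z

theorem toCell_mem {d : ℕ} (M : SpatialDomain) (z : Phase d) : toCell M z ∈ cell d M := by
  cases M
  · intro j
    simp only [toCell, latticeVec, PiLp.add_apply, Sum.elim_inl, Int.cast_neg]
    constructor
    · linarith [Int.floor_le (z (Sum.inl j))]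
    · linarith [Int.lt_floor_add_one (z (Sum.inl j))]
  · trivial

theorem toCell_eq {d : ℕ} (M : SpatialDomain) (z : Phase d) :
    ∃ g ∈ lattice d M, toCell M z = g + z := by
  cases M
  · exact ⟨_, ⟨_, rfl⟩, rfl⟩
  · exact ⟨0, zero_mem _, (zero_add z).symm⟩

theorem measurable_toCell {d : ℕ} (M : SpatialDomain) : Measurable (toCell (d := d) M) := by
  cases M
  · unfold toCell latticeVec
    refine Measurable.add ?_ measurable_id
    refine (WithLp.measurable_toLp 2 _).comp (measurable_pi_iff.2 ?_)
    rintro (i | i)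
    · simp only [Sum.elim_inl]
      have h1 : Measurable fun z : Phase d => z (Sum.inl i) := by fun_prop
      have h2 : Measurable fun x : ℝ => ((-⌊x⌋ : ℤ) : ℝ) :=
        (measurable_from_top (f := fun n : ℤ => ((-n : ℤ) : ℝ))).comp Int.measurable_floor
      exact h2.comp h1
    · simp
  · exact measurable_id

/-- Existence of a representative is the floor function. Uniqueness holds because two integers
shifting the same real number into `[0, 1)` differ by less than one. -/
theorem isAddFundamentalDomain_cell (d : ℕ) (M : SpatialDomain) :
    IsAddFundamentalDomain (lattice d M) (cell d M) (volume : Measure (Phase d)) := by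
  refine IsAddFundamentalDomain.mk' (measurableSet_cell d M).nullMeasurableSet fun z => ?_
  obtain ⟨g, hg, h⟩ := toCell_eq M z
  refine ⟨⟨g, hg⟩, ?_, ?_⟩
  · change g + z ∈ cell d M
    rw [← h]; exact toCell_mem M z
  · rintro ⟨g', hg'⟩ (h' : g' + z ∈ cell d M)
    have h1 : g + z ∈ cell d M := by rw [← h]; exact toCell_mem M z
    refine Subtype.ext ?_
    change g' = g
    cases M
    · obtain ⟨k, rfl⟩ := hg
      obtain ⟨k', rfl⟩ := hg'
      congr 1
      ext j
      have a1 := h1 j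
      have a2 := h' j
      simp only [latticeHom, latticeVec, AddMonoidHom.coe_mk, ZeroHom.coe_mk, PiLp.add_apply,
        Sum.elim_inl, mem_Ico] at a1 a2
      have b1 : ((k' j : ℤ) : ℝ) < k j + 1 := by linarith [a1.1, a2.2]
      have b2 : ((k j : ℤ) : ℝ) < k' j + 1 := by linarith [a1.2, a2.1]
      have c1 : k' j < k j + 1 := by exact_mod_cast b1
      have c2 : k j < k' j + 1 := by exact_mod_cast b2
      omega
    · have e1 : g = 0 := by simpa [lattice] using hg
      have e2 : g' = 0 := by simpa [lattice] using hg'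
      rw [e1, e2]

-- A translate of the cell is again a fundamental domain, since translations commute with the
-- lattice, and the integral of an invariant function does not depend on the fundamental domain.
open scoped Pointwise in
theorem lintegral_cell_add {d : ℕ} {M : SpatialDomain} {f : Phase d → ℝ≥0∞} (hf : IsFunOn M f)
    (h : Phase d) : ∫⁻ z in cell d M, f (h + z) = ∫⁻ z in cell d M, f z := by
  have hD := isAddFundamentalDomain_cell d M
  have hD' := hD.vadd_of_comm h
  rw [hD.setLIntegral_eq hD' f (fun g x => isFunOn_iff.1 hf g.1 g.2 x)]
  have hmp : MeasurePreserving (fun z : Phase d => h + z) volume volume :=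
    measurePreserving_add_left volume h
  have := hmp.setLIntegral_comp_preimage_emb (measurableEmbedding_addLeft h) f (h +ᵥ cell d M)
  rw [← this]
  congr 2
  ext z
  simp [Set.mem_vadd_set_iff_neg_vadd_mem]

open scoped Pointwise in
theorem integral_cell_add {d : ℕ} {M : SpatialDomain} {f : Phase d → ℝ} (hf : IsFunOn M f)
    (h : Phase d) : ∫ z in cell d M, f (h + z) = ∫ z in cell d M, f z := by
  have hD := isAddFundamentalDomain_cell d M
  have hD' := hD.vadd_of_comm h
  rw [hD.setIntegral_eq hD' (f := f) (fun g x => isFunOn_iff.1 hf g.1 g.2 x)]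
  have hmp : MeasurePreserving (fun z : Phase d => h + z) volume volume :=
    measurePreserving_add_left volume h
  have := hmp.setIntegral_preimage_emb (measurableEmbedding_addLeft h) f (h +ᵥ cell d M)
  rw [← this]
  congr 2
  ext z
  simp [Set.mem_vadd_set_iff_neg_vadd_mem]

/-- A periodic null set on the cell is null. -/
theorem ae_of_ae_cell {d : ℕ} {M : SpatialDomain} {p : Phase d → Prop} (hp : IsFunOn M p)
    (h : ∀ᵐ z ∂(phaseVol d M), p z) : ∀ᵐ z : Phase d, p z := by
  have hD := isAddFundamentalDomain_cell d M
  rw [ae_iff]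
  refine hD.measure_zero_of_invariant _ (fun g => ?_) ?_
  · ext z
    rw [Set.mem_vadd_set_iff_neg_vadd_mem]
    change ¬ p (((-g : lattice d M) : Phase d) + z) ↔ ¬ p z
    rw [isFunOn_iff.1 hp _ (-g).2]
  · rw [phaseVol, ae_restrict_iff' (measurableSet_cell d M), ae_iff] at h
    refine measure_mono_null ?_ h
    rintro z ⟨h1, h2⟩ h3
    exact h1 (h3 h2)

theorem ae_cell_of_ae {d : ℕ} {M : SpatialDomain} {p : Phase d → Prop}
    (h : ∀ᵐ z : Phase d, p z) : ∀ᵐ z ∂(phaseVol d M), p z :=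
  ae_restrict_of_ae h

/-- The cube around a point is contained in a translate of the cell. -/
theorem lintegral_ball_le {d : ℕ} {M : SpatialDomain} {f : Phase d → ℝ≥0∞} (hf : IsFunOn M f)
    (z : Phase d) : ∫⁻ y in Metric.ball z (1 / 2), f y ≤ ∫⁻ y in cell d M, f y := by
  -- This corner makes `z` the centre of the translated cell in the periodic coordinates, so every
  -- coordinate of a point within `1/2` of `z` stays in the unit interval.
  set h : Phase d := z - WithLp.toLp 2 (fun _ => (1 / 2 : ℝ)) with hh
  rw [← lintegral_cell_add hf h]
  have hmp : MeasurePreserving (fun z : Phase d => h + z) volume volume :=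
    measurePreserving_add_left volume h
  have := hmp.setLIntegral_comp_preimage_emb (measurableEmbedding_addLeft h) f
    (Metric.ball z (1 / 2))
  rw [← this]
  refine lintegral_mono_set ?_
  intro y hy
  cases M
  · intro j
    have h1 : ‖(h + y - z) (Sum.inl j)‖ < 1 / 2 :=
      (PiLp.norm_apply_le _ _).trans_lt (by
        have : dist (h + y) z < 1 / 2 := hy
        rwa [dist_eq_norm] at this)
    rw [Real.norm_eq_abs, abs_lt] at h1
    simp only [hh, PiLp.add_apply, PiLp.sub_apply] at h1
    constructor <;> linarith [h1.1, h1.2]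
  · trivial

/-! ### The shear. -/

/-- The nilpotent map `(x, v) ↦ (v, 0)`. -/
def shearNil (d : ℕ) : Phase d →L[ℝ] Phase d :=
  LinearMap.mkContinuous
    { toFun := fun z => WithLp.toLp 2 (Sum.elim (fun j => z (Sum.inr j)) (fun _ => 0))
      map_add' := fun a b => by ext i; rcases i with i | i <;> simp
      map_smul' := fun a b => by ext i; rcases i with i | i <;> simp } 1 (fun z => by
        rw [one_mul, EuclideanSpace.norm_eq, EuclideanSpace.norm_eq]
        refine Real.sqrt_le_sqrt ?_
        simp only [LinearMap.coe_mk, AddHom.coe_mk, Fintype.sum_sum_type, Sum.elim_inl,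
          Sum.elim_inr]
        have : 0 ≤ ∑ x : Fin d, ‖z (Sum.inl x)‖ ^ 2 := by positivity
        simpa using this)

@[simp] theorem shearNil_inl {d : ℕ} (z : Phase d) (j : Fin d) :
    shearNil d z (Sum.inl j) = z (Sum.inr j) := rfl

@[simp] theorem shearNil_inr {d : ℕ} (z : Phase d) (j : Fin d) :
    shearNil d z (Sum.inr j) = 0 := rfl

theorem norm_shearNil_le (d : ℕ) : ‖shearNil d‖ ≤ 1 :=
  LinearMap.mkContinuous_norm_le _ zero_le_one _

/-- The shear `(x, v) ↦ (x + τ v, v)`, which maps the coordinate frame to the frame `γ(τ)`. -/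
def shear (d : ℕ) (τ : ℝ) : Phase d →L[ℝ] Phase d := ContinuousLinearMap.id ℝ _ + τ • shearNil d

theorem shear_apply {d : ℕ} (τ : ℝ) (z : Phase d) : shear d τ z = z + τ • shearNil d z := rfl

@[simp] theorem shear_zero_apply {d : ℕ} (z : Phase d) : shear d 0 z = z := by
  simp [shear_apply]

/-- All powers of `1 + T` in the final estimates originate here. -/
theorem norm_shear_le {d : ℕ} {τ : ℝ} (hτ : 0 ≤ τ) : ‖shear d τ‖ ≤ 1 + τ := by
  refine (norm_add_le _ _).trans (add_le_add ContinuousLinearMap.norm_id_le ?_)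
  rw [norm_smul, Real.norm_of_nonneg hτ]
  exact mul_le_of_le_one_right hτ (norm_shearNil_le d)

@[simp] theorem shear_neg_shear {d : ℕ} (τ : ℝ) (z : Phase d) : shear d (-τ) (shear d τ z) = z := by
  ext i; rcases i with i | i <;> simp [shear_apply]

@[simp] theorem shear_shear_neg {d : ℕ} (τ : ℝ) (z : Phase d) : shear d τ (shear d (-τ) z) = z := by
  ext i; rcases i with i | i <;> simp [shear_apply]

theorem shear_coordFrame {d : ℕ} (τ : ℝ) (i : Fin d ⊕ Fin d) :
    shear d τ (coordFrame d i) = gammaFrame d τ i := by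
  ext k
  rcases i with i | i <;> rcases k with k | k <;>
    simp [shear_apply, coordFrame, gammaFrame, add_comm]

theorem gammaFrame_zero (d : ℕ) : gammaFrame d 0 = coordFrame d := by
  funext i
  rw [← shear_coordFrame, shear_zero_apply]

theorem continuous_shear {d : ℕ} : Continuous fun p : ℝ × Phase d => shear d p.1 p.2 := by
  simp only [shear_apply]
  fun_prop

theorem det_shear {d : ℕ} (τ : ℝ) : LinearMap.det (shear d τ : Phase d →ₗ[ℝ] Phase d) = 1 := by
  have : (shear d τ : Phase d →ₗ[ℝ] Phase d) =
      Matrix.toLin (EuclideanSpace.basisFun (Fin d ⊕ Fin d) ℝ).toBasis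
        (EuclideanSpace.basisFun (Fin d ⊕ Fin d) ℝ).toBasis
        (Matrix.fromBlocks 1 (τ • (1 : Matrix (Fin d) (Fin d) ℝ)) 0 1) := by
    refine (EuclideanSpace.basisFun (Fin d ⊕ Fin d) ℝ).toBasis.ext fun i => ?_
    rw [Matrix.toLin_self]
    ext k
    rcases i with i | i <;> rcases k with k | k <;>
      simp [shear_apply, Matrix.one_apply]
  rw [this, LinearMap.det_toLin, Matrix.det_fromBlocks_zero₂₁]
  simp

theorem measurePreserving_shear {d : ℕ} (τ : ℝ) :
    MeasurePreserving (shear d τ) (volume : Measure (Phase d)) volume := by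
  refine ⟨(shear d τ).continuous.measurable, ?_⟩
  have := Measure.map_linearMap_addHaar_eq_smul_addHaar (volume : Measure (Phase d))
    (f := (shear d τ : Phase d →ₗ[ℝ] Phase d)) (by rw [det_shear]; exact one_ne_zero)
  rw [det_shear] at this
  simpa using this

/-- The shear as a homeomorphism. -/
def shearHomeo (d : ℕ) (τ : ℝ) : Phase d ≃ₜ Phase d where
  toFun := shear d τ
  invFun := shear d (-τ)
  left_inv := shear_neg_shear τ
  right_inv := shear_shear_neg τ
  continuous_toFun := (shear d τ).continuous
  continuous_invFun := (shear d (-τ)).continuous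

/-- Periods have no velocity component. Consequently the shear commutes with the lattice
translations and acts on functions on the torus. -/
theorem shear_lattice {d : ℕ} {M : SpatialDomain} (τ : ℝ) {g : Phase d} (hg : g ∈ lattice d M) :
    shear d τ g = g := by
  cases M
  · obtain ⟨k, rfl⟩ := hg
    ext i; rcases i with i | i <;> simp [shear_apply, latticeHom, latticeVec]
  · have e1 : g = 0 := by simpa [lattice] using hg
    rw [e1, map_zero]

theorem IsFunOn.comp_shear {d : ℕ} {α : Type*} {M : SpatialDomain} {f : Phase d → α}
    (hf : IsFunOn M f) (τ : ℝ) : IsFunOn M (fun z => f (shear d τ z)) := by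
  rw [isFunOn_iff] at hf ⊢
  intro g hg z
  rw [map_add, shear_lattice τ hg, hf g hg]

/-- The sheared cell is another fundamental domain, because the shear commutes with the periods; the
measure is preserved because the determinant is one. -/
theorem lintegral_cell_shear {d : ℕ} {M : SpatialDomain} {f : Phase d → ℝ≥0∞} (hf : IsFunOn M f)
    (τ : ℝ) : ∫⁻ z in cell d M, f (shear d τ z) = ∫⁻ z in cell d M, f z := by
  have hD := isAddFundamentalDomain_cell d M
  have hD' : IsAddFundamentalDomain (lattice d M) (shear d (-τ) ⁻¹' cell d M)
      (volume : Measure (Phase d)) :=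
    hD.preimage_of_equiv (measurePreserving_shear (-τ)).quasiMeasurePreserving
      (e := id) Function.bijective_id (fun g z => by
        change shear d (-τ) ((g : Phase d) + z) = (g : Phase d) + shear d (-τ) z
        rw [map_add, shear_lattice _ g.2])
  rw [hD.setLIntegral_eq hD' f (fun g x => isFunOn_iff.1 hf g.1 g.2 x)]
  have := (measurePreserving_shear τ).setLIntegral_comp_preimage_emb
    (shearHomeo d τ).measurableEmbedding f (shear d (-τ) ⁻¹' cell d M)
  rw [← this]
  congr 2
  ext z
  simp

/-! ### Iterated directional derivatives -/

/-- Links iterated partial derivatives, in which weak derivatives are phrased, to the multilinear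
derivatives used by Taylor's and Faà di Bruno's formulas. -/
theorem listDeriv_eq_iteratedFDeriv {d : ℕ} (e : Frame d) {f : Phase d → ℝ} :
    ∀ (L : List (Fin d ⊕ Fin d)), ContDiff ℝ L.length f → ∀ z,
      listDeriv e L f z = iteratedFDeriv ℝ L.length f z (fun k => e (L.get k))
  | [], _, z => by simp [listDeriv]
  | i :: L, hf, z => by
    have hf' : ContDiff ℝ L.length f := hf.of_le (by simp)
    have h1 : listDeriv e L f =
        fun z => iteratedFDeriv ℝ L.length f z (fun k => e (L.get k)) := by
      funext z; exact listDeriv_eq_iteratedFDeriv e L hf' z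
    have hd : DifferentiableAt ℝ (iteratedFDeriv ℝ L.length f) z := by
      refine (hf.differentiable_iteratedFDeriv ?_) z
      simp only [List.length_cons]
      exact_mod_cast Nat.lt_succ_self _
    simp only [listDeriv]
    rw [h1]
    exact (hd.iteratedFDeriv_succ_apply_left' (m := fun k => e ((i :: L).get k))).symm

theorem contDiff_listDeriv {d : ℕ} (e : Frame d) {f : Phase d → ℝ} (L : List (Fin d ⊕ Fin d))
    {m : ℕ} {n : WithTop ℕ∞} (hf : ContDiff ℝ n f) (h : (m + L.length : ℕ) ≤ n) :
    ContDiff ℝ m (listDeriv e L f) := by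
  have h1 : ContDiff ℝ L.length f := hf.of_le (le_trans (by simp) h)
  have h2 : listDeriv e L f =
        fun z => iteratedFDeriv ℝ L.length f z (fun k => e (L.get k)) := by
    funext z; exact listDeriv_eq_iteratedFDeriv e L h1 z
  rw [h2]
  have h3 : ContDiff ℝ m (iteratedFDeriv ℝ L.length f) :=
    hf.iteratedFDeriv_right (by exact_mod_cast h)
  exact (ContinuousMultilinearMap.apply ℝ (fun _ : Fin L.length => Phase d) ℝ
    (fun k => e (L.get k))).contDiff.comp h3

theorem contDiff_infty_listDeriv {d : ℕ} (e : Frame d) {f : Phase d → ℝ}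
    (L : List (Fin d ⊕ Fin d)) (hf : ContDiff ℝ ∞ f) : ContDiff ℝ ∞ (listDeriv e L f) :=
  contDiff_infty.2 fun m => contDiff_listDeriv e L hf (by exact_mod_cast le_top)

theorem IsFunOn.fderiv {d : ℕ} {M : SpatialDomain} {F : Type*} [NormedAddCommGroup F]
    [NormedSpace ℝ F] {f : Phase d → F} (hf : IsFunOn M f) : IsFunOn M (fderiv ℝ f) := by
  rw [isFunOn_iff] at hf ⊢
  intro g hg z
  have : (fun z => f (g + z)) = f := funext fun z => hf g hg z
  rw [← fderiv_comp_add_left, this]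

theorem IsFunOn.iteratedFDeriv {d : ℕ} {M : SpatialDomain} {F : Type*} [NormedAddCommGroup F]
    [NormedSpace ℝ F] {f : Phase d → F} (hf : IsFunOn M f) (n : ℕ) :
    IsFunOn M (iteratedFDeriv ℝ n f) := by
  rw [isFunOn_iff] at hf ⊢
  intro g hg z
  have : (fun z => f (g + z)) = f := funext fun z => hf g hg z
  rw [← iteratedFDeriv_comp_add_left, this]

theorem IsFunOn.comp {d : ℕ} {M : SpatialDomain} {α β : Type*} {f : Phase d → α}
    (hf : IsFunOn M f) (φ : α → β) : IsFunOn M (fun z => φ (f z)) := by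
  rw [isFunOn_iff] at hf ⊢
  intro g hg z
  rw [hf g hg z]

theorem IsFunOn.comp₂ {d : ℕ} {M : SpatialDomain} {α β γ : Type*} {f : Phase d → α}
    {f' : Phase d → β} (hf : IsFunOn M f) (hf' : IsFunOn M f') (φ : α → β → γ) :
    IsFunOn M (fun z => φ (f z) (f' z)) := by
  rw [isFunOn_iff] at hf hf' ⊢
  intro g hg z
  rw [hf g hg z, hf' g hg z]

theorem IsFunOn.listDeriv {d : ℕ} {M : SpatialDomain} {f : Phase d → ℝ} (hf : IsFunOn M f)
    (e : Frame d) : ∀ L, IsFunOn M (listDeriv e L f)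
  | [] => hf
  | i :: L => (IsFunOn.listDeriv hf e L).fderiv.comp (fun T => T (e i))

theorem listDeriv_comp_shear {d : ℕ} (τ : ℝ) {f : Phase d → ℝ} :
    ∀ (L : List (Fin d ⊕ Fin d)), ContDiff ℝ L.length f →
      listDeriv (coordFrame d) L (fun z => f (shear d τ z)) =
        fun z => listDeriv (gammaFrame d τ) L f (shear d τ z)
  | [], _ => rfl
  | i :: L, hf => by
    have hf' : ContDiff ℝ L.length f := hf.of_le (by simp)
    funext z
    simp only [listDeriv]
    rw [listDeriv_comp_shear τ L hf']
    have h1 : ContDiff ℝ 1 (listDeriv (gammaFrame d τ) L f) :=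
      contDiff_listDeriv (m := 1) _ L hf (by simp [add_comm])
    have h2 := (((h1.differentiable one_ne_zero) (shear d τ z)).hasFDerivAt.comp z
      (shear d τ).hasFDerivAt).fderiv
    change _root_.fderiv ℝ (listDeriv (gammaFrame d τ) L f ∘ shear d τ) z (coordFrame d i) = _
    rw [h2, ContinuousLinearMap.comp_apply, shear_coordFrame]

/-- Needed for the test functions `y ↦ ρ (a - y)` that turn a weak derivative into a derivative of a
convolution. -/
theorem listDeriv_comp_sub_left {d : ℕ} (e : Frame d) (a : Phase d) {f : Phase d → ℝ} :
    ∀ (L : List (Fin d ⊕ Fin d)), ContDiff ℝ L.length f →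
      listDeriv e L (fun z => f (a - z)) =
        fun z => (-1 : ℝ) ^ L.length * listDeriv e L f (a - z)
  | [], _ => by simp [listDeriv]
  | i :: L, hf => by
    have hf' : ContDiff ℝ L.length f := hf.of_le (by simp)
    funext z
    simp only [listDeriv]
    rw [listDeriv_comp_sub_left e a L hf']
    have h1 : ContDiff ℝ 1 (listDeriv e L f) :=
      contDiff_listDeriv (m := 1) _ L hf (by simp [add_comm])
    have h2 := ((((h1.differentiable one_ne_zero) (a - z)).hasFDerivAt.comp z
      ((hasFDerivAt_id z).const_sub a)).const_mul ((-1 : ℝ) ^ L.length)).fderiv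
    change _root_.fderiv ℝ (fun y => (-1 : ℝ) ^ L.length * (listDeriv e L f ∘ HSub.hSub a) y) z
      (e i) = _
    rw [h2]
    simp [pow_succ]

/-- Symmetry of second derivatives settles a transposition, and transpositions generate.
Multi-indices give sorted lists, whereas basis expansions and integrations by parts produce
arbitrary orders. -/
theorem listDeriv_perm {d : ℕ} (e : Frame d) {f : Phase d → ℝ} {L L' : List (Fin d ⊕ Fin d)}
    (h : L.Perm L') : ContDiff ℝ L.length f → listDeriv e L f = listDeriv e L' f := by
  induction h with
  | nil => intro _; rfl
  | cons i _ ih =>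
    intro hf
    simp only [listDeriv]
    rw [ih (hf.of_le (by simp))]
  | swap i j L =>
    intro hf
    have hL : ContDiff ℝ 2 (listDeriv e L f) :=
      contDiff_listDeriv (m := 2) _ L hf
        (by simp only [List.length_cons]; exact_mod_cast (by omega))
    funext z
    have hs : IsSymmSndFDerivAt ℝ (listDeriv e L f) z :=
      hL.contDiffAt.isSymmSndFDerivAt (by simp)
    have hd : DifferentiableAt ℝ (_root_.fderiv ℝ (listDeriv e L f)) z :=
      ((hL.fderiv_right (m := 1) (by norm_num)).differentiable one_ne_zero) z
    simp only [listDeriv]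
    have key : ∀ a b : Phase d, _root_.fderiv ℝ (fun z => _root_.fderiv ℝ (listDeriv e L f) z a) z b =
        _root_.fderiv ℝ (_root_.fderiv ℝ (listDeriv e L f)) z b a := fun a b => by
      have := (hd.hasFDerivAt.clm_apply (hasFDerivAt_const a z)).fderiv
      rw [this]
      simp
    rw [key, key]
    exact hs.eq _ _
  | trans h1 _ ih1 ih2 =>
    intro hf
    rw [ih1 hf, ih2 (by rwa [← h1.length_eq])]

/-! ### Multi-indices and lists of indices. -/

theorem MultiIndex.count_toIndexList {d : ℕ} (β : MultiIndex d) (i : Fin d ⊕ Fin d) :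
    Multiset.count i (β.toIndexList : Multiset (Fin d ⊕ Fin d)) = β i := by
  have aux : ∀ (c : Fin d → ℕ) (k : Fin d), ((List.finRange d).map
      (fun j => if j = k then c j else 0)).sum = c k := by
    intro c k
    rw [← List.ofFn_eq_map, List.sum_ofFn, Finset.sum_ite_eq' Finset.univ k]
    simp
  rw [Multiset.coe_count]
  rcases i with i | i
  · simp only [MultiIndex.toIndexList, List.count_append, List.count_flatMap, Function.comp_def,
      List.count_replicate]
    rw [← aux (fun j => β (Sum.inl j)) i]
    simp
  · simp only [MultiIndex.toIndexList, List.count_append, List.count_flatMap, Function.comp_def,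
      List.count_replicate]
    rw [← aux (fun j => β (Sum.inr j)) i]
    simp

theorem MultiIndex.length_toIndexList {d : ℕ} (β : MultiIndex d) :
    β.toIndexList.length = β.order := by
  rw [MultiIndex.order, ← Finset.sum_congr rfl (fun i _ => β.count_toIndexList i)]
  have := Multiset.sum_count_eq_card (s := Finset.univ)
    (m := (β.toIndexList : Multiset (Fin d ⊕ Fin d))) (fun _ _ => Finset.mem_univ _)
  simpa using this.symm

/-- The multi-index counting the entries of a list. -/
def listIndex {d : ℕ} (L : List (Fin d ⊕ Fin d)) : MultiIndex d :=
  fun i => Multiset.count i (L : Multiset (Fin d ⊕ Fin d))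

theorem listIndex_perm {d : ℕ} (L : List (Fin d ⊕ Fin d)) :
    L.Perm (listIndex L).toIndexList :=
  Multiset.coe_eq_coe.1 (Multiset.ext.2 fun i => by rw [MultiIndex.count_toIndexList]; rfl)

theorem order_listIndex {d : ℕ} (L : List (Fin d ⊕ Fin d)) :
    (listIndex L).order = L.length := by
  rw [← MultiIndex.length_toIndexList, ← (listIndex_perm L).length_eq]

theorem mem_piAntidiag_iff_order {d k : ℕ} {β : MultiIndex d} :
    β ∈ Finset.piAntidiag (Finset.univ : Finset (Fin d ⊕ Fin d)) k ↔ β.order = k := by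
  simp [MultiIndex.order]

/-! ### Comparison of partial and full derivatives. -/

theorem norm_coordFrame {d : ℕ} (i : Fin d ⊕ Fin d) : ‖coordFrame d i‖ = 1 := by
  simp [coordFrame]

theorem abs_listDeriv_le {d : ℕ} {f : Phase d → ℝ} (L : List (Fin d ⊕ Fin d))
    (hf : ContDiff ℝ L.length f) (z : Phase d) :
    |listDeriv (coordFrame d) L f z| ≤ ‖iteratedFDeriv ℝ L.length f z‖ := by
  rw [listDeriv_eq_iteratedFDeriv _ L hf, ← Real.norm_eq_abs]
  refine (ContinuousMultilinearMap.le_opNorm _ _).trans ?_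
  simp [norm_coordFrame]

theorem abs_multiDeriv_le {d : ℕ} {f : Phase d → ℝ} (β : MultiIndex d)
    (hf : ContDiff ℝ β.order f) (z : Phase d) :
    |multiDeriv (coordFrame d) β f z| ≤ ‖iteratedFDeriv ℝ β.order f z‖ := by
  have := abs_listDeriv_le β.toIndexList (by rwa [β.length_toIndexList]) z
  rwa [β.length_toIndexList] at this

/-- Expand each argument in the orthonormal coordinate basis; every coordinate is bounded by the
norm. -/
theorem multilinear_norm_le_sum {d k : ℕ} {F : Type*} [NormedAddCommGroup F] [NormedSpace ℝ F]
    (T : ContinuousMultilinearMap ℝ (fun _ : Fin k => Phase d) F) :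
    ‖T‖ ≤ ∑ I : Fin k → Fin d ⊕ Fin d, ‖T (fun j => coordFrame d (I j))‖ := by
  refine ContinuousMultilinearMap.opNorm_le_bound (by positivity) fun v => ?_
  have hv : v = fun j => ∑ i, v j i • coordFrame d i := by
    funext j
    ext i
    rw [WithLp.ofLp_sum, Finset.sum_apply, Finset.sum_eq_single i] <;>
      simp +contextual [coordFrame, eq_comm]
  have h1 : T v = ∑ I : Fin k → Fin d ⊕ Fin d,
      (∏ j, v j (I j)) • T (fun j => coordFrame d (I j)) := by
    conv_lhs => rw [hv]
    rw [ContinuousMultilinearMap.map_sum]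
    exact Finset.sum_congr rfl fun I _ => T.map_smul_univ _ _
  rw [h1, Finset.sum_mul]
  refine (norm_sum_le _ _).trans (Finset.sum_le_sum fun I _ => ?_)
  rw [norm_smul, mul_comm, norm_prod]
  gcongr with j
  exact PiLp.norm_apply_le _ _

theorem iteratedFDeriv_coordFrame {d k : ℕ} {f : Phase d → ℝ} (hf : ContDiff ℝ k f)
    (I : Fin k → Fin d ⊕ Fin d) (z : Phase d) :
    iteratedFDeriv ℝ k f z (fun j => coordFrame d (I j)) =
      listDeriv (coordFrame d) (List.ofFn I) f z := by
  have h : ∀ (n : ℕ) (L : List (Fin d ⊕ Fin d)) (hn : L.length = n), ContDiff ℝ n f →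
      listDeriv (coordFrame d) L f z =
        iteratedFDeriv ℝ n f z (fun j => coordFrame d (L.get (Fin.cast hn.symm j))) := by
    rintro n L rfl hL
    exact listDeriv_eq_iteratedFDeriv _ L hL z
  rw [h k (List.ofFn I) List.length_ofFn hf]
  simp

theorem norm_iteratedFDeriv_le_sum_listDeriv {d k : ℕ} {f : Phase d → ℝ} (hf : ContDiff ℝ k f)
    (z : Phase d) :
    ‖iteratedFDeriv ℝ k f z‖ ≤
      ∑ I : Fin k → Fin d ⊕ Fin d, |listDeriv (coordFrame d) (List.ofFn I) f z| := by
  refine (multilinear_norm_le_sum _).trans (le_of_eq ?_)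
  refine Finset.sum_congr rfl fun I _ => ?_
  rw [iteratedFDeriv_coordFrame hf, Real.norm_eq_abs]

theorem listDeriv_eq_multiDeriv {d : ℕ} (e : Frame d) {f : Phase d → ℝ} (L : List (Fin d ⊕ Fin d))
    (hf : ContDiff ℝ L.length f) : listDeriv e L f = multiDeriv e (listIndex L) f :=
  listDeriv_perm e (listIndex_perm L) hf

/-- The norm of the full derivative is controlled by the partial derivatives. -/
theorem sq_norm_iteratedFDeriv_le {d k : ℕ} {f : Phase d → ℝ} (hf : ContDiff ℝ k f)
    (z : Phase d) :
    ‖iteratedFDeriv ℝ k f z‖ ^ 2 ≤ ((2 * d : ℕ) : ℝ) ^ (2 * k) *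
      ∑ β ∈ Finset.piAntidiag (Finset.univ : Finset (Fin d ⊕ Fin d)) k,
        multiDeriv (coordFrame d) β f z ^ 2 := by
  set Q := ∑ β ∈ Finset.piAntidiag (Finset.univ : Finset (Fin d ⊕ Fin d)) k,
        multiDeriv (coordFrame d) β f z ^ 2 with hQ
  have hQ0 : 0 ≤ Q := Finset.sum_nonneg fun _ _ => sq_nonneg _
  have h1 : ∀ I : Fin k → Fin d ⊕ Fin d,
      |listDeriv (coordFrame d) (List.ofFn I) f z| ≤ Real.sqrt Q := by
    intro I
    have hl : (List.ofFn I).length = k := List.length_ofFn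
    rw [listDeriv_eq_multiDeriv _ _ (by rwa [hl])]
    refine Real.abs_le_sqrt ?_
    exact Finset.single_le_sum (f := fun β => multiDeriv (coordFrame d) β f z ^ 2)
      (fun _ _ => sq_nonneg _) (mem_piAntidiag_iff_order.2 ((order_listIndex _).trans hl))
  have h2 := (norm_iteratedFDeriv_le_sum_listDeriv hf z).trans
    (Finset.sum_le_sum fun I _ => h1 I)
  have h3 : ∑ _I : Fin k → Fin d ⊕ Fin d, Real.sqrt Q =
      ((2 * d : ℕ) : ℝ) ^ k * Real.sqrt Q := by
    simp [two_mul]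
  rw [h3] at h2
  calc ‖iteratedFDeriv ℝ k f z‖ ^ 2 ≤ (((2 * d : ℕ) : ℝ) ^ k * Real.sqrt Q) ^ 2 := by gcongr
    _ = _ := by rw [mul_pow, Real.sq_sqrt hQ0, ← pow_mul, mul_comm k 2]

/-- Convergence of all partial derivatives implies convergence of the full derivative. -/
theorem exists_tendsto_iteratedFDeriv {d k : ℕ} {f : ℕ → Phase d → ℝ}
    (hf : ∀ n, ContDiff ℝ k (f n)) (z : Phase d)
    (h : ∀ β : MultiIndex d, β.order = k → ∃ a : ℝ,
      Filter.Tendsto (fun n => multiDeriv (coordFrame d) β (f n) z) Filter.atTop (nhds a)) :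
    ∃ T, Filter.Tendsto (fun n => iteratedFDeriv ℝ k (f n) z) Filter.atTop (nhds T) := by
  have hI : ∀ I : Fin k → Fin d ⊕ Fin d, ∃ a : ℝ, Filter.Tendsto
      (fun n => iteratedFDeriv ℝ k (f n) z (fun j => coordFrame d (I j))) Filter.atTop
        (nhds a) := by
    intro I
    have hl : (List.ofFn I).length = k := List.length_ofFn
    obtain ⟨a, ha⟩ := h (listIndex (List.ofFn I)) ((order_listIndex _).trans hl)
    refine ⟨a, ha.congr fun n => ?_⟩
    rw [iteratedFDeriv_coordFrame (hf n), listDeriv_eq_multiDeriv _ _ (by rw [hl]; exact hf n)]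
  choose a ha using hI
  refine cauchySeq_tendsto_of_complete ?_
  rw [Metric.cauchySeq_iff']
  intro ε hε
  set N : ℝ := ((Fintype.card (Fin k → Fin d ⊕ Fin d) : ℕ) : ℝ) with hN
  -- The `N` coefficients on basis vectors determine the multilinear map, so their convergence makes
  -- the sequence Cauchy. Dividing by `N + 1` gives a strict inequality and covers `N = 0`.
  have hev : ∀ᶠ n in Filter.atTop, ∀ I : Fin k → Fin d ⊕ Fin d,
      dist (iteratedFDeriv ℝ k (f n) z (fun j => coordFrame d (I j))) (a I) < ε / (2 * (N + 1)) :=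
    Filter.eventually_all.2 fun I => (ha I).eventually (Metric.ball_mem_nhds _ (by positivity))
  obtain ⟨n₀, hn₀⟩ := Filter.eventually_atTop.1 hev
  refine ⟨n₀, fun n hn => ?_⟩
  rw [dist_eq_norm]
  refine (multilinear_norm_le_sum _).trans_lt ?_
  have : ∀ I ∈ (Finset.univ : Finset (Fin k → Fin d ⊕ Fin d)),
      ‖(iteratedFDeriv ℝ k (f n) z - iteratedFDeriv ℝ k (f n₀) z)
        (fun j => coordFrame d (I j))‖ ≤ ε / (N + 1) := by
    intro I _
    rw [sub_apply, ← dist_eq_norm]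
    refine (dist_triangle_right _ _ (a I)).trans ?_
    have h1 := hn₀ n hn I
    have h2 := hn₀ n₀ le_rfl I
    have h3 : ε / (N + 1) = ε / (2 * (N + 1)) + ε / (2 * (N + 1)) := by field_simp; ring
    rw [h3]
    exact add_le_add h1.le h2.le
  refine (Finset.sum_le_sum this).trans_lt ?_
  rw [Finset.sum_const, nsmul_eq_mul, Finset.card_univ, ← hN, mul_div_assoc',
    div_lt_iff₀ (by positivity)]
  nlinarith

/-! ### Integration by parts on the cell -/

instance {d : ℕ} {M : SpatialDomain} : SFinite (phaseVol d M) := by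
  unfold phaseVol; infer_instance

/-- The integral of a directional derivative of a periodic function vanishes. -/
theorem integral_cell_deriv_eq_zero {d : ℕ} {M : SpatialDomain} {F G : Phase d → ℝ}
    (e : Phase d) (hF : IsFunOn M F) (hFc : Continuous F) (hG : IsFunOn M G)
    (hGc : Continuous G)
    (hd : ∀ z, ∀ t : ℝ, HasDerivAt (fun t : ℝ => F (t • e + z)) (G (t • e + z)) t)
    (hFi : Integrable F (phaseVol d M)) (hGi : Integrable G (phaseVol d M)) :
    ∫ z, G z ∂(phaseVol d M) = 0 := by
  have hsh : ∀ h : Phase d, Integrable (fun z => G (h + z)) (phaseVol d M) := by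
    intro h
    refine ⟨(hGc.comp (by fun_prop : Continuous fun z => h + z)).aestronglyMeasurable, ?_⟩
    have := hGi.2
    rw [hasFiniteIntegral_iff_enorm] at this ⊢
    rwa [phaseVol, lintegral_cell_add (hG.comp (fun x => ‖x‖ₑ)) h]
  have hnorm : ∀ h : Phase d, ∫ z, ‖G (h + z)‖ ∂(phaseVol d M) = ∫ z, ‖G z‖ ∂(phaseVol d M) :=
    fun h => integral_cell_add (hG.comp (fun x => ‖x‖)) h
  -- Translates along `e` are averaged over `0 ≤ t ≤ 1`. By translation invariance on the cell,
  -- integrating in `z` first returns the integral of `G`, while integrating in `t` first gives the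
  -- integral of `F (e + z) - F z`, which is zero. No boundary terms or cutoffs arise.
  have hint : Integrable (Function.uncurry fun (t : ℝ) z => G (t • e + z))
      ((volume.restrict (Ioc (0 : ℝ) 1)).prod (phaseVol d M)) := by
    rw [integrable_prod_iff]
    · refine ⟨Filter.Eventually.of_forall fun t => hsh (t • e), ?_⟩
      simp only [Function.uncurry]
      simp_rw [hnorm]
      exact integrable_const _
    · exact (hGc.comp (by fun_prop : Continuous fun p : ℝ × Phase d => p.1 • e + p.2)).aestronglyMeasurable
  have hswap := integral_integral_swap hint
  have h1 : ∀ t : ℝ, ∫ z, G (t • e + z) ∂(phaseVol d M) = ∫ z, G z ∂(phaseVol d M) :=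
    fun t => integral_cell_add hG _
  have h2 : ∀ z, ∫ t in Ioc (0 : ℝ) 1, G (t • e + z) = F (e + z) - F z := by
    intro z
    rw [← intervalIntegral.integral_of_le zero_le_one,
      intervalIntegral.integral_eq_sub_of_hasDerivAt (f := fun t : ℝ => F (t • e + z))
        (fun t _ => hd z t)]
    · simp
    · exact (hGc.comp (by fun_prop : Continuous fun t : ℝ => t • e + z)).intervalIntegrable _ _
  simp_rw [h1, h2] at hswap
  have hFe : Integrable (fun z => F (e + z)) (phaseVol d M) := by
    refine ⟨(hFc.comp (by fun_prop : Continuous fun z => e + z)).aestronglyMeasurable, ?_⟩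
    have := hFi.2
    rw [hasFiniteIntegral_iff_enorm] at this ⊢
    rwa [phaseVol, lintegral_cell_add (hF.comp (fun x => ‖x‖ₑ)) e]
  rw [integral_sub hFe hFi] at hswap
  have h3 : ∫ z, F (e + z) ∂(phaseVol d M) = ∫ z, F z ∂(phaseVol d M) := integral_cell_add hF e
  rw [h3, sub_self] at hswap
  simpa using hswap

/-- Away from zero this is the power rule. At zero the difference quotient is `|x|^(p - 2)` itself,
which is continuous. -/
theorem hasDerivAt_abs_rpow_mul {p : ℝ} (hp : 2 ≤ p) (x : ℝ) :
    HasDerivAt (fun x : ℝ => |x| ^ (p - 2) * x) ((p - 1) * |x| ^ (p - 2)) x := by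
  rcases lt_trichotomy x 0 with hx | rfl | hx
  · have h1 : HasDerivAt (fun x : ℝ => -(-x) ^ (p - 1)) ((p - 1) * |x| ^ (p - 2)) x := by
      have := ((Real.hasDerivAt_rpow_const (x := -x) (p := p - 1)
        (Or.inl (by linarith))).comp x (hasDerivAt_neg x)).neg
      refine HasDerivAt.congr_deriv (f := fun x : ℝ => -(-x) ^ (p - 1)) this ?_
      rw [abs_of_neg hx]; ring_nf
    refine h1.congr_of_eventuallyEq ?_
    filter_upwards [Iio_mem_nhds hx] with y hy
    have hy' : y < 0 := hy
    rw [abs_of_neg hy', show p - 1 = (p - 2) + 1 by ring, Real.rpow_add_one (by linarith)]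
    ring
  · rw [hasDerivAt_iff_tendsto_slope]
    have h1 : Filter.Tendsto (fun x : ℝ => |x| ^ (p - 2)) (nhdsWithin 0 {0}ᶜ)
        (nhds ((p - 1) * |(0 : ℝ)| ^ (p - 2))) := by
      have hc : Continuous fun x : ℝ => |x| ^ (p - 2) :=
        continuous_abs.rpow_const fun _ => Or.inr (by linarith)
      -- For `p = 2` the factor `p - 1` is one, with `0 ^ 0 = 1`; for `p > 2` both sides vanish.
      have h2 : (p - 1) * |(0 : ℝ)| ^ (p - 2) = |(0 : ℝ)| ^ (p - 2) := by
        rcases eq_or_lt_of_le hp with rfl | h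
        · norm_num
        · rw [abs_zero, Real.zero_rpow (by linarith)]; simp
      rw [h2]
      exact (hc.tendsto 0).mono_left nhdsWithin_le_nhds
    refine h1.congr' ?_
    filter_upwards [self_mem_nhdsWithin] with y hy
    have hy' : y ≠ 0 := hy
    rw [slope_def_field]
    field_simp
    simp
  · have h1 : HasDerivAt (fun x : ℝ => x ^ (p - 1)) ((p - 1) * |x| ^ (p - 2)) x := by
      have := (Real.hasDerivAt_rpow_const (x := x) (p := p - 1) (Or.inl hx.ne'))
      convert this using 1
      rw [abs_of_pos hx]; ring_nf
    refine h1.congr_of_eventuallyEq ?_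
    filter_upwards [Ioi_mem_nhds hx] with y hy
    have hy' : 0 < y := hy
    rw [abs_of_pos hy', show p - 1 = (p - 2) + 1 by ring, Real.rpow_add_one hy'.ne']

theorem integrable_mul_mul_bdd {α : Type*} [MeasurableSpace α] {μ : Measure α} {f g b : α → ℝ}
    (hf : MemLp f 2 μ) (hg : MemLp g 2 μ) (hb : AEStronglyMeasurable b μ) {C : ℝ}
    (hC : ∀ x, |b x| ≤ C) : Integrable (fun x => f x * g x * b x) μ :=
  (hf.integrable_mul hg).mul_bdd hb (Filter.Eventually.of_forall hC)

/-- With `h = ∂_e g`, the derivative along `e` of `g h |h|^(p-2)` is `|h|^p + (p-1) g (∂_e h)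
|h|^(p-2)`, and its integral over the cell is zero. The `L²` and sup bounds only serve
integrability. -/
theorem integral_abs_rpow_deriv_le {d : ℕ} {M : SpatialDomain} {g : Phase d → ℝ} {e : Phase d}
    {p : ℝ} (hp : 2 ≤ p) (hg : ContDiff ℝ 2 g) (hgM : IsFunOn M g)
    (m0 : MemLp g 2 (phaseVol d M)) (m1 : MemLp (fun z => fderiv ℝ g z e) 2 (phaseVol d M))
    (m2 : MemLp (fun z => fderiv ℝ (fun y => fderiv ℝ g y e) z e) 2 (phaseVol d M))
    {C : ℝ} (hC : ∀ z, |fderiv ℝ g z e| ≤ C) :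
    ∫ z, |fderiv ℝ g z e| ^ p ∂(phaseVol d M) ≤ (p - 1) * ∫ z, |g z| * |fderiv ℝ g z e| ^ (p - 2) *
      |fderiv ℝ (fun y => fderiv ℝ g y e) z e| ∂(phaseVol d M) := by
  set h : Phase d → ℝ := fun z => fderiv ℝ g z e with hh
  have hhd : ContDiff ℝ 1 h := (hg.fderiv_right (m := 1) (by norm_num)).clm_apply contDiff_const
  set h' : Phase d → ℝ := fun z => fderiv ℝ h z e with hh'
  have hh'c : Continuous h' := (hhd.continuous_fderiv one_ne_zero).clm_apply continuous_const
  have hhM : IsFunOn M h := hgM.fderiv.comp (fun T => T e)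
  have hh'M : IsFunOn M h' := hhM.fderiv.comp (fun T => T e)
  have hbc : Continuous fun z => |h z| ^ (p - 2) :=
    hhd.continuous.abs.rpow_const fun _ => Or.inr (by linarith)
  have hb : ∀ z, |(|h z| ^ (p - 2))| ≤ C ^ (p - 2) := fun z => by
    rw [abs_of_nonneg (by positivity)]
    exact Real.rpow_le_rpow (abs_nonneg _) (hC z) (by linarith)
  have i1 := integrable_mul_mul_bdd m0 m1 hbc.aestronglyMeasurable hb
  have i2 := integrable_mul_mul_bdd m1 m1 hbc.aestronglyMeasurable hb
  have i3 := integrable_mul_mul_bdd m0 m2 hbc.aestronglyMeasurable hb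
  have hder : ∀ z, ∀ t : ℝ, HasDerivAt (fun t : ℝ => g (t • e + z) * h (t • e + z) *
      |h (t • e + z)| ^ (p - 2)) (h (t • e + z) * h (t • e + z) * |h (t • e + z)| ^ (p - 2) +
        (p - 1) * (g (t • e + z) * h' (t • e + z) * |h (t • e + z)| ^ (p - 2))) t := by
    intro z t
    have hl : HasDerivAt (fun t : ℝ => t • e + z) e t := by
      simpa using ((hasDerivAt_id t).smul_const e).add_const z
    have d1 : HasDerivAt (fun t : ℝ => g (t • e + z)) (h (t • e + z)) t :=
      ((hg.differentiable two_ne_zero) _).hasFDerivAt.comp_hasDerivAt t hl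
    have d2 : HasDerivAt (fun t : ℝ => h (t • e + z)) (h' (t • e + z)) t :=
      ((hhd.differentiable one_ne_zero) _).hasFDerivAt.comp_hasDerivAt t hl
    have d3 := (hasDerivAt_abs_rpow_mul hp (h (t • e + z))).comp t d2
    have d4 : HasDerivAt (fun t : ℝ => g (t • e + z) *
        (|h (t • e + z)| ^ (p - 2) * h (t • e + z))) _ t := d1.mul d3
    have e4 : (fun t : ℝ => g (t • e + z) * h (t • e + z) * |h (t • e + z)| ^ (p - 2)) =
        fun t : ℝ => g (t • e + z) * (|h (t • e + z)| ^ (p - 2) * h (t • e + z)) := by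
      funext s; ring
    rw [e4]
    refine d4.congr_deriv ?_
    ring
  have key := integral_cell_deriv_eq_zero (M := M) (F := fun z => g z * h z * |h z| ^ (p - 2))
    (G := fun z => h z * h z * |h z| ^ (p - 2) + (p - 1) * (g z * h' z * |h z| ^ (p - 2))) e
    ((hgM.comp₂ hhM fun a b => (a, b)).comp fun x => x.1 * x.2 * |x.2| ^ (p - 2))
    (by have := hg.continuous; have := hhd.continuous; fun_prop)
    ((hgM.comp₂ (hhM.comp₂ hh'M fun a b => (a, b)) fun a b => (a, b)).comp fun x =>
      x.2.1 * x.2.1 * |x.2.1| ^ (p - 2) + (p - 1) * (x.1 * x.2.2 * |x.2.1| ^ (p - 2)))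
    (by have := hg.continuous; have := hhd.continuous; fun_prop) hder i1 (i2.add (i3.const_mul _))
  rw [integral_add i2 (i3.const_mul _), integral_const_mul] at key
  have e1 : ∀ z, |h z| ^ p = h z * h z * |h z| ^ (p - 2) := by
    intro z
    rw [← abs_mul_abs_self, ← sq, ← Real.rpow_natCast, ← Real.rpow_add_of_nonneg (abs_nonneg _)
      (by positivity) (by linarith)]
    congr 1
    push_cast; ring
  change ∫ z, |h z| ^ p ∂(phaseVol d M) ≤ (p - 1) * ∫ z, |g z| * |h z| ^ (p - 2) * |h' z| ∂(phaseVol d M)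
  simp_rw [e1]
  have e2 : ∫ z, h z * h z * |h z| ^ (p - 2) ∂(phaseVol d M) =
      (p - 1) * -∫ z, g z * h' z * |h z| ^ (p - 2) ∂(phaseVol d M) := by linarith
  rw [e2]
  refine mul_le_mul_of_nonneg_left ?_ (by linarith)
  rw [← integral_neg]
  refine integral_mono i3.neg ?_ fun z => ?_
  · refine i3.abs.congr (Filter.Eventually.of_forall fun z => ?_)
    simp only [abs_mul, abs_of_nonneg (Real.rpow_nonneg (abs_nonneg (h z)) (p - 2))]
    ring
  · simp only
    refine (neg_le_abs _).trans (le_of_eq ?_)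
    simp only [abs_mul, abs_of_nonneg (Real.rpow_nonneg (abs_nonneg (h z)) (p - 2))]
    ring

/-! ### Gagliardo–Nirenberg inequalities on the cell -/

/-- Classical functions on `𝕄 × ℝ^d` with derivatives up to order `k` in `L² ∩ L^∞`. -/
structure SmoothL2 {d : ℕ} (M : SpatialDomain) (k : ℕ) (f : Phase d → ℝ) : Prop where
  contDiff : ContDiff ℝ k f
  isFunOn : IsFunOn M f
  bdd : ∀ j ≤ k, ∃ C, ∀ z, ‖iteratedFDeriv ℝ j f z‖ ≤ C
  memLp : ∀ j ≤ k, MemLp (fun z => ‖iteratedFDeriv ℝ j f z‖) 2 (phaseVol d M)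

theorem SmoothL2.continuous_norm {d : ℕ} {M : SpatialDomain} {k : ℕ} {f : Phase d → ℝ}
    (hf : SmoothL2 M k f) {j : ℕ} (hj : j ≤ k) :
    Continuous fun z => ‖iteratedFDeriv ℝ j f z‖ :=
  (hf.contDiff.continuous_iteratedFDeriv (by exact_mod_cast hj)).norm

theorem SmoothL2.mono {d : ℕ} {M : SpatialDomain} {k k' : ℕ} {f : Phase d → ℝ}
    (hf : SmoothL2 M k f) (h : k' ≤ k) : SmoothL2 M k' f :=
  ⟨hf.contDiff.of_le (by exact_mod_cast h), hf.isFunOn, fun j hj => hf.bdd j (hj.trans h),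
    fun j hj => hf.memLp j (hj.trans h)⟩

theorem SmoothL2.memLp_listDeriv {d : ℕ} {M : SpatialDomain} {k : ℕ} {f : Phase d → ℝ}
    (hf : SmoothL2 M k f) (L : List (Fin d ⊕ Fin d)) (hL : L.length ≤ k) :
    MemLp (listDeriv (coordFrame d) L f) 2 (phaseVol d M) := by
  refine (hf.memLp _ hL).mono ?_ (Filter.Eventually.of_forall fun z => ?_)
  · exact (contDiff_listDeriv (m := 0) _ L hf.contDiff
      (by simpa using hL)).continuous.aestronglyMeasurable
  · rw [norm_norm]
    exact abs_listDeriv_le L (hf.contDiff.of_le (by exact_mod_cast hL)) z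

theorem SmoothL2.integrable_rpow {d : ℕ} {M : SpatialDomain} {k : ℕ} {f : Phase d → ℝ}
    (hf : SmoothL2 M k f) {j : ℕ} (hj : j ≤ k) {p : ℝ} (hp : 2 ≤ p) :
    Integrable (fun z => ‖iteratedFDeriv ℝ j f z‖ ^ p) (phaseVol d M) := by
  obtain ⟨C, hC⟩ := hf.bdd j hj
  have hc : Continuous fun z => ‖iteratedFDeriv ℝ j f z‖ ^ (p - 2) :=
    (hf.continuous_norm hj).rpow_const fun _ => Or.inr (by linarith)
  refine (integrable_mul_mul_bdd (hf.memLp j hj) (hf.memLp j hj) hc.aestronglyMeasurable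
    (C := C ^ (p - 2)) fun z => ?_).congr (Filter.Eventually.of_forall fun z => ?_)
  · rw [abs_of_nonneg (by positivity)]
    exact Real.rpow_le_rpow (norm_nonneg _) (hC z) (by linarith)
  · simp only
    rw [← sq, ← Real.rpow_natCast, ← Real.rpow_add_of_nonneg (norm_nonneg _)
      (by positivity) (by linarith)]
    congr 1
    push_cast; ring

theorem SmoothL2.integrable_mul {d : ℕ} {M : SpatialDomain} {k : ℕ} {f : Phase d → ℝ}
    (hf : SmoothL2 M k f) {j : ℕ} (hj : j + 2 ≤ k) {p : ℝ} (hp : 2 ≤ p) :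
    Integrable (fun z => ‖iteratedFDeriv ℝ j f z‖ * ‖iteratedFDeriv ℝ (j + 1) f z‖ ^ (p - 2) *
      ‖iteratedFDeriv ℝ (j + 2) f z‖) (phaseVol d M) := by
  obtain ⟨C, hC⟩ := hf.bdd (j + 1) (by omega)
  have hc : Continuous fun z => ‖iteratedFDeriv ℝ (j + 1) f z‖ ^ (p - 2) :=
    (hf.continuous_norm (by omega)).rpow_const fun _ => Or.inr (by linarith)
  refine (integrable_mul_mul_bdd (hf.memLp j (by omega)) (hf.memLp (j + 2) hj)
    hc.aestronglyMeasurable (C := C ^ (p - 2)) fun z => ?_).congr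
    (Filter.Eventually.of_forall fun z => ?_)
  · rw [abs_of_nonneg (by positivity)]
    exact Real.rpow_le_rpow (norm_nonneg _) (hC z) (by linarith)
  · simp only; ring

/-- Integration by parts for the full derivatives. -/
theorem SmoothL2.integral_rpow_le {d : ℕ} {M : SpatialDomain} {k : ℕ} {f : Phase d → ℝ}
    (hf : SmoothL2 M k f) {j : ℕ} (hj : j + 2 ≤ k) {p : ℝ} (hp : 2 ≤ p) :
    ∫ z, ‖iteratedFDeriv ℝ (j + 1) f z‖ ^ p ∂(phaseVol d M) ≤
      ((Fintype.card (Fin (j + 1) → Fin d ⊕ Fin d) : ℕ) : ℝ) ^ (p - 1) *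
        ((Fintype.card (Fin (j + 1) → Fin d ⊕ Fin d) : ℕ) : ℝ) * (p - 1) *
      ∫ z, ‖iteratedFDeriv ℝ j f z‖ * ‖iteratedFDeriv ℝ (j + 1) f z‖ ^ (p - 2) *
        ‖iteratedFDeriv ℝ (j + 2) f z‖ ∂(phaseVol d M) := by
  set N : ℝ := ((Fintype.card (Fin (j + 1) → Fin d ⊕ Fin d) : ℕ) : ℝ) with hN
  set A := ∫ z, ‖iteratedFDeriv ℝ j f z‖ * ‖iteratedFDeriv ℝ (j + 1) f z‖ ^ (p - 2) *
        ‖iteratedFDeriv ℝ (j + 2) f z‖ ∂(phaseVol d M) with hA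
  have hI : ∀ I : Fin (j + 1) → Fin d ⊕ Fin d,
      Integrable (fun z => |listDeriv (coordFrame d) (List.ofFn I) f z| ^ p) (phaseVol d M) ∧
      ∫ z, |listDeriv (coordFrame d) (List.ofFn I) f z| ^ p ∂(phaseVol d M) ≤ (p - 1) * A := by
    intro I
    rw [List.ofFn_succ]
    -- The first index of `I` is the direction of the integration by parts, and the derivative along
    -- the other `j` indices plays the role of `g`.
    set L := List.ofFn fun i : Fin j => I i.succ with hL
    have hl : L.length = j := List.length_ofFn
    have hg : ContDiff ℝ 2 (listDeriv (coordFrame d) L f) :=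
      contDiff_listDeriv (m := 2) _ L hf.contDiff (by rw [hl]; exact_mod_cast (by omega))
    have b0 : ∀ z, |listDeriv (coordFrame d) L f z| ≤ ‖iteratedFDeriv ℝ j f z‖ := fun z => by
      have := abs_listDeriv_le L (hf.contDiff.of_le (by rw [hl]; exact_mod_cast (by omega))) z
      rwa [hl] at this
    have b1 : ∀ i z, |listDeriv (coordFrame d) (i :: L) f z| ≤ ‖iteratedFDeriv ℝ (j + 1) f z‖ :=
      fun i z => by
        have := abs_listDeriv_le (i :: L) (hf.contDiff.of_le
          (by rw [List.length_cons, hl]; exact_mod_cast (by omega))) z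
        rwa [List.length_cons, hl] at this
    have b2 : ∀ i i' z, |listDeriv (coordFrame d) (i' :: i :: L) f z| ≤
        ‖iteratedFDeriv ℝ (j + 2) f z‖ := fun i i' z => by
      have := abs_listDeriv_le (i' :: i :: L) (hf.contDiff.of_le
        (by rw [List.length_cons, List.length_cons, hl]; exact_mod_cast (by omega))) z
      rwa [List.length_cons, List.length_cons, hl] at this
    have m1 := hf.memLp_listDeriv (I 0 :: L) (by rw [List.length_cons, hl]; omega)
    obtain ⟨C, hC⟩ := hf.bdd (j + 1) (by omega)
    refine ⟨?_, (integral_abs_rpow_deriv_le hp hg (hf.isFunOn.listDeriv _ L)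
      (hf.memLp_listDeriv L (by omega)) m1
      (hf.memLp_listDeriv (I 0 :: I 0 :: L) (by rw [List.length_cons, List.length_cons, hl]; omega))
      (C := C) fun z => (b1 (I 0) z).trans (hC z)).trans ?_⟩
    · refine (hf.integrable_rpow (j := j + 1) (by omega) hp).mono' ?_
        (Filter.Eventually.of_forall fun z => ?_)
      · have : Continuous (listDeriv (coordFrame d) (I 0 :: L) f) :=
          (contDiff_listDeriv (m := 0) _ (I 0 :: L) hf.contDiff
            (by rw [List.length_cons, hl]; exact_mod_cast (by omega))).continuous
        exact (this.abs.rpow_const fun _ => Or.inr (by linarith)).aestronglyMeasurable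
      · rw [Real.norm_of_nonneg (by positivity)]
        exact Real.rpow_le_rpow (abs_nonneg _) (b1 (I 0) z) (by linarith)
    · refine mul_le_mul_of_nonneg_left ?_ (by linarith)
      refine integral_mono_of_nonneg (Filter.Eventually.of_forall fun z => by positivity)
        (hf.integrable_mul hj hp) (Filter.Eventually.of_forall fun z => ?_)
      simp only
      gcongr
      · exact b0 z
      · exact b1 (I 0) z
      · exact b2 (I 0) (I 0) z
  -- Convexity of the `p`-th power costs `N^(p-1)`; summing the scalar estimates over the `N` index
  -- tuples gives the further factor `N`.
  have hpt : ∀ z, ‖iteratedFDeriv ℝ (j + 1) f z‖ ^ p ≤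
      N ^ (p - 1) * ∑ I : Fin (j + 1) → Fin d ⊕ Fin d,
        |listDeriv (coordFrame d) (List.ofFn I) f z| ^ p := by
    intro z
    have h1 := norm_iteratedFDeriv_le_sum_listDeriv
      (hf.contDiff.of_le (m := ((j + 1 : ℕ) : WithTop ℕ∞)) (by exact_mod_cast (by omega))) z
    refine (Real.rpow_le_rpow (norm_nonneg _) h1 (by linarith)).trans ?_
    have := Real.rpow_sum_le_const_mul_sum_rpow (s := Finset.univ)
      (f := fun I : Fin (j + 1) → Fin d ⊕ Fin d =>
        listDeriv (coordFrame d) (List.ofFn I) f z) (p := p) (by linarith)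
    simpa [hN] using this
  calc _ ≤ ∫ z, N ^ (p - 1) * ∑ I : Fin (j + 1) → Fin d ⊕ Fin d,
        |listDeriv (coordFrame d) (List.ofFn I) f z| ^ p ∂(phaseVol d M) :=
        integral_mono (hf.integrable_rpow (by omega) hp)
          ((integrable_finsetSum _ fun I _ => (hI I).1).const_mul _) hpt
    _ = N ^ (p - 1) * ∑ I : Fin (j + 1) → Fin d ⊕ Fin d, ∫ z,
        |listDeriv (coordFrame d) (List.ofFn I) f z| ^ p ∂(phaseVol d M) := by
        rw [integral_const_mul, integral_finsetSum _ fun I _ => (hI I).1]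
    _ ≤ N ^ (p - 1) * ∑ _I : Fin (j + 1) → Fin d ⊕ Fin d, (p - 1) * A := by
        refine mul_le_mul_of_nonneg_left (Finset.sum_le_sum fun I _ => (hI I).2) (by positivity)
    _ = _ := by
        rw [Finset.sum_const, nsmul_eq_mul, Finset.card_univ, ← hN]; ring

/-- Young's inequality with a small parameter. -/
theorem young_three {w₁ w₂ w₃ x y z ε : ℝ} (h₁ : 0 ≤ w₁) (h₂ : 0 ≤ w₂) (h₃ : 0 < w₃)
    (hw : w₁ + w₂ + w₃ = 1) (hx : 0 ≤ x) (hy : 0 ≤ y) (hz : 0 ≤ z) (hε : 0 < ε) :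
    x ^ w₁ * y ^ w₂ * z ^ w₃ ≤ ε * x + ε * y + ε ^ (-(w₁ + w₂) / w₃) * z := by
  have hw3 : w₃ ≠ 0 := h₃.ne'
  have hδ : 0 < ε ^ (-(w₁ + w₂) / w₃) := Real.rpow_pos_of_pos hε _
  have h := Real.geom_mean_le_arith_mean3_weighted h₁ h₂ h₃.le (p₁ := ε * x) (p₂ := ε * y)
    (p₃ := ε ^ (-(w₁ + w₂) / w₃) * z) (by positivity) (by positivity) (by positivity) hw
  -- The exponent on the third factor is chosen so that the powers of `ε` cancel in the geometric
  -- mean.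
  have e : (ε * x) ^ w₁ * (ε * y) ^ w₂ * (ε ^ (-(w₁ + w₂) / w₃) * z) ^ w₃ =
      x ^ w₁ * y ^ w₂ * z ^ w₃ := by
    rw [Real.mul_rpow hε.le hx, Real.mul_rpow hε.le hy, Real.mul_rpow hδ.le hz,
      ← Real.rpow_mul hε.le, div_mul_cancel₀ _ hw3]
    have : ε ^ w₁ * ε ^ w₂ * ε ^ (-(w₁ + w₂)) = 1 := by
      rw [← Real.rpow_add hε, ← Real.rpow_add hε, add_neg_cancel, Real.rpow_zero]
    linear_combination (x ^ w₁ * y ^ w₂ * z ^ w₃) * this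
  rw [← e]
  refine h.trans ?_
  have a1 : w₁ ≤ 1 := by linarith
  have a2 : w₂ ≤ 1 := by linarith
  have a3 : w₃ ≤ 1 := by linarith
  exact add_le_add (add_le_add (mul_le_of_le_one_left (by positivity) a1)
    (mul_le_of_le_one_left (by positivity) a2)) (mul_le_of_le_one_left (by positivity) a3)

/-- One step of the Gagliardo–Nirenberg chain. -/
theorem gagliardoNirenberg_step (d : ℕ) (M : SpatialDomain) (k : ℕ) :
    ∀ j : ℕ, j + 2 ≤ k → ∃ C : ℝ, 0 < C ∧ ∀ f : Phase d → ℝ, SmoothL2 M k f →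
      (∀ z, |f z| ≤ 1) →
      ∫ z, ‖iteratedFDeriv ℝ (j + 1) f z‖ ^ (2 * k / (j + 1 : ℕ) : ℝ) ∂(phaseVol d M) ≤
        C * ∫ z, ‖iteratedFDeriv ℝ (j + 2) f z‖ ^ (2 * k / (j + 2 : ℕ) : ℝ) ∂(phaseVol d M) := by
  -- The chain inequality before absorption, `B` being the constant obtained at the previous order.
  -- Since `K` is independent of `ε`, the term with `ε` can afterwards be moved to the left, all
  -- integrals being finite.
  have main : ∀ j : ℕ, j + 2 ≤ k → ∃ K : ℝ, 0 < K ∧ ∀ ε : ℝ, 0 < ε → ∃ C : ℝ, 0 < C ∧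
      ∀ f : Phase d → ℝ, SmoothL2 M k f → (∀ z, |f z| ≤ 1) → ∀ B : ℝ, 0 ≤ B →
      (1 ≤ j → ∫ z, ‖iteratedFDeriv ℝ j f z‖ ^ (2 * k / (j : ℕ) : ℝ) ∂(phaseVol d M) ≤
        B * ∫ z, ‖iteratedFDeriv ℝ (j + 1) f z‖ ^ (2 * k / (j + 1 : ℕ) : ℝ) ∂(phaseVol d M)) →
      ∫ z, ‖iteratedFDeriv ℝ (j + 1) f z‖ ^ (2 * k / (j + 1 : ℕ) : ℝ) ∂(phaseVol d M) ≤
        K * (ε * (B + 1) * ∫ z, ‖iteratedFDeriv ℝ (j + 1) f z‖ ^ (2 * k / (j + 1 : ℕ) : ℝ)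
            ∂(phaseVol d M)
        + C * ∫ z, ‖iteratedFDeriv ℝ (j + 2) f z‖ ^ (2 * k / (j + 2 : ℕ) : ℝ)
          ∂(phaseVol d M)) := by
    intro j hj
    have hk : (0 : ℝ) < k := by exact_mod_cast (by omega : 0 < k)
    have hjk : (j : ℝ) + 2 ≤ k := by exact_mod_cast hj
    set p : ℝ := 2 * k / (j + 1 : ℕ) with hp
    have hp2 : 2 ≤ p := by
      rw [hp, le_div_iff₀ (by positivity)]; push_cast; linarith
    have hq2 : (2 : ℝ) ≤ 2 * k / (j + 2 : ℕ) := by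
      rw [le_div_iff₀ (by positivity)]; push_cast; linarith
    set N : ℝ := ((Fintype.card (Fin (j + 1) → Fin d ⊕ Fin d) : ℕ) : ℝ) with hN
    have hN0 : 0 ≤ N := Nat.cast_nonneg _
    have hK0 : 0 ≤ N ^ (p - 1) * N * (p - 1) := by
      have : 0 ≤ p - 1 := by linarith
      positivity
    refine ⟨N ^ (p - 1) * N * (p - 1) + 1, by linarith, fun ε hε => ?_⟩
    -- The weights are the Hölder exponents of the three factors: with `D^i f` measured in
    -- `L^{2k/i}` they are `j/(2k)`, `(p-2)/p` and `(j+2)/(2k)`, which sum to one.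
    set w₁ : ℝ := j / (2 * k) with hw1
    set w₂ : ℝ := (k - (j + 1)) / k with hw2
    set w₃ : ℝ := (j + 2) / (2 * k) with hw3
    have h1 : 0 ≤ w₁ := by positivity
    have h2 : 0 ≤ w₂ := div_nonneg (by linarith) hk.le
    have h3 : 0 < w₃ := by positivity
    have hw : w₁ + w₂ + w₃ = 1 := by rw [hw1, hw2, hw3]; field_simp; ring
    refine ⟨ε ^ (-(w₁ + w₂) / w₃), Real.rpow_pos_of_pos hε _, fun f hf hf1 B hB hind => ?_⟩
    have hA := hf.integral_rpow_le hj hp2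
    set A := ∫ z, ‖iteratedFDeriv ℝ j f z‖ * ‖iteratedFDeriv ℝ (j + 1) f z‖ ^ (p - 2) *
      ‖iteratedFDeriv ℝ (j + 2) f z‖ ∂(phaseVol d M) with hAdef
    have hA0 : 0 ≤ A := integral_nonneg fun z => by positivity
    -- At `j = 0` the exponent `2k/j` is meaningless. There `w₁ = 0`, so any `X` has `X ^ w₁ = 1`,
    -- and `|f| ≤ 1` supplies the bound; the value zero contributes nothing to the integral.
    set X : Phase d → ℝ := fun z =>
      if j = 0 then 0 else ‖iteratedFDeriv ℝ j f z‖ ^ (2 * k / (j : ℕ) : ℝ) with hX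
    have hXi : Integrable X (phaseVol d M) := by
      rcases Nat.eq_zero_or_pos j with h0 | h0
      · simp [hX, h0]
      · simp only [hX, h0.ne', if_false]
        refine hf.integrable_rpow (by omega) ?_
        rw [le_div_iff₀ (by exact_mod_cast h0)]; push_cast; linarith
    have hXB : ∫ z, X z ∂(phaseVol d M) ≤
        B * ∫ z, ‖iteratedFDeriv ℝ (j + 1) f z‖ ^ p ∂(phaseVol d M) := by
      rcases Nat.eq_zero_or_pos j with h0 | h0
      · simp only [hX, h0, if_true, integral_zero]
        exact mul_nonneg hB (integral_nonneg fun z => by positivity)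
      · simp only [hX, h0.ne', if_false]
        exact hind h0
    have hpt : ∀ z, ‖iteratedFDeriv ℝ j f z‖ * ‖iteratedFDeriv ℝ (j + 1) f z‖ ^ (p - 2) *
        ‖iteratedFDeriv ℝ (j + 2) f z‖ ≤ ε * X z + ε * ‖iteratedFDeriv ℝ (j + 1) f z‖ ^ p +
          ε ^ (-(w₁ + w₂) / w₃) * ‖iteratedFDeriv ℝ (j + 2) f z‖ ^ (2 * k / (j + 2 : ℕ) : ℝ) := by
      intro z
      have hX0 : 0 ≤ X z := by
        simp only [hX]; split_ifs <;> positivity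
      refine le_trans ?_ (young_three (y := ‖iteratedFDeriv ℝ (j + 1) f z‖ ^ p)
        (z := ‖iteratedFDeriv ℝ (j + 2) f z‖ ^ (2 * k / (j + 2 : ℕ) : ℝ)) h1 h2 h3 hw hX0
        (by positivity) (by positivity) hε)
      have e1 : ‖iteratedFDeriv ℝ j f z‖ ≤ X z ^ w₁ := by
        rcases Nat.eq_zero_or_pos j with h0 | h0
        · subst h0
          simp only [hX, hw1, if_true, Nat.cast_zero, zero_div, Real.rpow_zero]
          simpa using hf1 z
        · have : (0 : ℝ) < j := by exact_mod_cast h0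
          simp only [hX, h0.ne', if_false, hw1]
          rw [← Real.rpow_mul (norm_nonneg _)]
          have : (2 * k / (j : ℕ) : ℝ) * (j / (2 * k)) = 1 := by field_simp
          rw [this, Real.rpow_one]
      have e2 : (‖iteratedFDeriv ℝ (j + 1) f z‖ ^ p) ^ w₂ =
          ‖iteratedFDeriv ℝ (j + 1) f z‖ ^ (p - 2) := by
        rw [← Real.rpow_mul (norm_nonneg _)]
        congr 1
        rw [hp, hw2]; push_cast; field_simp
      have e3 : (‖iteratedFDeriv ℝ (j + 2) f z‖ ^ (2 * k / (j + 2 : ℕ) : ℝ)) ^ w₃ =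
          ‖iteratedFDeriv ℝ (j + 2) f z‖ := by
        rw [← Real.rpow_mul (norm_nonneg _)]
        have : (2 * k / (j + 2 : ℕ) : ℝ) * w₃ = 1 := by
          rw [hw3]; push_cast; field_simp
        rw [this, Real.rpow_one]
      rw [e2, e3]
      gcongr
    have i2 := hf.integrable_rpow (j := j + 1) (by omega) hp2
    have i3 := hf.integrable_rpow (j := j + 2) (by omega) hq2
    have hAle : A ≤ ε * (B + 1) * ∫ z, ‖iteratedFDeriv ℝ (j + 1) f z‖ ^ p ∂(phaseVol d M) +
        ε ^ (-(w₁ + w₂) / w₃) *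
          ∫ z, ‖iteratedFDeriv ℝ (j + 2) f z‖ ^ (2 * k / (j + 2 : ℕ) : ℝ) ∂(phaseVol d M) := by
      have i12 : Integrable (fun z => ε * X z + ε * ‖iteratedFDeriv ℝ (j + 1) f z‖ ^ p)
        (phaseVol d M) := (hXi.const_mul ε).add (i2.const_mul ε)
      have := integral_mono (hf.integrable_mul hj hp2) (i12.add (i3.const_mul _)) hpt
      simp only [Pi.add_apply] at this
      rw [integral_add i12 (i3.const_mul _),
        integral_add (hXi.const_mul ε) (i2.const_mul ε), integral_const_mul, integral_const_mul,
        integral_const_mul] at this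
      have h5 := mul_le_mul_of_nonneg_left hXB hε.le
      rw [← hAdef] at this
      linarith
    refine hA.trans ?_
    calc _ ≤ (N ^ (p - 1) * N * (p - 1) + 1) * A :=
          mul_le_mul_of_nonneg_right (by linarith) hA0
      _ ≤ _ := mul_le_mul_of_nonneg_left hAle (by linarith)
  intro j
  induction j with
  | zero =>
    intro hj
    obtain ⟨K, hK, h⟩ := main 0 hj
    obtain ⟨C, hC, h⟩ := h (1 / (2 * K)) (by positivity)
    refine ⟨2 * K * C, by positivity, fun f hf hf1 => ?_⟩
    have := h f hf hf1 0 le_rfl (by omega)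
    rw [mul_add] at this
    have e : K * (1 / (2 * K) * (0 + 1) * ∫ z, ‖iteratedFDeriv ℝ (0 + 1) f z‖ ^
      (2 * k / (0 + 1 : ℕ) : ℝ) ∂(phaseVol d M)) = (∫ z, ‖iteratedFDeriv ℝ (0 + 1) f z‖ ^
      (2 * k / (0 + 1 : ℕ) : ℝ) ∂(phaseVol d M)) / 2 := by field_simp; ring
    rw [e] at this
    linarith
  | succ j ih =>
    intro hj
    obtain ⟨B, hB, ih⟩ := ih (by omega)
    obtain ⟨K, hK, h⟩ := main (j + 1) hj
    -- With this `ε` the term to be absorbed is exactly half of the left side, whence the final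
    -- constant `2 * K * C`.
    obtain ⟨C, hC, h⟩ := h (1 / (2 * K * (B + 1))) (by positivity)
    refine ⟨2 * K * C, by positivity, fun f hf hf1 => ?_⟩
    have := h f hf hf1 B hB.le (fun _ => ih f hf hf1)
    rw [mul_add] at this
    have e : K * (1 / (2 * K * (B + 1)) * (B + 1) * ∫ z, ‖iteratedFDeriv ℝ (j + 1 + 1) f z‖ ^
      (2 * k / (j + 1 + 1 : ℕ) : ℝ) ∂(phaseVol d M)) =
        (∫ z, ‖iteratedFDeriv ℝ (j + 1 + 1) f z‖ ^
      (2 * k / (j + 1 + 1 : ℕ) : ℝ) ∂(phaseVol d M)) / 2 := by field_simp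
    rw [e] at this
    linarith

/-- Gagliardo–Nirenberg: `‖D^j f‖_{L^{2k/j}}^{2k/j} ≤ C ‖D^k f‖_{L²}^2` if `|f| ≤ 1`. -/
theorem gagliardoNirenberg (d : ℕ) (M : SpatialDomain) (k j : ℕ) (hj : 1 ≤ j) (hjk : j ≤ k) :
    ∃ C : ℝ, 0 < C ∧ ∀ f : Phase d → ℝ, SmoothL2 M k f → (∀ z, |f z| ≤ 1) →
      ∫ z, ‖iteratedFDeriv ℝ j f z‖ ^ (2 * k / (j : ℕ) : ℝ) ∂(phaseVol d M) ≤
        C * ∫ z, ‖iteratedFDeriv ℝ k f z‖ ^ (2 : ℝ) ∂(phaseVol d M) := by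
  have key : ∀ n j : ℕ, 1 ≤ j → j + n = k →
      ∃ C : ℝ, 0 < C ∧ ∀ f : Phase d → ℝ, SmoothL2 M k f → (∀ z, |f z| ≤ 1) →
      ∫ z, ‖iteratedFDeriv ℝ j f z‖ ^ (2 * k / (j : ℕ) : ℝ) ∂(phaseVol d M) ≤
        C * ∫ z, ‖iteratedFDeriv ℝ k f z‖ ^ (2 : ℝ) ∂(phaseVol d M) := by
    intro n
    induction n with
    | zero =>
      intro j hj h
      obtain rfl : j = k := by omega
      refine ⟨1, one_pos, fun f _ _ => ?_⟩
      have : (2 * j / j : ℝ) = 2 := by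
        have : (j : ℝ) ≠ 0 := by exact_mod_cast (by omega)
        field_simp
      rw [this, one_mul]
    | succ n ih =>
      intro j hj h
      obtain ⟨C, hC, hC'⟩ := ih (j + 1) (by omega) (by omega)
      obtain ⟨i, rfl⟩ : ∃ i, j = i + 1 := ⟨j - 1, by omega⟩
      obtain ⟨C₁, hC₁, hC₁'⟩ := gagliardoNirenberg_step d M k i (by omega)
      refine ⟨C₁ * C, by positivity, fun f hf hf1 => (hC₁' f hf hf1).trans ?_⟩
      rw [mul_assoc]
      exact mul_le_mul_of_nonneg_left (hC' f hf hf1) hC₁.le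
  exact key (k - j) j hj (by omega)

/-- Interpolation between `L²` norms of derivatives. -/
theorem interpolation_step (d : ℕ) (M : SpatialDomain) :
    ∀ j : ℕ, ∃ C : ℝ, 0 < C ∧ ∀ f : Phase d → ℝ, SmoothL2 M (j + 1) f →
      ∫ z, ‖iteratedFDeriv ℝ j f z‖ ^ (2 : ℝ) ∂(phaseVol d M) ≤
        C * (∫ z, ‖iteratedFDeriv ℝ 0 f z‖ ^ (2 : ℝ) ∂(phaseVol d M) +
          ∫ z, ‖iteratedFDeriv ℝ (j + 1) f z‖ ^ (2 : ℝ) ∂(phaseVol d M)) := by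
  intro j
  induction j with
  | zero =>
    refine ⟨1, one_pos, fun f hf => ?_⟩
    have : 0 ≤ ∫ z, ‖iteratedFDeriv ℝ (0 + 1) f z‖ ^ (2 : ℝ) ∂(phaseVol d M) :=
      integral_nonneg fun z => by positivity
    linarith
  | succ j ih =>
    obtain ⟨B, hB, ih⟩ := ih
    set N : ℝ := ((Fintype.card (Fin (j + 1) → Fin d ⊕ Fin d) : ℕ) : ℝ) with hN
    set K : ℝ := N ^ ((2 : ℝ) - 1) * N * (2 - 1) + 1 with hK
    have hN0 : 0 ≤ N := Nat.cast_nonneg _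
    have hK0 : 0 < K := by
      have : 0 ≤ N ^ ((2 : ℝ) - 1) * N * (2 - 1) := by norm_num; positivity
      linarith
    -- After the induction hypothesis replaces the norm of order `j` by `B * (J₀ + J₁)`, this choice
    -- leaves `J₁ / 2`, which is absorbed.
    set ε : ℝ := 1 / (2 * K * B) with hε
    have hε0 : 0 < ε := by positivity
    refine ⟨1 + 2 * K * (ε ⁻¹), by positivity, fun f hf => ?_⟩
    have hA := hf.integral_rpow_le (j := j) (by omega) (p := 2) le_rfl
    set A := ∫ z, ‖iteratedFDeriv ℝ j f z‖ * ‖iteratedFDeriv ℝ (j + 1) f z‖ ^ ((2 : ℝ) - 2) *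
      ‖iteratedFDeriv ℝ (j + 2) f z‖ ∂(phaseVol d M) with hAdef
    have hA0 : 0 ≤ A := integral_nonneg fun z => by positivity
    have i1 := hf.integrable_rpow (j := j) (by omega) (p := 2) le_rfl
    have i2 := hf.integrable_rpow (j := j + 2) (by omega) (p := 2) le_rfl
    have hpt : ∀ z, ‖iteratedFDeriv ℝ j f z‖ * ‖iteratedFDeriv ℝ (j + 1) f z‖ ^ ((2 : ℝ) - 2) *
      ‖iteratedFDeriv ℝ (j + 2) f z‖ ≤ ε * ‖iteratedFDeriv ℝ j f z‖ ^ (2 : ℝ) +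
        ε⁻¹ * ‖iteratedFDeriv ℝ (j + 2) f z‖ ^ (2 : ℝ) := by
      intro z
      rw [sub_self, Real.rpow_zero, mul_one, Real.rpow_two, Real.rpow_two]
      set a := ‖iteratedFDeriv ℝ j f z‖
      set b := ‖iteratedFDeriv ℝ (j + 2) f z‖
      have hs : 0 ≤ ε * (a - ε⁻¹ * b) ^ 2 := by positivity
      have e : ε * (a - ε⁻¹ * b) ^ 2 = ε * a ^ 2 + ε⁻¹ * b ^ 2 - 2 * (a * b) := by
        field_simp; ring
      have h0 : 0 ≤ a * b := by positivity
      linarith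
    have hAle := integral_mono (hf.integrable_mul (j := j) (by omega) (p := 2) le_rfl)
      ((i1.const_mul ε).add (i2.const_mul ε⁻¹)) hpt
    simp only [Pi.add_apply] at hAle
    rw [integral_add (i1.const_mul ε) (i2.const_mul _), integral_const_mul, integral_const_mul,
      ← hAdef] at hAle
    have hi := ih f (hf.mono (by omega))
    set J₀ := ∫ z, ‖iteratedFDeriv ℝ 0 f z‖ ^ (2 : ℝ) ∂(phaseVol d M)
    set J := ∫ z, ‖iteratedFDeriv ℝ j f z‖ ^ (2 : ℝ) ∂(phaseVol d M)
    set J₁ := ∫ z, ‖iteratedFDeriv ℝ (j + 1) f z‖ ^ (2 : ℝ) ∂(phaseVol d M)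
    set J₂ := ∫ z, ‖iteratedFDeriv ℝ (j + 2) f z‖ ^ (2 : ℝ) ∂(phaseVol d M)
    have hJ0 : 0 ≤ J₀ := integral_nonneg fun z => by positivity
    have hJ2 : 0 ≤ J₂ := integral_nonneg fun z => by positivity
    have h1 : J₁ ≤ K * A := hA.trans (mul_le_mul_of_nonneg_right (by rw [hK]; linarith) hA0)
    have h2 : J₁ ≤ K * (ε * (B * (J₀ + J₁)) + ε⁻¹ * J₂) := by
      refine h1.trans (mul_le_mul_of_nonneg_left (hAle.trans ?_) hK0.le)
      gcongr
    have e : K * (ε * (B * (J₀ + J₁)) + ε⁻¹ * J₂) = (J₀ + J₁) / 2 + K * ε⁻¹ * J₂ := by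
      rw [mul_add, hε]; field_simp
    rw [e] at h2
    have h3 : 0 ≤ K * ε⁻¹ * J₀ := by positivity
    change J₁ ≤ (1 + 2 * K * ε⁻¹) * (J₀ + J₂)
    nlinarith

/-- Raise the top order by one at a time: the norm of order `k` is bounded by those of orders `0`
and `k + 1`. -/
theorem interpolation (d : ℕ) (M : SpatialDomain) (k j : ℕ) (hjk : j ≤ k) :
    ∃ C : ℝ, 0 < C ∧ ∀ f : Phase d → ℝ, SmoothL2 M k f →
      ∫ z, ‖iteratedFDeriv ℝ j f z‖ ^ (2 : ℝ) ∂(phaseVol d M) ≤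
        C * (∫ z, ‖iteratedFDeriv ℝ 0 f z‖ ^ (2 : ℝ) ∂(phaseVol d M) +
          ∫ z, ‖iteratedFDeriv ℝ k f z‖ ^ (2 : ℝ) ∂(phaseVol d M)) := by
  induction k, hjk using Nat.le_induction with
  | base =>
    refine ⟨1, one_pos, fun f _ => ?_⟩
    have : 0 ≤ ∫ z, ‖iteratedFDeriv ℝ 0 f z‖ ^ (2 : ℝ) ∂(phaseVol d M) :=
      integral_nonneg fun z => by positivity
    linarith
  | succ k hk ih =>
    obtain ⟨C, hC, h⟩ := ih
    obtain ⟨B, hB, h'⟩ := interpolation_step d M k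
    refine ⟨C * (1 + B), by positivity, fun f hf => (h f (hf.mono (by omega))).trans ?_⟩
    rw [mul_assoc]
    refine mul_le_mul_of_nonneg_left ?_ hC.le
    have h1 := h' f hf
    have : 0 ≤ ∫ z, ‖iteratedFDeriv ℝ (k + 1) f z‖ ^ (2 : ℝ) ∂(phaseVol d M) :=
      integral_nonneg fun z => by positivity
    linarith

/-! ### Sobolev embedding -/

/-- `‖D^j f‖_{L²}^2`. -/
def energy {d : ℕ} (M : SpatialDomain) (j : ℕ) {F : Type*} [NormedAddCommGroup F] [NormedSpace ℝ F]
    (f : Phase d → F) : ℝ≥0∞ := ∫⁻ z, ‖iteratedFDeriv ℝ j f z‖ₑ ^ 2 ∂(phaseVol d M)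

theorem lintegral_le_sqrt_mul_sqrt {α : Type*} [MeasurableSpace α] (μ : Measure α) {g : α → ℝ≥0∞}
    (hg : AEMeasurable g μ) :
    ∫⁻ x, g x ∂μ ≤ (μ univ) ^ (1 / 2 : ℝ) * (∫⁻ x, g x ^ 2 ∂μ) ^ (1 / 2 : ℝ) := by
  have := ENNReal.lintegral_mul_le_Lp_mul_Lq μ (p := 2) (q := 2)
    (Real.HolderConjugate.two_two) (f := fun _ => (1 : ℝ≥0∞)) (g := g) aemeasurable_const hg
  simpa using this

/-- Phase space has dimension `2d`, and the contracted ball lies in the original one. After a square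
root the Jacobian becomes `t^{-d}`, which matches the weight of the Taylor remainder. -/
theorem lintegral_ball_smul_le {d : ℕ} {g : Phase d → ℝ≥0∞} (hg : Measurable g) {t : ℝ}
    (ht0 : 0 < t) (ht1 : t ≤ 1) :
    ∫⁻ y in Metric.ball (0 : Phase d) (1 / 2), g (t • y) ≤
      ENNReal.ofReal (t ^ (2 * d))⁻¹ * ∫⁻ y in Metric.ball (0 : Phase d) (1 / 2), g y := by
  have hm := Measure.map_addHaar_smul (volume : Measure (Phase d)) ht0.ne'
  have h2 : Module.finrank ℝ (Phase d) = 2 * d := by simp [two_mul]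
  rw [h2, abs_of_pos (by positivity)] at hm
  have hB : MeasurableSet (Metric.ball (0 : Phase d) (1 / 2)) := measurableSet_ball
  calc ∫⁻ y in Metric.ball (0 : Phase d) (1 / 2), g (t • y)
      = ∫⁻ y, (Metric.ball (0 : Phase d) (1 / 2)).indicator (fun y => g (t • y)) y :=
        (lintegral_indicator hB _).symm
    _ ≤ ∫⁻ y, (Metric.ball (0 : Phase d) (1 / 2)).indicator g (t • y) := by
        refine lintegral_mono fun y => ?_
        by_cases hy : y ∈ Metric.ball (0 : Phase d) (1 / 2)
        · have : t • y ∈ Metric.ball (0 : Phase d) (1 / 2) := by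
            rw [mem_ball_zero_iff] at hy ⊢
            rw [norm_smul, Real.norm_of_nonneg ht0.le]
            exact (mul_le_of_le_one_left (norm_nonneg _) ht1).trans_lt hy
          rw [indicator_of_mem hy, indicator_of_mem this]
        · rw [indicator_of_notMem hy]; exact zero_le
    _ = ∫⁻ y, (Metric.ball (0 : Phase d) (1 / 2)).indicator g y ∂(Measure.map (t • ·) volume) := by
        rw [lintegral_map (hg.indicator hB) (measurable_const_smul t)]
    _ = _ := by
        rw [hm, lintegral_smul_measure, lintegral_indicator hB, smul_eq_mul]

/-- Taylor's formula is based at `z + y` and evaluated at `z`, so that averaging in `y` turns the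
values of the derivatives into integrals. The weight `(1 - t)^d` is kept because the points `z + (1
- t) y` concentrate at `z` as `t` tends to one. -/
theorem taylor_enorm_le {d : ℕ} {f : Phase d → ℝ} (hf : ContDiff ℝ (d + 1 : ℕ) f) (z y : Phase d)
    (hy : ‖y‖ ≤ 1) :
    ‖f z‖ₑ ≤ ∑ k ∈ Finset.range (d + 1), ‖iteratedFDeriv ℝ k f (z + y)‖ₑ +
      ∫⁻ t in Ioc (0 : ℝ) 1, ENNReal.ofReal ((1 - t) ^ d) *
        ‖iteratedFDeriv ℝ (d + 1) f (z + (1 - t) • y)‖ₑ := by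
  have h := map_add_eq_sum_add_integral_iteratedFDeriv (n := d) (f := f) (x := z + y) (y := -y)
    (fun t _ => by exact_mod_cast hf.contDiffAt)
  rw [add_neg_cancel_right] at h
  have hb : ∀ (k : ℕ) (x : Phase d),
      ‖iteratedFDeriv ℝ k f x (fun _ => -y)‖ₑ ≤ ‖iteratedFDeriv ℝ k f x‖ₑ := by
    intro k x
    refine enorm_le_iff_norm_le.2 ((ContinuousMultilinearMap.le_opNorm _ _).trans ?_)
    refine mul_le_of_le_one_right (norm_nonneg _) ?_
    exact Finset.prod_le_one (fun _ _ => norm_nonneg _) (fun _ _ => by rwa [norm_neg])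
  have hfac : ∀ k : ℕ, ‖((k.factorial : ℝ))⁻¹‖ₑ ≤ 1 := by
    intro k
    rw [← enorm_one (G := ℝ), enorm_le_iff_norm_le, norm_inv, norm_one, RCLike.norm_natCast]
    exact inv_le_one_of_one_le₀ (by exact_mod_cast k.factorial_pos)
  rw [h]
  refine (enorm_add_le _ _).trans (add_le_add ?_ ?_)
  · refine (enorm_sum_le _ _).trans (Finset.sum_le_sum fun k _ => ?_)
    rw [enorm_smul]
    exact (mul_le_mul' (hfac k) (hb k _)).trans (one_mul _).le
  · rw [enorm_smul, intervalIntegral.integral_of_le zero_le_one]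
    refine (mul_le_mul' (hfac d) (enorm_integral_le_lintegral_enorm _)).trans ?_
    rw [one_mul]
    refine setLIntegral_mono' measurableSet_Ioc fun t ht => ?_
    rw [enorm_smul, Real.enorm_of_nonneg (pow_nonneg (by linarith [ht.2]) _)]
    refine mul_le_mul' le_rfl ((hb _ _).trans (le_of_eq ?_))
    congr 2
    module

/-- The local Sobolev inequality of order `d + 1`. -/
theorem sobolev_sum (d : ℕ) (M : SpatialDomain) : ∃ C : ℝ≥0, ∀ f : Phase d → ℝ,
    ContDiff ℝ (d + 1 : ℕ) f → IsFunOn M f → ∀ z,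
      ‖f z‖ₑ ≤ C * ∑ k ∈ Finset.range (d + 2), energy M k f ^ (1 / 2 : ℝ) := by
  set V : ℝ≥0∞ := volume (Metric.ball (0 : Phase d) (1 / 2)) with hV
  have hV0 : V ≠ 0 := (Metric.measure_ball_pos _ _ (by norm_num)).ne'
  have hVt : V ≠ ⊤ := measure_ball_lt_top.ne
  set A : ℝ≥0∞ := V ^ (1 / 2 : ℝ) with hA
  have hAt : A ≠ ⊤ := ENNReal.rpow_ne_top_of_nonneg (by norm_num) hVt
  refine ⟨(V⁻¹ * A).toNNReal, fun f hf hM z => ?_⟩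
  rw [ENNReal.coe_toNNReal (ENNReal.mul_ne_top (ENNReal.inv_ne_top.2 hV0) hAt)]
  set B := Metric.ball (0 : Phase d) (1 / 2) with hB
  have hc : ∀ k ≤ d + 1, Continuous fun x => ‖iteratedFDeriv ℝ k f x‖ₑ := fun k hk =>
    (hf.continuous_iteratedFDeriv (by exact_mod_cast hk)).enorm
  -- the contribution of a derivative in the unscaled ball
  have hloc : ∀ k ≤ d + 1, ∫⁻ y in B, ‖iteratedFDeriv ℝ k f (z + y)‖ₑ ^ 2 ≤ energy M k f := by
    intro k hk
    have h1 : ∫⁻ y in B, ‖iteratedFDeriv ℝ k f (z + y)‖ₑ ^ 2 =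
        ∫⁻ y in Metric.ball z (1 / 2), ‖iteratedFDeriv ℝ k f y‖ₑ ^ 2 := by
      have hmp : MeasurePreserving (fun y : Phase d => z + y) volume volume :=
        measurePreserving_add_left volume z
      rw [← hmp.setLIntegral_comp_preimage_emb (measurableEmbedding_addLeft z)
        (fun y => ‖iteratedFDeriv ℝ k f y‖ₑ ^ 2) (Metric.ball z (1 / 2))]
      congr 2
      ext y; simp [hB, dist_eq_norm]
    rw [h1]
    exact lintegral_ball_le ((hM.iteratedFDeriv k).comp fun T => ‖T‖ₑ ^ 2) z
  have hCS : ∀ k ≤ d + 1, ∫⁻ y in B, ‖iteratedFDeriv ℝ k f (z + y)‖ₑ ≤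
      A * energy M k f ^ (1 / 2 : ℝ) := by
    intro k hk
    refine (lintegral_le_sqrt_mul_sqrt _ ?_).trans ?_
    · exact ((hc k hk).comp (by fun_prop : Continuous fun y => z + y)).measurable.aemeasurable
    · rw [Measure.restrict_apply_univ]
      gcongr
      exact hloc k hk
  have hscaled : ∀ t ∈ Ioo (0 : ℝ) 1, ∫⁻ y in B, ENNReal.ofReal ((1 - t) ^ d) *
      ‖iteratedFDeriv ℝ (d + 1) f (z + (1 - t) • y)‖ₑ ≤ A * energy M (d + 1) f ^ (1 / 2 : ℝ) := by
    intro t ht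
    have hs0 : 0 < 1 - t := by linarith [ht.2]
    have hs1 : 1 - t ≤ 1 := by linarith [ht.1]
    set τ := 1 - t
    rw [lintegral_const_mul' _ _ ENNReal.ofReal_ne_top]
    have hm : Measurable fun y => ‖iteratedFDeriv ℝ (d + 1) f (z + y)‖ₑ :=
      ((hc (d + 1) le_rfl).comp (by fun_prop : Continuous fun y => z + y)).measurable
    have h1 := lintegral_le_sqrt_mul_sqrt (volume.restrict B)
      (g := fun y => ‖iteratedFDeriv ℝ (d + 1) f (z + τ • y)‖ₑ)
      (hm.comp (measurable_const_smul τ)).aemeasurable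
    have h2 := lintegral_ball_smul_le (hm.pow_const 2) hs0 hs1
    rw [Measure.restrict_apply_univ] at h1
    -- The factor `τ^{-d}` produced here cancels the Taylor weight `τ^d` exactly, which is why order
    -- `d + 1` suffices in dimension `2d`.
    have h3 : (∫⁻ y in B, ‖iteratedFDeriv ℝ (d + 1) f (z + τ • y)‖ₑ ^ 2) ^ (1 / 2 : ℝ) ≤
        ENNReal.ofReal (τ ^ d)⁻¹ * energy M (d + 1) f ^ (1 / 2 : ℝ) := by
      calc _ ≤ (ENNReal.ofReal (τ ^ (2 * d))⁻¹ * energy M (d + 1) f) ^ (1 / 2 : ℝ) := by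
            gcongr
            exact h2.trans (mul_le_mul' le_rfl (hloc _ le_rfl))
        _ = _ := by
            rw [ENNReal.mul_rpow_of_nonneg _ _ (by norm_num),
              ENNReal.ofReal_rpow_of_nonneg (by positivity) (by norm_num)]
            congr 2
            rw [Real.inv_rpow (by positivity), pow_mul', ← Real.sqrt_eq_rpow,
              Real.sqrt_sq (by positivity)]
    calc _ ≤ ENNReal.ofReal (τ ^ d) * (A * (ENNReal.ofReal (τ ^ d)⁻¹ *
          energy M (d + 1) f ^ (1 / 2 : ℝ))) := by
          gcongr
          exact h1.trans (mul_le_mul' le_rfl h3)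
      _ = (ENNReal.ofReal (τ ^ d) * ENNReal.ofReal (τ ^ d)⁻¹) *
          (A * energy M (d + 1) f ^ (1 / 2 : ℝ)) := by ring
      _ = _ := by
          rw [← ENNReal.ofReal_mul (by positivity), mul_inv_cancel₀ (by positivity),
            ENNReal.ofReal_one, one_mul]
  have hmeas2 : Measurable (Function.uncurry fun (y : Phase d) (t : ℝ) =>
      ENNReal.ofReal ((1 - t) ^ d) * ‖iteratedFDeriv ℝ (d + 1) f (z + (1 - t) • y)‖ₑ) := by
    have h0 : Measurable fun p : Phase d × ℝ => ENNReal.ofReal ((1 - p.2) ^ d) := by fun_prop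
    refine h0.mul ?_
    exact ((hc (d + 1) le_rfl).comp
      (by fun_prop : Continuous fun p : Phase d × ℝ => z + (1 - p.2) • p.1)).measurable
  have hmain : V * ‖f z‖ₑ ≤ A * ∑ k ∈ Finset.range (d + 2), energy M k f ^ (1 / 2 : ℝ) := by
    calc V * ‖f z‖ₑ = ∫⁻ _y in B, ‖f z‖ₑ := by rw [setLIntegral_const, mul_comm]
      _ ≤ ∫⁻ y in B, (∑ k ∈ Finset.range (d + 1), ‖iteratedFDeriv ℝ k f (z + y)‖ₑ +
          ∫⁻ t in Ioc (0 : ℝ) 1, ENNReal.ofReal ((1 - t) ^ d) *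
            ‖iteratedFDeriv ℝ (d + 1) f (z + (1 - t) • y)‖ₑ) := by
          refine setLIntegral_mono' measurableSet_ball fun y hy => taylor_enorm_le hf z y ?_
          rw [hB, mem_ball_zero_iff] at hy
          linarith
      _ = (∑ k ∈ Finset.range (d + 1), ∫⁻ y in B, ‖iteratedFDeriv ℝ k f (z + y)‖ₑ) +
          ∫⁻ t in Ioc (0 : ℝ) 1, ∫⁻ y in B, ENNReal.ofReal ((1 - t) ^ d) *
            ‖iteratedFDeriv ℝ (d + 1) f (z + (1 - t) • y)‖ₑ := by
          have hmk : ∀ k ∈ Finset.range (d + 1), Measurable fun y =>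
              ‖iteratedFDeriv ℝ k f (z + y)‖ₑ := fun k hk =>
            ((hc k (by rw [Finset.mem_range] at hk; omega)).comp
              (by fun_prop : Continuous fun y => z + y)).measurable
          rw [lintegral_add_left (Finset.measurable_fun_sum _ hmk), lintegral_finsetSum _ hmk,
            lintegral_lintegral_swap hmeas2.aemeasurable]
      _ ≤ ∑ k ∈ Finset.range (d + 1), A * energy M k f ^ (1 / 2 : ℝ) +
          ∫⁻ _t in Ioc (0 : ℝ) 1, A * energy M (d + 1) f ^ (1 / 2 : ℝ) := by
          refine add_le_add (Finset.sum_le_sum fun k hk => hCS k ?_) ?_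
          · rw [Finset.mem_range] at hk; omega
          -- At `t = 1` the dilation degenerates, so this endpoint is dropped as a null set.
          · rw [Measure.restrict_congr_set Ioo_ae_eq_Ioc.symm]
            exact setLIntegral_mono' measurableSet_Ioo hscaled
      _ = _ := by
          rw [setLIntegral_const, Real.volume_Ioc, Finset.sum_range_succ (n := d + 1), mul_add,
            Finset.mul_sum]
          simp
  calc ‖f z‖ₑ = V⁻¹ * (V * ‖f z‖ₑ) := by
        rw [← mul_assoc, ENNReal.inv_mul_cancel hV0 hVt, one_mul]
    _ ≤ V⁻¹ * (A * ∑ k ∈ Finset.range (d + 2), energy M k f ^ (1 / 2 : ℝ)) := by gcongr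
    _ = _ := by rw [mul_assoc]

theorem SmoothL2.lintegral_rpow {d : ℕ} {M : SpatialDomain} {k : ℕ} {f : Phase d → ℝ}
    (hf : SmoothL2 M k f) {j : ℕ} (hj : j ≤ k) {p : ℝ} (hp : 2 ≤ p) :
    ∫⁻ z, ‖iteratedFDeriv ℝ j f z‖ₑ ^ p ∂(phaseVol d M) =
      ENNReal.ofReal (∫ z, ‖iteratedFDeriv ℝ j f z‖ ^ p ∂(phaseVol d M)) := by
  rw [ofReal_integral_eq_lintegral_ofReal (hf.integrable_rpow hj hp)
    (Filter.Eventually.of_forall fun z => by positivity)]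
  refine lintegral_congr fun z => ?_
  rw [← ofReal_norm, ENNReal.ofReal_rpow_of_nonneg (norm_nonneg _) (by linarith)]

theorem SmoothL2.energy_eq {d : ℕ} {M : SpatialDomain} {k : ℕ} {f : Phase d → ℝ}
    (hf : SmoothL2 M k f) {j : ℕ} (hj : j ≤ k) :
    energy M j f = ENNReal.ofReal (∫ z, ‖iteratedFDeriv ℝ j f z‖ ^ (2 : ℝ) ∂(phaseVol d M)) := by
  rw [← hf.lintegral_rpow hj le_rfl, energy]
  refine lintegral_congr fun z => ?_
  rw [← ENNReal.rpow_natCast]; norm_num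

theorem energy_interpolation (d : ℕ) (M : SpatialDomain) (k : ℕ) :
    ∃ C : ℝ≥0, ∀ j ≤ k, ∀ f : Phase d → ℝ, SmoothL2 M k f →
      energy M j f ≤ C * (energy M 0 f + energy M k f) := by
  have h : ∀ j : ℕ, ∃ C : ℝ≥0, j ≤ k → ∀ f : Phase d → ℝ, SmoothL2 M k f →
      energy M j f ≤ C * (energy M 0 f + energy M k f) := by
    intro j
    by_cases hj : j ≤ k
    · obtain ⟨C, hC, h⟩ := interpolation d M k j hj
      refine ⟨C.toNNReal, fun _ f hf => ?_⟩
      rw [hf.energy_eq hj, hf.energy_eq (Nat.zero_le k), hf.energy_eq le_rfl,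
        ← ENNReal.ofReal_add (integral_nonneg fun z => by positivity)
          (integral_nonneg fun z => by positivity)]
      change _ ≤ ENNReal.ofReal C * _
      rw [← ENNReal.ofReal_mul hC.le]
      exact ENNReal.ofReal_le_ofReal (h f hf)
    · exact ⟨0, fun h => absurd h hj⟩
  choose C hC using h
  refine ⟨∑ j ∈ Finset.range (k + 1), C j, fun j hj f hf => (hC j hj f hf).trans ?_⟩
  gcongr
  exact Finset.single_le_sum (f := C) (fun _ _ => zero_le) (Finset.mem_range.2 (by omega))

/-- The Sobolev embedding `H^k ⊂ L^∞` for `k ≥ d + 1`. -/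
theorem sobolev (d : ℕ) (M : SpatialDomain) (k : ℕ) (hk : d + 1 ≤ k) :
    ∃ C : ℝ≥0, ∀ f : Phase d → ℝ, SmoothL2 M k f → ∀ z,
      ‖f z‖ₑ ≤ C * (energy M 0 f + energy M k f) ^ (1 / 2 : ℝ) := by
  obtain ⟨C, hC⟩ := sobolev_sum d M
  obtain ⟨B, hB⟩ := energy_interpolation d M k
  refine ⟨C * ((d + 2 : ℕ) * B ^ (1 / 2 : ℝ)), fun f hf z => ?_⟩
  refine (hC f (hf.contDiff.of_le (by exact_mod_cast hk)) hf.isFunOn z).trans ?_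
  rw [ENNReal.coe_mul, mul_assoc]
  refine mul_le_mul' le_rfl ?_
  have : ∀ j ∈ Finset.range (d + 2), energy M j f ^ (1 / 2 : ℝ) ≤
      (B : ℝ≥0∞) ^ (1 / 2 : ℝ) * (energy M 0 f + energy M k f) ^ (1 / 2 : ℝ) := by
    intro j hj
    rw [Finset.mem_range] at hj
    rw [← ENNReal.mul_rpow_of_nonneg _ _ (by norm_num)]
    exact ENNReal.rpow_le_rpow (hB j (by omega) f hf) (by norm_num)
  refine (Finset.sum_le_sum this).trans (le_of_eq ?_)
  rw [Finset.sum_const, Finset.card_range, nsmul_eq_mul, ENNReal.coe_mul,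
    ENNReal.coe_rpow_of_nonneg _ (by norm_num), mul_assoc]
  simp

/-- Gagliardo–Nirenberg in terms of energies. -/
theorem energy_gagliardoNirenberg (d : ℕ) (M : SpatialDomain) (k j : ℕ) (hj : 1 ≤ j)
    (hjk : j ≤ k) : ∃ C : ℝ≥0, ∀ f : Phase d → ℝ, SmoothL2 M k f → (∀ z, |f z| ≤ 1) →
      ∫⁻ z, ‖iteratedFDeriv ℝ j f z‖ₑ ^ (2 * k / (j : ℕ) : ℝ) ∂(phaseVol d M) ≤
        C * energy M k f := by
  obtain ⟨C, hC, h⟩ := gagliardoNirenberg d M k j hj hjk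
  refine ⟨C.toNNReal, fun f hf hf1 => ?_⟩
  have hj' : (0 : ℝ) < j := by exact_mod_cast hj
  have hjk' : (j : ℝ) ≤ k := by exact_mod_cast hjk
  rw [hf.lintegral_rpow hjk (by rw [le_div_iff₀ hj']; linarith), hf.energy_eq le_rfl]
  change _ ≤ ENNReal.ofReal C * _
  rw [← ENNReal.ofReal_mul hC.le]
  exact ENNReal.ofReal_le_ofReal (h f hf hf1)

/-! ### Composition with a nonlinear function -/

theorem norm_iteratedFDeriv_id_le {E : Type*} [NormedAddCommGroup E] [NormedSpace ℝ E] {j : ℕ}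
    (hj : 1 ≤ j) (z : E) : ‖iteratedFDeriv ℝ j (fun z : E => z) z‖ ≤ 1 := by
  obtain ⟨n, rfl⟩ : ∃ n, j = n + 1 := ⟨j - 1, by omega⟩
  rw [← norm_iteratedFDeriv_fderiv]
  have : fderiv ℝ (fun z : E => z) = fun _ => ContinuousLinearMap.id ℝ E := by
    funext x; exact fderiv_fun_id
  rw [this]
  rcases n with _ | n
  · rw [norm_iteratedFDeriv_zero]; exact ContinuousLinearMap.norm_id_le
  · rw [iteratedFDeriv_succ_const]; simp

theorem norm_iteratedFDeriv_pi_le {E κ : Type*} [NormedAddCommGroup E] [NormedSpace ℝ E]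
    [Fintype κ] {j : ℕ} {u : E → κ → ℝ} (hu : ContDiff ℝ j u) (z : E) :
    ‖iteratedFDeriv ℝ j u z‖ ≤ ∑ i, ‖iteratedFDeriv ℝ j (fun z => u z i) z‖ := by
  refine ContinuousMultilinearMap.opNorm_le_bound (by positivity) fun v => ?_
  rw [Finset.sum_mul]
  refine (pi_norm_le_iff_of_nonneg (by positivity)).2 fun i => ?_
  have h := (ContinuousLinearMap.proj (R := ℝ) (φ := fun _ : κ => ℝ) i).iteratedFDeriv_comp_left
    (x := z) hu.contDiffAt (i := j) le_rfl
  have h2 : iteratedFDeriv ℝ j u z v i = iteratedFDeriv ℝ j (fun z => u z i) z v := by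
    change _ = iteratedFDeriv ℝ j
      (⇑(ContinuousLinearMap.proj (R := ℝ) (φ := fun _ : κ => ℝ) i) ∘ u) z v
    rw [h]; rfl
  rw [h2]
  refine (ContinuousMultilinearMap.le_opNorm _ _).trans ?_
  exact Finset.single_le_sum
    (f := fun i => ‖iteratedFDeriv ℝ j (fun z => u z i) z‖ * ∏ l, ‖v l‖)
    (fun _ _ => by positivity) (Finset.mem_univ i)

/-- Bounds for a nonlinear function of `z` and of values `w` with `|w| ≤ r`. -/
structure NonlinBound {d : ℕ} {κ : Type*} [Fintype κ] (s : ℕ) (B r : ℝ)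
    (h : Phase d × (κ → ℝ) → ℝ) : Prop where
  contDiff : ContDiff ℝ s h
  bound : ∀ n ≤ s, ∀ z w, ‖w‖ ≤ r → ‖iteratedFDeriv ℝ n h (z, w)‖ ≤ B
  lip : ∀ n ≤ s, ∀ z w₁ w₂, ‖w₁‖ ≤ r → ‖w₂‖ ≤ r →
    ‖iteratedFDeriv ℝ n h (z, w₁) - iteratedFDeriv ℝ n h (z, w₂)‖ ≤ B * ‖w₁ - w₂‖

theorem one_le_prod_one_add {ι : Type*} (S : Finset ι) (θ : ι → ℝ) (hθ : ∀ i, 0 ≤ θ i) :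
    1 ≤ ∏ l ∈ S, (1 + θ l) := by
  calc (1 : ℝ) = ∏ _l ∈ S, 1 := by simp
    _ ≤ _ := Finset.prod_le_prod (fun _ _ => zero_le_one) fun l _ => by linarith [hθ l]

/-- With `Q ≥ 1` the product of the other factors, this is `Q θ_i ≤ Q (1 + θ_i) - 1`. It applies to
partitions in which one inner derivative is a derivative of the difference and therefore lacks the
constant coming from the variable `z`. -/
theorem prod_update_one_add_le {ι : Type*} [Fintype ι] [DecidableEq ι] (θ : ι → ℝ)
    (hθ : ∀ i, 0 ≤ θ i) (i : ι) :
    ∏ l, (if l = i then θ l else 1 + θ l) ≤ ∏ l, (1 + θ l) - 1 := by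
  have h1 := Finset.prod_erase_mul Finset.univ (fun l => 1 + θ l) (Finset.mem_univ i)
  have h2 := Finset.prod_erase_mul Finset.univ (fun l => if l = i then θ l else 1 + θ l)
    (Finset.mem_univ i)
  have h3 : ∏ l ∈ Finset.univ.erase i, (if l = i then θ l else 1 + θ l) =
      ∏ l ∈ Finset.univ.erase i, (1 + θ l) :=
    Finset.prod_congr rfl fun l hl => by rw [if_neg (Finset.ne_of_mem_erase hl)]
  have h4 : 1 ≤ ∏ l ∈ Finset.univ.erase i, (1 + θ l) :=
    one_le_prod_one_add _ θ hθ
  rw [h3] at h2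
  simp only [if_true] at h2
  rw [← h2, ← h1]
  nlinarith

/-- Pointwise Faà di Bruno estimate for the difference of two compositions. -/
theorem norm_iteratedFDeriv_comp_sub_le {d : ℕ} {κ : Type*} [Fintype κ] {s : ℕ} {B R lam : ℝ}
    {h : Phase d × (κ → ℝ) → ℝ} (hB : 0 ≤ B) (hR : 1 ≤ R) (hlam : 0 ≤ lam)
    (hh : NonlinBound s B R h) {u₁ u₂ : Phase d → κ → ℝ}
    (hu₁ : ContDiff ℝ s u₁) (hu₂ : ContDiff ℝ s u₂) {z : Phase d} (hr₁ : ‖u₁ z‖ ≤ R)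
    (hr₂ : ‖u₂ z‖ ≤ R) (hδ : ‖u₁ z - u₂ z‖ ≤ lam) {k : ℕ} (hk : k ≤ s) {θ : ℕ → ℝ}
    (hθ : ∀ j, 0 ≤ θ j)
    (h₁ : ∀ j ≤ s, ‖iteratedFDeriv ℝ j u₁ z‖ ≤ R * θ j)
    (h₂ : ∀ j ≤ s, ‖iteratedFDeriv ℝ j u₂ z‖ ≤ R * θ j)
    (h₃ : ∀ j ≤ s, ‖iteratedFDeriv ℝ j (u₁ - u₂) z‖ ≤ lam * θ j) :
    ‖iteratedFDeriv ℝ k (fun z => h (z, u₁ z) - h (z, u₂ z)) z‖ ≤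
      ∑ c : OrderedFinpartition k, B * R ^ k * (‖u₁ z - u₂ z‖ +
        lam * (k + 1) * (∏ i, (1 + θ (c.partSize i)) - 1)) := by
  have hR0 : 0 ≤ R := by linarith
  have hid : ContDiff ℝ s (fun z : Phase d => z) := contDiff_id
  have hks : (k : WithTop ℕ∞) ≤ s := by exact_mod_cast hk
  have hy : ∀ u : Phase d → κ → ℝ, ContDiff ℝ s u → ContDiff ℝ s (fun z => (z, u z)) :=
    fun u hu => contDiff_id.prodMk hu
  -- The inner map is `z ↦ (z, u z)`, so derivatives of the nonlinearity in `z` need no separate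
  -- treatment; the identity component is responsible for the `1` in `1 + θ`.
  have hcomp : ∀ u : Phase d → κ → ℝ, ContDiff ℝ s u →
      iteratedFDeriv ℝ k (fun z => h (z, u z)) z =
        ∑ c : OrderedFinpartition k, c.compAlongOrderedFinpartition
          (iteratedFDeriv ℝ c.length h (z, u z))
          (fun i => iteratedFDeriv ℝ (c.partSize i) (fun z => (z, u z)) z) := fun u hu =>
    iteratedFDeriv_comp (g := h) (f := fun z => (z, u z)) hh.contDiff.contDiffAt
      (hy u hu).contDiffAt hks
  have hsub : iteratedFDeriv ℝ k (fun z => h (z, u₁ z) - h (z, u₂ z)) z =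
      iteratedFDeriv ℝ k (fun z => h (z, u₁ z)) z - iteratedFDeriv ℝ k (fun z => h (z, u₂ z)) z :=
    iteratedFDeriv_sub_apply ((hh.contDiff.comp (hy u₁ hu₁)).of_le hks).contDiffAt
      ((hh.contDiff.comp (hy u₂ hu₂)).of_le hks).contDiffAt
  rw [hsub, hcomp u₁ hu₁, hcomp u₂ hu₂, ← Finset.sum_sub_distrib]
  refine (norm_sum_le _ _).trans (Finset.sum_le_sum fun c _ => ?_)
  have hc1 : ∀ i, 1 ≤ c.partSize i := fun i => c.partSize_pos i
  have hc2 : ∀ i, c.partSize i ≤ s := fun i => (c.partSize_le i).trans hk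
  have hcl : c.length ≤ s := c.length_le.trans hk
  have hp : ∀ u : Phase d → κ → ℝ, ContDiff ℝ s u → (∀ j ≤ s, ‖iteratedFDeriv ℝ j u z‖ ≤ R * θ j) →
      ∀ i, ‖iteratedFDeriv ℝ (c.partSize i) (fun z => (z, u z)) z‖ ≤
        R * (1 + θ (c.partSize i)) := by
    intro u hu hb i
    rw [iteratedFDeriv_prodMk (n := s) hid.contDiffAt hu.contDiffAt
      (by exact_mod_cast hc2 i), ContinuousMultilinearMap.opNorm_prod]
    have := hθ (c.partSize i)
    refine max_le ((norm_iteratedFDeriv_id_le (hc1 i) z).trans ?_) ((hb _ (hc2 i)).trans ?_)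
    · nlinarith
    · nlinarith
  have hpd : ∀ i, ‖iteratedFDeriv ℝ (c.partSize i) (fun z => (z, u₁ z)) z -
      iteratedFDeriv ℝ (c.partSize i) (fun z => (z, u₂ z)) z‖ ≤ lam * θ (c.partSize i) := by
    intro i
    have hi : ((c.partSize i : ℕ) : WithTop ℕ∞) ≤ s := by exact_mod_cast hc2 i
    rw [iteratedFDeriv_prodMk (n := s) hid.contDiffAt hu₁.contDiffAt hi,
      iteratedFDeriv_prodMk (n := s) hid.contDiffAt hu₂.contDiffAt hi]
    have e : (iteratedFDeriv ℝ (c.partSize i) (fun z : Phase d => z) z).prod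
        (iteratedFDeriv ℝ (c.partSize i) u₁ z) -
        (iteratedFDeriv ℝ (c.partSize i) (fun z : Phase d => z) z).prod
        (iteratedFDeriv ℝ (c.partSize i) u₂ z) =
        (0 : ContinuousMultilinearMap ℝ (fun _ : Fin (c.partSize i) => Phase d) (Phase d)).prod
          (iteratedFDeriv ℝ (c.partSize i) (u₁ - u₂) z) := by
      rw [iteratedFDeriv_sub_apply (hu₁.of_le hi).contDiffAt (hu₂.of_le hi).contDiffAt]
      ext v <;> simp
    rw [e, ContinuousMultilinearMap.opNorm_prod, norm_zero]
    exact max_le (mul_nonneg hlam (hθ _)) (h₃ _ (hc2 i))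
  set q₁ := iteratedFDeriv ℝ c.length h (z, u₁ z)
  set q₂ := iteratedFDeriv ℝ c.length h (z, u₂ z)
  set p₁ : ∀ i : Fin c.length, ContinuousMultilinearMap ℝ (fun _ : Fin (c.partSize i) => Phase d)
    (Phase d × (κ → ℝ)) := fun i => iteratedFDeriv ℝ (c.partSize i) (fun z => (z, u₁ z)) z
  set p₂ : ∀ i : Fin c.length, ContinuousMultilinearMap ℝ (fun _ : Fin (c.partSize i) => Phase d)
    (Phase d × (κ → ℝ)) := fun i => iteratedFDeriv ℝ (c.partSize i) (fun z => (z, u₂ z)) z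
  have hq : ‖q₁ - q₂‖ ≤ B * ‖u₁ z - u₂ z‖ := hh.lip _ hcl _ _ _ hr₁ hr₂
  have hq₂ : ‖q₂‖ ≤ B := hh.bound _ hcl _ _ hr₂
  set Pr : ℝ := ∏ i, (1 + θ (c.partSize i)) with hPi
  have hPi1 : 1 ≤ Pr :=
    one_le_prod_one_add _ (fun i => θ (c.partSize i)) fun i => hθ _
  have hRk : R ^ c.length ≤ R ^ k := pow_le_pow_right₀ hR c.length_le
  -- Change of the outer derivative, controlled by its Lipschitz bound.
  have t1 : ‖c.compAlongOrderedFinpartition q₁ p₁ - c.compAlongOrderedFinpartition q₂ p₁‖ ≤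
      B * ‖u₁ z - u₂ z‖ * (R ^ k * Pr) := by
    have e : c.compAlongOrderedFinpartition q₁ p₁ - c.compAlongOrderedFinpartition q₂ p₁ =
        c.compAlongOrderedFinpartition (q₁ - q₂) p₁ := by
      ext v; simp
    rw [e]
    refine (c.norm_compAlongOrderedFinpartition_le _ _).trans ?_
    refine mul_le_mul hq ?_ (by positivity) (by positivity)
    calc ∏ i, ‖p₁ i‖ ≤ ∏ i, (R * (1 + θ (c.partSize i))) :=
          Finset.prod_le_prod (fun _ _ => norm_nonneg _) fun i _ => hp u₁ hu₁ h₁ i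
      _ = R ^ c.length * Pr := by
          rw [Finset.prod_mul_distrib, Finset.prod_const, Finset.card_univ, Fintype.card_fin]
      _ ≤ R ^ k * Pr := by gcongr
  -- Change of the inner derivatives: multilinearity replaces them one at a time, at most `k` times,
  -- and each replacement gains the factor `lam`.
  have t2 : ‖c.compAlongOrderedFinpartition q₂ p₁ - c.compAlongOrderedFinpartition q₂ p₂‖ ≤
      B * (k * (lam * (R ^ k * (Pr - 1)))) := by
    refine ((OrderedFinpartition.compAlongOrderedFinpartitionL ℝ (Phase d) (Phase d × (κ → ℝ)) ℝ c
      q₂).norm_image_sub_le' p₁ p₂).trans ?_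
    refine mul_le_mul ((c.norm_compAlongOrderedFinpartitionL_apply_le _).trans hq₂) ?_
      (Finset.sum_nonneg fun i _ => Finset.prod_nonneg fun j _ => by split_ifs <;> positivity) hB
    have hterm : ∀ i ∈ (Finset.univ : Finset (Fin c.length)),
        (∏ j, if j = i then ‖p₁ i - p₂ i‖ else max ‖p₁ j‖ ‖p₂ j‖) ≤
          lam * (R ^ k * (Pr - 1)) := by
      intro i _
      calc (∏ j, if j = i then ‖p₁ i - p₂ i‖ else max ‖p₁ j‖ ‖p₂ j‖) ≤
          ∏ j, ((if j = i then lam else R) *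
            (if j = i then θ (c.partSize j) else 1 + θ (c.partSize j))) := by
            refine Finset.prod_le_prod (fun j _ => by split_ifs <;> positivity) fun j _ => ?_
            split_ifs with hj
            · subst hj; exact hpd j
            · exact max_le (hp u₁ hu₁ h₁ j) (hp u₂ hu₂ h₂ j)
        _ = (∏ j, if j = i then lam else R) *
            ∏ j, (if j = i then θ (c.partSize j) else 1 + θ (c.partSize j)) :=
            Finset.prod_mul_distrib
        _ ≤ (lam * R ^ k) * (Pr - 1) := by
            have e : (∏ j, if j = i then lam else R) ≤ lam * R ^ k := by
              rw [← Finset.mul_prod_erase Finset.univ _ (Finset.mem_univ i), if_pos rfl]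
              refine mul_le_mul_of_nonneg_left ?_ hlam
              rw [Finset.prod_congr rfl (g := fun _ => R)
                (fun j hj => if_neg (Finset.ne_of_mem_erase hj)), Finset.prod_const]
              refine pow_le_pow_right₀ hR ?_
              refine (Finset.card_le_univ _).trans ?_
              rw [Fintype.card_fin]; exact c.length_le
            refine mul_le_mul e (prod_update_one_add_le (fun j => θ (c.partSize j))
              (fun j => hθ _) i) (Finset.prod_nonneg fun j _ => ?_) (by positivity)
            have := hθ (c.partSize j)
            split_ifs <;> positivity
        _ = _ := by ring
    refine (Finset.sum_le_sum hterm).trans ?_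
    rw [Finset.sum_const, Finset.card_univ, Fintype.card_fin, nsmul_eq_mul]
    refine mul_le_mul_of_nonneg_right (by exact_mod_cast c.length_le) ?_
    have : 0 ≤ Pr - 1 := by linarith
    positivity
  have hsplit := norm_sub_le_norm_sub_add_norm_sub (c.compAlongOrderedFinpartition q₁ p₁)
    (c.compAlongOrderedFinpartition q₂ p₁) (c.compAlongOrderedFinpartition q₂ p₂)
  refine hsplit.trans ((add_le_add t1 t2).trans ?_)
  set b := ‖u₁ z - u₂ z‖
  have hb0 : 0 ≤ b := norm_nonneg _
  -- Since `b ≤ lam`, the constant term of the product is charged to the pointwise difference `b`,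
  -- and only `Pr - 1` is multiplied by `lam`. A bare constant would not be square integrable on the
  -- phase space.
  have : b * Pr ≤ b + lam * (Pr - 1) := by nlinarith
  have hBR : 0 ≤ B * R ^ k := by positivity
  have h5 := mul_le_mul_of_nonneg_left this hBR
  nlinarith

/-- Young's inequality for products of quantities of different homogeneity. -/
theorem prod_le_of_forall_rpow_le {ι : Type*} (S : Finset ι) (n : ι → ℕ) (hn : ∀ i ∈ S, 1 ≤ n i)
    (hS : S.Nonempty) (x : ι → ℝ) (hx : ∀ i ∈ S, 0 ≤ x i) {Θ : ℝ}
    (h : ∀ i ∈ S, x i ^ ((∑ l ∈ S, n l : ℕ) / (n i : ℕ) : ℝ) ≤ Θ) : ∏ i ∈ S, x i ≤ Θ := by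
  set m := ∑ l ∈ S, n l with hm
  have hm0 : 0 < m := Finset.sum_pos (fun i hi => hn i hi) hS
  have hm0' : (0 : ℝ) < m := by exact_mod_cast hm0
  have hw : ∑ i ∈ S, ((n i : ℝ) / m) = 1 := by
    rw [← Finset.sum_div, div_eq_one_iff_eq hm0'.ne', hm]; push_cast; rfl
  have key := Real.geom_mean_le_arith_mean_weighted S (fun i => (n i : ℝ) / m)
    (fun i => x i ^ ((m : ℕ) / (n i : ℕ) : ℝ)) (fun i _ => by positivity) hw
    (fun i hi => Real.rpow_nonneg (hx i hi) _)
  calc ∏ i ∈ S, x i = ∏ i ∈ S, (x i ^ ((m : ℕ) / (n i : ℕ) : ℝ)) ^ ((n i : ℝ) / m) := by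
        refine Finset.prod_congr rfl fun i hi => ?_
        have : (n i : ℝ) ≠ 0 := by exact_mod_cast (by have := hn i hi; omega)
        rw [← Real.rpow_mul (hx i hi), div_mul_div_cancel₀ this, div_self hm0'.ne', Real.rpow_one]
    _ ≤ _ := key
    _ ≤ ∑ i ∈ S, (n i : ℝ) / m * Θ :=
        Finset.sum_le_sum fun i hi => mul_le_mul_of_nonneg_left (h i hi) (by positivity)
    _ = Θ := by rw [← Finset.sum_mul, hw, one_mul]

/-- The sum of all powers `θ_j^{m/j}`, `1 ≤ j ≤ m ≤ k`. -/
def youngSum (k : ℕ) (θ : ℕ → ℝ) : ℝ :=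
  ∑ m ∈ Finset.Icc 1 k, ∑ j ∈ Finset.Icc 1 m, θ j ^ ((m : ℕ) / (j : ℕ) : ℝ)

theorem youngSum_nonneg (k : ℕ) {θ : ℕ → ℝ} (hθ : ∀ j, 0 ≤ θ j) : 0 ≤ youngSum k θ :=
  Finset.sum_nonneg fun m _ => Finset.sum_nonneg fun j _ => Real.rpow_nonneg (hθ j) _

/-- Expand the product over subsets of the parts; subtracting one removes the empty subset. A
nonempty subset has total size `m` between `1` and `k`, and weighted AM-GM with weights `partSize /
m` bounds its term by the powers `θ_j^{m/j}`. There are at most `2^k` subsets. -/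
theorem prod_one_add_sub_one_le {k : ℕ} (c : OrderedFinpartition k) {θ : ℕ → ℝ}
    (hθ : ∀ j, 0 ≤ θ j) :
    ∏ i, (1 + θ (c.partSize i)) - 1 ≤ 2 ^ k * youngSum k θ := by
  classical
  have hY := youngSum_nonneg k hθ
  have hsum : ∑ i, c.partSize i = k := by
    have := c.sum_sigma_eq_sum (fun _ : Fin k => 1)
    simpa using this
  rw [Finset.prod_one_add, ← Finset.sum_erase_add _ _ (Finset.empty_mem_powerset _),
    Finset.prod_empty, add_sub_cancel_right]
  have hterm : ∀ S ∈ (Finset.univ : Finset (Fin c.length)).powerset.erase ∅,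
      ∏ i ∈ S, θ (c.partSize i) ≤ youngSum k θ := by
    intro S hS
    have hSne : S.Nonempty := Finset.nonempty_iff_ne_empty.2 (Finset.ne_of_mem_erase hS)
    refine prod_le_of_forall_rpow_le S c.partSize (fun i _ => c.partSize_pos i) hSne _
      (fun i _ => hθ _) fun i hi => ?_
    set m := ∑ l ∈ S, c.partSize l with hm
    have hm1 : c.partSize i ≤ m := Finset.single_le_sum (f := c.partSize) (fun _ _ => zero_le) hi
    have hmk : m ≤ k := by
      rw [← hsum]; exact Finset.sum_le_univ_sum_of_nonneg fun _ => zero_le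
    have hi1 : 1 ≤ c.partSize i := c.partSize_pos i
    refine le_trans ?_ (Finset.single_le_sum (f := fun m : ℕ => ∑ j ∈ Finset.Icc 1 m,
      θ j ^ ((m : ℕ) / (j : ℕ) : ℝ)) (fun m _ => Finset.sum_nonneg fun j _ =>
        Real.rpow_nonneg (hθ j) _) (Finset.mem_Icc.2 ⟨hi1.trans hm1, hmk⟩))
    exact Finset.single_le_sum (f := fun j : ℕ => θ j ^ ((m : ℕ) / (j : ℕ) : ℝ))
      (fun j _ => Real.rpow_nonneg (hθ j) _) (Finset.mem_Icc.2 ⟨hi1, hm1⟩)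
  refine (Finset.sum_le_sum hterm).trans ?_
  rw [Finset.sum_const, nsmul_eq_mul]
  refine mul_le_mul_of_nonneg_right ?_ hY
  have : ((Finset.univ : Finset (Fin c.length)).powerset.erase ∅).card ≤ 2 ^ k := by
    refine (Finset.card_erase_le).trans ?_
    rw [Finset.card_powerset, Finset.card_univ, Fintype.card_fin]
    exact Nat.pow_le_pow_right (by norm_num) c.length_le
  exact_mod_cast this

/-! ### `L²` bounds for compositions of smooth functions -/

theorem ennreal_sq_sum_le {ι : Type*} (S : Finset ι) (a : ι → ℝ≥0∞) :
    (∑ i ∈ S, a i) ^ 2 ≤ (S.card : ℝ≥0∞) * ∑ i ∈ S, a i ^ 2 := by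
  have h := ENNReal.rpow_sum_le_const_mul_sum_rpow S a (p := 2) (by norm_num)
  have e : (2 : ℝ) - 1 = 1 := by norm_num
  simpa only [e, ENNReal.rpow_one, ENNReal.rpow_two] using h

theorem iteratedFDeriv_const_mul {d : ℕ} {j : ℕ} {f : Phase d → ℝ} (hf : ContDiff ℝ j f) (c : ℝ)
    (z : Phase d) : iteratedFDeriv ℝ j (fun z => c * f z) z = c • iteratedFDeriv ℝ j f z :=
  iteratedFDeriv_const_smul_apply (a := c) hf.contDiffAt

theorem SmoothL2.const_mul {d : ℕ} {M : SpatialDomain} {k : ℕ} {f : Phase d → ℝ}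
    (hf : SmoothL2 M k f) (c : ℝ) : SmoothL2 M k (fun z => c * f z) := by
  have h : ∀ j ≤ k, ∀ z, ‖iteratedFDeriv ℝ j (fun z => c * f z) z‖ =
      |c| * ‖iteratedFDeriv ℝ j f z‖ := fun j hj z => by
    rw [iteratedFDeriv_const_mul (hf.contDiff.of_le (by exact_mod_cast hj)), norm_smul,
      Real.norm_eq_abs]
  refine ⟨contDiff_const.mul hf.contDiff, hf.isFunOn.comp fun x => c * x, fun j hj => ?_,
    fun j hj => ?_⟩
  · obtain ⟨C, hC⟩ := hf.bdd j hj
    exact ⟨|c| * C, fun z => by rw [h j hj]; exact mul_le_mul_of_nonneg_left (hC z) (abs_nonneg _)⟩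
  · simp_rw [h j hj]
    exact (hf.memLp j hj).const_mul _

theorem SmoothL2.sub {d : ℕ} {M : SpatialDomain} {k : ℕ} {f g : Phase d → ℝ}
    (hf : SmoothL2 M k f) (hg : SmoothL2 M k g) : SmoothL2 M k (fun z => f z - g z) := by
  have hd : ContDiff ℝ k (fun z => f z - g z) := hf.contDiff.sub hg.contDiff
  have h : ∀ j ≤ k, ∀ z, ‖iteratedFDeriv ℝ j (fun z => f z - g z) z‖ ≤
      ‖iteratedFDeriv ℝ j f z‖ + ‖iteratedFDeriv ℝ j g z‖ := fun j hj z => by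
    have := iteratedFDeriv_sub_apply (x := z)
      (hf.contDiff.of_le (m := j) (by exact_mod_cast hj)).contDiffAt
      (hg.contDiff.of_le (m := j) (by exact_mod_cast hj)).contDiffAt
    change ‖iteratedFDeriv ℝ j (f - g) z‖ ≤ _
    rw [this]
    exact norm_sub_le _ _
  refine ⟨hd, hf.isFunOn.comp₂ hg.isFunOn fun x y => x - y, fun j hj => ?_, fun j hj => ?_⟩
  · obtain ⟨C, hC⟩ := hf.bdd j hj
    obtain ⟨C', hC'⟩ := hg.bdd j hj
    exact ⟨C + C', fun z => (h j hj z).trans (add_le_add (hC z) (hC' z))⟩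
  · refine ((hf.memLp j hj).add (hg.memLp j hj)).mono
      (hd.continuous_iteratedFDeriv (by exact_mod_cast hj)).norm.aestronglyMeasurable
      (Filter.Eventually.of_forall fun z => ?_)
    rw [norm_norm]
    exact (h j hj z).trans (le_abs_self _)

theorem SmoothL2.energy_const_mul {d : ℕ} {M : SpatialDomain} {k : ℕ} {f : Phase d → ℝ}
    (hf : SmoothL2 M k f) (c : ℝ) {j : ℕ} (hj : j ≤ k) :
    energy M j (fun z => c * f z) = ‖c‖ₑ ^ 2 * energy M j f := by
  unfold energy
  rw [← lintegral_const_mul' _ _ (by simp)]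
  refine lintegral_congr fun z => ?_
  rw [iteratedFDeriv_const_mul (hf.contDiff.of_le (by exact_mod_cast hj)), enorm_smul, mul_pow]

theorem measurable_enorm_iteratedFDeriv {d : ℕ} {j : ℕ} {f : Phase d → ℝ}
    (hf : ContDiff ℝ j f) : Measurable fun z => ‖iteratedFDeriv ℝ j f z‖ₑ :=
  (hf.continuous_iteratedFDeriv le_rfl).enorm.measurable

/-- The `L²` norm of the Young sum of normalised functions. -/
theorem lintegral_youngSum_le (d : ℕ) (M : SpatialDomain) (s : ℕ) (Ω : Type*) [Fintype Ω] :
    ∃ C : ℝ≥0, ∀ φ : Ω → Phase d → ℝ, (∀ o, SmoothL2 M s (φ o)) → (∀ o z, |φ o z| ≤ 1) →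
      ∫⁻ z, ENNReal.ofReal (youngSum s fun j => ∑ o, ‖iteratedFDeriv ℝ j (φ o) z‖) ^ 2
        ∂(phaseVol d M) ≤ C * ∑ o, (energy M 0 (φ o) + energy M s (φ o)) := by
  obtain ⟨CI, hCI⟩ := energy_interpolation d M s
  -- The square of `θ_j^{m/j}` has exponent `2m/j`, so Gagliardo–Nirenberg is used with top order
  -- `m` rather than `s`; interpolation then brings the energy of order `m` back to orders `0` and
  -- `s`.
  have hGN : ∀ m j : ℕ, ∃ C : ℝ≥0, 1 ≤ j → j ≤ m → m ≤ s → ∀ f : Phase d → ℝ, SmoothL2 M s f →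
      (∀ z, |f z| ≤ 1) →
      ∫⁻ z, ‖iteratedFDeriv ℝ j f z‖ₑ ^ (2 * m / (j : ℕ) : ℝ) ∂(phaseVol d M) ≤
        C * (energy M 0 f + energy M s f) := by
    intro m j
    by_cases h : 1 ≤ j ∧ j ≤ m ∧ m ≤ s
    · obtain ⟨C, hC⟩ := energy_gagliardoNirenberg d M m j h.1 h.2.1
      refine ⟨C * CI, fun _ _ _ f hf hf1 => (hC f (hf.mono h.2.2) hf1).trans ?_⟩
      rw [ENNReal.coe_mul, mul_assoc]
      exact mul_le_mul' le_rfl (hCI m h.2.2 f hf)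
    · exact ⟨0, fun h1 h2 h3 => absurd ⟨h1, h2, h3⟩ h⟩
  choose G hG using hGN
  set N : ℝ≥0 := (Fintype.card Ω : ℝ≥0) with hN
  refine ⟨(Finset.Icc 1 s).card * ∑ m ∈ Finset.Icc 1 s, ((Finset.Icc 1 m).card *
    ∑ j ∈ Finset.Icc 1 m, N ^ ((2 * m / (j : ℕ) : ℝ) - 1) * G m j), fun φ hφ hφ1 => ?_⟩
  set E := ∑ o, (energy M 0 (φ o) + energy M s (φ o)) with hE
  have hpt : ∀ z, ENNReal.ofReal (youngSum s fun j => ∑ o, ‖iteratedFDeriv ℝ j (φ o) z‖) ^ 2 ≤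
      ((Finset.Icc 1 s).card : ℝ≥0∞) * ∑ m ∈ Finset.Icc 1 s, (((Finset.Icc 1 m).card : ℝ≥0∞) *
        ∑ j ∈ Finset.Icc 1 m, (N : ℝ≥0∞) ^ ((2 * m / (j : ℕ) : ℝ) - 1) *
          ∑ o, ‖iteratedFDeriv ℝ j (φ o) z‖ₑ ^ (2 * m / (j : ℕ) : ℝ)) := by
    intro z
    unfold youngSum
    rw [ENNReal.ofReal_sum_of_nonneg fun m _ => Finset.sum_nonneg fun j _ => by positivity]
    refine (ennreal_sq_sum_le _ _).trans ?_
    gcongr with m hm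
    rw [ENNReal.ofReal_sum_of_nonneg fun j _ => by positivity]
    refine (ennreal_sq_sum_le _ _).trans ?_
    gcongr with j hj
    rw [Finset.mem_Icc] at hj
    have hj0 : (0 : ℝ) < j := by exact_mod_cast hj.1
    have hjm : (j : ℝ) ≤ m := by exact_mod_cast hj.2
    rw [← ENNReal.ofReal_rpow_of_nonneg (by positivity) (by positivity),
      ENNReal.ofReal_sum_of_nonneg fun _ _ => norm_nonneg _, ← ENNReal.rpow_two,
      ← ENNReal.rpow_mul]
    have e : (m : ℝ) / j * 2 = 2 * m / j := by ring
    rw [e]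
    simp_rw [ofReal_norm]
    have := ENNReal.rpow_sum_le_const_mul_sum_rpow Finset.univ
      (fun o => ‖iteratedFDeriv ℝ j (φ o) z‖ₑ) (p := 2 * m / j)
      (by rw [le_div_iff₀ hj0]; linarith)
    simpa [hN] using this
  have hmeas : ∀ m ∈ Finset.Icc 1 s, ∀ j ∈ Finset.Icc 1 m, ∀ o, Measurable fun z =>
      ‖iteratedFDeriv ℝ j (φ o) z‖ₑ ^ (2 * m / (j : ℕ) : ℝ) := by
    intro m hm j hj o
    rw [Finset.mem_Icc] at hm hj
    exact (measurable_enorm_iteratedFDeriv ((hφ o).contDiff.of_le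
      (by exact_mod_cast hj.2.trans hm.2))).pow_const _
  refine (lintegral_mono hpt).trans ?_
  have hm1 : ∀ m ∈ Finset.Icc 1 s, ∀ j ∈ Finset.Icc 1 m, Measurable fun z =>
      (N : ℝ≥0∞) ^ ((2 * m / (j : ℕ) : ℝ) - 1) *
        ∑ o, ‖iteratedFDeriv ℝ j (φ o) z‖ₑ ^ (2 * m / (j : ℕ) : ℝ) := fun m hm j hj =>
    (Finset.measurable_fun_sum _ fun o _ => hmeas m hm j hj o).const_mul _
  have hm2 : ∀ m ∈ Finset.Icc 1 s, Measurable fun z => ((Finset.Icc 1 m).card : ℝ≥0∞) *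
      ∑ j ∈ Finset.Icc 1 m, (N : ℝ≥0∞) ^ ((2 * m / (j : ℕ) : ℝ) - 1) *
        ∑ o, ‖iteratedFDeriv ℝ j (φ o) z‖ₑ ^ (2 * m / (j : ℕ) : ℝ) := fun m hm =>
    (Finset.measurable_fun_sum _ fun j hj => hm1 m hm j hj).const_mul _
  rw [lintegral_const_mul _ (Finset.measurable_fun_sum _ hm2), lintegral_finsetSum _ hm2]
  push_cast
  rw [mul_assoc, Finset.sum_mul]
  gcongr with m hm
  rw [lintegral_const_mul _ (Finset.measurable_fun_sum _ (hm1 m hm)),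
    lintegral_finsetSum _ (hm1 m hm), mul_assoc, Finset.sum_mul]
  gcongr with j hj
  rw [lintegral_const_mul _ (Finset.measurable_fun_sum _ fun o _ => hmeas m hm j hj o),
    lintegral_finsetSum _ fun o _ => hmeas m hm j hj o, mul_assoc]
  rw [Finset.mem_Icc] at hm hj
  have hj0 : (0 : ℝ) < j := by exact_mod_cast hj.1
  have hjm : (j : ℝ) ≤ m := by exact_mod_cast hj.2
  have e1 : (0 : ℝ) ≤ 2 * m / j - 1 := by
    rw [sub_nonneg, le_div_iff₀ hj0]; linarith
  rw [ENNReal.coe_rpow_of_nonneg _ e1]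
  refine mul_le_mul' le_rfl ?_
  rw [hE, Finset.mul_sum]
  refine Finset.sum_le_sum fun o _ => ?_
  exact hG m j hj.1 hj.2 hm.2 (φ o) (hφ o) (hφ1 o)

theorem youngSum_mono {k s : ℕ} (h : k ≤ s) {θ : ℕ → ℝ} (hθ : ∀ j, 0 ≤ θ j) :
    youngSum k θ ≤ youngSum s θ :=
  Finset.sum_le_sum_of_subset_of_nonneg (Finset.Icc_subset_Icc le_rfl h) fun _ _ _ =>
    Finset.sum_nonneg fun j _ => Real.rpow_nonneg (hθ j) _

/-- The main difference estimate for smooth functions. -/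
theorem energy_comp_sub_le (d : ℕ) (M : SpatialDomain) (s : ℕ) (κ : Type*) [Fintype κ] :
    ∃ C : ℝ≥0, ∀ k ≤ s, ∀ B R lam : ℝ, 0 ≤ B → 1 ≤ R → 0 < lam →
      ∀ h : Phase d × (κ → ℝ) → ℝ, NonlinBound s B R h → ∀ u₁ u₂ : Phase d → κ → ℝ,
      (∀ i, SmoothL2 M s (fun z => u₁ z i)) → (∀ i, SmoothL2 M s (fun z => u₂ z i)) →
      (∀ z, ‖u₁ z‖ ≤ R) → (∀ z, ‖u₂ z‖ ≤ R) → (∀ z, ‖u₁ z - u₂ z‖ ≤ lam) →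
      energy M k (fun z => h (z, u₁ z) - h (z, u₂ z)) ≤
        C * ENNReal.ofReal (B * R ^ s) ^ 2 *
          (∑ i, (energy M 0 (fun z => u₁ z i - u₂ z i) + energy M s (fun z => u₁ z i - u₂ z i)) +
            ENNReal.ofReal lam ^ 2 *
              (∑ i, (energy M 0 (fun z => u₁ z i) + energy M s (fun z => u₁ z i)) +
                ∑ i, (energy M 0 (fun z => u₂ z i) + energy M s (fun z => u₂ z i)))) := by
  obtain ⟨CY, hCY⟩ := lintegral_youngSum_le d M s ((κ ⊕ κ) ⊕ κ)
  have hA : ∃ A : ℝ≥0, ∀ k ≤ s, (Fintype.card (OrderedFinpartition k) : ℝ≥0) *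
      ((k + 1) * 2 ^ k) ≤ A :=
    ⟨∑ k ∈ Finset.range (s + 1), (Fintype.card (OrderedFinpartition k) : ℝ≥0) *
      ((k + 1) * 2 ^ k), fun k hk => Finset.single_le_sum (f := fun k : ℕ =>
        (Fintype.card (OrderedFinpartition k) : ℝ≥0) * ((k + 1) * 2 ^ k))
        (fun _ _ => zero_le) (Finset.mem_range.2 (by omega))⟩
  obtain ⟨A, hA⟩ := hA
  refine ⟨2 * A ^ 2 * (Fintype.card κ + CY), fun k hk B R lam hB hR hlam h hh u₁ u₂ hu₁ hu₂
    hr₁ hr₂ hδ => ?_⟩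
  have hR0 : 0 < R := by linarith
  have hc₁ : ContDiff ℝ s u₁ := contDiff_pi.2 fun i => (hu₁ i).contDiff
  have hc₂ : ContDiff ℝ s u₂ := contDiff_pi.2 fun i => (hu₂ i).contDiff
  have hu₃ : ∀ i, SmoothL2 M s (fun z => u₁ z i - u₂ z i) := fun i => (hu₁ i).sub (hu₂ i)
  -- All components are normalised to sup norm at most one, as Gagliardo–Nirenberg requires. The
  -- difference is divided by its own bound `lam`, so that its smallness is not lost.
  set φ : (κ ⊕ κ) ⊕ κ → Phase d → ℝ := Sum.elim (Sum.elim (fun i z => R⁻¹ * u₁ z i)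
    (fun i z => R⁻¹ * u₂ z i)) (fun i z => lam⁻¹ * (u₁ z i - u₂ z i)) with hφ
  have hφs : ∀ o, SmoothL2 M s (φ o) := by
    rintro ((i | i) | i)
    · exact (hu₁ i).const_mul _
    · exact (hu₂ i).const_mul _
    · exact (hu₃ i).const_mul _
  have hφ1 : ∀ o z, |φ o z| ≤ 1 := by
    rintro ((i | i) | i) z
    · simp only [hφ, Sum.elim_inl, abs_mul, abs_inv, abs_of_pos hR0]
      rw [inv_mul_le_iff₀ hR0, mul_one]
      exact (norm_le_pi_norm (u₁ z) i).trans (hr₁ z)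
    · simp only [hφ, Sum.elim_inl, Sum.elim_inr, abs_mul, abs_inv, abs_of_pos hR0]
      rw [inv_mul_le_iff₀ hR0, mul_one]
      exact (norm_le_pi_norm (u₂ z) i).trans (hr₂ z)
    · simp only [hφ, Sum.elim_inr, abs_mul, abs_inv, abs_of_pos hlam]
      rw [inv_mul_le_iff₀ hlam, mul_one]
      exact (norm_le_pi_norm (u₁ z - u₂ z) i).trans (hδ z)
  set θ : Phase d → ℕ → ℝ := fun z j => ∑ o, ‖iteratedFDeriv ℝ j (φ o) z‖ with hθ
  have hθ0 : ∀ z j, 0 ≤ θ z j := fun z j => by positivity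
  have hscale : ∀ (c : ℝ), 0 < c → ∀ (f : Phase d → ℝ), SmoothL2 M s f → ∀ j ≤ s, ∀ z,
      ‖iteratedFDeriv ℝ j f z‖ = c * ‖iteratedFDeriv ℝ j (fun z => c⁻¹ * f z) z‖ := by
    intro c hc f hf j hj z
    rw [iteratedFDeriv_const_mul (hf.contDiff.of_le (by exact_mod_cast hj)), norm_smul, norm_inv,
      Real.norm_of_nonneg hc.le, mul_inv_cancel_left₀ hc.ne']
  have hb : ∀ z, ∀ j ≤ s, ‖iteratedFDeriv ℝ j u₁ z‖ ≤ R * θ z j ∧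
      ‖iteratedFDeriv ℝ j u₂ z‖ ≤ R * θ z j ∧
      ‖iteratedFDeriv ℝ j (u₁ - u₂) z‖ ≤ lam * θ z j := by
    intro z j hj
    have hj' : (j : WithTop ℕ∞) ≤ s := by exact_mod_cast hj
    simp only [hθ, Fintype.sum_sum_type, hφ, Sum.elim_inl, Sum.elim_inr]
    have p1 : 0 ≤ ∑ i, ‖iteratedFDeriv ℝ j (fun z => R⁻¹ * u₁ z i) z‖ := by positivity
    have p2 : 0 ≤ ∑ i, ‖iteratedFDeriv ℝ j (fun z => R⁻¹ * u₂ z i) z‖ := by positivity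
    have p3 : 0 ≤ ∑ i, ‖iteratedFDeriv ℝ j (fun z => lam⁻¹ * (u₁ z i - u₂ z i)) z‖ := by positivity
    refine ⟨(norm_iteratedFDeriv_pi_le (hc₁.of_le hj') z).trans ?_,
      (norm_iteratedFDeriv_pi_le (hc₂.of_le hj') z).trans ?_,
      (norm_iteratedFDeriv_pi_le ((hc₁.sub hc₂).of_le hj') z).trans ?_⟩
    · rw [Finset.sum_congr rfl fun i _ => hscale R hR0 _ (hu₁ i) j hj z, ← Finset.mul_sum]
      exact mul_le_mul_of_nonneg_left (by linarith) hR0.le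
    · rw [Finset.sum_congr rfl fun i _ => hscale R hR0 _ (hu₂ i) j hj z, ← Finset.mul_sum]
      exact mul_le_mul_of_nonneg_left (by linarith) hR0.le
    · simp only [Pi.sub_apply]
      rw [Finset.sum_congr rfl fun i _ => hscale lam hlam _ (hu₃ i) j hj z, ← Finset.mul_sum]
      exact mul_le_mul_of_nonneg_left (by linarith) hlam.le
  have hBR : 0 ≤ B * R ^ s := by positivity
  have hpt : ∀ z, ‖iteratedFDeriv ℝ k (fun z => h (z, u₁ z) - h (z, u₂ z)) z‖ ≤
      A * (B * R ^ s) * (‖u₁ z - u₂ z‖ + lam * youngSum s (θ z)) := by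
    intro z
    have h1 := norm_iteratedFDeriv_comp_sub_le hB hR hlam.le hh hc₁ hc₂ (hr₁ z) (hr₂ z) (hδ z) hk
      (hθ0 z) (fun j hj => (hb z j hj).1) (fun j hj => (hb z j hj).2.1)
      (fun j hj => (hb z j hj).2.2)
    have hY := youngSum_nonneg s (hθ0 z)
    refine h1.trans ?_
    have h2 : ∀ c ∈ (Finset.univ : Finset (OrderedFinpartition k)),
        B * R ^ k * (‖u₁ z - u₂ z‖ + lam * (k + 1) * (∏ i, (1 + θ z (c.partSize i)) - 1)) ≤
        B * R ^ s * (((k + 1) * 2 ^ k) * (‖u₁ z - u₂ z‖ + lam * youngSum s (θ z))) := by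
      intro c _
      have h3 := (prod_one_add_sub_one_le c (hθ0 z)).trans
        (mul_le_mul_of_nonneg_left (youngSum_mono hk (hθ0 z)) (by positivity))
      have h4 : 0 ≤ ∏ i, (1 + θ z (c.partSize i)) - 1 := by
        have := one_le_prod_one_add Finset.univ (fun i => θ z (c.partSize i)) fun i => hθ0 z _
        linarith
      have h5 : (1 : ℝ) ≤ (k + 1) * 2 ^ k := by
        have : (1 : ℝ) ≤ 2 ^ k := one_le_pow₀ (by norm_num)
        nlinarith [(Nat.cast_nonneg k : (0 : ℝ) ≤ k)]
      refine mul_le_mul (mul_le_mul_of_nonneg_left (pow_le_pow_right₀ hR hk) hB) ?_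
        (by positivity) hBR
      rw [mul_add ((k + 1 : ℝ) * 2 ^ k)]
      refine add_le_add (le_mul_of_one_le_left (norm_nonneg (u₁ z - u₂ z)) h5) ?_
      calc lam * (k + 1) * (∏ i, (1 + θ z (c.partSize i)) - 1)
          ≤ lam * (k + 1) * (2 ^ k * youngSum s (θ z)) := by gcongr
        _ = _ := by ring
    refine (Finset.sum_le_sum h2).trans ?_
    rw [Finset.sum_const, Finset.card_univ, nsmul_eq_mul]
    have h6 : (Fintype.card (OrderedFinpartition k) : ℝ) * ((k + 1) * 2 ^ k) ≤ A := by
      exact_mod_cast hA k hk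
    have h7 : 0 ≤ B * R ^ s * (‖u₁ z - u₂ z‖ + lam * youngSum s (θ z)) := by positivity
    have := mul_le_mul_of_nonneg_right h6 h7
    linarith
  have hpt2 : ∀ z, ‖iteratedFDeriv ℝ k (fun z => h (z, u₁ z) - h (z, u₂ z)) z‖ₑ ^ 2 ≤
      (2 * A ^ 2 * ENNReal.ofReal (B * R ^ s) ^ 2) *
        ((Fintype.card κ : ℝ≥0∞) * ∑ i, ‖iteratedFDeriv ℝ 0 (fun z => u₁ z i - u₂ z i) z‖ₑ ^ 2 +
          ENNReal.ofReal lam ^ 2 * ENNReal.ofReal (youngSum s (θ z)) ^ 2) := by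
    intro z
    have hY := youngSum_nonneg s (hθ0 z)
    have hδs : ENNReal.ofReal ‖u₁ z - u₂ z‖ ≤
        ∑ i, ‖iteratedFDeriv ℝ 0 (fun z => u₁ z i - u₂ z i) z‖ₑ := by
      have h1 : ‖u₁ z - u₂ z‖ ≤ ∑ i, ‖iteratedFDeriv ℝ 0 (fun z => u₁ z i - u₂ z i) z‖ := by
        simp only [norm_iteratedFDeriv_zero]
        refine (pi_norm_le_iff_of_nonneg (by positivity)).2 fun i => ?_
        exact Finset.single_le_sum (f := fun i => ‖u₁ z i - u₂ z i‖)
          (fun _ _ => norm_nonneg _) (Finset.mem_univ i)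
      refine (ENNReal.ofReal_le_ofReal h1).trans (le_of_eq ?_)
      rw [ENNReal.ofReal_sum_of_nonneg fun _ _ => norm_nonneg _]
      simp_rw [ofReal_norm]
    have h1 : ‖iteratedFDeriv ℝ k (fun z => h (z, u₁ z) - h (z, u₂ z)) z‖ₑ ≤
        A * ENNReal.ofReal (B * R ^ s) *
          ((∑ i, ‖iteratedFDeriv ℝ 0 (fun z => u₁ z i - u₂ z i) z‖ₑ) +
            ENNReal.ofReal lam * ENNReal.ofReal (youngSum s (θ z))) := by
      rw [← ofReal_norm]
      refine (ENNReal.ofReal_le_ofReal (hpt z)).trans ?_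
      rw [ENNReal.ofReal_mul (by positivity), ENNReal.ofReal_mul (by positivity),
        ENNReal.ofReal_add (norm_nonneg _) (by positivity), ENNReal.ofReal_mul hlam.le,
        ENNReal.ofReal_coe_nnreal]
      gcongr
    calc _ ≤ (A * ENNReal.ofReal (B * R ^ s) *
          ((∑ i, ‖iteratedFDeriv ℝ 0 (fun z => u₁ z i - u₂ z i) z‖ₑ) +
            ENNReal.ofReal lam * ENNReal.ofReal (youngSum s (θ z)))) ^ 2 := by gcongr
      _ = A ^ 2 * ENNReal.ofReal (B * R ^ s) ^ 2 *
          ((∑ i, ‖iteratedFDeriv ℝ 0 (fun z => u₁ z i - u₂ z i) z‖ₑ) +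
            ENNReal.ofReal lam * ENNReal.ofReal (youngSum s (θ z))) ^ 2 := by ring
      _ ≤ A ^ 2 * ENNReal.ofReal (B * R ^ s) ^ 2 * (2 *
          ((∑ i, ‖iteratedFDeriv ℝ 0 (fun z => u₁ z i - u₂ z i) z‖ₑ) ^ 2 +
            (ENNReal.ofReal lam * ENNReal.ofReal (youngSum s (θ z))) ^ 2)) := by
          gcongr
          have := ennreal_sq_sum_le Finset.univ
            ![∑ i, ‖iteratedFDeriv ℝ 0 (fun z => u₁ z i - u₂ z i) z‖ₑ,
              ENNReal.ofReal lam * ENNReal.ofReal (youngSum s (θ z))]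
          simpa using this
      _ = (2 * A ^ 2 * ENNReal.ofReal (B * R ^ s) ^ 2) *
          ((∑ i, ‖iteratedFDeriv ℝ 0 (fun z => u₁ z i - u₂ z i) z‖ₑ) ^ 2 +
            ENNReal.ofReal lam ^ 2 * ENNReal.ofReal (youngSum s (θ z)) ^ 2) := by ring
      _ ≤ _ := by
          gcongr
          have := ennreal_sq_sum_le Finset.univ
            (fun i => ‖iteratedFDeriv ℝ 0 (fun z => u₁ z i - u₂ z i) z‖ₑ)
          simpa using this
  have hm0 : ∀ i ∈ (Finset.univ : Finset κ), Measurable fun z =>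
      ‖iteratedFDeriv ℝ 0 (fun z => u₁ z i - u₂ z i) z‖ₑ ^ 2 := fun i _ =>
    (measurable_enorm_iteratedFDeriv ((hu₃ i).contDiff.of_le (by simp))).pow_const 2
  have hE : ∀ j ≤ s, ∑ o, energy M j (φ o) ≤ ∑ i, energy M j (fun z => u₁ z i) +
      ∑ i, energy M j (fun z => u₂ z i) +
      (ENNReal.ofReal lam ^ 2)⁻¹ * ∑ i, energy M j (fun z => u₁ z i - u₂ z i) := by
    intro j hj
    simp only [Fintype.sum_sum_type, hφ, Sum.elim_inl, Sum.elim_inr, Finset.mul_sum]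
    have hR1 : ‖R⁻¹‖ₑ ^ 2 ≤ 1 := by
      refine pow_le_one₀ zero_le ?_
      rw [Real.enorm_of_nonneg (by positivity), ENNReal.ofReal_le_one]
      exact inv_le_one_of_one_le₀ hR
    gcongr with i _ i _ i
    · rw [(hu₁ i).energy_const_mul _ hj]
      exact mul_le_of_le_one_left zero_le hR1
    · rw [(hu₂ i).energy_const_mul _ hj]
      exact mul_le_of_le_one_left zero_le hR1
    · rw [(hu₃ i).energy_const_mul _ hj, Real.enorm_of_nonneg (by positivity),
        ENNReal.ofReal_inv_of_pos hlam, ENNReal.inv_pow]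
  -- Undoing the normalisation: the energies of the difference return without `lam`, while those of
  -- `u₁` and `u₂` keep the factor `lam²`.
  have hlam2 : ENNReal.ofReal lam ^ 2 * (ENNReal.ofReal lam ^ 2)⁻¹ = 1 :=
    ENNReal.mul_inv_cancel (pow_ne_zero _ (by simpa using hlam)) (by simp)
  set D0 := ∑ i, energy M 0 (fun z => u₁ z i - u₂ z i) with hD0
  set Ds := ∑ i, energy M s (fun z => u₁ z i - u₂ z i) with hDs
  set X0 := ∑ i, energy M 0 (fun z => u₁ z i) with hX0
  set Xs := ∑ i, energy M s (fun z => u₁ z i) with hXs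
  set Y0 := ∑ i, energy M 0 (fun z => u₂ z i) with hY0
  set Ys := ∑ i, energy M s (fun z => u₂ z i) with hYs
  have hYI : ∫⁻ z, ENNReal.ofReal lam ^ 2 * ENNReal.ofReal (youngSum s (θ z)) ^ 2 ∂(phaseVol d M) ≤
      CY * ((D0 + Ds) + ENNReal.ofReal lam ^ 2 * ((X0 + Xs) + (Y0 + Ys))) := by
    rw [lintegral_const_mul' _ _ (by simp)]
    have h1 := hCY φ hφs hφ1
    rw [Finset.sum_add_distrib] at h1
    have h2 := add_le_add (hE 0 (Nat.zero_le s)) (hE s le_rfl)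
    calc _ ≤ ENNReal.ofReal lam ^ 2 * (CY * ((X0 + Y0 + (ENNReal.ofReal lam ^ 2)⁻¹ * D0) +
          (Xs + Ys + (ENNReal.ofReal lam ^ 2)⁻¹ * Ds))) := by
          gcongr
          exact h1.trans (mul_le_mul' le_rfl h2)
      _ = CY * ((ENNReal.ofReal lam ^ 2 * (ENNReal.ofReal lam ^ 2)⁻¹) * (D0 + Ds) +
          ENNReal.ofReal lam ^ 2 * ((X0 + Xs) + (Y0 + Ys))) := by ring
      _ = _ := by rw [hlam2, one_mul]
  simp only [Finset.sum_add_distrib]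
  rw [← hD0, ← hDs, ← hX0, ← hXs, ← hY0, ← hYs]
  have hD0' : D0 = ∑ i, ∫⁻ z, ‖iteratedFDeriv ℝ 0 (fun z => u₁ z i - u₂ z i) z‖ₑ ^ 2
    ∂(phaseVol d M) := rfl
  calc _ ≤ ∫⁻ z, (2 * A ^ 2 * ENNReal.ofReal (B * R ^ s) ^ 2) *
        ((Fintype.card κ : ℝ≥0∞) * ∑ i, ‖iteratedFDeriv ℝ 0 (fun z => u₁ z i - u₂ z i) z‖ₑ ^ 2 +
          ENNReal.ofReal lam ^ 2 * ENNReal.ofReal (youngSum s (θ z)) ^ 2) ∂(phaseVol d M) :=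
        lintegral_mono hpt2
    _ = (2 * A ^ 2 * ENNReal.ofReal (B * R ^ s) ^ 2) * ((Fintype.card κ : ℝ≥0∞) * D0 +
          ∫⁻ z, ENNReal.ofReal lam ^ 2 * ENNReal.ofReal (youngSum s (θ z)) ^ 2
            ∂(phaseVol d M)) := by
        rw [lintegral_const_mul' _ _ (by
          refine ENNReal.mul_ne_top (ENNReal.mul_ne_top (by simp) (by simp)) (by simp)),
          lintegral_add_left ((Finset.measurable_fun_sum _ hm0).const_mul _),
          lintegral_const_mul _ (Finset.measurable_fun_sum _ hm0), lintegral_finsetSum _ hm0,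
          hD0']
    _ ≤ (2 * A ^ 2 * ENNReal.ofReal (B * R ^ s) ^ 2) * ((Fintype.card κ : ℝ≥0∞) *
          ((D0 + Ds) + ENNReal.ofReal lam ^ 2 * ((X0 + Xs) + (Y0 + Ys))) +
          CY * ((D0 + Ds) + ENNReal.ofReal lam ^ 2 * ((X0 + Xs) + (Y0 + Ys)))) := by
        gcongr
        exact le_self_add.trans le_self_add
    _ = _ := by
        push_cast
        ring

/-! ### Mollification -/

theorem isFunOn_toCell (d : ℕ) (M : SpatialDomain) : IsFunOn M (toCell (d := d) M) := by
  cases M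
  · intro k z
    simp only [toCell]
    ext j
    rcases j with j | j
    · simp [latticeVec]
      ring
    · simp [latticeVec]
  · trivial

theorem eLpNorm_two_sq {α : Type*} [MeasurableSpace α] (μ : Measure α) (F : α → ℝ) :
    eLpNorm F 2 μ ^ 2 = ∫⁻ z, ‖F z‖ₑ ^ 2 ∂μ := by
  have := eLpNorm_nnreal_pow_eq_lintegral (μ := μ) (f := F) (p := 2) (by norm_num)
  simpa [ENNReal.rpow_two] using this

theorem memLp_two_iff {α : Type*} [MeasurableSpace α] {μ : Measure α} {F : α → ℝ}
    (hF : AEStronglyMeasurable F μ) : MemLp F 2 μ ↔ ∫⁻ z, ‖F z‖ₑ ^ 2 ∂μ < ⊤ := by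
  rw [← eLpNorm_two_sq, MemLp]
  simp [hF, lt_top_iff_ne_top]

theorem toCell_of_mem {d : ℕ} {M : SpatialDomain} {z : Phase d} (hz : z ∈ cell d M) :
    toCell M z = z := by
  cases M
  · simp only [toCell]
    have : (fun j => -⌊z (Sum.inl j)⌋) = fun _ => (0 : ℤ) := by
      funext j
      rw [neg_eq_zero, Int.floor_eq_zero_iff]
      exact hz j
    rw [this]
    ext j
    rcases j with j | j <;> simp [latticeVec]
  · rfl

/-- Take a measurable representative on the cell and compose it with `toCell`; the exceptional set
is periodic, hence null in the whole space. -/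
theorem exists_measurable_isFunOn {d : ℕ} {M : SpatialDomain} {F : Phase d → ℝ}
    (hF : IsFunOn M F) (hm : AEStronglyMeasurable F (phaseVol d M)) :
    ∃ F' : Phase d → ℝ, Measurable F' ∧ IsFunOn M F' ∧ F =ᵐ[volume] F' := by
  obtain ⟨F₁, h1, h2⟩ := hm
  refine ⟨fun z => F₁ (toCell M z), h1.measurable.comp (measurable_toCell M),
    (isFunOn_toCell d M).comp F₁, ae_of_ae_cell (M := M)
      (hF.comp₂ ((isFunOn_toCell d M).comp F₁) fun x y => x = y) ?_⟩
  have h3 : ∀ᵐ z ∂(phaseVol d M), z ∈ cell d M := by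
    rw [phaseVol]; exact ae_restrict_mem (measurableSet_cell d M)
  filter_upwards [h2, h3] with z hz hz'
  have : toCell M z = z := toCell_of_mem hz'
  rw [this, hz]

theorem aestronglyMeasurable_of_cell {d : ℕ} {M : SpatialDomain} {F : Phase d → ℝ}
    (hF : IsFunOn M F) (hm : AEStronglyMeasurable F (phaseVol d M)) :
    AEStronglyMeasurable F volume := by
  obtain ⟨F', h1, -, h3⟩ := exists_measurable_isFunOn hF hm
  exact ⟨F', h1.stronglyMeasurable, h3⟩

theorem locallyIntegrable_of_cell {d : ℕ} {M : SpatialDomain} {F : Phase d → ℝ}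
    (hF : IsFunOn M F) (hm : MemLp F 2 (phaseVol d M)) : LocallyIntegrable F volume := by
  intro x
  refine ⟨Metric.ball x (1 / 2), Metric.ball_mem_nhds x (by norm_num), ?_⟩
  have h1 : AEStronglyMeasurable F (volume.restrict (Metric.ball x (1 / 2))) :=
    (aestronglyMeasurable_of_cell hF hm.1).restrict
  have h2 : MemLp F 2 (volume.restrict (Metric.ball x (1 / 2))) := by
    rw [memLp_two_iff h1]
    exact (lintegral_ball_le (hF.comp fun x => ‖x‖ₑ ^ 2) x).trans_lt ((memLp_two_iff hm.1).1 hm)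
  have : IsFiniteMeasure (volume.restrict (Metric.ball x (1 / 2 : ℝ))) :=
    ⟨by rw [Measure.restrict_apply_univ]; exact measure_ball_lt_top⟩
  exact h2.integrable (by norm_num)

/-- Standard mollification kernels. -/
def bump (d n : ℕ) : ContDiffBump (0 : Phase d) where
  -- The outer radius is at most `1/4`, so supports fit in the balls of radius `1/2` controlled by
  -- the cell. The fixed ratio of the radii is what the almost everywhere convergence of
  -- `ae_tendsto_mol` requires.
  rIn := 1 / (8 * (n + 1))
  rOut := 1 / (4 * (n + 1))
  rIn_pos := by positivity
  rIn_lt_rOut := by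
    apply one_div_lt_one_div_of_lt
    · positivity
    · have : (0 : ℝ) < n + 1 := by positivity
      linarith

def kernel (d n : ℕ) : Phase d → ℝ := (bump d n).normed volume

open scoped Convolution in
/-- Convolution of a function with a kernel. -/
def conv {d : ℕ} (ρ f : Phase d → ℝ) : Phase d → ℝ := ρ ⋆[ContinuousLinearMap.lsmul ℝ ℝ, volume] f

/-- Mollification. -/
def mol {d : ℕ} (n : ℕ) (f : Phase d → ℝ) : Phase d → ℝ := conv (kernel d n) f

theorem contDiff_kernel (d n : ℕ) : ContDiff ℝ ∞ (kernel d n) := (bump d n).contDiff_normed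

theorem hasCompactSupport_kernel (d n : ℕ) : HasCompactSupport (kernel d n) :=
  (bump d n).hasCompactSupport_normed

theorem kernel_nonneg (d n : ℕ) (z : Phase d) : 0 ≤ kernel d n z := (bump d n).nonneg_normed z

theorem lintegral_kernel (d n : ℕ) : ∫⁻ z, ENNReal.ofReal (kernel d n z) = 1 := by
  rw [← ofReal_integral_eq_lintegral_ofReal]
  · simp [kernel, (bump d n).integral_normed]
  · exact (contDiff_kernel d n).continuous.integrable_of_hasCompactSupport
      (hasCompactSupport_kernel d n)
  · exact Filter.Eventually.of_forall (kernel_nonneg d n)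

theorem conv_apply {d : ℕ} (ρ f : Phase d → ℝ) (z : Phase d) :
    conv ρ f z = ∫ y, ρ (z - y) * f y := by
  rw [conv, convolution_eq_swap]; rfl

theorem conv_apply' {d : ℕ} (ρ f : Phase d → ℝ) (z : Phase d) :
    conv ρ f z = ∫ t, ρ t * f (z - t) := rfl

theorem conv_congr_ae {d : ℕ} (ρ : Phase d → ℝ) {f f' : Phase d → ℝ} (h : f =ᵐ[volume] f') :
    conv ρ f = conv ρ f' := by
  funext z
  rw [conv_apply, conv_apply]
  exact integral_congr_ae (h.mono fun y hy => by simp only [hy])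

theorem IsFunOn.conv {d : ℕ} {M : SpatialDomain} {f : Phase d → ℝ} (hf : IsFunOn M f)
    (ρ : Phase d → ℝ) : IsFunOn M (conv ρ f) := by
  rw [isFunOn_iff] at hf ⊢
  intro g hg z
  simp only [conv_apply', add_sub_assoc, hf g hg]

theorem contDiff_conv {d : ℕ} {ρ f : Phase d → ℝ} (hρ : ContDiff ℝ ∞ ρ)
    (hc : HasCompactSupport ρ) (hf : LocallyIntegrable f volume) : ContDiff ℝ ∞ (conv ρ f) :=
  hc.contDiff_convolution_left _ hρ hf

theorem hasCompactSupport_listDeriv {d : ℕ} (e : Frame d) {ρ : Phase d → ℝ}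
    (hc : HasCompactSupport ρ) (L : List (Fin d ⊕ Fin d)) :
    HasCompactSupport (listDeriv e L ρ) := by
  induction L with
  | nil => exact hc
  | cons i L ih => exact (ih.fderiv (𝕜 := ℝ)).comp_left (g := fun A => A (e i)) rfl

theorem conv_integrable {d : ℕ} {ρ f : Phase d → ℝ} (hρ : Continuous ρ)
    (hc : HasCompactSupport ρ) (hf : LocallyIntegrable f volume) (z : Phase d) :
    Integrable fun y => ρ (z - y) * f y := by
  have h1 : Continuous fun y => ρ (z - y) := hρ.comp (continuous_const.sub continuous_id)
  have h2 : HasCompactSupport fun y => ρ (z - y) := hc.comp_homeomorph (Homeomorph.subLeft z)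
  simpa only [smul_eq_mul] using hf.integrable_smul_left_of_hasCompactSupport h1 h2

theorem listDeriv_conv {d : ℕ} (e : Frame d) {ρ f : Phase d → ℝ} (hρ : ContDiff ℝ ∞ ρ)
    (hc : HasCompactSupport ρ) (hf : LocallyIntegrable f volume) (L : List (Fin d ⊕ Fin d)) :
    listDeriv e L (conv ρ f) = conv (listDeriv e L ρ) f := by
  induction L with
  | nil => rfl
  | cons i L ih =>
    have h1 := contDiff_infty_listDeriv e L hρ
    have h2 := hasCompactSupport_listDeriv e hc L
    funext z
    simp only [listDeriv, ih]
    have h3 := h2.hasFDerivAt_convolution_left (ContinuousLinearMap.lsmul ℝ ℝ) (h1.of_le (by simp))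
      hf z
    rw [conv, h3.fderiv, convolution_def, ContinuousLinearMap.integral_apply]
    · rfl
    · exact (h2.fderiv (𝕜 := ℝ)).convolutionExists_left _ (h1.continuous_fderiv (by simp)) hf z

/-- Test the weak derivative against `y ↦ ρ (z - y)`. The sign from integrating by parts cancels the
sign from reflecting the kernel. -/
theorem multiDeriv_mol {d : ℕ} {M : SpatialDomain} {β : MultiIndex d} {f g : Phase d → ℝ}
    (hf : LocallyIntegrable f volume) (h : IsL2WeakDeriv M (coordFrame d) β f g) (n : ℕ) :
    multiDeriv (coordFrame d) β (mol n f) = mol n g := by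
  have hk := contDiff_kernel d n
  have hc := hasCompactSupport_kernel d n
  funext z
  rw [multiDeriv, mol, listDeriv_conv _ hk hc hf, conv_apply, mol, conv_apply]
  have h1 := h.weak (fun y => kernel d n (z - y)) (hk.comp (contDiff_const.sub contDiff_id))
    (hc.comp_homeomorph (Homeomorph.subLeft z))
  rw [multiDeriv, listDeriv_comp_sub_left _ _ _ (hk.of_le (by exact_mod_cast le_top)),
    MultiIndex.length_toIndexList] at h1
  have h2 : ∀ y, f y * ((-1) ^ β.order * listDeriv (coordFrame d) β.toIndexList (kernel d n)
      (z - y)) = (-1 : ℝ) ^ β.order *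
        (listDeriv (coordFrame d) β.toIndexList (kernel d n) (z - y) * f y) := fun y => by ring
  simp only [h2, integral_const_mul] at h1
  have h3 := mul_left_cancel₀ (pow_ne_zero _ (by norm_num)) h1
  rw [h3]
  simp only [mul_comm]

/-- Cauchy–Schwarz for the probability measure whose density is the kernel. -/
theorem enorm_mol_sq_le {d : ℕ} {F : Phase d → ℝ} (hF : Measurable F) (n : ℕ) (z : Phase d) :
    ‖mol n F z‖ₑ ^ 2 ≤ ∫⁻ t, ENNReal.ofReal (kernel d n t) * ‖F (z - t)‖ₑ ^ 2 := by
  have hk : Measurable fun t => ENNReal.ofReal (kernel d n t) :=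
    (contDiff_kernel d n).continuous.measurable.ennreal_ofReal
  have hg : Measurable fun t => ‖F (z - t)‖ₑ := (hF.comp (measurable_const.sub measurable_id)).enorm
  have h1 : ‖mol n F z‖ₑ ≤ ∫⁻ t, ENNReal.ofReal (kernel d n t) * ‖F (z - t)‖ₑ := by
    rw [mol, conv_apply']
    refine (enorm_integral_le_lintegral_enorm _).trans (le_of_eq (lintegral_congr fun t => ?_))
    rw [enorm_mul, Real.enorm_of_nonneg (kernel_nonneg d n t)]
  set μ := (volume : Measure (Phase d)).withDensity fun t => ENNReal.ofReal (kernel d n t) with hμ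
  have h2 : μ univ = 1 := by
    rw [hμ, withDensity_apply _ MeasurableSet.univ, setLIntegral_univ, lintegral_kernel]
  have h3 := lintegral_le_sqrt_mul_sqrt μ hg.aemeasurable
  rw [h2, ENNReal.one_rpow, one_mul, hμ, lintegral_withDensity_eq_lintegral_mul _ hk hg,
    lintegral_withDensity_eq_lintegral_mul _ hk (hg.pow_const 2)] at h3
  simp only [Pi.mul_apply] at h3
  calc _ ≤ ((∫⁻ t, ENNReal.ofReal (kernel d n t) * ‖F (z - t)‖ₑ ^ 2) ^ (1 / 2 : ℝ)) ^ 2 := by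
        gcongr; exact h1.trans h3
    _ = _ := by rw [← ENNReal.rpow_two, ← ENNReal.rpow_mul]; norm_num

/-- The integrals are exchanged, and each translate of a periodic function has the same integral
over the cell. -/
theorem lintegral_mol_le {d : ℕ} {M : SpatialDomain} {F : Phase d → ℝ} (hF : IsFunOn M F)
    (hm : AEStronglyMeasurable F (phaseVol d M)) (n : ℕ) :
    ∫⁻ z, ‖mol n F z‖ₑ ^ 2 ∂(phaseVol d M) ≤ ∫⁻ z, ‖F z‖ₑ ^ 2 ∂(phaseVol d M) := by
  obtain ⟨F', h1, h2, h3⟩ := exists_measurable_isFunOn hF hm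
  have h4 : ∫⁻ z, ‖F z‖ₑ ^ 2 ∂(phaseVol d M) = ∫⁻ z, ‖F' z‖ₑ ^ 2 ∂(phaseVol d M) :=
    lintegral_congr_ae ((ae_cell_of_ae h3).mono fun z hz => by simp only [hz])
  rw [h4, mol, conv_congr_ae _ h3]
  refine (lintegral_mono fun z => enorm_mol_sq_le h1 n z).trans ?_
  have hk : Measurable fun t => ENNReal.ofReal (kernel d n t) :=
    (contDiff_kernel d n).continuous.measurable.ennreal_ofReal
  rw [lintegral_lintegral_swap]
  · have h5 : ∀ t, ∫⁻ z, ENNReal.ofReal (kernel d n t) * ‖F' (z - t)‖ₑ ^ 2 ∂(phaseVol d M) =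
        ENNReal.ofReal (kernel d n t) * ∫⁻ z, ‖F' z‖ₑ ^ 2 ∂(phaseVol d M) := by
      intro t
      rw [lintegral_const_mul' _ _ ENNReal.ofReal_ne_top]
      congr 1
      have := lintegral_cell_add (h2.comp fun x => ‖x‖ₑ ^ 2) (-t)
      simpa only [phaseVol, neg_add_eq_sub] using this
    simp_rw [h5]
    rw [lintegral_mul_const _ hk, lintegral_kernel, one_mul]
  · refine Measurable.aemeasurable ?_
    exact (hk.comp measurable_snd).mul
      ((h1.comp (measurable_fst.sub measurable_snd)).enorm.pow_const 2)

/-- The kernel is bounded with support in a small ball. The constant depends on `n`: it is used only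
to know that mollifications are bounded. -/
theorem exists_mol_bound (d n : ℕ) (M : SpatialDomain) : ∃ C : ℝ≥0, ∀ F : Phase d → ℝ,
    IsFunOn M F → AEStronglyMeasurable F (phaseVol d M) → ∀ z,
    ‖mol n F z‖ₑ ^ 2 ≤ C * ∫⁻ z, ‖F z‖ₑ ^ 2 ∂(phaseVol d M) := by
  obtain ⟨C, hC⟩ := (contDiff_kernel d n).continuous.bounded_above_of_compact_support
    (hasCompactSupport_kernel d n)
  refine ⟨C.toNNReal, fun F hF hm z => ?_⟩
  obtain ⟨F', h1, h2, h3⟩ := exists_measurable_isFunOn hF hm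
  have h4 : ∫⁻ z, ‖F z‖ₑ ^ 2 ∂(phaseVol d M) = ∫⁻ z, ‖F' z‖ₑ ^ 2 ∂(phaseVol d M) :=
    lintegral_congr_ae ((ae_cell_of_ae h3).mono fun z hz => by simp only [hz])
  rw [h4, mol, conv_congr_ae _ h3]
  refine (enorm_mol_sq_le h1 n z).trans ?_
  have h5 := lintegral_sub_left_eq_self (μ := (volume : Measure (Phase d)))
    (fun t => ENNReal.ofReal (kernel d n t) * ‖F' (z - t)‖ₑ ^ 2) z
  rw [← h5]
  simp only [sub_sub_cancel]
  calc ∫⁻ y, ENNReal.ofReal (kernel d n (z - y)) * ‖F' y‖ₑ ^ 2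
      ≤ ∫⁻ y, (Metric.ball z (1 / 2)).indicator (fun y => (C.toNNReal : ℝ≥0∞) * ‖F' y‖ₑ ^ 2) y := by
        refine lintegral_mono fun y => ?_
        by_cases hy : y ∈ Metric.ball z (1 / 2)
        · rw [indicator_of_mem hy]
          refine mul_le_mul' ?_ le_rfl
          exact ENNReal.ofReal_le_ofReal ((le_abs_self _).trans (hC (z - y)))
        · rw [indicator_of_notMem hy]
          have : kernel d n (z - y) = 0 := by
            by_contra hne
            have hs : z - y ∈ Function.support (kernel d n) := hne
            rw [kernel, (bump d n).support_normed_eq, mem_ball_zero_iff] at hs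
            apply hy
            rw [Metric.mem_ball, dist_comm, dist_eq_norm]
            refine hs.trans_le ?_
            change 1 / (4 * ((n : ℝ) + 1)) ≤ 1 / 2
            apply one_div_le_one_div_of_le (by norm_num)
            have : (0 : ℝ) ≤ n := by positivity
            linarith
          simp [this]
    _ = ∫⁻ y in Metric.ball z (1 / 2), (C.toNNReal : ℝ≥0∞) * ‖F' y‖ₑ ^ 2 :=
        lintegral_indicator measurableSet_ball _
    _ = C.toNNReal * ∫⁻ y in Metric.ball z (1 / 2), ‖F' y‖ₑ ^ 2 :=
        lintegral_const_mul' _ _ (by simp)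
    _ ≤ _ := mul_le_mul' le_rfl (lintegral_ball_le (h2.comp fun x => ‖x‖ₑ ^ 2) z)

theorem mol_sub {d : ℕ} {f g : Phase d → ℝ} (hf : LocallyIntegrable f volume)
    (hg : LocallyIntegrable g volume) (n : ℕ) (z : Phase d) :
    mol n (fun z => f z - g z) z = mol n f z - mol n g z := by
  have hk := (contDiff_kernel d n).continuous
  have hc := hasCompactSupport_kernel d n
  rw [mol, mol, mol, conv_apply, conv_apply, conv_apply,
    ← integral_sub (conv_integrable hk hc hf z) (conv_integrable hk hc hg z)]
  simp only [mul_sub]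

/-- Lebesgue differentiation. Pointwise convergence, rather than convergence in `L²`, is what
survives a nonlinear composition. -/
theorem ae_tendsto_mol {d : ℕ} {f : Phase d → ℝ} (hf : LocallyIntegrable f volume) :
    ∀ᵐ z, Filter.Tendsto (fun n => mol n f z) Filter.atTop (nhds (f z)) := by
  refine ContDiffBump.ae_convolution_tendsto_right_of_locallyIntegrable (φ := fun n => bump d n)
    (K := 2) ?_ (Filter.Eventually.of_forall fun n => ?_) hf
  · have h := (tendsto_one_div_add_atTop_nhds_zero_nat (𝕜 := ℝ)).const_mul (1 / 4)
    rw [mul_zero] at h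
    refine h.congr fun n => ?_
    change _ = 1 / (4 * ((n : ℝ) + 1))
    rw [one_div_mul_one_div]
  · change 1 / (4 * ((n : ℝ) + 1)) ≤ 2 * (1 / (8 * (n + 1)))
    apply le_of_eq
    field_simp
    norm_num

/-! ### Approximation of Sobolev functions by smooth functions -/

theorem MemHs.mono {d : ℕ} {M : SpatialDomain} {s k : ℕ} {f : Phase d → ℝ} (hf : MemHs M s f)
    (h : k ≤ s) : MemHs M k f :=
  ⟨hf.isFunOn, hf.memLp, fun β hβ => hf.weakDeriv β (hβ.trans h)⟩

theorem MemHs.locallyIntegrable {d : ℕ} {M : SpatialDomain} {s : ℕ} {f : Phase d → ℝ}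
    (hf : MemHs M s f) : LocallyIntegrable f volume :=
  locallyIntegrable_of_cell hf.isFunOn hf.memLp

theorem weakDerivSq_le {d : ℕ} {M : SpatialDomain} {e : Frame d} {β : MultiIndex d}
    {f g : Phase d → ℝ} (h : IsL2WeakDeriv M e β f g) :
    weakDerivSq M e β f ≤ eLpNorm g 2 (phaseVol d M) ^ 2 :=
  iInf₂_le g h

theorem MemHs.hsSq_lt_top {d : ℕ} {M : SpatialDomain} {s k : ℕ} {f : Phase d → ℝ}
    (hf : MemHs M s f) (hk : k ≤ s) : hsSq M k f < ⊤ := by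
  refine ENNReal.add_lt_top.2 ⟨ENNReal.sum_lt_top.2 fun β hβ => ?_, ?_⟩
  · obtain ⟨g, hg⟩ := hf.weakDeriv β ((mem_piAntidiag_iff_order.1 hβ).le.trans hk)
    exact (weakDerivSq_le hg).trans_lt (ENNReal.pow_lt_top hg.memLp.2)
  · exact ENNReal.pow_lt_top hf.memLp.2

theorem contDiff_mol {d : ℕ} {f : Phase d → ℝ} (hf : LocallyIntegrable f volume) (n : ℕ) :
    ContDiff ℝ ∞ (mol n f) :=
  contDiff_conv (contDiff_kernel d n) (hasCompactSupport_kernel d n) hf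

theorem lintegral_multiDeriv_mol_le {d : ℕ} {M : SpatialDomain} {β : MultiIndex d}
    {f : Phase d → ℝ} (hf : LocallyIntegrable f volume) (n : ℕ) :
    ∫⁻ z, ‖multiDeriv (coordFrame d) β (mol n f) z‖ₑ ^ 2 ∂(phaseVol d M) ≤
      weakDerivSq M (coordFrame d) β f := by
  refine le_iInf₂ fun g hg => ?_
  rw [multiDeriv_mol hf hg, eLpNorm_two_sq]
  exact lintegral_mol_le hg.isFunOn hg.memLp.1 n

theorem enorm_sq_iteratedFDeriv_le {d k : ℕ} {f : Phase d → ℝ} (hf : ContDiff ℝ k f)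
    (z : Phase d) : ‖iteratedFDeriv ℝ k f z‖ₑ ^ 2 ≤ ((2 * d : ℕ) : ℝ≥0∞) ^ (2 * k) *
      ∑ β ∈ Finset.piAntidiag (Finset.univ : Finset (Fin d ⊕ Fin d)) k,
        ‖multiDeriv (coordFrame d) β f z‖ₑ ^ 2 := by
  have h := ENNReal.ofReal_le_ofReal (sq_norm_iteratedFDeriv_le hf z)
  rw [ENNReal.ofReal_mul (by positivity), ENNReal.ofReal_sum_of_nonneg fun _ _ => sq_nonneg _,
    ENNReal.ofReal_pow (norm_nonneg _), ofReal_norm, ENNReal.ofReal_pow (by positivity),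
    ENNReal.ofReal_natCast] at h
  refine h.trans (le_of_eq ?_)
  congr 1
  refine Finset.sum_congr rfl fun β _ => ?_
  rw [← sq_abs, ENNReal.ofReal_pow (abs_nonneg _), Real.enorm_eq_ofReal_abs]

theorem continuous_multiDeriv {d : ℕ} (e : Frame d) {β : MultiIndex d} {f : Phase d → ℝ}
    (hf : ContDiff ℝ β.order f) : Continuous (multiDeriv e β f) :=
  (contDiff_listDeriv (m := 0) e β.toIndexList hf
    (by rw [zero_add, MultiIndex.length_toIndexList])).continuous

theorem energy_le_sum {d k : ℕ} (M : SpatialDomain) {f : Phase d → ℝ} (hf : ContDiff ℝ k f) :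
    energy M k f ≤ ((2 * d : ℕ) : ℝ≥0∞) ^ (2 * k) *
      ∑ β ∈ Finset.piAntidiag (Finset.univ : Finset (Fin d ⊕ Fin d)) k,
        ∫⁻ z, ‖multiDeriv (coordFrame d) β f z‖ₑ ^ 2 ∂(phaseVol d M) := by
  have hm : ∀ β ∈ Finset.piAntidiag (Finset.univ : Finset (Fin d ⊕ Fin d)) k,
      Measurable fun z => ‖multiDeriv (coordFrame d) β f z‖ₑ ^ 2 := fun β hβ =>
    (continuous_multiDeriv _ (by rwa [mem_piAntidiag_iff_order.1 hβ])).enorm.measurable.pow_const 2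
  rw [← lintegral_finsetSum _ hm, ← lintegral_const_mul _ (Finset.measurable_fun_sum _ hm)]
  exact lintegral_mono fun z => enorm_sq_iteratedFDeriv_le hf z

theorem energy_zero {d : ℕ} (M : SpatialDomain) (f : Phase d → ℝ) :
    energy M 0 f = ∫⁻ z, ‖f z‖ₑ ^ 2 ∂(phaseVol d M) := by
  unfold energy
  refine lintegral_congr fun z => ?_
  rw [← ofReal_norm, norm_iteratedFDeriv_zero, ofReal_norm]

theorem energy_mol_le_pow_mul {d k : ℕ} {M : SpatialDomain} {f : Phase d → ℝ}
    (hf : LocallyIntegrable f volume) (n : ℕ) :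
    energy M k (mol n f) ≤ ((2 * d : ℕ) : ℝ≥0∞) ^ (2 * k) * hsSq M k f := by
  refine (energy_le_sum M ((contDiff_mol hf n).of_le (by exact_mod_cast le_top))).trans
    (mul_le_mul' le_rfl ?_)
  exact (Finset.sum_le_sum fun β _ => lintegral_multiDeriv_mol_le hf n).trans le_self_add

theorem energy_zero_mol_le {d s k : ℕ} {M : SpatialDomain} {f : Phase d → ℝ}
    (hf : MemHs M s f) (n : ℕ) : energy M 0 (mol n f) ≤ hsSq M k f := by
  rw [energy_zero]
  refine (lintegral_mol_le hf.isFunOn hf.memLp.1 n).trans ?_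
  rw [← eLpNorm_two_sq]
  exact le_add_self

/-- Each derivative of order at most `s` is the mollification of an `L²` weak derivative, hence
bounded and square integrable on the cell. -/
theorem MemHs.smoothL2_mol {d s : ℕ} {M : SpatialDomain} {f : Phase d → ℝ} (hf : MemHs M s f)
    (n : ℕ) : SmoothL2 M s (mol n f) := by
  have hl := hf.locallyIntegrable
  have hc := contDiff_mol hl n
  refine ⟨hc.of_le (by exact_mod_cast le_top), hf.isFunOn.conv _, fun j hj => ?_, fun j hj => ?_⟩
  · have hcj : ContDiff ℝ j (mol n f) := hc.of_le (by exact_mod_cast le_top)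
    obtain ⟨C, hC⟩ := exists_mol_bound d n M
    have h1 : ∀ β : MultiIndex d, ∃ C : ℝ≥0∞, C < ⊤ ∧ (β.order ≤ s →
        ∀ z, ‖multiDeriv (coordFrame d) β (mol n f) z‖ₑ ^ 2 ≤ C) := by
      intro β
      by_cases hβ : β.order ≤ s
      · obtain ⟨g, hg⟩ := hf.weakDeriv β hβ
        refine ⟨C * ∫⁻ z, ‖g z‖ₑ ^ 2 ∂(phaseVol d M),
          ENNReal.mul_lt_top (by simp) ((memLp_two_iff hg.memLp.1).1 hg.memLp), fun _ z => ?_⟩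
        rw [multiDeriv_mol hl hg]
        exact hC g hg.isFunOn hg.memLp.1 z
      · exact ⟨0, by simp, fun h => absurd h hβ⟩
    choose D hD hD' using h1
    set A : ℝ≥0∞ := ((2 * d : ℕ) : ℝ≥0∞) ^ (2 * j) *
      ∑ β ∈ Finset.piAntidiag (Finset.univ : Finset (Fin d ⊕ Fin d)) j, D β with hA
    have hAt : A < ⊤ := ENNReal.mul_lt_top (ENNReal.pow_lt_top (ENNReal.natCast_lt_top _))
      (ENNReal.sum_lt_top.2 fun β _ => hD β)
    have h2 : ∀ z, ‖iteratedFDeriv ℝ j (mol n f) z‖ₑ ^ 2 ≤ A := fun z =>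
      (enorm_sq_iteratedFDeriv_le hcj z).trans (mul_le_mul' le_rfl (Finset.sum_le_sum fun β hβ =>
        hD' β ((mem_piAntidiag_iff_order.1 hβ).le.trans hj) z))
    refine ⟨√A.toReal, fun z => Real.le_sqrt_of_sq_le ?_⟩
    rw [← ENNReal.ofReal_le_iff_le_toReal hAt.ne, ENNReal.ofReal_pow (norm_nonneg _), ofReal_norm]
    exact h2 z
  · have hcj : ContDiff ℝ j (mol n f) := hc.of_le (by exact_mod_cast le_top)
    rw [memLp_two_iff (hcj.continuous_iteratedFDeriv le_rfl).norm.aestronglyMeasurable]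
    simp only [enorm_norm]
    exact (energy_mol_le_pow_mul hl n).trans_lt (ENNReal.mul_lt_top
      (ENNReal.pow_lt_top (ENNReal.natCast_lt_top _)) (hf.hsSq_lt_top hj))

theorem MemHs.ae_tendsto_iteratedFDeriv_mol {d s k : ℕ} {M : SpatialDomain} {f : Phase d → ℝ}
    (hf : MemHs M s f) (hk : k ≤ s) : ∀ᵐ z : Phase d, ∃ A,
      Filter.Tendsto (fun n => iteratedFDeriv ℝ k (mol n f) z) Filter.atTop (nhds A) := by
  have hl := hf.locallyIntegrable
  have h1 : ∀ᵐ z : Phase d,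
      ∀ β ∈ Finset.piAntidiag (Finset.univ : Finset (Fin d ⊕ Fin d)) k, ∃ a,
      Filter.Tendsto (fun n => multiDeriv (coordFrame d) β (mol n f) z) Filter.atTop (nhds a) := by
    rw [Finset.eventually_all]
    intro β hβ
    obtain ⟨g, hg⟩ := hf.weakDeriv β ((mem_piAntidiag_iff_order.1 hβ).le.trans hk)
    filter_upwards [ae_tendsto_mol (locallyIntegrable_of_cell hg.isFunOn hg.memLp)] with z hz
    exact ⟨g z, by simpa only [multiDeriv_mol hl hg] using hz⟩
  filter_upwards [h1] with z hz
  exact exists_tendsto_iteratedFDeriv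
    (fun n => (contDiff_mol hl n).of_le (by exact_mod_cast le_top)) z
    fun β hβ => hz β (mem_piAntidiag_iff_order.2 hβ)

/-! ### Weak derivatives of limits of smooth functions -/

theorem exists_lintegral_compact_le {d : ℕ} (M : SpatialDomain) {K : Set (Phase d)}
    (hK : IsCompact K) : ∃ N : ℕ, ∀ F : Phase d → ℝ≥0∞, IsFunOn M F →
      ∫⁻ z in K, F z ≤ N * ∫⁻ z in cell d M, F z := by
  obtain ⟨S, -, hS⟩ := hK.elim_nhds_subcover (fun x => Metric.ball x (1 / 2))
    fun x _ => Metric.ball_mem_nhds x (by norm_num)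
  refine ⟨S.card, fun F hF => ?_⟩
  calc ∫⁻ z in K, F z ≤ ∫⁻ z in ⋃ x ∈ S, Metric.ball x (1 / 2), F z :=
        lintegral_mono_set hS
    _ ≤ ∑ x ∈ S, ∫⁻ z in Metric.ball x (1 / 2), F z := by
        rw [← lintegral_finsetSum_measure]
        refine lintegral_mono' ?_ le_rfl
        refine Measure.le_iff.2 fun t ht => ?_
        rw [Measure.restrict_apply ht, Measure.finsetSum_apply, inter_iUnion₂]
        refine (measure_biUnion_finset_le _ _).trans (Finset.sum_le_sum fun x _ => ?_)
        rw [Measure.restrict_apply ht]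
    _ ≤ ∑ _x ∈ S, ∫⁻ z in cell d M, F z := Finset.sum_le_sum fun x _ => lintegral_ball_le hF x
    _ = _ := by rw [Finset.sum_const, nsmul_eq_mul]

/-- An `L²` bound gives uniform integrability: `x ≤ min x Λ + x² / Λ`, where the first term is
handled by dominated convergence and the second is uniformly small for large `Λ`. -/
theorem tendsto_lintegral_of_sq_bounded {α : Type*} [MeasurableSpace α] {μ : Measure α}
    [IsFiniteMeasure μ] {D : ℕ → α → ℝ≥0∞} (hD : ∀ n, AEMeasurable (D n) μ)
    (hlim : ∀ᵐ z ∂μ, Filter.Tendsto (fun n => D n z) Filter.atTop (nhds 0)) {A : ℝ≥0∞}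
    (hA : A < ⊤) (hb : ∀ n, ∫⁻ z, D n z ^ 2 ∂μ ≤ A) :
    Filter.Tendsto (fun n => ∫⁻ z, D n z ∂μ) Filter.atTop (nhds 0) := by
  rw [ENNReal.tendsto_nhds_zero]
  intro ε hε
  by_cases hε' : ε = ⊤
  · simp [hε']
  have hε2 : ε / 2 ≠ 0 := (ENNReal.half_pos hε.ne').ne'
  -- Chosen so that `A / Λ ≤ ε / 2`; the added one keeps `Λ` nonzero.
  set Λ : ℝ≥0∞ := A / (ε / 2) + 1 with hΛ
  have hΛt : Λ ≠ ⊤ := by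
    simp [hΛ, ENNReal.div_eq_top, hε2, hA.ne, hε.ne']
  have hΛ0 : Λ ≠ 0 := by simp [hΛ]
  have h1 : Filter.Tendsto (fun n => ∫⁻ z, min (D n z) Λ ∂μ) Filter.atTop (nhds 0) := by
    have := tendsto_lintegral_of_dominated_convergence' (μ := μ) (F := fun n z => min (D n z) Λ)
      (f := fun _ => 0) (fun _ => Λ) (fun n => (hD n).min aemeasurable_const)
      (fun n => Filter.Eventually.of_forall fun z => min_le_right _ _)
      (by rw [lintegral_const]; exact ENNReal.mul_ne_top hΛt (measure_ne_top _ _))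
      (hlim.mono fun z hz => by
        have := hz.min (tendsto_const_nhds (x := Λ))
        simpa using this)
    simpa using this
  filter_upwards [(ENNReal.tendsto_nhds_zero.1 h1) (ε / 2) (ENNReal.half_pos hε.ne')] with n hn
  have h2 : ∀ x : ℝ≥0∞, x ≤ min x Λ + Λ⁻¹ * x ^ 2 := by
    intro x
    rcases le_total x Λ with h | h
    · rw [min_eq_left h]; exact le_self_add
    · refine le_trans ?_ le_add_self
      rw [sq, ← mul_assoc]
      refine le_mul_of_one_le_left zero_le ?_
      calc (1 : ℝ≥0∞) = Λ⁻¹ * Λ := (ENNReal.inv_mul_cancel hΛ0 hΛt).symm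
        _ ≤ _ := mul_le_mul' le_rfl h
  calc ∫⁻ z, D n z ∂μ ≤ ∫⁻ z, (min (D n z) Λ + Λ⁻¹ * D n z ^ 2) ∂μ := lintegral_mono fun z => h2 _
    _ = (∫⁻ z, min (D n z) Λ ∂μ) + Λ⁻¹ * ∫⁻ z, D n z ^ 2 ∂μ := by
        rw [lintegral_add_left' ((hD n).min aemeasurable_const),
          lintegral_const_mul' _ _ (ENNReal.inv_ne_top.2 hΛ0)]
    _ ≤ ε / 2 + ε / 2 := by
        refine add_le_add hn ?_
        calc Λ⁻¹ * ∫⁻ z, D n z ^ 2 ∂μ ≤ Λ⁻¹ * A := mul_le_mul' le_rfl (hb n)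
          _ ≤ ε / 2 := by
            rw [mul_comm, ← div_eq_mul_inv]
            refine ENNReal.div_le_of_le_mul ?_
            calc A = ε / 2 * (A / (ε / 2)) := by
                  rw [ENNReal.mul_div_cancel hε2]
                  exact (ENNReal.div_lt_top hε' (by norm_num)).ne
              _ ≤ _ := mul_le_mul' le_rfl le_self_add
    _ = ε := ENNReal.add_halves ε

/-- On the compact support of `ψ`, covered by finitely many balls that the cell controls, almost
everywhere convergence and an `L²` bound give convergence in `L¹`. -/
theorem tendsto_integral_mul {d : ℕ} {M : SpatialDomain} {F : ℕ → Phase d → ℝ} {G : Phase d → ℝ}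
    (hF : ∀ n, IsFunOn M (F n)) (hG : IsFunOn M G) (hFm : ∀ n, AEStronglyMeasurable (F n) volume)
    (hlim : ∀ᵐ z, Filter.Tendsto (fun n => F n z) Filter.atTop (nhds (G z))) {A : ℝ≥0∞}
    (hA : A < ⊤) (hFA : ∀ n, ∫⁻ z, ‖F n z‖ₑ ^ 2 ∂(phaseVol d M) ≤ A)
    (hGA : ∫⁻ z, ‖G z‖ₑ ^ 2 ∂(phaseVol d M) ≤ A) {ψ : Phase d → ℝ} (hψ : Continuous ψ)
    (hc : HasCompactSupport ψ) :
    Filter.Tendsto (fun n => ∫ z, F n z * ψ z) Filter.atTop (nhds (∫ z, G z * ψ z)) := by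
  have hGm : AEStronglyMeasurable G volume := aestronglyMeasurable_of_tendsto_ae _ hFm hlim
  have hint : ∀ H : Phase d → ℝ, IsFunOn M H → AEStronglyMeasurable H volume →
      ∫⁻ z, ‖H z‖ₑ ^ 2 ∂(phaseVol d M) ≤ A → Integrable fun z => H z * ψ z := by
    intro H h1 h2 h3
    have h4 : LocallyIntegrable H volume := locallyIntegrable_of_cell (M := M) h1
      ((memLp_two_iff (by rw [phaseVol]; exact h2.restrict)).2 (h3.trans_lt hA))
    simpa only [smul_eq_mul, mul_comm] using h4.integrable_smul_left_of_hasCompactSupport hψ hc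
  obtain ⟨C, hC⟩ := hψ.bounded_above_of_compact_support hc
  obtain ⟨N, hN⟩ := exists_lintegral_compact_le M hc.isCompact
  have : IsFiniteMeasure (volume.restrict (tsupport ψ)) :=
    ⟨by rw [Measure.restrict_apply_univ]; exact hc.isCompact.measure_lt_top⟩
  have h0 : Filter.Tendsto (fun n => ∫⁻ z in tsupport ψ, ‖F n z - G z‖ₑ) Filter.atTop
      (nhds 0) := by
    refine tendsto_lintegral_of_sq_bounded (A := N * (2 * (A + A)))
      (fun n => ((hFm n).sub hGm).enorm.restrict) ?_ ?_ fun n => ?_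
    · refine ae_restrict_of_ae (hlim.mono fun z hz => ?_)
      have := (hz.sub_const (G z)).enorm
      simpa using this
    · exact ENNReal.mul_lt_top (by simp) (ENNReal.mul_lt_top (by simp) (by simp [hA]))
    · refine (hN _ ((hF n).comp₂ hG fun x y => ‖x - y‖ₑ ^ 2)).trans (mul_le_mul' le_rfl ?_)
      calc ∫⁻ z in cell d M, ‖F n z - G z‖ₑ ^ 2
          ≤ ∫⁻ z in cell d M, 2 * (‖F n z‖ₑ ^ 2 + ‖G z‖ₑ ^ 2) := by
            refine lintegral_mono fun z => ?_
            have h1 := ennreal_sq_sum_le Finset.univ ![‖F n z‖ₑ, ‖G z‖ₑ]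
            simp only [Fin.sum_univ_two, Matrix.cons_val_zero, Matrix.cons_val_one,
              Finset.card_univ, Fintype.card_fin] at h1
            exact le_trans (by gcongr; exact enorm_sub_le) h1
        _ = 2 * ((∫⁻ z in cell d M, ‖F n z‖ₑ ^ 2) + ∫⁻ z in cell d M, ‖G z‖ₑ ^ 2) := by
            rw [lintegral_const_mul' _ _ (by simp),
              lintegral_add_left' ((hFm n).enorm.pow_const 2).restrict]
        _ ≤ _ := mul_le_mul' le_rfl (add_le_add (hFA n) hGA)
  refine tendsto_integral_of_L1 _ (hint G hG hGm hGA).aestronglyMeasurable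
    (Filter.Eventually.of_forall fun n => hint _ (hF n) (hFm n) (hFA n)) ?_
  have h1 := ENNReal.Tendsto.const_mul (a := ENNReal.ofReal C) h0 (Or.inr ENNReal.ofReal_ne_top)
  rw [mul_zero] at h1
  refine tendsto_of_tendsto_of_tendsto_of_le_of_le tendsto_const_nhds h1 (fun _ => zero_le)
    fun n => ?_
  change ∫⁻ z, ‖F n z * ψ z - G z * ψ z‖ₑ ≤ ENNReal.ofReal C * ∫⁻ z in tsupport ψ, ‖F n z - G z‖ₑ
  rw [← lintegral_const_mul' _ _ ENNReal.ofReal_ne_top,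
    ← lintegral_indicator (isClosed_tsupport ψ).measurableSet]
  refine lintegral_mono fun z => ?_
  by_cases hz : z ∈ tsupport ψ
  · rw [indicator_of_mem hz, ← sub_mul, enorm_mul, mul_comm]
    refine mul_le_mul' ?_ le_rfl
    rw [← ofReal_norm]
    exact ENNReal.ofReal_le_ofReal (hC z)
  · simp [image_eq_zero_of_notMem_tsupport hz]

theorem listDeriv_append_singleton {d : ℕ} (e : Frame d) (L : List (Fin d ⊕ Fin d))
    (i : Fin d ⊕ Fin d) (f : Phase d → ℝ) :
    listDeriv e (L ++ [i]) f = listDeriv e L (fun z => fderiv ℝ f z (e i)) := by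
  induction L with
  | nil => rfl
  | cons j L ih => simp only [List.cons_append, listDeriv, ih]

theorem integral_mul_listDeriv {d : ℕ} (e : Frame d) (L : List (Fin d ⊕ Fin d))
    {w φ : Phase d → ℝ} (hw : ContDiff ℝ L.length w) (hφ : ContDiff ℝ ∞ φ)
    (hc : HasCompactSupport φ) :
    ∫ z, w z * listDeriv e L φ z = (-1) ^ L.length * ∫ z, listDeriv e L w z * φ z := by
  induction L generalizing w with
  | nil => simp [listDeriv]
  | cons i L ih =>
    have hw1 : ContDiff ℝ (L.length + 1 : ℕ) w := hw
    have h1 : ContDiff ℝ L.length (fun z => fderiv ℝ w z (e i)) :=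
      (hw1.fderiv_right (m := L.length) (by norm_cast)).clm_apply contDiff_const
    have h2 := ih h1
    have hg := contDiff_infty_listDeriv e L hφ
    have hgc := hasCompactSupport_listDeriv e hc L
    have hw0 : Continuous w := hw.continuous
    have hwd : Differentiable ℝ w := hw1.differentiable (by simp)
    have h3 := integral_mul_fderiv_eq_neg_fderiv_mul_of_integrable (μ := volume) (f := w)
      (g := listDeriv e L φ) (v := e i)
      ((h1.continuous.mul hg.continuous).integrable_of_hasCompactSupport hgc.mul_left)
      ((hw0.mul (((hg.continuous_fderiv (by simp)).clm_apply
        continuous_const))).integrable_of_hasCompactSupport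
        (hasCompactSupport_listDeriv e hc (i :: L)).mul_left)
      ((hw0.mul hg.continuous).integrable_of_hasCompactSupport hgc.mul_left)
      (fun x _ => hwd x) (fun x _ => hg.differentiable (by simp) x)
    simp only [listDeriv]
    -- The outermost derivative of `φ` reaches `w` first and so becomes its innermost one; the order
    -- is restored by `listDeriv_perm`.
    rw [h3, h2, ← listDeriv_append_singleton]
    have hp : (L ++ [i]).Perm (i :: L) := List.perm_append_singleton i L
    rw [listDeriv_perm e hp (by simpa using hw1), List.length_cons, pow_succ]
    simp only [listDeriv]
    ring

/-- The weak derivative is the pointwise limit of the classical ones: both sides of the integration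
by parts identity converge, and Fatou's lemma bounds its norm. -/
theorem exists_isL2WeakDeriv_of_tendsto {d : ℕ} {M : SpatialDomain} {β : MultiIndex d}
    {w : ℕ → Phase d → ℝ} {W : Phase d → ℝ} (hw : ∀ n, ContDiff ℝ β.order (w n))
    (hp : ∀ n, IsFunOn M (w n)) (hP : IsFunOn M W)
    (hlim : ∀ᵐ z, Filter.Tendsto (fun n => w n z) Filter.atTop (nhds (W z)))
    (hder : ∀ᵐ z, ∃ a, Filter.Tendsto (fun n => multiDeriv (coordFrame d) β (w n) z)
      Filter.atTop (nhds a)) {A : ℝ≥0∞} (hA : A < ⊤)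
    (hwA : ∀ n, ∫⁻ z, ‖w n z‖ₑ ^ 2 ∂(phaseVol d M) ≤ A)
    (hdA : ∀ n, ∫⁻ z, ‖multiDeriv (coordFrame d) β (w n) z‖ₑ ^ 2 ∂(phaseVol d M) ≤ A) :
    ∃ g, IsL2WeakDeriv M (coordFrame d) β W g ∧ eLpNorm g 2 (phaseVol d M) ^ 2 ≤
      Filter.liminf (fun n => ∫⁻ z, ‖multiDeriv (coordFrame d) β (w n) z‖ₑ ^ 2 ∂(phaseVol d M))
        Filter.atTop := by
  set D : ℕ → Phase d → ℝ := fun n => multiDeriv (coordFrame d) β (w n) with hD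
  have hDc : ∀ n, Continuous (D n) := fun n => continuous_multiDeriv _ (hw n)
  have hDp : ∀ n, IsFunOn M (D n) := fun n => (hp n).listDeriv _ _
  -- `limUnder` depends only on the sequence, so `g` is periodic at every point, including those
  -- where the limit fails to exist.
  set g : Phase d → ℝ := fun z => Filter.limUnder Filter.atTop (fun n => D n z) with hg
  have hgp : IsFunOn M g := by
    rw [isFunOn_iff]
    intro k hk z
    simp only [hg, isFunOn_iff.1 (hDp _) k hk]
  have hDg : ∀ᵐ z, Filter.Tendsto (fun n => D n z) Filter.atTop (nhds (g z)) :=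
    hder.mono fun z hz => tendsto_nhds_limUnder hz
  have fatou : ∀ {F : ℕ → Phase d → ℝ} {G : Phase d → ℝ}, (∀ n, Continuous (F n)) →
      (∀ᵐ z, Filter.Tendsto (fun n => F n z) Filter.atTop (nhds (G z))) →
      ∫⁻ z, ‖G z‖ₑ ^ 2 ∂(phaseVol d M) ≤
        Filter.liminf (fun n => ∫⁻ z, ‖F n z‖ₑ ^ 2 ∂(phaseVol d M)) Filter.atTop := by
    intro F G h1 h2
    refine le_trans (le_of_eq (lintegral_congr_ae ?_))
      (lintegral_liminf_le fun n => (h1 n).enorm.measurable.pow_const 2)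
    filter_upwards [ae_cell_of_ae h2] with z hz
    exact ((ENNReal.continuous_pow 2).continuousAt.tendsto.comp hz.enorm).liminf_eq.symm
  have hbd : ∀ {a : ℕ → ℝ≥0∞}, (∀ n, a n ≤ A) → Filter.liminf a Filter.atTop ≤ A := fun h =>
    Filter.liminf_le_of_le (by isBoundedDefault) fun b hb => by
      obtain ⟨n, hn⟩ := hb.exists
      exact hn.trans (h n)
  have hgA := (fatou hDc hDg).trans (hbd hdA)
  have hWA := (fatou (fun n => (hw n).continuous) hlim).trans (hbd hwA)
  have hgm : AEStronglyMeasurable g volume :=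
    aestronglyMeasurable_of_tendsto_ae _ (fun n => (hDc n).aestronglyMeasurable) hDg
  refine ⟨g, ⟨hgp, ?_, fun φ hφ hc => ?_⟩, ?_⟩
  · exact (memLp_two_iff (by rw [phaseVol]; exact hgm.restrict)).2 (hgA.trans_lt hA)
  · have h1 := tendsto_integral_mul hp hP (fun n => (hw n).continuous.aestronglyMeasurable) hlim hA
      hwA hWA (contDiff_infty_listDeriv (coordFrame d) β.toIndexList hφ).continuous
      (hasCompactSupport_listDeriv _ hc _)
    have h2 := (tendsto_integral_mul hDp hgp (fun n => (hDc n).aestronglyMeasurable) hDg hA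
      hdA hgA hφ.continuous hc).const_mul ((-1) ^ β.order)
    refine tendsto_nhds_unique h1 (h2.congr fun n => ?_)
    rw [integral_mul_listDeriv _ _ (by rw [MultiIndex.length_toIndexList]; exact hw n) hφ hc,
      MultiIndex.length_toIndexList]
    rfl
  · rw [eLpNorm_two_sq]
    exact fatou hDc hDg

/-- Limits of smooth functions bounded in `H^s`. -/
theorem memHs_of_tendsto_of_le {d s : ℕ} {M : SpatialDomain} {w : ℕ → Phase d → ℝ} {W : Phase d → ℝ}
    (hw : ∀ n, ContDiff ℝ s (w n)) (hp : ∀ n, IsFunOn M (w n)) (hP : IsFunOn M W)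
    (hlim : ∀ᵐ z, Filter.Tendsto (fun n => w n z) Filter.atTop (nhds (W z)))
    (hder : ∀ k ≤ s, ∀ᵐ z, ∃ a, Filter.Tendsto (fun n => iteratedFDeriv ℝ k (w n) z)
      Filter.atTop (nhds a)) {A : ℕ → ℝ≥0∞} (hA : ∀ k ≤ s, A k < ⊤)
    (hE : ∀ k ≤ s, ∀ n, energy M k (w n) ≤ A k) :
    MemHs M s W ∧ ∀ k ≤ s, hsSq M k W ≤
      (Finset.piAntidiag (Finset.univ : Finset (Fin d ⊕ Fin d)) k).card * A k + A 0 := by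
  have key : ∀ β : MultiIndex d, β.order ≤ s → ∃ g, IsL2WeakDeriv M (coordFrame d) β W g ∧
      eLpNorm g 2 (phaseVol d M) ^ 2 ≤ A β.order := by
    intro β hβ
    have hwβ : ∀ n, ContDiff ℝ β.order (w n) := fun n => (hw n).of_le (by exact_mod_cast hβ)
    have h1 : ∀ n, ∫⁻ z, ‖multiDeriv (coordFrame d) β (w n) z‖ₑ ^ 2 ∂(phaseVol d M) ≤
        A β.order := by
      intro n
      refine (lintegral_mono fun z => ?_).trans (hE β.order hβ n)
      gcongr
      rw [Real.enorm_eq_ofReal_abs, ← ofReal_norm]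
      exact ENNReal.ofReal_le_ofReal (abs_multiDeriv_le β (hwβ n) z)
    have hder' : ∀ᵐ z, ∃ a, Filter.Tendsto (fun n => multiDeriv (coordFrame d) β (w n) z)
        Filter.atTop (nhds a) := by
      filter_upwards [hder β.order hβ] with z hz
      have h2 : ∀ n, multiDeriv (coordFrame d) β (w n) z =
          iteratedFDeriv ℝ β.toIndexList.length (w n) z
            fun j => coordFrame d (β.toIndexList.get j) := fun n => by
        rw [multiDeriv, listDeriv_eq_iteratedFDeriv _ _ (by
          rw [MultiIndex.length_toIndexList]; exact hwβ n)]
      simp only [h2]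
      obtain ⟨a', ha'⟩ : ∃ a', Filter.Tendsto
          (fun n => iteratedFDeriv ℝ β.toIndexList.length (w n) z) Filter.atTop (nhds a') := by
        rw [MultiIndex.length_toIndexList]; exact hz
      exact ⟨_, ((ContinuousMultilinearMap.apply ℝ (fun _ => Phase d) ℝ
        (fun j => coordFrame d (β.toIndexList.get j))).continuous.tendsto a').comp ha'⟩
    obtain ⟨g, hg, hg'⟩ := exists_isL2WeakDeriv_of_tendsto (M := M) (β := β) hwβ hp hP hlim
      hder' (A := A 0 + A β.order)
      (ENNReal.add_lt_top.2 ⟨hA 0 (Nat.zero_le s), hA _ hβ⟩)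
      (fun n => by rw [← energy_zero]; exact (hE 0 (Nat.zero_le s) n).trans le_self_add)
      (fun n => (h1 n).trans le_add_self)
    refine ⟨g, hg, hg'.trans (Filter.liminf_le_of_le (by isBoundedDefault) fun b hb => ?_)⟩
    obtain ⟨n, hn⟩ := hb.exists
    exact hn.trans (h1 n)
  have hWm : AEStronglyMeasurable W (phaseVol d M) := by
    rw [phaseVol]
    exact (aestronglyMeasurable_of_tendsto_ae _
      (fun n => (hw n).continuous.aestronglyMeasurable) hlim).restrict
  have hW0 : ∫⁻ z, ‖W z‖ₑ ^ 2 ∂(phaseVol d M) ≤ A 0 := by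
    calc ∫⁻ z, ‖W z‖ₑ ^ 2 ∂(phaseVol d M)
        = ∫⁻ z, Filter.liminf (fun n => ‖w n z‖ₑ ^ 2) Filter.atTop ∂(phaseVol d M) := by
          refine lintegral_congr_ae ?_
          filter_upwards [ae_cell_of_ae hlim] with z hz
          exact ((ENNReal.continuous_pow 2).continuousAt.tendsto.comp hz.enorm).liminf_eq.symm
      _ ≤ Filter.liminf (fun n => ∫⁻ z, ‖w n z‖ₑ ^ 2 ∂(phaseVol d M)) Filter.atTop :=
          lintegral_liminf_le fun n => (hw n).continuous.enorm.measurable.pow_const 2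
      _ ≤ A 0 := Filter.liminf_le_of_le (by isBoundedDefault) fun b hb => by
          obtain ⟨n, hn⟩ := hb.exists
          exact hn.trans (by rw [← energy_zero]; exact hE 0 (Nat.zero_le s) n)
  refine ⟨⟨hP, (memLp_two_iff hWm).2 (hW0.trans_lt (hA 0 (Nat.zero_le s))), fun β hβ => ?_⟩,
    fun k hk => add_le_add ?_ (by rwa [eLpNorm_two_sq])⟩
  · obtain ⟨g, hg, -⟩ := key β hβ
    exact ⟨g, hg⟩
  · rw [← nsmul_eq_mul]
    refine Finset.sum_le_card_nsmul _ _ _ fun β hβ => ?_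
    rw [mem_piAntidiag_iff_order] at hβ
    obtain ⟨g, hg, hg'⟩ := key β (hβ.le.trans hk)
    exact (weakDerivSq_le hg).trans (by rwa [hβ] at hg')

/-- `‖∂^β f‖²` is the limit inferior of the corresponding quantities for the mollifications. -/
theorem MemHs.weakDerivSq_eq_liminf {d s : ℕ} {M : SpatialDomain} {β : MultiIndex d}
    {f : Phase d → ℝ} (hf : MemHs M s f) (hβ : β.order ≤ s) :
    weakDerivSq M (coordFrame d) β f = Filter.liminf (fun n =>
      ∫⁻ z, ‖multiDeriv (coordFrame d) β (mol n f) z‖ₑ ^ 2 ∂(phaseVol d M)) Filter.atTop := by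
  have hl := hf.locallyIntegrable
  obtain ⟨g₀, hg₀⟩ := hf.weakDeriv β hβ
  refine le_antisymm ?_ (Filter.liminf_le_of_le (by isBoundedDefault) fun b hb => ?_)
  · have h0 : ∀ n, ∫⁻ z, ‖mol n f z‖ₑ ^ 2 ∂(phaseVol d M) ≤ hsSq M 0 f := fun n => by
      rw [← energy_zero]; exact energy_zero_mol_le hf n
    have h1 := fun n => lintegral_multiDeriv_mol_le (M := M) (β := β) hl n
    obtain ⟨g, hg, hg'⟩ := exists_isL2WeakDeriv_of_tendsto (M := M) (β := β)
      (fun n => (contDiff_mol hl n).of_le (by exact_mod_cast le_top))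
      (fun n => hf.isFunOn.conv _) hf.isFunOn (ae_tendsto_mol hl)
      ((ae_tendsto_mol (locallyIntegrable_of_cell hg₀.isFunOn hg₀.memLp)).mono fun z hz =>
        ⟨g₀ z, by simpa only [multiDeriv_mol hl hg₀] using hz⟩)
      (A := hsSq M 0 f + weakDerivSq M (coordFrame d) β f)
      (ENNReal.add_lt_top.2 ⟨hf.hsSq_lt_top (Nat.zero_le s),
        (weakDerivSq_le hg₀).trans_lt (ENNReal.pow_lt_top hg₀.memLp.2)⟩)
      (fun n => (h0 n).trans le_self_add) (fun n => (h1 n).trans le_add_self)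
    exact (weakDerivSq_le hg).trans hg'
  · obtain ⟨n, hn⟩ := hb.exists
    exact hn.trans (lintegral_multiDeriv_mol_le hl n)

/-! ### The moving frame and shears -/

/-- Change variables in the weak formulation: shearing the test function exchanges the two frames
and the measure is unchanged. -/
theorem IsL2WeakDeriv.comp_shear {d : ℕ} {M : SpatialDomain} {β : MultiIndex d} {τ : ℝ}
    {f g : Phase d → ℝ} (h : IsL2WeakDeriv M (gammaFrame d τ) β f g) :
    IsL2WeakDeriv M (coordFrame d) β (fun z => f (shear d τ z)) (fun z => g (shear d τ z)) := by
  have hmp := measurePreserving_shear (d := d) τ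
  have hme : MeasurableEmbedding (shear d τ) := (shearHomeo d τ).measurableEmbedding
  refine ⟨h.isFunOn.comp_shear τ, ?_, fun φ hφ hc => ?_⟩
  · have h1 := (aestronglyMeasurable_of_cell h.isFunOn h.memLp.1).comp_measurePreserving hmp
    refine (memLp_two_iff (by rw [phaseVol]; exact h1.restrict)).2 ?_
    have h2 := lintegral_cell_shear (h.isFunOn.comp fun x => ‖x‖ₑ ^ 2) τ
    rw [phaseVol, h2]
    exact (memLp_two_iff h.memLp.1).1 h.memLp
  · set ψ : Phase d → ℝ := fun z => φ (shear d (-τ) z) with hψ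
    have hψs : ContDiff ℝ ∞ ψ := hφ.comp (shear d (-τ)).contDiff
    have hψc : HasCompactSupport ψ := hc.comp_homeomorph (shearHomeo d τ).symm
    have e : φ = fun z => ψ (shear d τ z) := by
      funext z; simp only [hψ, shear_neg_shear]
    have h1 := h.weak ψ hψs hψc
    have h2 : multiDeriv (coordFrame d) β φ =
        fun z => multiDeriv (gammaFrame d τ) β ψ (shear d τ z) := by
      rw [e, multiDeriv, listDeriv_comp_shear τ _ (hψs.of_le (by exact_mod_cast le_top))]
      rfl
    rw [h2, e, hmp.integral_comp hme fun z => f z * multiDeriv (gammaFrame d τ) β ψ z,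
      hmp.integral_comp hme fun z => g z * ψ z, h1]

theorem IsL2WeakDeriv.of_comp_shear {d : ℕ} {M : SpatialDomain} {β : MultiIndex d} {τ : ℝ}
    {f g : Phase d → ℝ} (h : IsL2WeakDeriv M (coordFrame d) β (fun z => f (shear d τ z)) g) :
    IsL2WeakDeriv M (gammaFrame d τ) β f (fun z => g (shear d (-τ) z)) := by
  have hmp := measurePreserving_shear (d := d) τ
  have hmp' := measurePreserving_shear (d := d) (-τ)
  have hme : MeasurableEmbedding (shear d τ) := (shearHomeo d τ).measurableEmbedding
  refine ⟨h.isFunOn.comp_shear _, ?_, fun φ hφ hc => ?_⟩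
  · have h1 := (aestronglyMeasurable_of_cell h.isFunOn h.memLp.1).comp_measurePreserving hmp'
    refine (memLp_two_iff (by rw [phaseVol]; exact h1.restrict)).2 ?_
    have h2 := lintegral_cell_shear (h.isFunOn.comp fun x => ‖x‖ₑ ^ 2) (-τ)
    rw [phaseVol, h2]
    exact (memLp_two_iff h.memLp.1).1 h.memLp
  · have h1 := h.weak (fun z => φ (shear d τ z)) (hφ.comp (shear d τ).contDiff)
      (hc.comp_homeomorph (shearHomeo d τ))
    have h2 : multiDeriv (coordFrame d) β (fun z => φ (shear d τ z)) =
        fun z => multiDeriv (gammaFrame d τ) β φ (shear d τ z) := by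
      rw [multiDeriv, listDeriv_comp_shear τ _ (hφ.of_le (by exact_mod_cast le_top))]
      rfl
    rw [h2, hmp.integral_comp hme fun z => f z * multiDeriv (gammaFrame d τ) β φ z] at h1
    rw [h1, ← hmp.integral_comp hme fun z => g (shear d (-τ) z) * φ z]
    simp only [shear_neg_shear]

theorem eLpNorm_comp_shear {d : ℕ} {M : SpatialDomain} {f : Phase d → ℝ} (hf : IsFunOn M f)
    (τ : ℝ) : eLpNorm (fun z => f (shear d τ z)) 2 (phaseVol d M) ^ 2 =
      eLpNorm f 2 (phaseVol d M) ^ 2 := by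
  rw [eLpNorm_two_sq, eLpNorm_two_sq]
  exact lintegral_cell_shear (hf.comp fun x => ‖x‖ₑ ^ 2) τ

/-- The shear puts the admissible weak derivatives of both sides in correspondence with equal `L²`
norms, so the infima agree. All estimates in the moving frame reduce to `H^k` through this identity.
-/
theorem gammaSq_eq {d : ℕ} {M : SpatialDomain} {f : Phase d → ℝ} (hf : IsFunOn M f) (k : ℕ)
    (τ : ℝ) : gammaSq M k τ f = hsSq M k (fun z => f (shear d τ z)) := by
  unfold gammaSq hsSq sobolevSq
  rw [eLpNorm_comp_shear hf]
  congr 1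
  refine Finset.sum_congr rfl fun β _ => le_antisymm (le_iInf₂ fun g hg => ?_)
    (le_iInf₂ fun g hg => ?_)
  · refine (weakDerivSq_le hg.of_comp_shear).trans (le_of_eq ?_)
    exact eLpNorm_comp_shear hg.isFunOn _
  · refine (weakDerivSq_le hg.comp_shear).trans (le_of_eq ?_)
    exact eLpNorm_comp_shear hg.isFunOn _

/-! ### Consequences of the approximation -/

theorem memHs_of_tendsto {d s : ℕ} {M : SpatialDomain} {w : ℕ → Phase d → ℝ} {W : Phase d → ℝ}
    (hw : ∀ n, ContDiff ℝ s (w n)) (hp : ∀ n, IsFunOn M (w n)) (hP : IsFunOn M W)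
    (hlim : ∀ᵐ z, Filter.Tendsto (fun n => w n z) Filter.atTop (nhds (W z)))
    (hder : ∀ k ≤ s, ∀ᵐ z, ∃ a, Filter.Tendsto (fun n => iteratedFDeriv ℝ k (w n) z)
      Filter.atTop (nhds a)) (hE : ∀ k ≤ s, ∃ A < ⊤, ∀ n, energy M k (w n) ≤ A) :
    MemHs M s W ∧ ∀ k ≤ s, ∀ a b, (∀ n, energy M k (w n) ≤ a) → (∀ n, energy M 0 (w n) ≤ b) →
      hsSq M k W ≤
        (Finset.piAntidiag (Finset.univ : Finset (Fin d ⊕ Fin d)) k).card * a + b := by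
  obtain ⟨h1, h2⟩ := memHs_of_tendsto_of_le (A := fun k => ⨆ n, energy M k (w n)) hw hp hP hlim hder
    (fun k hk => by
      obtain ⟨A, hA, hA'⟩ := hE k hk
      exact (iSup_le hA').trans_lt hA) (fun k hk n => le_iSup (fun n => energy M k (w n)) n)
  refine ⟨h1, fun k hk a b ha hb => (h2 k hk).trans ?_⟩
  exact add_le_add (mul_le_mul' le_rfl (iSup_le ha)) (iSup_le hb)

theorem energy_comp_shear_le {d k : ℕ} {M : SpatialDomain} {f : Phase d → ℝ}
    (hf : ContDiff ℝ k f) (hp : IsFunOn M f) {τ : ℝ} (hτ : 0 ≤ τ) :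
    energy M k (fun z => f (shear d τ z)) ≤ ENNReal.ofReal ((1 + τ) ^ (2 * k)) * energy M k f := by
  have h0 : IsFunOn M fun z => ‖iteratedFDeriv ℝ k f z‖ₑ ^ 2 :=
    (hp.iteratedFDeriv k).comp fun x => ‖x‖ₑ ^ 2
  unfold energy phaseVol
  rw [← lintegral_cell_shear h0 τ, ← lintegral_const_mul' _ _ ENNReal.ofReal_ne_top]
  refine lintegral_mono fun z => ?_
  have h1 := (shear d τ).iteratedFDeriv_comp_right hf z (i := k) le_rfl
  have h2 : ‖iteratedFDeriv ℝ k (fun z => f (shear d τ z)) z‖ ≤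
      (1 + τ) ^ k * ‖iteratedFDeriv ℝ k f (shear d τ z)‖ := by
    change ‖iteratedFDeriv ℝ k (f ∘ shear d τ) z‖ ≤ _
    rw [h1, mul_comm]
    refine (ContinuousMultilinearMap.norm_compContinuousLinearMap_le _ _).trans ?_
    rw [Finset.prod_const, Finset.card_univ, Fintype.card_fin]
    gcongr
    exact norm_shear_le hτ
  rw [← ofReal_norm, ← ofReal_norm, ← ENNReal.ofReal_pow (norm_nonneg _),
    ← ENNReal.ofReal_pow (norm_nonneg _), ← ENNReal.ofReal_mul (by positivity)]
  refine ENNReal.ofReal_le_ofReal ((pow_le_pow_left₀ (norm_nonneg _) h2 2).trans (le_of_eq ?_))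
  ring

/-- The constant relating energies and Sobolev norms. -/
def sobConst (d k : ℕ) : ℝ≥0 := ((2 * d : ℕ) : ℝ≥0) ^ (2 * k)

def cardConst (d k : ℕ) : ℝ≥0 :=
  (Finset.piAntidiag (Finset.univ : Finset (Fin d ⊕ Fin d)) k).card

theorem energy_mol_le {d k : ℕ} {M : SpatialDomain} {f : Phase d → ℝ}
    (hf : LocallyIntegrable f volume) (n : ℕ) :
    energy M k (mol n f) ≤ sobConst d k * hsSq M k f := by
  refine (energy_mol_le_pow_mul hf n).trans (le_of_eq ?_)
  rw [sobConst]; push_cast; rfl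

/-- The chain rule is applied to the mollifications, and the bound passes to the limit. -/
theorem MemHs.comp_shear {d s : ℕ} {M : SpatialDomain} {f : Phase d → ℝ} (hf : MemHs M s f)
    {τ : ℝ} (hτ : 0 ≤ τ) : MemHs M s (fun z => f (shear d τ z)) ∧ ∀ k ≤ s,
      hsSq M k (fun z => f (shear d τ z)) ≤
        ENNReal.ofReal ((1 + τ) ^ (2 * k)) * ((cardConst d k * sobConst d k + 1 : ℝ≥0) : ℝ≥0∞) *
          hsSq M k f := by
  have hl := hf.locallyIntegrable
  have hs : ∀ n, ContDiff ℝ s (mol n f) := fun n => (hf.smoothL2_mol n).contDiff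
  have hsk : ∀ n k, k ≤ s → ContDiff ℝ k (mol n f) := fun n k hk =>
    (hs n).of_le (by exact_mod_cast hk)
  have hp : ∀ n, IsFunOn M (mol n f) := fun n => (hf.smoothL2_mol n).isFunOn
  have hqmp := (measurePreserving_shear (d := d) τ).quasiMeasurePreserving
  obtain ⟨h1, h2⟩ := memHs_of_tendsto (s := s) (M := M)
    (w := fun n z => mol n f (shear d τ z)) (W := fun z => f (shear d τ z))
    (fun n => (hs n).comp (shear d τ).contDiff) (fun n => (hp n).comp_shear τ)
    (hf.isFunOn.comp_shear τ) (hqmp.ae (ae_tendsto_mol hl))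
    (fun k hk => by
      filter_upwards [hqmp.ae (hf.ae_tendsto_iteratedFDeriv_mol hk)] with z hz
      obtain ⟨a, ha⟩ := hz
      refine ⟨a.compContinuousLinearMap fun _ => shear d τ, ?_⟩
      have h3 : ∀ n, iteratedFDeriv ℝ k (fun z => mol n f (shear d τ z)) z =
          (iteratedFDeriv ℝ k (mol n f) (shear d τ z)).compContinuousLinearMap
            fun _ => shear d τ := fun n =>
        (shear d τ).iteratedFDeriv_comp_right (hsk n k hk) z (i := k) le_rfl
      simp only [h3]
      exact ((ContinuousMultilinearMap.compContinuousLinearMapL (𝕜 := ℝ) (F := ℝ)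
        (fun _ : Fin k => shear d τ)).continuous.tendsto a).comp ha)
    (fun k hk => ⟨ENNReal.ofReal ((1 + τ) ^ (2 * k)) * (sobConst d k * hsSq M k f),
      ENNReal.mul_lt_top ENNReal.ofReal_lt_top (ENNReal.mul_lt_top ENNReal.coe_lt_top
        (hf.hsSq_lt_top hk)), fun n => (energy_comp_shear_le (hsk n k hk) (hp n) hτ).trans
          (mul_le_mul' le_rfl (energy_mol_le hl n))⟩)
  refine ⟨h1, fun k hk => (h2 k hk _ (hsSq M k f) (fun n =>
    (energy_comp_shear_le (hsk n k hk) (hp n) hτ).trans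
          (mul_le_mul' le_rfl (energy_mol_le hl n))) fun n => ?_).trans ?_⟩
  · refine (energy_comp_shear_le (hsk n 0 (Nat.zero_le s)) (hp n) hτ).trans ?_
    simpa using energy_zero_mol_le hf n
  · have h3 : (1 : ℝ≥0∞) ≤ ENNReal.ofReal ((1 + τ) ^ (2 * k)) := by
      rw [ENNReal.one_le_ofReal]
      exact one_le_pow₀ (by linarith)
    have h4 : hsSq M k f ≤ ENNReal.ofReal ((1 + τ) ^ (2 * k)) * hsSq M k f :=
      le_mul_of_one_le_left zero_le h3
    refine (add_le_add le_rfl h4).trans (le_of_eq ?_)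
    rw [cardConst]
    push_cast
    ring

theorem MemHs.of_smooth {d s : ℕ} {M : SpatialDomain} {f : Phase d → ℝ} (hf : ContDiff ℝ s f)
    (hp : IsFunOn M f) (hE : ∀ k ≤ s, energy M k f < ⊤) : MemHs M s f ∧ ∀ k ≤ s,
      hsSq M k f ≤ cardConst d k * energy M k f + energy M 0 f := by
  obtain ⟨h1, h2⟩ := memHs_of_tendsto (w := fun _ => f) (W := f) (fun _ => hf) (fun _ => hp) hp
    (Filter.Eventually.of_forall fun z => tendsto_const_nhds)
    (fun k hk => Filter.Eventually.of_forall fun z => ⟨_, tendsto_const_nhds⟩)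
    (fun k hk => ⟨_, hE k hk, fun _ => le_rfl⟩)
  exact ⟨h1, fun k hk => (h2 k hk _ _ (fun _ => le_rfl) (fun _ => le_rfl)).trans
    (by rw [cardConst]; push_cast; rfl)⟩

/-- Lower order norms are controlled by higher order ones. -/
theorem hsSq_le_hsSq (d : ℕ) (M : SpatialDomain) (s : ℕ) : ∃ C : ℝ≥0, ∀ k ≤ s,
    ∀ f : Phase d → ℝ, MemHs M s f → hsSq M k f ≤ C * hsSq M s f := by
  obtain ⟨CI, hCI⟩ := energy_interpolation d M s
  set K : ℝ≥0 := ∑ k ∈ Finset.range (s + 1), cardConst d k with hK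
  refine ⟨K * (CI * (1 + sobConst d s)) + 1, fun k hk f hf => ?_⟩
  have hl := hf.locallyIntegrable
  have hKk : cardConst d k ≤ K := Finset.single_le_sum (f := fun k => cardConst d k)
    (fun _ _ => zero_le) (Finset.mem_range.2 (by omega))
  have hs : ∀ n, ContDiff ℝ s (mol n f) := fun n => (hf.smoothL2_mol n).contDiff
  obtain ⟨-, h2⟩ := memHs_of_tendsto (w := fun n => mol n f) (W := f) hs
    (fun n => (hf.smoothL2_mol n).isFunOn) hf.isFunOn (ae_tendsto_mol hl)
    (fun k hk => hf.ae_tendsto_iteratedFDeriv_mol hk)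
    (fun k hk => ⟨_, ENNReal.mul_lt_top ENNReal.coe_lt_top (hf.hsSq_lt_top hk),
      fun n => energy_mol_le hl n⟩)
  refine (h2 k hk (CI * (1 + sobConst d s) * hsSq M s f) (hsSq M s f) (fun n => ?_)
    fun n => energy_zero_mol_le hf n).trans ?_
  · refine (hCI k hk _ (hf.smoothL2_mol n)).trans ?_
    rw [mul_assoc, add_mul, one_mul]
    gcongr
    · exact energy_zero_mol_le hf n
    · exact energy_mol_le hl n
  · have : ((Finset.piAntidiag (Finset.univ : Finset (Fin d ⊕ Fin d)) k).card : ℝ≥0∞) ≤ K := by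
      have h3 : (cardConst d k : ℝ≥0∞) ≤ K := by exact_mod_cast hKk
      rwa [cardConst, ENNReal.coe_natCast] at h3
    push_cast
    rw [add_mul, one_mul, mul_assoc (K : ℝ≥0∞)]
    gcongr

theorem enorm_add_sq_le {E : Type*} [NormedAddCommGroup E] (a b : E) :
    ‖a + b‖ₑ ^ 2 ≤ 2 * (‖a‖ₑ ^ 2 + ‖b‖ₑ ^ 2) := by
  have h1 := ennreal_sq_sum_le Finset.univ ![‖a‖ₑ, ‖b‖ₑ]
  simp only [Fin.sum_univ_two, Matrix.cons_val_zero, Matrix.cons_val_one,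
    Finset.card_univ, Fintype.card_fin] at h1
  exact le_trans (by gcongr; exact enorm_add_le _ _) h1

theorem energy_add_le {d k : ℕ} (M : SpatialDomain) {f g : Phase d → ℝ} (hf : ContDiff ℝ k f)
    (hg : ContDiff ℝ k g) :
    energy M k (fun z => f z + g z) ≤ 2 * (energy M k f + energy M k g) := by
  unfold energy
  rw [← lintegral_add_left ((measurable_enorm_iteratedFDeriv hf).pow_const 2),
    ← lintegral_const_mul' _ _ (by simp)]
  refine lintegral_mono fun z => ?_
  have := iteratedFDeriv_add_apply (x := z) hf.contDiffAt hg.contDiffAt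
  change ‖iteratedFDeriv ℝ k (f + g) z‖ₑ ^ 2 ≤ _
  rw [this]
  exact enorm_add_sq_le _ _

theorem MemHs.add (d s : ℕ) {M : SpatialDomain} {f g : Phase d → ℝ} (hf : MemHs M s f)
    (hg : MemHs M s g) : MemHs M s (fun z => f z + g z) ∧ ∀ k ≤ s,
      hsSq M k (fun z => f z + g z) ≤ ((2 * (cardConst d k * sobConst d k + 1) : ℝ≥0) : ℝ≥0∞) *
        (hsSq M k f + hsSq M k g) := by
  have hlf := hf.locallyIntegrable
  have hlg := hg.locallyIntegrable
  have hcf : ∀ n k, k ≤ s → ContDiff ℝ k (mol n f) := fun n k hk =>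
    (hf.smoothL2_mol n).contDiff.of_le (by exact_mod_cast hk)
  have hcg : ∀ n k, k ≤ s → ContDiff ℝ k (mol n g) := fun n k hk =>
    (hg.smoothL2_mol n).contDiff.of_le (by exact_mod_cast hk)
  have hE : ∀ k ≤ s, ∀ n, energy M k (fun z => mol n f z + mol n g z) ≤
      2 * (sobConst d k * (hsSq M k f + hsSq M k g)) := fun k hk n => by
    refine (energy_add_le M (hcf n k hk) (hcg n k hk)).trans (mul_le_mul' le_rfl ?_)
    rw [mul_add]
    exact add_le_add (energy_mol_le hlf n) (energy_mol_le hlg n)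
  obtain ⟨h1, h2⟩ := memHs_of_tendsto (w := fun n z => mol n f z + mol n g z)
    (W := fun z => f z + g z) (fun n => (hcf n s le_rfl).add (hcg n s le_rfl))
    (fun n => (hf.smoothL2_mol n).isFunOn.comp₂ (hg.smoothL2_mol n).isFunOn fun x y => x + y)
    (hf.isFunOn.comp₂ hg.isFunOn fun x y => x + y)
    (by
      filter_upwards [ae_tendsto_mol hlf, ae_tendsto_mol hlg] with z h1 h2
      exact h1.add h2)
    (fun k hk => by
      filter_upwards [hf.ae_tendsto_iteratedFDeriv_mol hk,
        hg.ae_tendsto_iteratedFDeriv_mol hk] with z ⟨a, ha⟩ ⟨b, hb⟩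
      refine ⟨a + b, (ha.add hb).congr fun n => ?_⟩
      exact (iteratedFDeriv_add_apply (hcf n k hk).contDiffAt (hcg n k hk).contDiffAt).symm)
    (fun k hk => ⟨_, ENNReal.mul_lt_top (by simp) (ENNReal.mul_lt_top ENNReal.coe_lt_top
      (ENNReal.add_lt_top.2 ⟨hf.hsSq_lt_top hk, hg.hsSq_lt_top hk⟩)), hE k hk⟩)
  refine ⟨h1, fun k hk => (h2 k hk _ (2 * (hsSq M k f + hsSq M k g)) (hE k hk) fun n => ?_).trans
    (le_of_eq ?_)⟩
  · refine (energy_add_le M (hcf n 0 (Nat.zero_le s)) (hcg n 0 (Nat.zero_le s))).trans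
      (mul_le_mul' le_rfl ?_)
    exact add_le_add (energy_zero_mol_le hf n) (energy_zero_mol_le hg n)
  · rw [cardConst]
    push_cast
    ring

theorem MemHs.neg {d s : ℕ} {M : SpatialDomain} {f : Phase d → ℝ} (hf : MemHs M s f) :
    MemHs M s (fun z => -f z) := by
  refine ⟨hf.isFunOn.comp fun x => -x, hf.memLp.neg, fun β hβ => ?_⟩
  obtain ⟨g, hg⟩ := hf.weakDeriv β hβ
  refine ⟨fun z => -g z, hg.isFunOn.comp fun x => -x, hg.memLp.neg, fun φ h1 h2 => ?_⟩
  simp only [neg_mul, integral_neg, hg.weak φ h1 h2]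
  ring

theorem MemHs.sub {d s : ℕ} {M : SpatialDomain} {f g : Phase d → ℝ} (hf : MemHs M s f)
    (hg : MemHs M s g) : MemHs M s (fun z => f z - g z) := by
  simpa only [sub_eq_add_neg] using (MemHs.add d s hf hg.neg).1

/-! ### Composition of Sobolev functions with nonlinear functions -/

theorem tendsto_compAlongOrderedFinpartition {E F : Type*} [NormedAddCommGroup E]
    [NormedSpace ℝ E] [NormedAddCommGroup F] [NormedSpace ℝ F] {k : ℕ} (c : OrderedFinpartition k)
    {q : ℕ → ContinuousMultilinearMap ℝ (fun _ : Fin c.length => F) ℝ}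
    {p : ℕ → ∀ i : Fin c.length, ContinuousMultilinearMap ℝ (fun _ : Fin (c.partSize i) => E) F}
    {q₀ p₀} (hq : Filter.Tendsto q Filter.atTop (nhds q₀))
    (hp : ∀ i, Filter.Tendsto (fun n => p n i) Filter.atTop (nhds (p₀ i))) :
    Filter.Tendsto (fun n => c.compAlongOrderedFinpartition (q n) (p n)) Filter.atTop
      (nhds (c.compAlongOrderedFinpartition q₀ p₀)) := by
  have h1 := ((c.compAlongOrderedFinpartitionL ℝ E F ℝ).continuous.tendsto q₀).comp hq
  exact h1.eval (tendsto_pi_nhds.2 hp)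

/-- Faà di Bruno's formula is continuous in the derivatives of the inner and outer maps, so
convergence at a point is inherited by the composition. Only existence of the limit is needed. -/
theorem tendsto_iteratedFDeriv_comp {d : ℕ} {κ : Type*} [Fintype κ] {s : ℕ}
    {h : Phase d × (κ → ℝ) → ℝ} (hh : ContDiff ℝ s h) {v : ℕ → Phase d → κ → ℝ}
    (hv : ∀ n i, ContDiff ℝ s (fun z => v n z i)) {z : Phase d}
    (hlim : ∀ i, ∀ k ≤ s, ∃ a, Filter.Tendsto (fun n => iteratedFDeriv ℝ k (fun z => v n z i) z)
      Filter.atTop (nhds a)) {b : κ → ℝ}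
    (hb : Filter.Tendsto (fun n => v n z) Filter.atTop (nhds b)) {k : ℕ} (hk : k ≤ s) :
    ∃ a, Filter.Tendsto (fun n => iteratedFDeriv ℝ k (fun z => h (z, v n z)) z)
      Filter.atTop (nhds a) := by
  have hks : (k : WithTop ℕ∞) ≤ s := by exact_mod_cast hk
  have hid : ContDiff ℝ s (fun z : Phase d => z) := contDiff_id
  have hvc : ∀ n, ContDiff ℝ s (v n) := fun n => contDiff_pi.2 (hv n)
  have h1 : ∀ j ≤ s, ∃ p, Filter.Tendsto (fun n => iteratedFDeriv ℝ j (fun z => (z, v n z)) z)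
      Filter.atTop (nhds p) := by
    intro j hj
    have hj' : (j : WithTop ℕ∞) ≤ s := by exact_mod_cast hj
    choose a ha using fun i => hlim i j hj
    have h2 : ∀ n, iteratedFDeriv ℝ j (v n) z = ContinuousMultilinearMap.piₗᵢ ℝ
        (fun _ : Fin j => Phase d) (E' := fun _ : κ => ℝ)
        (fun i => iteratedFDeriv ℝ j (fun z => v n z i) z) := by
      intro n
      ext w i
      have h3 := (ContinuousLinearMap.proj (R := ℝ) (φ := fun _ : κ => ℝ) i).iteratedFDeriv_comp_left
        (x := z) (hvc n).contDiffAt (i := j) hj'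
      change _ = iteratedFDeriv ℝ j
        (⇑(ContinuousLinearMap.proj (R := ℝ) (φ := fun _ : κ => ℝ) i) ∘ v n) z w
      rw [h3]; rfl
    have h4 := ((ContinuousMultilinearMap.piₗᵢ ℝ (fun _ : Fin j => Phase d)
      (E' := fun _ : κ => ℝ)).continuous.tendsto a).comp (tendsto_pi_nhds.2 ha)
    have h5 := ((ContinuousMultilinearMap.prodL ℝ (fun _ : Fin j => Phase d) (Phase d)
      (κ → ℝ)).continuous.tendsto _).comp
        ((tendsto_const_nhds (x := iteratedFDeriv ℝ j (fun z : Phase d => z) z)).prodMk_nhds h4)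
    refine ⟨_, h5.congr fun n => ?_⟩
    rw [iteratedFDeriv_prodMk (n := s) hid.contDiffAt (hvc n).contDiffAt hj', h2]
    rfl
  have hcomp : ∀ n, iteratedFDeriv ℝ k (fun z => h (z, v n z)) z =
      ∑ c : OrderedFinpartition k, c.compAlongOrderedFinpartition
        (iteratedFDeriv ℝ c.length h (z, v n z))
          (fun i => iteratedFDeriv ℝ (c.partSize i) (fun z => (z, v n z)) z) := fun n =>
    iteratedFDeriv_comp (g := h) (f := fun z => (z, v n z)) hh.contDiffAt
      (contDiff_id.prodMk (hvc n)).contDiffAt hks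
  simp only [hcomp]
  have h6 : ∀ j ≤ s, Filter.Tendsto (fun n => iteratedFDeriv ℝ j h (z, v n z)) Filter.atTop
      (nhds (iteratedFDeriv ℝ j h (z, b))) := fun j hj =>
    ((hh.continuous_iteratedFDeriv (by exact_mod_cast hj)).tendsto _).comp
      (tendsto_const_nhds.prodMk_nhds hb)
  choose! p hp using h1
  exact ⟨_, tendsto_finsetSum _ fun c _ => tendsto_compAlongOrderedFinpartition c
    (h6 c.length (c.length_le.trans hk)) fun i => hp (c.partSize i) ((c.partSize_le i).trans hk)⟩

theorem IsFunOn.comp_nonlin {d : ℕ} {M : SpatialDomain} {κ : Type*} {h : Phase d × (κ → ℝ) → ℝ}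
    (hh : ∀ w, IsFunOn M fun z => h (z, w)) {u : Phase d → κ → ℝ}
    (hu : ∀ i, IsFunOn M fun z => u z i) : IsFunOn M fun z => h (z, u z) := by
  rw [isFunOn_iff]
  intro g hg z
  have h1 : u (g + z) = u z := funext fun i => isFunOn_iff.1 (hu i) g hg z
  rw [h1]
  exact isFunOn_iff.1 (hh (u z)) g hg z

/-- A sup bound uniform in the mollification parameter, which keeps all approximations in one ball
of values. -/
theorem sobolev_mol (d : ℕ) (M : SpatialDomain) (k : ℕ) (hk : d + 1 ≤ k) : ∃ S : ℝ≥0,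
    ∀ f : Phase d → ℝ, MemHs M k f → ∀ n z, ‖mol n f z‖ₑ ≤ S * hsSq M k f ^ (1 / 2 : ℝ) := by
  obtain ⟨C, hC⟩ := sobolev d M k hk
  refine ⟨C * (1 + sobConst d k) ^ (1 / 2 : ℝ), fun f hf n z => ?_⟩
  refine (hC _ (hf.smoothL2_mol n) z).trans ?_
  rw [ENNReal.coe_mul, mul_assoc, ENNReal.coe_rpow_of_nonneg _ (by norm_num),
    ← ENNReal.mul_rpow_of_nonneg _ _ (by norm_num)]
  refine mul_le_mul' le_rfl (ENNReal.rpow_le_rpow ?_ (by norm_num))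
  push_cast
  rw [add_mul, one_mul]
  exact add_le_add (energy_zero_mol_le hf n) (energy_mol_le hf.locallyIntegrable n)

/-- The difference estimate for the composition operator. -/
theorem hsSq_comp_sub_le (d : ℕ) (M : SpatialDomain) (s : ℕ) (hs : d + 2 ≤ s) (κ : Type*)
    [Fintype κ] : ∃ C S : ℝ≥0, ∀ B R : ℝ, 0 ≤ B → 1 ≤ R → ∀ h : Phase d × (κ → ℝ) → ℝ,
      NonlinBound s B R h → (∀ w, IsFunOn M fun z => h (z, w)) → ∀ u₁ u₂ : Phase d → κ → ℝ,
      (∀ i, MemHs M s fun z => u₁ z i) → (∀ i, MemHs M s fun z => u₂ z i) →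
      (∀ i, S * hsSq M (s - 1) (fun z => u₁ z i) ^ (1 / 2 : ℝ) ≤ ENNReal.ofReal R) →
      (∀ i, S * hsSq M (s - 1) (fun z => u₂ z i) ^ (1 / 2 : ℝ) ≤ ENNReal.ofReal R) →
      MemHs M s (fun z => h (z, u₁ z) - h (z, u₂ z)) ∧
      hsSq M s (fun z => h (z, u₁ z) - h (z, u₂ z)) ≤ C * ENNReal.ofReal (B * R ^ s) ^ 2 *
        (∑ i, hsSq M s (fun z => u₁ z i - u₂ z i) +
          (∑ i, hsSq M (s - 1) (fun z => u₁ z i - u₂ z i)) *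
            ∑ i, (hsSq M s (fun z => u₁ z i) + hsSq M s (fun z => u₂ z i))) := by
  obtain ⟨C₀, hC₀⟩ := energy_comp_sub_le d M s κ
  -- The embedding is used at order `s - 1`, which is where `d + 2 ≤ s` enters; this is why the
  -- constants depend on the lower norm only.
  obtain ⟨S, hS⟩ := sobolev_mol d M (s - 1) (by omega)
  set K : ℝ≥0 := C₀ * ((1 + sobConst d s) * (1 + S ^ 2)) with hK
  refine ⟨(cardConst d s + 1) * K, S, fun B R hB hR h hh hp u₁ u₂ hu₁ hu₂ hr₁ hr₂ => ?_⟩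
  have hR0 : 0 < R := by linarith
  have hδ : ∀ i, MemHs M s (fun z => u₁ z i - u₂ z i) := fun i => (hu₁ i).sub (hu₂ i)
  set U₁ : ℕ → Phase d → κ → ℝ := fun n z i => mol n (fun z => u₁ z i) z with hU₁
  set U₂ : ℕ → Phase d → κ → ℝ := fun n z i => mol n (fun z => u₂ z i) z with hU₂
  have hs₁ : ∀ n i, SmoothL2 M s (fun z => U₁ n z i) := fun n i => (hu₁ i).smoothL2_mol n
  have hs₂ : ∀ n i, SmoothL2 M s (fun z => U₂ n z i) := fun n i => (hu₂ i).smoothL2_mol n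
  have hdiff : ∀ n z i, U₁ n z i - U₂ n z i = mol n (fun z => u₁ z i - u₂ z i) z := fun n z i =>
    (mol_sub (hu₁ i).locallyIntegrable (hu₂ i).locallyIntegrable n z).symm
  have hbound : ∀ u : Phase d → κ → ℝ, (∀ i, MemHs M s fun z => u z i) →
      (∀ i, S * hsSq M (s - 1) (fun z => u z i) ^ (1 / 2 : ℝ) ≤ ENNReal.ofReal R) →
      ∀ n z, ‖fun i => mol n (fun z => u z i) z‖ ≤ R := by
    intro u hu hr n z
    refine (pi_norm_le_iff_of_nonneg hR0.le).2 fun i => ?_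
    have := (hS _ ((hu i).mono (Nat.sub_le s 1)) n z).trans (hr i)
    rwa [← ofReal_norm, ENNReal.ofReal_le_ofReal_iff hR0.le] at this
  set N : ℝ≥0∞ := ∑ i, hsSq M (s - 1) (fun z => u₁ z i - u₂ z i) with hN
  set D : ℝ≥0∞ := ∑ i, hsSq M s (fun z => u₁ z i - u₂ z i) with hD
  set X : ℝ≥0∞ := ∑ i, (hsSq M s (fun z => u₁ z i) + hsSq M s (fun z => u₂ z i)) with hX
  have hNt : N < ⊤ := ENNReal.sum_lt_top.2 fun i _ => (hδ i).hsSq_lt_top (Nat.sub_le s 1)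
  have hDt : D < ⊤ := ENNReal.sum_lt_top.2 fun i _ => (hδ i).hsSq_lt_top le_rfl
  have hXt : X < ⊤ := ENNReal.sum_lt_top.2 fun i _ =>
    ENNReal.add_lt_top.2 ⟨(hu₁ i).hsSq_lt_top le_rfl, (hu₂ i).hsSq_lt_top le_rfl⟩
  -- The sup bound of the difference supplied by its `H^{s-1}` norm; its square turns the `lam²`
  -- term into the product `N * X`.
  set lamE : ℝ≥0∞ := S * N ^ (1 / 2 : ℝ) with hlamE
  have hlamt : lamE ≠ ⊤ :=
    ENNReal.mul_ne_top ENNReal.coe_ne_top (ENNReal.rpow_ne_top_of_nonneg (by norm_num) hNt.ne)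
  have hlam2 : lamE ^ 2 = S ^ 2 * N := by
    rw [hlamE, mul_pow, ← ENNReal.rpow_two (N ^ (1 / 2 : ℝ)), ← ENNReal.rpow_mul]
    norm_num
  have hlamb : ∀ n z, ‖U₁ n z - U₂ n z‖ ≤ lamE.toReal := by
    intro n z
    refine (pi_norm_le_iff_of_nonneg ENNReal.toReal_nonneg).2 fun i => ?_
    rw [Pi.sub_apply, hdiff, ← ENNReal.ofReal_le_iff_le_toReal hlamt, ofReal_norm]
    refine (hS _ ((hδ i).mono (Nat.sub_le s 1)) n z).trans
      (mul_le_mul' le_rfl (ENNReal.rpow_le_rpow ?_ (by norm_num)))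
    exact Finset.single_le_sum (f := fun i => hsSq M (s - 1) (fun z => u₁ z i - u₂ z i))
      (fun _ _ => zero_le) (Finset.mem_univ i)
  set A : ℝ≥0∞ := K * ENNReal.ofReal (B * R ^ s) ^ 2 * (D + N * X) with hA
  have hAt : A < ⊤ := ENNReal.mul_lt_top (ENNReal.mul_lt_top ENNReal.coe_lt_top
    (ENNReal.pow_lt_top ENNReal.ofReal_lt_top)) (ENNReal.add_lt_top.2
      ⟨hDt, ENNReal.mul_lt_top hNt hXt⟩)
  have hEb : ∀ f : Phase d → ℝ, MemHs M s f → ∀ n,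
      energy M 0 (mol n f) + energy M s (mol n f) ≤ (1 + sobConst d s : ℝ≥0) * hsSq M s f := by
    intro f hf n
    push_cast
    rw [add_mul, one_mul]
    exact add_le_add (energy_zero_mol_le hf n) (energy_mol_le hf.locallyIntegrable n)
  have hE : ∀ k ≤ s, ∀ n, energy M k (fun z => h (z, U₁ n z) - h (z, U₂ n z)) ≤ A := by
    intro k hk n
    -- The smooth estimate divides by `lam`. If `lam` vanishes, so does the difference of the
    -- mollifications, and there is nothing to bound.
    rcases eq_or_ne lamE 0 with h0 | h0
    · have h1 : (fun z => h (z, U₁ n z) - h (z, U₂ n z)) = fun _ => 0 := by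
        funext z
        have h2 := hlamb n z
        rw [h0, ENNReal.toReal_zero, norm_le_zero_iff, sub_eq_zero] at h2
        rw [h2, sub_self]
      rw [h1]
      simp [energy]
    · have h1 := hC₀ k hk B R lamE.toReal hB hR (ENNReal.toReal_pos h0 hlamt) h hh (U₁ n) (U₂ n)
        (hs₁ n) (hs₂ n) (hbound u₁ hu₁ hr₁ n) (hbound u₂ hu₂ hr₂ n) (hlamb n)
      refine h1.trans ?_
      rw [ENNReal.ofReal_toReal hlamt, hlam2, ← Finset.sum_add_distrib]
      have h2 : ∑ i, (energy M 0 (fun z => U₁ n z i - U₂ n z i) +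
          energy M s (fun z => U₁ n z i - U₂ n z i)) ≤ (1 + sobConst d s : ℝ≥0) * D := by
        rw [hD, Finset.mul_sum]
        refine Finset.sum_le_sum fun i _ => ?_
        simp only [hdiff]
        exact hEb _ (hδ i) n
      have h3 : ∑ i, ((energy M 0 (fun z => U₁ n z i) + energy M s (fun z => U₁ n z i)) +
          (energy M 0 (fun z => U₂ n z i) + energy M s (fun z => U₂ n z i))) ≤
            (1 + sobConst d s : ℝ≥0) * X := by
        rw [hX, Finset.mul_sum]
        refine Finset.sum_le_sum fun i _ => ?_
        rw [mul_add]
        exact add_le_add (hEb _ (hu₁ i) n) (hEb _ (hu₂ i) n)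
      calc _ ≤ C₀ * ENNReal.ofReal (B * R ^ s) ^ 2 * ((1 + sobConst d s : ℝ≥0) * D +
            S ^ 2 * N * ((1 + sobConst d s : ℝ≥0) * X)) := by gcongr
        _ = C₀ * ENNReal.ofReal (B * R ^ s) ^ 2 * ((1 + sobConst d s : ℝ≥0) *
            (1 * D + S ^ 2 * (N * X))) := by ring
        _ ≤ C₀ * ENNReal.ofReal (B * R ^ s) ^ 2 * ((1 + sobConst d s : ℝ≥0) *
            ((1 + S ^ 2) * D + (1 + S ^ 2) * (N * X))) := by
            gcongr
            · exact le_self_add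
            · exact le_add_self
        _ = A := by
            rw [hA, hK]
            push_cast
            ring
  have hcs : ∀ u : Phase d → κ → ℝ, (∀ i, ContDiff ℝ s fun z => u z i) →
      ContDiff ℝ s fun z => h (z, u z) := fun u hu =>
    hh.contDiff.comp (contDiff_id.prodMk (contDiff_pi.2 hu))
  have hlim : ∀ᵐ z, ∀ i, Filter.Tendsto (fun n => U₁ n z i) Filter.atTop (nhds (u₁ z i)) ∧
      Filter.Tendsto (fun n => U₂ n z i) Filter.atTop (nhds (u₂ z i)) := by
    rw [Filter.eventually_all]
    intro i
    filter_upwards [ae_tendsto_mol (hu₁ i).locallyIntegrable,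
      ae_tendsto_mol (hu₂ i).locallyIntegrable] with z h1 h2
    exact ⟨h1, h2⟩
  have hlimd : ∀ᵐ z, ∀ i, ∀ k ≤ s,
      (∃ a, Filter.Tendsto (fun n => iteratedFDeriv ℝ k (fun z => U₁ n z i) z)
        Filter.atTop (nhds a)) ∧
      ∃ a, Filter.Tendsto (fun n => iteratedFDeriv ℝ k (fun z => U₂ n z i) z)
        Filter.atTop (nhds a) := by
    rw [Filter.eventually_all]
    intro i
    rw [ae_all_iff]
    intro k
    by_cases hk : k ≤ s
    · filter_upwards [(hu₁ i).ae_tendsto_iteratedFDeriv_mol hk,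
        (hu₂ i).ae_tendsto_iteratedFDeriv_mol hk] with z h1 h2 _
      exact ⟨h1, h2⟩
    · exact Filter.Eventually.of_forall fun z h => absurd h hk
  obtain ⟨h1, h2⟩ := memHs_of_tendsto (s := s) (M := M)
    (w := fun n z => h (z, U₁ n z) - h (z, U₂ n z)) (W := fun z => h (z, u₁ z) - h (z, u₂ z))
    (fun n => (hcs _ fun i => (hs₁ n i).contDiff).sub (hcs _ fun i => (hs₂ n i).contDiff))
    (fun n => (IsFunOn.comp_nonlin hp fun i => (hs₁ n i).isFunOn).comp₂
      (IsFunOn.comp_nonlin hp fun i => (hs₂ n i).isFunOn) fun x y => x - y)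
    ((IsFunOn.comp_nonlin hp fun i => (hu₁ i).isFunOn).comp₂
      (IsFunOn.comp_nonlin hp fun i => (hu₂ i).isFunOn) fun x y => x - y)
    (by
      filter_upwards [hlim] with z hz
      have h3 : Filter.Tendsto (fun n => h (z, U₁ n z)) Filter.atTop (nhds (h (z, u₁ z))) :=
        (hh.contDiff.continuous.tendsto _).comp
          (tendsto_const_nhds.prodMk_nhds (tendsto_pi_nhds.2 fun i => (hz i).1))
      have h4 : Filter.Tendsto (fun n => h (z, U₂ n z)) Filter.atTop (nhds (h (z, u₂ z))) :=
        (hh.contDiff.continuous.tendsto _).comp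
          (tendsto_const_nhds.prodMk_nhds (tendsto_pi_nhds.2 fun i => (hz i).2))
      exact h3.sub h4)
    (fun k hk => by
      have hk' : (k : WithTop ℕ∞) ≤ s := by exact_mod_cast hk
      filter_upwards [hlim, hlimd] with z hz hz'
      obtain ⟨a, ha⟩ := tendsto_iteratedFDeriv_comp hh.contDiff (v := U₁)
        (fun n i => (hs₁ n i).contDiff) (fun i k hk => (hz' i k hk).1)
        (tendsto_pi_nhds.2 fun i => (hz i).1) hk
      obtain ⟨b, hb⟩ := tendsto_iteratedFDeriv_comp hh.contDiff (v := U₂)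
        (fun n i => (hs₂ n i).contDiff) (fun i k hk => (hz' i k hk).2)
        (tendsto_pi_nhds.2 fun i => (hz i).2) hk
      refine ⟨a - b, (ha.sub hb).congr fun n => ?_⟩
      exact (iteratedFDeriv_sub_apply
        ((hcs _ fun i => (hs₁ n i).contDiff).of_le hk').contDiffAt
        ((hcs _ fun i => (hs₂ n i).contDiff).of_le hk').contDiffAt).symm)
    (fun k hk => ⟨A, hAt, hE k hk⟩)
  refine ⟨h1, (h2 s le_rfl A A (hE s le_rfl) (hE 0 (Nat.zero_le s))).trans (le_of_eq ?_)⟩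
  rw [hA, cardConst]
  push_cast
  ring

/-! ### The composition estimate in the moving frame -/

/-- Composing with the linear map `shear × A` costs its norm to the power of the order, at most `(a
(1 + τ))^s`. The values are not sheared, so the Lipschitz bound in `w` costs only one more `a`. -/
theorem nonlinBound_shear {d : ℕ} {κ W : Type*} [Fintype κ] [NormedAddCommGroup W]
    [NormedSpace ℝ W] {s : ℕ} {G : Phase d × W → ℝ} (hG : ContDiff ℝ (s + 1 : ℕ) G)
    (A : (κ → ℝ) →L[ℝ] W) {a R τ b : ℝ} (ha : 1 ≤ a) (hA : ‖A‖ ≤ a) (hτ : 0 ≤ τ)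
    (hb : ∀ n ≤ s + 1, ∀ z w, ‖w‖ ≤ a * R → ‖iteratedFDeriv ℝ n G (z, w)‖ ≤ b) (hR : 0 ≤ R) :
    NonlinBound s (a ^ (s + 1) * (1 + τ) ^ s * b) R
      (fun y : Phase d × (κ → ℝ) => G (shear d τ y.1, A y.2)) := by
  set L : (Phase d × (κ → ℝ)) →L[ℝ] (Phase d × W) := (shear d τ).prodMap A with hL
  have hb0 : 0 ≤ b := (norm_nonneg _).trans (hb 0 (Nat.zero_le _) 0 0 (by
    rw [norm_zero]; positivity))
  have hLn : ‖L‖ ≤ a * (1 + τ) := by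
    refine ContinuousLinearMap.opNorm_le_bound _ (by positivity) fun y => ?_
    have h1 : ‖shear d τ y.1‖ ≤ (1 + τ) * ‖y‖ :=
      ((shear d τ).le_opNorm _).trans (mul_le_mul (norm_shear_le hτ) (norm_fst_le y)
        (norm_nonneg _) (by positivity))
    have h2 : ‖A y.2‖ ≤ a * ‖y‖ :=
      (A.le_opNorm _).trans (mul_le_mul hA (norm_snd_le y) (norm_nonneg _) (by positivity))
    have h3 := norm_nonneg y
    change max ‖shear d τ y.1‖ ‖A y.2‖ ≤ _
    refine max_le (h1.trans ?_) (h2.trans ?_)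
    · nlinarith [mul_nonneg (by linarith : 0 ≤ a - 1) (by positivity : 0 ≤ (1 + τ) * ‖y‖)]
    · nlinarith [mul_nonneg (by positivity : 0 ≤ a * τ) h3]
  have hLp : ∀ n ≤ s, ‖L‖ ^ n ≤ a ^ s * (1 + τ) ^ s := by
    intro n hn
    rw [← mul_pow]
    refine (pow_le_pow_left₀ (norm_nonneg _) hLn n).trans (pow_le_pow_right₀ ?_ hn)
    nlinarith
  have hGs : ContDiff ℝ s G := hG.of_le (by exact_mod_cast Nat.le_succ s)
  have hcomp : ∀ n ≤ s, ∀ y, iteratedFDeriv ℝ n (fun y : Phase d × (κ → ℝ) =>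
      G (shear d τ y.1, A y.2)) y =
      (iteratedFDeriv ℝ n G (L y)).compContinuousLinearMap fun _ => L := fun n hn y =>
    L.iteratedFDeriv_comp_right hGs y (i := n) (by exact_mod_cast hn)
  have hAw : ∀ w : κ → ℝ, ‖w‖ ≤ R → ‖A w‖ ≤ a * R := fun w hw =>
    (A.le_opNorm _).trans (mul_le_mul hA hw (norm_nonneg _) (by positivity))
  have hnorm : ∀ n ≤ s, ∀ q : ContinuousMultilinearMap ℝ (fun _ : Fin n => Phase d × W) ℝ,
      ‖q.compContinuousLinearMap fun _ => L‖ ≤ a ^ s * (1 + τ) ^ s * ‖q‖ := by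
    intro n hn q
    refine (ContinuousMultilinearMap.norm_compContinuousLinearMap_le _ _).trans ?_
    rw [Finset.prod_const, Finset.card_univ, Fintype.card_fin, mul_comm]
    exact mul_le_mul_of_nonneg_right (hLp n hn) (norm_nonneg _)
  refine ⟨hGs.comp L.contDiff, fun n hn z w hw => ?_, fun n hn z w₁ w₂ hw₁ hw₂ => ?_⟩
  · rw [hcomp n hn]
    refine (hnorm n hn _).trans ?_
    have h1 := hb n (hn.trans (Nat.le_succ s)) (shear d τ z) (A w) (hAw w hw)
    calc a ^ s * (1 + τ) ^ s * ‖iteratedFDeriv ℝ n G (L (z, w))‖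
        ≤ a ^ s * (1 + τ) ^ s * b := mul_le_mul_of_nonneg_left h1 (by positivity)
      _ ≤ a ^ s * (1 + τ) ^ s * b * a := le_mul_of_one_le_right (by positivity) ha
      _ = _ := by ring
  · rw [hcomp n hn, hcomp n hn]
    have e : (iteratedFDeriv ℝ n G (L (z, w₁))).compContinuousLinearMap (fun _ => L) -
        (iteratedFDeriv ℝ n G (L (z, w₂))).compContinuousLinearMap (fun _ => L) =
        (iteratedFDeriv ℝ n G (L (z, w₁)) - iteratedFDeriv ℝ n G (L (z, w₂))
          ).compContinuousLinearMap (fun _ => L) := rfl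
    rw [e]
    refine (hnorm n hn _).trans ?_
    have hdiff : Differentiable ℝ (iteratedFDeriv ℝ n G) :=
      hG.differentiable_iteratedFDeriv (by exact_mod_cast Nat.lt_succ_of_le hn)
    -- The mean value inequality on the convex set of values of norm at most `a * R` consumes the
    -- derivative of order `s + 1`.
    have hmv := Convex.norm_image_sub_le_of_norm_fderiv_le (𝕜 := ℝ) (f := iteratedFDeriv ℝ n G)
      (s := (univ : Set (Phase d)) ×ˢ Metric.closedBall (0 : W) (a * R)) (C := b)
      (x := L (z, w₂)) (y := L (z, w₁)) (fun y _ => hdiff y) (fun y hy => by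
        rw [norm_fderiv_iteratedFDeriv]
        exact hb (n + 1) (by omega) y.1 y.2 (by simpa using hy.2))
      (convex_univ.prod (convex_closedBall _ _))
      ⟨mem_univ _, by simpa [hL] using hAw w₂ hw₂⟩ ⟨mem_univ _, by simpa [hL] using hAw w₁ hw₁⟩
    have h2 : ‖L (z, w₁) - L (z, w₂)‖ ≤ a * ‖w₁ - w₂‖ := by
      have : L (z, w₁) - L (z, w₂) = (0, A (w₁ - w₂)) := by
        simp [hL]
      rw [this, Prod.norm_def]
      simp only [norm_zero]
      refine max_le (by positivity) ((A.le_opNorm _).trans ?_)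
      exact mul_le_mul_of_nonneg_right hA (norm_nonneg _)
    calc a ^ s * (1 + τ) ^ s * ‖iteratedFDeriv ℝ n G (L (z, w₁)) - iteratedFDeriv ℝ n G (L (z, w₂))‖
        ≤ a ^ s * (1 + τ) ^ s * (b * (a * ‖w₁ - w₂‖)) := by
          refine mul_le_mul_of_nonneg_left (hmv.trans ?_) (by positivity)
          exact mul_le_mul_of_nonneg_left h2 hb0
      _ = _ := by ring

theorem hsSq_zero {d : ℕ} (M : SpatialDomain) (k : ℕ) : hsSq M k (fun _ : Phase d => (0 : ℝ)) = 0 := by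
  have h1 : IsFunOn M fun _ : Phase d => (0 : ℝ) := isFunOn_iff.2 fun _ _ _ => rfl
  have h2 : ∀ j, energy M j (fun _ : Phase d => (0 : ℝ)) = 0 := fun j => by simp [energy]
  have := (MemHs.of_smooth (s := k) (M := M) contDiff_const h1
    (fun j _ => by rw [h2]; simp)).2 k le_rfl
  simpa [h2] using this

theorem memHs_zero (d : ℕ) (M : SpatialDomain) (s : ℕ) : MemHs M s (fun _ : Phase d => (0 : ℝ)) :=
  (MemHs.of_smooth contDiff_const (isFunOn_iff.2 fun _ _ _ => rfl)
    (fun j _ => by simp [energy])).1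

/-- A nonlinear function of `(z, w)` which is periodic in `z` and whose derivatives up to order
`s + 1` are bounded by `b` for `|w| ≤ r`. -/
structure NonlinData {d : ℕ} (M : SpatialDomain) {W : Type*} [NormedAddCommGroup W]
    [NormedSpace ℝ W] (s : ℕ) (r b : ℝ) (G : Phase d × W → ℝ) : Prop where
  contDiff : ContDiff ℝ (s + 1 : ℕ) G
  isFunOn : ∀ w, IsFunOn M fun z => G (z, w)
  bound : ∀ n ≤ s + 1, ∀ z w, ‖w‖ ≤ r → ‖iteratedFDeriv ℝ n G (z, w)‖ ≤ b

/-- The difference estimate for the composition operator in the moving frame. -/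
theorem gammaSq_comp_sub_le (d : ℕ) (M : SpatialDomain) (s : ℕ) (hs : d + 2 ≤ s) {κ W : Type*}
    [Fintype κ] [NormedAddCommGroup W] [NormedSpace ℝ W] (A : (κ → ℝ) →L[ℝ] W) {a : ℝ}
    (ha : 1 ≤ a) (hA : ‖A‖ ≤ a) : ∃ C S : ℝ≥0, ∀ τ R b : ℝ, 0 ≤ τ → 1 ≤ R →
      ∀ G : Phase d × W → ℝ, NonlinData M s (a * R) b G → ∀ u₁ u₂ : Phase d → κ → ℝ,
      (∀ i, MemHs M s fun z => u₁ z i) → (∀ i, MemHs M s fun z => u₂ z i) →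
      (∀ i, S * gammaSq M (s - 1) τ (fun z => u₁ z i) ^ (1 / 2 : ℝ) ≤ ENNReal.ofReal R) →
      (∀ i, S * gammaSq M (s - 1) τ (fun z => u₂ z i) ^ (1 / 2 : ℝ) ≤ ENNReal.ofReal R) →
      MemHs M s (fun z => G (shear d τ z, A (u₁ (shear d τ z))) -
        G (shear d τ z, A (u₂ (shear d τ z)))) ∧
      gammaSq M s τ (fun z => G (z, A (u₁ z)) - G (z, A (u₂ z))) ≤
        C * ENNReal.ofReal ((1 + τ) ^ (2 * s)) * ENNReal.ofReal (b * R ^ s) ^ 2 *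
        (∑ i, gammaSq M s τ (fun z => u₁ z i - u₂ z i) +
          (∑ i, gammaSq M (s - 1) τ (fun z => u₁ z i - u₂ z i)) *
            ∑ i, (gammaSq M s τ (fun z => u₁ z i) + gammaSq M s τ (fun z => u₂ z i))) := by
  obtain ⟨C, S, hC⟩ := hsSq_comp_sub_le d M s hs κ
  refine ⟨C * (a ^ (s + 1)).toNNReal ^ 2, S,
    fun τ R b hτ hR G hG u₁ u₂ hu₁ hu₂ hr₁ hr₂ => ?_⟩
  have hb0 : 0 ≤ b := (norm_nonneg _).trans (hG.bound 0 (Nat.zero_le _) 0 0 (by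
    rw [norm_zero]; positivity))
  have hN := nonlinBound_shear (κ := κ) hG.contDiff A ha hA hτ hG.bound (by linarith)
  have hp : ∀ w : κ → ℝ, IsFunOn M fun z => G (shear d τ z, A w) := fun w =>
    (hG.isFunOn (A w)).comp_shear τ
  have hd : ∀ i, IsFunOn M fun z => u₁ z i - u₂ z i := fun i =>
    (hu₁ i).isFunOn.comp₂ (hu₂ i).isFunOn fun x y => x - y
  have hW : IsFunOn M fun z => G (z, A (u₁ z)) - G (z, A (u₂ z)) :=
    (IsFunOn.comp_nonlin (h := fun y => G (y.1, A y.2)) (fun w => hG.isFunOn (A w))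
      fun i => (hu₁ i).isFunOn).comp₂ (IsFunOn.comp_nonlin (h := fun y => G (y.1, A y.2))
        (fun w => hG.isFunOn (A w)) fun i => (hu₂ i).isFunOn) fun x y => x - y
  -- Nonlinearity and arguments are sheared together; the constant enters squared, which gives `(1 +
  -- τ)^{2s}`.
  have h1 := hC (a ^ (s + 1) * (1 + τ) ^ s * b) R (by positivity) hR _ hN hp
    (fun z => u₁ (shear d τ z)) (fun z => u₂ (shear d τ z))
    (fun i => ((hu₁ i).comp_shear hτ).1) (fun i => ((hu₂ i).comp_shear hτ).1)
    (fun i => by rw [← gammaSq_eq (hu₁ i).isFunOn]; exact hr₁ i)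
    (fun i => by rw [← gammaSq_eq (hu₂ i).isFunOn]; exact hr₂ i)
  refine ⟨h1.1, ?_⟩
  rw [gammaSq_eq hW]
  simp only [gammaSq_eq (hd _), gammaSq_eq (hu₁ _).isFunOn, gammaSq_eq (hu₂ _).isFunOn]
  refine h1.2.trans (le_of_eq ?_)
  congr 1
  have e : a ^ (s + 1) * (1 + τ) ^ s * b * R ^ s = a ^ (s + 1) * ((1 + τ) ^ s * (b * R ^ s)) := by
    ring
  have e2 : ENNReal.ofReal ((1 + τ) ^ (2 * s)) = ENNReal.ofReal ((1 + τ) ^ s) ^ 2 := by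
    rw [← ENNReal.ofReal_pow (by positivity), pow_mul']
  rw [e, e2, ENNReal.ofReal_mul (by positivity), ENNReal.ofReal_mul (by positivity)]
  push_cast
  change _ = C * ENNReal.ofReal (a ^ (s + 1)) ^ 2 * _ * _
  ring

/-- Used for the inhomogeneous part `G(·, 0)`, whose coordinate derivatives are square integrable by
hypothesis. -/
theorem gammaSq_of_smooth (d : ℕ) (M : SpatialDomain) (s : ℕ) : ∃ C : ℝ≥0, ∀ f : Phase d → ℝ,
    ContDiff ℝ s f → IsFunOn M f → ∀ b : ℝ≥0, (∀ β : MultiIndex d, β.order ≤ s →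
      eLpNorm (multiDeriv (coordFrame d) β f) 2 (phaseVol d M) ≤ b) → MemHs M s f ∧
      ∀ τ, 0 ≤ τ → gammaSq M s τ f ≤ C * ENNReal.ofReal ((1 + τ) ^ (2 * s)) * (b : ℝ≥0∞) ^ 2 := by
  refine ⟨(cardConst d s * sobConst d s + 1) * (cardConst d s * (sobConst d s * cardConst d s) + 1),
    fun f hf hp b hb => ?_⟩
  have hE : ∀ k ≤ s, energy M k f ≤ sobConst d k * cardConst d k * b ^ 2 := by
    intro k hk
    refine (energy_le_sum M (hf.of_le (by exact_mod_cast hk))).trans ?_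
    rw [sobConst, cardConst, mul_assoc]
    push_cast
    refine mul_le_mul' le_rfl ?_
    rw [← nsmul_eq_mul]
    refine Finset.sum_le_card_nsmul _ _ _ fun β hβ => ?_
    rw [← eLpNorm_two_sq]
    gcongr
    exact hb β ((mem_piAntidiag_iff_order.1 hβ).le.trans hk)
  have hE0 : energy M 0 f ≤ b ^ 2 := by
    rw [energy_zero, ← eLpNorm_two_sq]
    gcongr
    have := hb 0 (by simp [MultiIndex.order])
    have e : (MultiIndex.toIndexList (0 : MultiIndex d)) = [] :=
      List.length_eq_zero_iff.1 ((MultiIndex.length_toIndexList _).trans (by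
        simp [MultiIndex.order]))
    simpa [multiDeriv, e, listDeriv] using this
  obtain ⟨h1, h2⟩ := MemHs.of_smooth hf hp fun k hk => (hE k hk).trans_lt
    (ENNReal.mul_lt_top (ENNReal.mul_lt_top ENNReal.coe_lt_top ENNReal.coe_lt_top)
      (ENNReal.pow_lt_top ENNReal.coe_lt_top))
  refine ⟨h1, fun τ hτ => ?_⟩
  rw [gammaSq_eq hp]
  refine ((h1.comp_shear hτ).2 s le_rfl).trans ?_
  calc _ ≤ ENNReal.ofReal ((1 + τ) ^ (2 * s)) *
        ((cardConst d s * sobConst d s + 1 : ℝ≥0) : ℝ≥0∞) *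
          (cardConst d s * (sobConst d s * cardConst d s * b ^ 2) + b ^ 2) := by
        refine mul_le_mul' le_rfl ((h2 s le_rfl).trans ?_)
        exact add_le_add (mul_le_mul' le_rfl (hE s le_rfl)) hE0
    _ = _ := by
        push_cast
        ring

theorem gammaSq_add_le (d : ℕ) (M : SpatialDomain) (s : ℕ) : ∃ C : ℝ≥0, ∀ τ, 0 ≤ τ →
    ∀ f g : Phase d → ℝ, IsFunOn M f → IsFunOn M g → MemHs M s (fun z => f (shear d τ z)) →
      MemHs M s (fun z => g (shear d τ z)) →
      gammaSq M s τ (fun z => f z + g z) ≤ C * (gammaSq M s τ f + gammaSq M s τ g) := by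
  refine ⟨2 * (cardConst d s * sobConst d s + 1), fun τ hτ f g hf hg hfs hgs => ?_⟩
  rw [gammaSq_eq (hf.comp₂ hg fun x y => x + y), gammaSq_eq hf, gammaSq_eq hg]
  exact (hfs.add d s hgs).2 s le_rfl

/-- The bound for the composition operator in the moving frame. -/
theorem gammaSq_comp_le (d : ℕ) (M : SpatialDomain) (s : ℕ) (hs : d + 2 ≤ s) {κ W : Type*}
    [Fintype κ] [NormedAddCommGroup W] [NormedSpace ℝ W] (A : (κ → ℝ) →L[ℝ] W) {a : ℝ}
    (ha : 1 ≤ a) (hA : ‖A‖ ≤ a) : ∃ C S : ℝ≥0, ∀ τ R b : ℝ, 0 ≤ τ → 1 ≤ R → ∀ b₀ : ℝ≥0,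
      ∀ G : Phase d × W → ℝ, NonlinData M s (a * R) b G → (∀ β : MultiIndex d, β.order ≤ s →
        eLpNorm (multiDeriv (coordFrame d) β (fun z => G (z, 0))) 2 (phaseVol d M) ≤ b₀) →
      ∀ u : Phase d → κ → ℝ, (∀ i, MemHs M s fun z => u z i) →
      (∀ i, S * gammaSq M (s - 1) τ (fun z => u z i) ^ (1 / 2 : ℝ) ≤ ENNReal.ofReal R) →
      MemHs M s (fun z => G (shear d τ z, A (u (shear d τ z)))) ∧
      gammaSq M s τ (fun z => G (z, A (u z))) ≤
        C * ENNReal.ofReal ((1 + τ) ^ (2 * s)) * (ENNReal.ofReal (b * R ^ s) ^ 2 *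
        ((1 + ∑ i, gammaSq M (s - 1) τ (fun z => u z i)) *
            ∑ i, gammaSq M s τ (fun z => u z i)) + (b₀ : ℝ≥0∞) ^ 2) := by
  obtain ⟨C₁, S, h1⟩ := gammaSq_comp_sub_le d M s hs A ha hA
  obtain ⟨C₂, h2⟩ := gammaSq_of_smooth d M s
  obtain ⟨C₃, h3⟩ := gammaSq_add_le d M s
  refine ⟨C₃ * (C₁ + C₂), S, fun τ R b hτ hR b₀ G hG hb₀ u hu hr => ?_⟩
  have hz : ∀ i : κ, MemHs M s fun z : Phase d => (0 : Phase d → κ → ℝ) z i := fun i =>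
    memHs_zero d M s
  have hγ0 : ∀ k, gammaSq M k τ (fun _ : Phase d => (0 : ℝ)) = 0 := fun k => by
    rw [gammaSq_eq (isFunOn_iff.2 fun _ _ _ => rfl), hsSq_zero]
  -- Comparison with the zero function; the remaining term `G(·, 0)` is added back afterwards.
  obtain ⟨h4, h5⟩ := h1 τ R b hτ hR G hG u 0 hu hz hr fun i => by
    simp only [Pi.zero_apply, hγ0]
    rw [ENNReal.zero_rpow_of_pos (by norm_num), mul_zero]
    exact zero_le
  simp only [Pi.zero_apply, map_zero, sub_zero, hγ0, add_zero] at h4 h5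
  have hG0 : ContDiff ℝ s fun z : Phase d => G (z, 0) :=
    (hG.contDiff.of_le (by exact_mod_cast Nat.le_succ s)).comp (contDiff_id.prodMk contDiff_const)
  obtain ⟨h6, h7⟩ := h2 _ hG0 (hG.isFunOn 0) b₀ hb₀
  have h8 := (h6.comp_shear hτ).1
  have hu1 : IsFunOn M fun z => G (z, A (u z)) :=
    IsFunOn.comp_nonlin (h := fun y => G (y.1, A y.2)) (fun w => hG.isFunOn (A w))
      fun i => (hu i).isFunOn
  have h9 := h3 τ hτ (fun z => G (z, A (u z)) - G (z, 0)) (fun z => G (z, 0))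
    (hu1.comp₂ (hG.isFunOn 0) fun x y => x - y) (hG.isFunOn 0) h4 h8
  simp only [sub_add_cancel] at h9
  refine ⟨by simpa only [sub_add_cancel] using (h4.add d s h8).1, h9.trans ?_⟩
  calc _ ≤ C₃ * (C₁ * ENNReal.ofReal ((1 + τ) ^ (2 * s)) * ENNReal.ofReal (b * R ^ s) ^ 2 *
          (∑ i, gammaSq M s τ (fun z => u z i) +
            (∑ i, gammaSq M (s - 1) τ (fun z => u z i)) *
              ∑ i, gammaSq M s τ (fun z => u z i)) +
        C₂ * ENNReal.ofReal ((1 + τ) ^ (2 * s)) * (b₀ : ℝ≥0∞) ^ 2) :=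
        mul_le_mul' le_rfl (add_le_add h5 (h7 τ hτ))
    _ = C₃ * ENNReal.ofReal ((1 + τ) ^ (2 * s)) * (C₁ * (ENNReal.ofReal (b * R ^ s) ^ 2 *
          ((1 + ∑ i, gammaSq M (s - 1) τ (fun z => u z i)) *
              ∑ i, gammaSq M s τ (fun z => u z i))) + C₂ * (b₀ : ℝ≥0∞) ^ 2) := by ring
    _ ≤ C₃ * ENNReal.ofReal ((1 + τ) ^ (2 * s)) * ((C₁ + C₂) * (ENNReal.ofReal (b * R ^ s) ^ 2 *
          ((1 + ∑ i, gammaSq M (s - 1) τ (fun z => u z i)) *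
              ∑ i, gammaSq M s τ (fun z => u z i))) + (C₁ + C₂) * (b₀ : ℝ≥0∞) ^ 2) := by
        gcongr
        · exact le_self_add
        · exact le_add_self
    _ = _ := by
        push_cast
        ring

/-! ### Monotone bounds -/

/-- A nonlinear function with a bounding function for all radii. -/
structure NonlinFamily {d : ℕ} (M : SpatialDomain) {W : Type*} [NormedAddCommGroup W]
    [NormedSpace ℝ W] (s : ℕ) (Ψ : ℝ≥0 → ℝ≥0) (G : Phase d × W → ℝ) : Prop where
  data : ∀ r : ℝ≥0, NonlinData M s r (Ψ r) G
  zero : ∀ β : MultiIndex d, β.order ≤ s →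
    eLpNorm (multiDeriv (coordFrame d) β (fun z => G (z, 0))) 2 (phaseVol d M) ≤ Ψ 0

theorem MemHs.gammaSq_lt_top {d s k : ℕ} {M : SpatialDomain} {f : Phase d → ℝ} (hf : MemHs M s f)
    (hk : k ≤ s) {τ : ℝ} (hτ : 0 ≤ τ) : gammaSq M k τ f < ⊤ := by
  rw [gammaSq_eq hf.isFunOn]
  exact (hf.comp_shear hτ).1.hsSq_lt_top hk

/-- The radius `R` is made an explicit function of the bound `x` on the lower norm, so that a single
monotone function, depending on the nonlinearity only through `Ψ`, serves both estimates. -/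
theorem exists_monotone_bound (d : ℕ) (M : SpatialDomain) (s : ℕ) (hs : d + 2 ≤ s) {κ W : Type*}
    [Fintype κ] [NormedAddCommGroup W] [NormedSpace ℝ W] (A : (κ → ℝ) →L[ℝ] W) {Ψ : ℝ≥0 → ℝ≥0}
    (hΨ : Monotone Ψ) : ∃ F : ℝ≥0 → ℝ≥0, Monotone F ∧ ∀ G : Phase d × W → ℝ,
      NonlinFamily M s Ψ G → ∀ τ : ℝ, 0 ≤ τ →
      (∀ (u : Phase d → κ → ℝ) (x : ℝ≥0), (∀ i, MemHs M s fun z => u z i) →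
        ∑ i, gammaSq M (s - 1) τ (fun z => u z i) ≤ x →
        MemHs M s (fun z => G (shear d τ z, A (u (shear d τ z)))) ∧
        gammaSq M s τ (fun z => G (z, A (u z))) ≤ ENNReal.ofReal ((1 + τ) ^ (2 * s)) * F x *
          (1 + ∑ i, gammaSq M s τ (fun z => u z i))) ∧
      (∀ (u₁ u₂ : Phase d → κ → ℝ) (x : ℝ≥0), (∀ i, MemHs M s fun z => u₁ z i) →
        (∀ i, MemHs M s fun z => u₂ z i) →
        ∑ i, gammaSq M (s - 1) τ (fun z => u₁ z i) ≤ x →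
        ∑ i, gammaSq M (s - 1) τ (fun z => u₂ z i) ≤ x →
        gammaSq M s τ (fun z => G (z, A (u₁ z)) - G (z, A (u₂ z))) ≤
          ENNReal.ofReal ((1 + τ) ^ (2 * s)) * F x *
          (∑ i, gammaSq M s τ (fun z => u₁ z i - u₂ z i) +
          (∑ i, gammaSq M (s - 1) τ (fun z => u₁ z i - u₂ z i)) *
            (∑ i, gammaSq M s τ (fun z => u₁ z i) + ∑ i, gammaSq M s τ (fun z => u₂ z i)))) := by
  set a : ℝ≥0 := 1 + ‖A‖₊ with haA
  have ha : (1 : ℝ) ≤ a := by rw [haA]; push_cast; linarith [norm_nonneg A]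
  have hA : ‖A‖ ≤ a := by rw [haA]; push_cast; linarith
  obtain ⟨C₁, S₁, h1⟩ := gammaSq_comp_sub_le d M s hs A ha hA
  obtain ⟨C₂, S₂, h2⟩ := gammaSq_comp_le d M s hs A ha hA
  -- Dominates both Sobolev bounds; the added one meets the requirement `1 ≤ R`.
  set R : ℝ≥0 → ℝ≥0 := fun x => (S₁ + S₂) * x ^ (1 / 2 : ℝ) + 1 with hR
  have hRm : Monotone R := fun x y h => by
    simp only [hR]
    gcongr
  set P : ℝ≥0 → ℝ≥0 := fun x => Ψ (a * R x) * R x ^ s with hP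
  have hPm : Monotone P := fun x y h => by
    simp only [hP]
    exact mul_le_mul' (hΨ (mul_le_mul' le_rfl (hRm h))) (pow_le_pow_left' (hRm h) s)
  refine ⟨fun x => (C₁ + C₂) * (P x ^ 2 * (1 + x) + Ψ 0 ^ 2), fun x y h => ?_,
    fun G hG τ hτ => ?_⟩
  · have := hPm h
    dsimp only
    gcongr
  have hR1 : ∀ x, (1 : ℝ) ≤ R x := fun x => by
    have : (1 : ℝ≥0) ≤ R x := le_add_self
    exact_mod_cast this
  have hdata : ∀ x, NonlinData M s ((a : ℝ) * R x) (Ψ (a * R x)) G := fun x => by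
    have := hG.data (a * R x)
    push_cast at this
    exact this
  have hSR : ∀ (u : Phase d → κ → ℝ) (x : ℝ≥0), ∑ i, gammaSq M (s - 1) τ (fun z => u z i) ≤ x →
      ∀ S : ℝ≥0, S ≤ S₁ + S₂ → ∀ i,
      S * gammaSq M (s - 1) τ (fun z => u z i) ^ (1 / 2 : ℝ) ≤ ENNReal.ofReal (R x) := by
    intro u x hx S hS i
    rw [ENNReal.ofReal_coe_nnreal]
    have h3 : gammaSq M (s - 1) τ (fun z => u z i) ≤ x :=
      (Finset.single_le_sum (f := fun i => gammaSq M (s - 1) τ (fun z => u z i))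
        (fun _ _ => zero_le) (Finset.mem_univ i)).trans hx
    calc _ ≤ ((S₁ + S₂ : ℝ≥0) : ℝ≥0∞) * (x : ℝ≥0∞) ^ (1 / 2 : ℝ) := by gcongr
      _ = (((S₁ + S₂) * x ^ (1 / 2 : ℝ) : ℝ≥0) : ℝ≥0∞) := by
          rw [ENNReal.coe_mul, ENNReal.coe_rpow_of_nonneg _ (by norm_num)]
      _ ≤ _ := by
          rw [ENNReal.coe_le_coe]
          exact le_self_add
  have hPx : ∀ x, ENNReal.ofReal ((Ψ (a * R x) : ℝ) * (R x : ℝ) ^ s) = P x := fun x => by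
    rw [hP, ← ENNReal.ofReal_coe_nnreal]
    push_cast
    rfl
  refine ⟨fun u x hu hx => ?_, fun u₁ u₂ x hu₁ hu₂ hx₁ hx₂ => ?_⟩
  · obtain ⟨h3, h4⟩ := h2 τ (R x) (Ψ (a * R x)) hτ (hR1 x) (Ψ 0) G (hdata x) hG.zero u hu
      (hSR u x hx S₂ le_add_self)
    refine ⟨h3, h4.trans ?_⟩
    rw [hPx]
    set X := ∑ i, gammaSq M s τ (fun z => u z i)
    push_cast
    calc _ ≤ C₂ * ENNReal.ofReal ((1 + τ) ^ (2 * s)) * ((P x : ℝ≥0∞) ^ 2 * ((1 + x) * X) +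
          (Ψ 0 : ℝ≥0∞) ^ 2) := by gcongr
      _ ≤ C₂ * ENNReal.ofReal ((1 + τ) ^ (2 * s)) * ((P x : ℝ≥0∞) ^ 2 * ((1 + x) * (1 + X)) +
          (Ψ 0 : ℝ≥0∞) ^ 2 * (1 + X)) := by
          gcongr
          · exact le_add_self
          · exact le_mul_of_one_le_right zero_le le_self_add
      _ = ENNReal.ofReal ((1 + τ) ^ (2 * s)) * (C₂ * ((P x : ℝ≥0∞) ^ 2 * (1 + x) +
          (Ψ 0 : ℝ≥0∞) ^ 2)) * (1 + X) := by ring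
      _ ≤ _ := by
          gcongr
          exact le_add_self
  · obtain ⟨-, h4⟩ := h1 τ (R x) (Ψ (a * R x)) hτ (hR1 x) G (hdata x) u₁ u₂ hu₁ hu₂
      (hSR u₁ x hx₁ S₁ le_self_add) (hSR u₂ x hx₂ S₁ le_self_add)
    refine h4.trans ?_
    rw [hPx, Finset.sum_add_distrib]
    set Y := ∑ i, gammaSq M s τ (fun z => u₁ z i - u₂ z i) +
          (∑ i, gammaSq M (s - 1) τ (fun z => u₁ z i - u₂ z i)) *
            (∑ i, gammaSq M s τ (fun z => u₁ z i) + ∑ i, gammaSq M s τ (fun z => u₂ z i))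
    push_cast
    calc C₁ * ENNReal.ofReal ((1 + τ) ^ (2 * s)) * (P x : ℝ≥0∞) ^ 2 * Y
        = ENNReal.ofReal ((1 + τ) ^ (2 * s)) * (C₁ * ((P x : ℝ≥0∞) ^ 2 * 1)) * Y := by ring
      _ ≤ _ := by
          gcongr
          · exact le_self_add
          · exact le_trans (by gcongr; exact le_self_add) le_self_add

/-! ### The nonlinearities of the system -/

/-- The identification of `ℝ^{1+d}` with `ℝ × ℝ^d`. -/
def pairMap (d : ℕ) : (Unit ⊕ Fin d → ℝ) →L[ℝ] ℝ × Vel d :=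
  (ContinuousLinearMap.proj (Sum.inl ())).prod
    (((EuclideanSpace.equiv (Fin d) ℝ).symm : (Fin d → ℝ) →L[ℝ] Vel d).comp
      (ContinuousLinearMap.pi fun i => ContinuousLinearMap.proj (Sum.inr i)))

/-- The pair `(m, p)` as a function with values in `ℝ^{1+d}`. -/
def pairFun {d : ℕ} (m : Phase d → ℝ) (p : Phase d → Vel d) (z : Phase d) : Unit ⊕ Fin d → ℝ :=
  Sum.elim (fun _ => m z) (fun i => p z i)

theorem pairMap_pairFun {d : ℕ} (m : Phase d → ℝ) (p : Phase d → Vel d) (z : Phase d) :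
    pairMap d (pairFun m p z) = (m z, p z) := by
  refine Prod.ext rfl ?_
  ext i
  rfl

/-- The assumption on `H` uses the Euclidean norm of `(m, p)`, while the product type carries the
sup norm. This, with the strict inequality in the assumption, explains the radius `2 * r + 1` in
`hamBound`. -/
theorem norm_toLp_pair_le {d : ℕ} (w : ℝ × Vel d) : ‖WithLp.toLp 2 (w.1, w.2)‖ ≤ 2 * ‖w‖ := by
  have h1 : (WithLp.toLp 2 (w.1, w.2) : WithLp 2 (ℝ × Vel d)) =
      WithLp.toLp 2 (w.1, 0) + WithLp.toLp 2 (0, w.2) := by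
    rw [← WithLp.toLp_add]; simp
  rw [h1]
  refine (norm_add_le _ _).trans ?_
  rw [WithLp.norm_toLp_fst, WithLp.norm_toLp_snd]
  have := norm_fst_le w
  have := norm_snd_le w
  linarith

theorem listDeriv_zero {d : ℕ} (e : Frame d) (L : List (Fin d ⊕ Fin d)) :
    listDeriv e L (fun _ => 0) = fun _ => 0 := by
  induction L with
  | nil => rfl
  | cons i L ih =>
    funext z
    simp [listDeriv, ih]

/-- The bounding function of the nonlinearities built from `H`. -/
def hamBound (s : ℕ) (Φ : ℝ≥0 → ℝ≥0) (r : ℝ≥0) : ℝ≥0 := 2 ^ (s + 1) * (r + 1) * Φ (2 * r + 1)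

theorem monotone_hamBound (s : ℕ) {Φ : ℝ≥0 → ℝ≥0} (hΦ : Monotone Φ) : Monotone (hamBound s Φ) := by
  intro x y h
  unfold hamBound
  have := hΦ (show 2 * x + 1 ≤ 2 * y + 1 by gcongr)
  gcongr

theorem le_hamBound (s : ℕ) (Φ : ℝ≥0 → ℝ≥0) (r : ℝ≥0) : Φ (2 * r + 1) ≤ hamBound s Φ r := by
  unfold hamBound
  refine le_mul_of_one_le_left zero_le (one_le_mul (one_le_pow₀ (by norm_num)) le_add_self)

theorem HamiltonianAssumption.bound' {d : ℕ} {M : SpatialDomain} {s : ℕ} {T : ℝ} {Φ : ℝ≥0 → ℝ≥0}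
    {H : ℝ → Phase d → ℝ → Vel d → ℝ} (hH : HamiltonianAssumption M s T Φ H) {t : ℝ}
    (ht : t ∈ Icc 0 T) (r : ℝ≥0) {n : ℕ} (hn : n ≤ s + 2) (z : Phase d) (w : ℝ × Vel d)
    (hw : ‖w‖ ≤ r) :
    ‖iteratedFDeriv ℝ n (fun y : Phase d × ℝ × Vel d => H t y.1 y.2.1 y.2.2) (z, w)‖ ≤
      Φ (2 * r + 1) := by
  refine hH.bound t ht (2 * r + 1) z w.1 w.2 ?_ n hn
  have := norm_toLp_pair_le w
  push_cast
  linarith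

theorem HamiltonianAssumption.nonlinFamily {d : ℕ} {M : SpatialDomain} {s : ℕ} {T : ℝ}
    {Φ : ℝ≥0 → ℝ≥0} {H : ℝ → Phase d → ℝ → Vel d → ℝ} (hH : HamiltonianAssumption M s T Φ H)
    {t : ℝ} (ht : t ∈ Icc 0 T) : NonlinFamily M s (hamBound s Φ)
      (fun y : Phase d × ℝ × Vel d => H t y.1 y.2.1 y.2.2) := by
  refine ⟨fun r => ⟨(hH.contDiff t ht).of_le (by exact_mod_cast Nat.le_succ _), fun w =>
    (hH.isFunOn t ht).comp fun h => h w.1 w.2, fun n hn z w hw => ?_⟩, fun β hβ => ?_⟩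
  · exact (hH.bound' ht r (hn.trans (Nat.le_succ _)) z w hw).trans
      (by exact_mod_cast le_hamBound s Φ r)
  · have h0 : ∀ {q : ℝ≥0∞}, MemLp (fun _ : Phase d => (WithLp.toLp 2 ((0 : ℝ), (0 : Vel d)) :
        WithLp 2 (ℝ × Vel d))) q (phaseVol d M) := MemLp.zero'
    -- The `L²` hypothesis is needed only at the zero pair; the rest of the composition is
    -- controlled by differences.
    have h1 := hH.l2Bound β hβ (fun _ => 0) (fun _ => 0) (isFunOn_iff.2 fun _ _ _ => rfl)
      (isFunOn_iff.2 fun _ _ _ => rfl) h0 h0 t ht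
    have h2 : (fun _ : Phase d => (WithLp.toLp 2 ((0 : ℝ), (0 : Vel d)) :
        WithLp 2 (ℝ × Vel d))) = 0 := by
      funext z; exact WithLp.toLp_zero 2
    rw [h2, eLpNorm_zero, eLpNorm_zero, add_zero, ENNReal.toNNReal_zero] at h1
    refine h1.trans ?_
    rw [ENNReal.coe_le_coe]
    exact (hH.mono zero_le).trans (le_hamBound s Φ 0)

/-- The `i`-th component of `J`. -/
def fluxComp {d : ℕ} (H : ℝ → Phase d → ℝ → Vel d → ℝ) (t : ℝ) (i : Fin d)
    (y : Phase d × ℝ × Vel d) : ℝ :=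
  y.2.1 * fderiv ℝ (fun y : Phase d × ℝ × Vel d => H t y.1 y.2.1 y.2.2) y
    (0, 0, EuclideanSpace.single i 1)

/-- Writing the gradient through the joint derivative of `H` makes each component of the flux a
smooth function of `(z, m, p)`, open to the same composition estimate. -/
theorem fluxJ_apply {d : ℕ} {H : ℝ → Phase d → ℝ → Vel d → ℝ} {t : ℝ}
    (hH : Differentiable ℝ (fun y : Phase d × ℝ × Vel d => H t y.1 y.2.1 y.2.2)) (z : Phase d)
    (m : ℝ) (p : Vel d) (i : Fin d) : fluxJ H t z m p i = fluxComp H t i (z, m, p) := by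
  have h1 : HasFDerivAt (fun q : Vel d => H t z m q)
      ((fderiv ℝ (fun y : Phase d × ℝ × Vel d => H t y.1 y.2.1 y.2.2) (z, m, p)).comp
        ((0 : Vel d →L[ℝ] Phase d).prod ((0 : Vel d →L[ℝ] ℝ).prod
          (ContinuousLinearMap.id ℝ (Vel d))))) p :=
    (hH (z, m, p)).hasFDerivAt.comp (f := fun q : Vel d => (z, m, q)) p
      ((hasFDerivAt_const z p).prodMk ((hasFDerivAt_const m p).prodMk (hasFDerivAt_id p)))
  have h2 : gradient (fun q : Vel d => H t z m q) p i =
      fderiv ℝ (fun q : Vel d => H t z m q) p (EuclideanSpace.single i 1) := by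
    have h3 := InnerProductSpace.toDual_symm_apply (𝕜 := ℝ) (E := Vel d)
      (x := EuclideanSpace.single i 1) (y := fderiv ℝ (fun q : Vel d => H t z m q) p)
    rw [← h3, gradient, EuclideanSpace.inner_single_right]
    simp
  rw [fluxJ, PiLp.smul_apply, h2, h1.fderiv]
  rfl

theorem norm_iteratedFDeriv_clm_le {E : Type*} [NormedAddCommGroup E] [NormedSpace ℝ E]
    (l : E →L[ℝ] ℝ) (n : ℕ) (y : E) : ‖iteratedFDeriv ℝ n l y‖ ≤ ‖l y‖ + ‖l‖ := by
  rcases n with _ | n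
  · rw [norm_iteratedFDeriv_zero]; linarith [norm_nonneg l]
  · rw [← norm_iteratedFDeriv_fderiv]
    have : fderiv ℝ (l : E → ℝ) = fun _ => l := by
      funext x; exact l.fderiv
    rw [this]
    rcases n with _ | n
    · rw [norm_iteratedFDeriv_zero]; linarith [norm_nonneg (l y)]
    · rw [iteratedFDeriv_succ_const]
      simp only [Pi.zero_apply, norm_zero]
      positivity

/-- The derivative in `p` uses one order of smoothness, so `s + 2` derivatives of `H` leave the `s +
1` required. The flux vanishes at `m = 0`, which makes the condition at zero trivial. -/
theorem HamiltonianAssumption.nonlinFamily_fluxComp {d : ℕ} {M : SpatialDomain} {s : ℕ} {T : ℝ}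
    {Φ : ℝ≥0 → ℝ≥0} {H : ℝ → Phase d → ℝ → Vel d → ℝ} (hH : HamiltonianAssumption M s T Φ H)
    {t : ℝ} (ht : t ∈ Icc 0 T) (i : Fin d) :
    NonlinFamily M s (hamBound s Φ) (fluxComp H t i) := by
  set Ht : Phase d × ℝ × Vel d → ℝ := fun y => H t y.1 y.2.1 y.2.2 with hHt
  set e : Phase d × ℝ × Vel d := (0, 0, EuclideanSpace.single i 1) with he
  have hen : ‖e‖ ≤ 1 := by simp [he, Prod.norm_def]
  set l : Phase d × ℝ × Vel d →L[ℝ] ℝ :=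
    (ContinuousLinearMap.fst ℝ ℝ (Vel d)).comp (ContinuousLinearMap.snd ℝ (Phase d) (ℝ × Vel d))
    with hl
  have hln : ‖l‖ ≤ 1 := ContinuousLinearMap.opNorm_le_bound _ zero_le_one fun y => by
    rw [one_mul]
    exact (norm_fst_le y.2).trans (norm_snd_le y)
  have hc : ContDiff ℝ (s + 2 : ℕ) Ht := hH.contDiff t ht
  have hcd : ContDiff ℝ (s + 1 : ℕ) (fderiv ℝ Ht) := hc.fderiv_right (by norm_cast)
  have hge : ContDiff ℝ (s + 1 : ℕ) fun y => fderiv ℝ Ht y e := hcd.clm_apply contDiff_const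
  have hp : ∀ w, IsFunOn M fun z => Ht (z, w) := fun w =>
    (hH.isFunOn t ht).comp fun h => h w.1 w.2
  refine ⟨fun r => ⟨l.contDiff.mul hge, fun w => ?_, fun n hn z w hw => ?_⟩, fun β hβ => ?_⟩
  · rw [isFunOn_iff]
    intro k hk z
    have h1 : (fun y : Phase d × ℝ × Vel d => Ht ((k, 0) + y)) = Ht := by
      funext y
      have := isFunOn_iff.1 (hp y.2) k hk y.1
      rw [← this]
      simp only [hHt, Prod.fst_add, Prod.snd_add, zero_add]
    have h2 : fderiv ℝ Ht (k + z, w) = fderiv ℝ Ht (z, w) := by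
      conv_rhs => rw [← h1]
      rw [fderiv_comp_add_left]
      simp
    change w.1 * fderiv ℝ Ht (k + z, w) e = w.1 * fderiv ℝ Ht (z, w) e
    rw [h2]
  · have hn' : (n : WithTop ℕ∞) ≤ (s + 1 : ℕ) := by exact_mod_cast hn
    have h1 := norm_iteratedFDeriv_mul_le (f := fun y => l y) (g := fun y => fderiv ℝ Ht y e)
      l.contDiff hge (z, w) hn'
    refine h1.trans ?_
    -- Leibniz' rule: derivatives of the linear form `m` are at most `r + 1`, those of `H` at most
    -- `Φ (2 * r + 1)`, and the binomial coefficients sum to `2 ^ n`.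
    have h2 : ∀ j ∈ Finset.range (n + 1), (n.choose j : ℝ) *
        ‖iteratedFDeriv ℝ j (fun y => l y) (z, w)‖ *
        ‖iteratedFDeriv ℝ (n - j) (fun y => fderiv ℝ Ht y e) (z, w)‖ ≤
        n.choose j * ((r + 1) * Φ (2 * r + 1)) := by
      intro j hj
      rw [mul_assoc]
      refine mul_le_mul_of_nonneg_left (mul_le_mul ?_ ?_ (norm_nonneg _) (by positivity))
        (by positivity)
      · refine (norm_iteratedFDeriv_clm_le l j (z, w)).trans (add_le_add ?_ hln)
        exact (norm_fst_le w).trans hw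
      · have h3 := (ContinuousLinearMap.apply ℝ ℝ e).norm_iteratedFDeriv_comp_left (x := (z, w))
          (f := fderiv ℝ Ht) (N := (s + 1 : ℕ)) (n := n - j) hcd.contDiffAt
          (by exact_mod_cast (Nat.sub_le n j).trans hn)
        refine le_trans h3 ?_
        rw [norm_iteratedFDeriv_fderiv]
        have h4 : ‖ContinuousLinearMap.apply ℝ ℝ e‖ ≤ 1 :=
          ContinuousLinearMap.opNorm_le_bound _ zero_le_one fun A => by
            rw [one_mul]
            exact (A.le_opNorm e).trans (mul_le_of_le_one_right (norm_nonneg _) hen)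
        exact (mul_le_of_le_one_left (norm_nonneg _) h4).trans
          (hH.bound' ht r (by omega) z w hw)
    refine (Finset.sum_le_sum h2).trans ?_
    rw [← Finset.sum_mul]
    have h3 : (∑ j ∈ Finset.range (n + 1), (n.choose j : ℝ)) = 2 ^ n := by
      exact_mod_cast Nat.sum_range_choose n
    rw [h3, hamBound]
    push_cast
    rw [mul_assoc]
    exact mul_le_mul_of_nonneg_right (pow_le_pow_right₀ (by norm_num) hn) (by positivity)
  · have h1 : (fun z : Phase d => fluxComp H t i (z, 0)) = fun _ => 0 := by
      funext z; simp [fluxComp]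
    rw [h1, multiDeriv, listDeriv_zero, eLpNorm_zero']
    exact zero_le

theorem TerminalAssumption.nonlinFamily {d : ℕ} {M : SpatialDomain} {s : ℕ}
    {Φ : ℝ≥0 → ℝ≥0} {g : Phase d → ℝ → ℝ} (hg : TerminalAssumption M s Φ g) :
    NonlinFamily M s (fun r => Φ (r + 1)) (fun y : Phase d × ℝ => g y.1 y.2) := by
  refine ⟨fun r => ⟨hg.contDiff, fun w => hg.isFunOn.comp fun h => h w, fun n hn z w hw => ?_⟩,
    fun β hβ => ?_⟩
  · refine hg.bound (r + 1) z w ?_ n hn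
    push_cast
    rw [← Real.norm_eq_abs]
    linarith
  · have h1 := hg.l2Bound β hβ (fun _ => 0) (isFunOn_iff.2 fun _ _ _ => rfl) (by simp) (by simp)
    rw [eLpNorm_zero', eLpNorm_zero', add_zero, ENNReal.toNNReal_zero] at h1
    refine h1.trans ?_
    rw [ENNReal.coe_le_coe]
    exact hg.mono zero_le

/-! ### Measurability in time of the Sobolev norms -/

theorem IsMeasFun.exists_measurable {d : ℕ} {M : SpatialDomain} {T : ℝ} {m : ℝ → Phase d → ℝ}
    (hm : IsMeasFun M T m) : ∃ m' : ℝ × Phase d → ℝ, Measurable m' ∧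
      ∀ᵐ t ∂(volume.restrict (Icc 0 T)), IsFunOn M (m t) →
        m t =ᵐ[volume] fun z => m' (t, z) := by
  obtain ⟨m₁, h1, h2⟩ := hm
  refine ⟨fun y => m₁ (y.1, toCell M y.2), h1.measurable.comp
    (measurable_fst.prodMk ((measurable_toCell M).comp measurable_snd)), ?_⟩
  filter_upwards [Measure.ae_ae_of_ae_prod h2] with t ht hp
  refine ae_of_ae_cell (M := M)
    (hp.comp₂ ((isFunOn_toCell d M).comp fun x => m₁ (t, x)) fun x y => x = y) ?_
  have h3 : ∀ᵐ z ∂(phaseVol d M), z ∈ cell d M := by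
    rw [phaseVol]; exact ae_restrict_mem (measurableSet_cell d M)
  filter_upwards [ht, h3] with z hz hz'
  rw [toCell_of_mem hz']
  exact hz

/-- As an infimum over weak derivatives the norm is not visibly measurable in time. By
`MemHs.weakDerivSq_eq_liminf` it is, for almost every time, a lower limit of integrals of
convolutions, which depend measurably on time for a jointly measurable representative. -/
theorem aemeasurable_gammaSq {d : ℕ} {M : SpatialDomain} {T : ℝ} {s k : ℕ} {m : ℝ → Phase d → ℝ}
    (hm : IsMeasFun M T m) (hs : ∀ᵐ t ∂(volume.restrict (Icc 0 T)), MemHs M s (m t)) (hk : k ≤ s)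
    {c : ℝ → ℝ} (hc : Continuous c) (hc0 : ∀ t ∈ Icc 0 T, 0 ≤ c t) :
    AEMeasurable (fun t => gammaSq M k (c t) (m t)) (volume.restrict (Icc 0 T)) := by
  obtain ⟨m', h1, h2⟩ := hm.exists_measurable
  have hsh : Continuous fun y : ℝ × Phase d => shear d (c y.1) y.2 :=
    (continuous_shear (d := d)).comp ((hc.comp continuous_fst).prodMk continuous_snd)
  set q : ℝ × Phase d → ℝ := fun y => m' (y.1, shear d (c y.1) y.2) with hq
  have hqm : Measurable q := h1.comp (measurable_fst.prodMk hsh.measurable)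
  set V : MultiIndex d → ℕ → ℝ → Phase d → ℝ := fun β n t z =>
    conv (multiDeriv (coordFrame d) β (kernel d n)) (fun y => q (t, y)) z with hV
  have hVm : ∀ β n, Measurable (fun y : ℝ × Phase d => V β n y.1 y.2) := by
    intro β n
    have h3 : Measurable fun y : (ℝ × Phase d) × Phase d =>
        multiDeriv (coordFrame d) β (kernel d n) (y.1.2 - y.2) * q (y.1.1, y.2) := by
      refine Measurable.mul ?_ (hqm.comp (measurable_fst.fst.prodMk measurable_snd))
      exact (continuous_multiDeriv (coordFrame d) ((contDiff_kernel d n).of_le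
        (by exact_mod_cast le_top))).measurable.comp (measurable_fst.snd.sub measurable_snd)
    have h4 := h3.stronglyMeasurable.integral_prod_right' (ν := (volume : Measure (Phase d)))
    have e : (fun y : ℝ × Phase d => V β n y.1 y.2) = fun y => ∫ x,
        multiDeriv (coordFrame d) β (kernel d n) (y.2 - x) * q (y.1, x) := by
      funext y
      simp only [hV, conv_apply]
    rw [e]
    exact h4.measurable
  have hN : Measurable fun t =>
      (∑ β ∈ Finset.piAntidiag (Finset.univ : Finset (Fin d ⊕ Fin d)) k,
        Filter.liminf (fun n => ∫⁻ z, ‖V β n t z‖ₑ ^ 2 ∂(phaseVol d M)) Filter.atTop) +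
        ∫⁻ z, ‖q (t, z)‖ₑ ^ 2 ∂(phaseVol d M) := by
    refine Measurable.add (Finset.measurable_fun_sum _ fun β _ => Measurable.liminf fun n => ?_) ?_
    · exact Measurable.lintegral_prod_right' ((hVm β n).enorm.pow_const 2)
    · exact Measurable.lintegral_prod_right' (hqm.enorm.pow_const 2)
  refine ⟨_, hN, ?_⟩
  filter_upwards [h2, hs, ae_restrict_mem measurableSet_Icc] with t h3 h4 ht
  have h5 := (h4.comp_shear (hc0 t ht)).1
  have h6 : (fun z => m t (shear d (c t) z)) =ᵐ[volume] fun z => q (t, z) :=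
    (measurePreserving_shear (c t)).quasiMeasurePreserving.ae (h3 h4.isFunOn)
  rw [gammaSq_eq h4.isFunOn]
  unfold hsSq sobolevSq
  congr 1
  · refine Finset.sum_congr rfl fun β hβ => ?_
    rw [h5.weakDerivSq_eq_liminf ((mem_piAntidiag_iff_order.1 hβ).le.trans hk)]
    refine congrArg (fun a => Filter.liminf a Filter.atTop) (funext fun n =>
      lintegral_congr fun z => ?_)
    rw [multiDeriv, mol, listDeriv_conv _ (contDiff_kernel d n) (hasCompactSupport_kernel d n)
      h5.locallyIntegrable, conv_congr_ae _ h6]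
    rfl
  · rw [eLpNorm_two_sq]
    exact lintegral_congr_ae ((ae_cell_of_ae h6).mono fun z hz => by simp only [hz])

/-! ### The pointwise-in-time estimates for `𝓗` and `𝓙` -/

/-- `‖(m, p)‖_{Γ^k(τ)}^2`. -/
def pairSum {d : ℕ} (M : SpatialDomain) (k : ℕ) (τ : ℝ) (m : Phase d → ℝ)
    (p : Phase d → Vel d) : ℝ≥0∞ :=
  gammaSq M k τ m + gammaSqVec M k τ p

theorem gammaSqVec_eq {d : ℕ} (M : SpatialDomain) (k : ℕ) (τ : ℝ) (p : Phase d → Vel d) :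
    gammaSqVec M k τ p = ∑ i, gammaSq M k τ (fun z => p z i) := rfl

theorem sum_pairFun {d : ℕ} (M : SpatialDomain) (k : ℕ) (τ : ℝ) (m : Phase d → ℝ)
    (p : Phase d → Vel d) :
    ∑ i, gammaSq M k τ (fun z => pairFun m p z i) = pairSum M k τ m p := by
  rw [Fintype.sum_sum_type, pairSum]
  simp only [Finset.univ_unique, Finset.sum_singleton]
  rfl

theorem sum_pairFun_sub {d : ℕ} (M : SpatialDomain) (k : ℕ) (τ : ℝ) (m₁ m₂ : Phase d → ℝ)
    (p₁ p₂ : Phase d → Vel d) :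
    ∑ i, gammaSq M k τ (fun z => pairFun m₁ p₁ z i - pairFun m₂ p₂ z i) =
      pairSum M k τ (m₁ - m₂) (p₁ - p₂) := by
  rw [← sum_pairFun]
  refine Finset.sum_congr rfl fun i _ => ?_
  rcases i with i | i <;> rfl

theorem memHs_pairFun {d s : ℕ} {M : SpatialDomain} {m : Phase d → ℝ} {p : Phase d → Vel d}
    (hm : MemHs M s m) (hp : ∀ i, MemHs M s fun z => p z i) (i : Unit ⊕ Fin d) :
    MemHs M s fun z => pairFun m p z i := by
  rcases i with i | i
  · exact hm
  · exact hp i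

theorem exists_pair_bound (d : ℕ) (M : SpatialDomain) (s : ℕ) (hs : d + 2 ≤ s) {Φ : ℝ≥0 → ℝ≥0}
    (hΦ : Monotone Φ) : ∃ F : ℝ≥0 → ℝ≥0, Monotone F ∧ ∀ (T : ℝ)
      (H : ℝ → Phase d → ℝ → Vel d → ℝ), HamiltonianAssumption M s T Φ H → ∀ t ∈ Icc 0 T,
      (∀ (m : Phase d → ℝ) (p : Phase d → Vel d), MemHs M s m → (∀ i, MemHs M s fun z => p z i) →
        MemHs M s (fun z => H t z (m z) (p z)) ∧
        (∀ i, MemHs M s (fun z => fluxJ H t z (m z) (p z) i)) ∧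
        ∀ (τ : ℝ) (x : ℝ≥0), 0 ≤ τ → pairSum M (s - 1) τ m p ≤ x →
          pairSum M s τ (fun z => H t z (m z) (p z)) (fun z => fluxJ H t z (m z) (p z)) ≤
            ENNReal.ofReal ((1 + τ) ^ (2 * s)) * F x * (1 + pairSum M s τ m p)) ∧
      (∀ (m₁ m₂ : Phase d → ℝ) (p₁ p₂ : Phase d → Vel d), MemHs M s m₁ → MemHs M s m₂ →
        (∀ i, MemHs M s fun z => p₁ z i) → (∀ i, MemHs M s fun z => p₂ z i) →
        ∀ (τ : ℝ) (x : ℝ≥0), 0 ≤ τ → pairSum M (s - 1) τ m₁ p₁ ≤ x →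
          pairSum M (s - 1) τ m₂ p₂ ≤ x →
          pairSum M s τ (fun z => H t z (m₁ z) (p₁ z) - H t z (m₂ z) (p₂ z))
            (fun z => fluxJ H t z (m₁ z) (p₁ z) - fluxJ H t z (m₂ z) (p₂ z)) ≤
            ENNReal.ofReal ((1 + τ) ^ (2 * s)) * F x *
              (pairSum M s τ (m₁ - m₂) (p₁ - p₂) + pairSum M (s - 1) τ (m₁ - m₂) (p₁ - p₂) *
                (pairSum M s τ m₁ p₁ + pairSum M s τ m₂ p₂))) := by
  obtain ⟨F, hF, h1⟩ := exists_monotone_bound d M s hs (pairMap d) (monotone_hamBound s hΦ)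
  -- One contribution from `H` and one from each of the `d` components of the flux.
  refine ⟨fun x => (1 + d) * F x, fun x y h => mul_le_mul' le_rfl (hF h), fun T H hH t ht => ?_⟩
  have hdiff : Differentiable ℝ (fun y : Phase d × ℝ × Vel d => H t y.1 y.2.1 y.2.2) :=
    (hH.contDiff t ht).differentiable (by simp)
  have hH0 := h1 _ (hH.nonlinFamily ht)
  have hJ0 := fun i => h1 _ (hH.nonlinFamily_fluxComp ht i)
  refine ⟨fun m p hm hp => ?_, fun m₁ m₂ p₁ p₂ hm₁ hm₂ hp₁ hp₂ τ x hτ hx₁ hx₂ => ?_⟩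
  · have hu := memHs_pairFun hm hp
    refine ⟨?_, fun i => ?_, fun τ x hτ hx => ?_⟩
    · have hx := ENNReal.sum_lt_top.2 fun i (_ : i ∈ (Finset.univ : Finset (Unit ⊕ Fin d))) =>
        (hu i).gammaSq_lt_top (Nat.sub_le s 1) le_rfl
      have := ((hH0 0 le_rfl).1 (pairFun m p) _ hu (ENNReal.coe_toNNReal hx.ne).ge).1
      simpa only [pairMap_pairFun, shear_zero_apply] using this
    · have hx := ENNReal.sum_lt_top.2 fun i (_ : i ∈ (Finset.univ : Finset (Unit ⊕ Fin d))) =>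
        (hu i).gammaSq_lt_top (Nat.sub_le s 1) le_rfl
      have := ((hJ0 i 0 le_rfl).1 (pairFun m p) _ hu (ENNReal.coe_toNNReal hx.ne).ge).1
      simpa only [pairMap_pairFun, shear_zero_apply, fluxJ_apply hdiff] using this
    · rw [← sum_pairFun] at hx
      have h2 := ((hH0 τ hτ).1 (pairFun m p) x hu hx).2
      have h3 := fun i => ((hJ0 i τ hτ).1 (pairFun m p) x hu hx).2
      simp only [pairMap_pairFun, sum_pairFun] at h2 h3
      rw [pairSum, gammaSqVec_eq]
      calc _ ≤ ENNReal.ofReal ((1 + τ) ^ (2 * s)) * F x * (1 + pairSum M s τ m p) +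
            ∑ _i : Fin d, ENNReal.ofReal ((1 + τ) ^ (2 * s)) * F x * (1 + pairSum M s τ m p) := by
            refine add_le_add h2 (Finset.sum_le_sum fun i _ => ?_)
            have := h3 i
            simpa only [fluxJ_apply hdiff] using this
        _ = _ := by
            rw [Finset.sum_const, Finset.card_univ, Fintype.card_fin, nsmul_eq_mul]
            push_cast
            ring
  · have hu₁ := memHs_pairFun hm₁ hp₁
    have hu₂ := memHs_pairFun hm₂ hp₂
    rw [← sum_pairFun] at hx₁ hx₂
    have h2 := (hH0 τ hτ).2 (pairFun m₁ p₁) (pairFun m₂ p₂) x hu₁ hu₂ hx₁ hx₂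
    have h3 := fun i => (hJ0 i τ hτ).2 (pairFun m₁ p₁) (pairFun m₂ p₂) x hu₁ hu₂ hx₁ hx₂
    simp only [pairMap_pairFun, sum_pairFun, sum_pairFun_sub] at h2 h3
    set Y := pairSum M s τ (m₁ - m₂) (p₁ - p₂) + pairSum M (s - 1) τ (m₁ - m₂) (p₁ - p₂) *
                (pairSum M s τ m₁ p₁ + pairSum M s τ m₂ p₂)
    rw [pairSum, gammaSqVec_eq]
    calc _ ≤ ENNReal.ofReal ((1 + τ) ^ (2 * s)) * F x * Y +
          ∑ _i : Fin d, ENNReal.ofReal ((1 + τ) ^ (2 * s)) * F x * Y := by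
          refine add_le_add h2 (Finset.sum_le_sum fun i _ => ?_)
          have := h3 i
          simpa only [PiLp.sub_apply, fluxJ_apply hdiff] using this
      _ = _ := by
          rw [Finset.sum_const, Finset.card_univ, Fintype.card_fin, nsmul_eq_mul]
          push_cast
          ring

/-! ### Measurability of `𝓗[m, p]` and `𝓙[m, p]` -/

theorem ae_fst_mem {d : ℕ} (M : SpatialDomain) (T : ℝ) :
    ∀ᵐ y ∂((volume.restrict (Icc 0 T)).prod (phaseVol d M)), y.1 ∈ Icc 0 T :=
  Measure.quasiMeasurePreserving_fst.ae (ae_restrict_mem measurableSet_Icc)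

theorem aestronglyMeasurable_vec {α : Type*} [MeasurableSpace α] {μ : Measure α} {d : ℕ}
    {p : α → Vel d} (hp : ∀ i, AEStronglyMeasurable (fun y => p y i) μ) :
    AEStronglyMeasurable p μ := by
  have h1 : AEMeasurable (fun y i => p y i) μ := aemeasurable_pi_lambda _ fun i =>
    (hp i).aemeasurable
  exact ((WithLp.measurable_toLp 2 (Fin d → ℝ)).comp_aemeasurable h1).aestronglyMeasurable

theorem HamiltonianAssumption.aestronglyMeasurable_comp {d : ℕ} {M : SpatialDomain} {s : ℕ} {T : ℝ}
    {Φ : ℝ≥0 → ℝ≥0} {H : ℝ → Phase d → ℝ → Vel d → ℝ} (hH : HamiltonianAssumption M s T Φ H)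
    (hT : 0 ≤ T) {m : ℝ × Phase d → ℝ} {p : ℝ × Phase d → Vel d}
    (hm : AEStronglyMeasurable m ((volume.restrict (Icc 0 T)).prod (phaseVol d M)))
    (hp : AEStronglyMeasurable p ((volume.restrict (Icc 0 T)).prod (phaseVol d M))) :
    AEStronglyMeasurable (fun y => H y.1 y.2 (m y) (p y))
      ((volume.restrict (Icc 0 T)).prod (phaseVol d M)) := by
  -- Continuity is assumed only for times in `[0, T]`; projecting time onto this interval gives a
  -- globally continuous function that agrees almost everywhere for the restricted measure.
  have hc : Continuous fun y : ℝ × Phase d × ℝ × Vel d =>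
      H (projIcc 0 T hT y.1) y.2.1 y.2.2.1 y.2.2.2 :=
    hH.continuous.comp_continuous (f := fun y : ℝ × Phase d × ℝ × Vel d =>
      ((projIcc 0 T hT y.1 : ℝ), y.2))
      ((continuous_subtype_val.comp (continuous_projIcc.comp continuous_fst)).prodMk
        continuous_snd) fun y => ⟨(projIcc 0 T hT y.1).2, mem_univ _⟩
  have h1 := hc.comp_aestronglyMeasurable (f := fun y : ℝ × Phase d => (y.1, y.2, m y, p y))
    (measurable_fst.aestronglyMeasurable.prodMk
      (measurable_snd.aestronglyMeasurable.prodMk (hm.prodMk hp)))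
  refine h1.congr ((ae_fst_mem M T).mono fun y hy => ?_)
  simp only [projIcc_of_mem hT hy]

theorem isMeasFun_opH {d : ℕ} {M : SpatialDomain} {s : ℕ} {T : ℝ}
    {Φ : ℝ≥0 → ℝ≥0} {H : ℝ → Phase d → ℝ → Vel d → ℝ} (hH : HamiltonianAssumption M s T Φ H)
    (hT : 0 ≤ T) {m : ℝ → Phase d → ℝ} {p : ℝ → Phase d → Vel d} (hm : IsMeasFun M T m)
    (hp : ∀ i, IsMeasFun M T fun t z => p t z i) : IsMeasFun M T (opH H m p) :=
  hH.aestronglyMeasurable_comp hT hm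
    (aestronglyMeasurable_vec (p := fun y : ℝ × Phase d => p y.1 y.2) hp)

/-- No joint continuity of the momentum derivative is assumed. It is a pointwise limit of difference
quotients of `H`, each measurable after composition. -/
theorem isMeasFun_opJ {d : ℕ} {M : SpatialDomain} {s : ℕ} {T : ℝ}
    {Φ : ℝ≥0 → ℝ≥0} {H : ℝ → Phase d → ℝ → Vel d → ℝ} (hH : HamiltonianAssumption M s T Φ H)
    (hT : 0 ≤ T) {m : ℝ → Phase d → ℝ} {p : ℝ → Phase d → Vel d} (hm : IsMeasFun M T m)
    (hp : ∀ i, IsMeasFun M T fun t z => p t z i) (i : Fin d) :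
    IsMeasFun M T fun t z => opJ H m p t z i := by
  have hpv := aestronglyMeasurable_vec (p := fun y : ℝ × Phase d => p y.1 y.2) hp
  set e : Vel d := EuclideanSpace.single i 1
  set r : ℕ → ℝ := fun n => 1 / ((n : ℝ) + 1) with hr
  have hr0 : ∀ n, r n ≠ 0 := fun n => by simp only [hr]; positivity
  have hrl : Filter.Tendsto r Filter.atTop (nhdsWithin 0 {0}ᶜ) :=
    tendsto_nhdsWithin_iff.2 ⟨tendsto_one_div_add_atTop_nhds_zero_nat,
      Filter.Eventually.of_forall hr0⟩
  refine aestronglyMeasurable_of_tendsto_ae Filter.atTop (f := fun n (y : ℝ × Phase d) =>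
    m y.1 y.2 * ((r n)⁻¹ * (H y.1 y.2 (m y.1 y.2) (p y.1 y.2 + r n • e) -
      H y.1 y.2 (m y.1 y.2) (p y.1 y.2)))) (fun n => ?_) ?_
  · refine AEStronglyMeasurable.mul hm (AEStronglyMeasurable.const_mul
      ((hH.aestronglyMeasurable_comp hT hm (hpv.add aestronglyMeasurable_const)).sub
        (hH.aestronglyMeasurable_comp hT hm hpv)) _)
  · filter_upwards [ae_fst_mem M T] with y hy
    set Ht : Phase d × ℝ × Vel d → ℝ := fun x => H y.1 x.1 x.2.1 x.2.2 with hHt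
    have hd : Differentiable ℝ Ht := (hH.contDiff y.1 hy).differentiable (by simp)
    have h1 : HasLineDerivAt ℝ Ht (fderiv ℝ Ht (y.2, m y.1 y.2, p y.1 y.2) (0, 0, e))
        (y.2, m y.1 y.2, p y.1 y.2) (0, 0, e) :=
      (hd (y.2, m y.1 y.2, p y.1 y.2)).hasFDerivAt.hasLineDerivAt _
    have h2 := (h1.tendsto_slope_zero.comp hrl).const_mul (m y.1 y.2)
    have h3 : opJ H m p y.1 y.2 i = m y.1 y.2 *
        fderiv ℝ Ht (y.2, m y.1 y.2, p y.1 y.2) (0, 0, e) := fluxJ_apply hd _ _ _ i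
    change Filter.Tendsto _ _ (nhds (opJ H m p y.1 y.2 i))
    rw [h3]
    refine h2.congr fun n => ?_
    simp [hHt]

/-! ### Estimates in time -/

/-- Measurable pairs with values in `H^s`. -/
structure PairMem {d : ℕ} (M : SpatialDomain) (s : ℕ) (T : ℝ) (m : ℝ → Phase d → ℝ)
    (p : ℝ → Phase d → Vel d) : Prop where
  meas : IsMeasFun M T m
  measVec : ∀ i, IsMeasFun M T fun t z => p t z i
  memHs : ∀ᵐ t ∂(volume.restrict (Icc 0 T)), MemHs M s (m t) ∧ ∀ i, MemHs M s fun z => p t z i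

theorem MemX.pairMem {d : ℕ} {M : SpatialDomain} {s : ℕ} {T : ℝ} {m : ℝ → Phase d → ℝ}
    {p : ℝ → Phase d → Vel d} (h : MemX M s T m p) : PairMem M s T m p := by
  refine ⟨h.m_L2.meas, fun i => (h.p_L2 i).meas, ?_⟩
  filter_upwards [h.m_L2.memHs, Filter.eventually_all.2 fun i => (h.p_L2 i).memHs] with t h1 h2
  exact ⟨h1, h2⟩

theorem PairMem.sub {d : ℕ} {M : SpatialDomain} {s : ℕ} {T : ℝ} {m₁ m₂ : ℝ → Phase d → ℝ}
    {p₁ p₂ : ℝ → Phase d → Vel d} (h₁ : PairMem M s T m₁ p₁) (h₂ : PairMem M s T m₂ p₂) :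
    PairMem M s T (m₁ - m₂) (p₁ - p₂) := by
  refine ⟨h₁.meas.sub h₂.meas, fun i => (h₁.measVec i).sub (h₂.measVec i), ?_⟩
  filter_upwards [h₁.memHs, h₂.memHs] with t h3 h4
  exact ⟨h3.1.sub h4.1, fun i => (h3.2 i).sub (h4.2 i)⟩

theorem PairMem.aemeasurable_pairSum {d : ℕ} {M : SpatialDomain} {s k : ℕ} {T : ℝ}
    {m : ℝ → Phase d → ℝ} {p : ℝ → Phase d → Vel d} (h : PairMem M s T m p) (hk : k ≤ s)
    {c : ℝ → ℝ} (hc : Continuous c) (hc0 : ∀ t ∈ Icc 0 T, 0 ≤ c t) :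
    AEMeasurable (fun t => pairSum M k (c t) (m t) (p t)) (volume.restrict (Icc 0 T)) := by
  refine (aemeasurable_gammaSq h.meas (h.memHs.mono fun t ht => ht.1) hk hc hc0).add ?_
  simp only [gammaSqVec_eq]
  exact Finset.aemeasurable_fun_sum _ fun i _ =>
    aemeasurable_gammaSq (h.measVec i) (h.memHs.mono fun t ht => ht.2 i) hk hc hc0

/-- Superadditivity of the lower integral suffices on the left, so `N₁` and `N₂` need not be
measurable. -/
theorem lintegral_le_of_bound {T : ℝ} {N₁ N₂ E : ℝ → ℝ≥0∞} {K : ℝ≥0∞} (hK : K ≠ ⊤)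
    (h : ∀ᵐ t ∂(volume.restrict (Icc 0 T)), N₁ t + N₂ t ≤ K * (1 + E t)) :
    timeL2Sq T N₁ + timeL2Sq T N₂ ≤ K * (ENNReal.ofReal T + timeL2Sq T E) := by
  refine (le_lintegral_add _ _).trans ((lintegral_mono_ae h).trans (le_of_eq ?_))
  rw [lintegral_const_mul' _ _ hK, lintegral_add_left measurable_const, lintegral_const, one_mul,
    Measure.restrict_apply_univ, Real.volume_Icc, sub_zero]
  rfl

theorem lintegral_le_of_bound_sub {T : ℝ} {N₁ N₂ D D' E₁ E₂ : ℝ → ℝ≥0∞} {K L : ℝ≥0∞} (hK : K ≠ ⊤)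
    (hD : AEMeasurable D (volume.restrict (Icc 0 T)))
    (hE₁ : AEMeasurable E₁ (volume.restrict (Icc 0 T)))
    (hE₂ : AEMeasurable E₂ (volume.restrict (Icc 0 T)))
    (hL : ∀ᵐ t ∂(volume.restrict (Icc 0 T)), D' t ≤ L)
    (h : ∀ᵐ t ∂(volume.restrict (Icc 0 T)), N₁ t + N₂ t ≤ K * (D t + D' t * (E₁ t + E₂ t))) :
    timeL2Sq T N₁ + timeL2Sq T N₂ ≤
      K * (timeL2Sq T D + L * (timeL2Sq T E₁ + timeL2Sq T E₂)) := by
  have h1 : ∀ᵐ t ∂(volume.restrict (Icc 0 T)), N₁ t + N₂ t ≤ K * (D t + L * (E₁ t + E₂ t)) := by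
    filter_upwards [h, hL] with t h2 h3
    exact h2.trans (by gcongr)
  refine (le_lintegral_add _ _).trans ((lintegral_mono_ae h1).trans (le_of_eq ?_))
  rw [lintegral_const_mul' _ _ hK, lintegral_add_left' hD, lintegral_const_mul'' (f := fun t => E₁ t + E₂ t) _ (hE₁.add hE₂),
    lintegral_add_left' hE₁]
  rfl

theorem gammaSq_time_zero {d : ℕ} (M : SpatialDomain) (k : ℕ) (f : Phase d → ℝ) :
    gammaSq M k 0 f = hsSq M k f := by
  rw [gammaSq, hsSq, gammaFrame_zero]

theorem gammaSqVec_time_zero {d : ℕ} (M : SpatialDomain) (k : ℕ) (p : Phase d → Vel d) :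
    gammaSqVec M k 0 p = hsSqVec M k p := by
  rw [gammaSqVec, hsSqVec, gammaFrame_zero]

theorem pairSum_time_zero {d : ℕ} (M : SpatialDomain) (k : ℕ) (m : Phase d → ℝ)
    (p : Phase d → Vel d) : pairSum M k 0 m p = hsSq M k m + hsSqVec M k p := by
  rw [pairSum, gammaSq_time_zero, gammaSqVec_time_zero]

theorem sq_rpow_half (a : ℝ≥0∞) : (a ^ (1 / 2 : ℝ)) ^ 2 = a := by
  rw [← ENNReal.rpow_two, ← ENNReal.rpow_mul]
  norm_num

theorem le_sq_of_rpow_half_le {a : ℝ≥0∞} {R : ℝ≥0} (h : a ^ (1 / 2 : ℝ) ≤ R) :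
    a ≤ ((R ^ 2 : ℝ≥0) : ℝ≥0∞) := by
  rw [← sq_rpow_half a]
  push_cast
  gcongr

theorem rpow_half_le_of_le {a : ℝ≥0∞} {b : ℝ≥0} (h : a ≤ b) :
    a ^ (1 / 2 : ℝ) ≤ ((b ^ (1 / 2 : ℝ) : ℝ≥0) : ℝ≥0∞) := by
  rw [ENNReal.coe_rpow_of_nonneg _ (by norm_num)]
  exact ENNReal.rpow_le_rpow h (by norm_num)

/-- Finiteness of this quantity ensures that its `toNNReal`, the argument of `F`, loses nothing. -/
theorem MemX.linf_bound {d : ℕ} {M : SpatialDomain} {s : ℕ} {T : ℝ} {m : ℝ → Phase d → ℝ}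
    {p : ℝ → Phase d → Vel d} (h : MemX M s T m p) {c : ℝ → ℝ} {T' : ℝ}
    (hc : ∀ t ∈ Icc 0 T, 0 ≤ c t ∧ c t ≤ T') :
    timeLinfSq T (fun t => pairSum M (s - 1) (c t) (m t) (p t)) < ⊤ := by
  set K : ℝ≥0∞ := ENNReal.ofReal ((1 + T') ^ (2 * (s - 1))) *
    ((cardConst d (s - 1) * sobConst d (s - 1) + 1 : ℝ≥0) : ℝ≥0∞) with hK
  have hKt : K < ⊤ := ENNReal.mul_lt_top ENNReal.ofReal_lt_top ENNReal.coe_lt_top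
  have key : ∀ f : ℝ → Phase d → ℝ, MemLinfHs M (s - 1) T f →
      ∀ᵐ t ∂(volume.restrict (Icc 0 T)), gammaSq M (s - 1) (c t) (f t) ≤
        K * timeLinfSq T (fun t => hsSq M (s - 1) (f t)) := by
    intro f hf
    filter_upwards [hf.memHs, ENNReal.ae_le_essSup (fun t => hsSq M (s - 1) (f t)),
      ae_restrict_mem measurableSet_Icc] with t h1 h2 ht
    obtain ⟨h3, h4⟩ := hc t ht
    rw [gammaSq_eq h1.isFunOn]
    refine ((h1.comp_shear h3).2 (s - 1) le_rfl).trans (mul_le_mul' ?_ h2)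
    rw [hK]
    gcongr
  refine (essSup_le_of_ae_le (K * timeLinfSq T (fun t => hsSq M (s - 1) (m t)) +
    ∑ i, K * timeLinfSq T (fun t => hsSq M (s - 1) (fun z => p t z i))) ?_).trans_lt ?_
  · filter_upwards [key m h.m_Linf, Filter.eventually_all.2 fun i => key _ (h.p_Linf i)]
      with t h1 h2
    rw [pairSum, gammaSqVec_eq]
    exact add_le_add h1 (Finset.sum_le_sum fun i _ => h2 i)
  · exact ENNReal.add_lt_top.2 ⟨ENNReal.mul_lt_top hKt h.m_Linf.finite,
      ENNReal.sum_lt_top.2 fun i _ => ENNReal.mul_lt_top hKt (h.p_Linf i).finite⟩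

theorem MemX.l2_finite {d : ℕ} {M : SpatialDomain} {s : ℕ} {T : ℝ} {m : ℝ → Phase d → ℝ}
    {p : ℝ → Phase d → Vel d} (h : MemX M s T m p) :
    timeL2Sq T (fun t => pairSum M s 0 (m t) (p t)) < ⊤ := by
  have hP := h.pairMem
  have h1 : AEMeasurable (fun t => gammaSq M s 0 (m t)) (volume.restrict (Icc 0 T)) :=
    aemeasurable_gammaSq (c := fun _ => 0) h.m_L2.meas h.m_L2.memHs le_rfl continuous_const
      fun _ _ => le_rfl
  have h2 : ∀ i, AEMeasurable (fun t => gammaSq M s 0 (fun z => p t z i))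
      (volume.restrict (Icc 0 T)) := fun i =>
    aemeasurable_gammaSq (c := fun _ => 0) (h.p_L2 i).meas (h.p_L2 i).memHs le_rfl
      continuous_const fun _ _ => le_rfl
  simp only [timeL2Sq, pairSum, gammaSqVec_eq]
  rw [lintegral_add_left' h1, lintegral_finsetSum' _ fun i _ => h2 i]
  simp only [gammaSq_time_zero]
  exact ENNReal.add_lt_top.2 ⟨h.m_L2.finite, ENNReal.sum_lt_top.2 fun i _ => (h.p_L2 i).finite⟩

theorem timeL2Sq_mono_left {T : ℝ} {a b : ℝ → ℝ≥0∞} {B : ℝ≥0∞}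
    (h : timeL2Sq T a + timeL2Sq T b ≤ B) : timeL2Sq T a ≤ B ∧ timeL2Sq T b ≤ B :=
  ⟨le_self_add.trans h, le_add_self.trans h⟩

/-- The estimates for the Hamiltonian nonlinearities. -/
theorem hamiltonian_estimates (d : ℕ) (M : SpatialDomain) (s : ℕ) (hs : d + 2 ≤ s)
    {Φ : ℝ≥0 → ℝ≥0} (hΦ : Monotone Φ) : ∃ F : ℝ≥0 → ℝ≥0, Monotone F ∧
      ∀ T : ℝ, 0 < T → ∀ H : ℝ → Phase d → ℝ → Vel d → ℝ, HamiltonianAssumption M s T Φ H →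
      (∀ m p, MemX M s T m p → MemL2Hs M s T (opH H m p) ∧ MemL2HsVec M s T (opJ H m p)) ∧
      ∀ (c : ℝ → ℝ) (T' : ℝ), Continuous c → (∀ t ∈ Icc 0 T, 0 ≤ c t ∧ c t ≤ T') →
        (∀ m p, MemX M s T m p → ∀ x : ℝ≥0,
          timeLinfSq T (fun t => pairSum M (s - 1) (c t) (m t) (p t)) ≤ x →
          timeL2Sq T (fun t => gammaSq M s (c t) (opH H m p t)) +
              timeL2Sq T (fun t => gammaSqVec M s (c t) (opJ H m p t)) ≤
            ENNReal.ofReal ((1 + T') ^ (2 * s)) * F x *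
              (ENNReal.ofReal T + timeL2Sq T (fun t => pairSum M s (c t) (m t) (p t)))) ∧
        (∀ m₁ p₁ m₂ p₂, MemX M s T m₁ p₁ → MemX M s T m₂ p₂ → ∀ x : ℝ≥0,
          timeLinfSq T (fun t => pairSum M (s - 1) (c t) (m₁ t) (p₁ t)) ≤ x →
          timeLinfSq T (fun t => pairSum M (s - 1) (c t) (m₂ t) (p₂ t)) ≤ x →
          timeL2Sq T (fun t => gammaSq M s (c t) (opH H m₁ p₁ t - opH H m₂ p₂ t)) +
              timeL2Sq T (fun t => gammaSqVec M s (c t) (opJ H m₁ p₁ t - opJ H m₂ p₂ t)) ≤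
            ENNReal.ofReal ((1 + T') ^ (2 * s)) * F x *
              (timeL2Sq T (fun t => pairSum M s (c t) ((m₁ - m₂) t) ((p₁ - p₂) t)) +
                timeLinfSq T (fun t => pairSum M (s - 1) (c t) ((m₁ - m₂) t) ((p₁ - p₂) t)) *
                  (timeL2Sq T (fun t => pairSum M s (c t) (m₁ t) (p₁ t)) +
                    timeL2Sq T (fun t => pairSum M s (c t) (m₂ t) (p₂ t))))) := by
  obtain ⟨F, hF, hpt⟩ := exists_pair_bound d M s hs hΦ
  refine ⟨F, hF, fun T hT H hH => ?_⟩
  have hest : ∀ (c : ℝ → ℝ) (T' : ℝ), Continuous c → (∀ t ∈ Icc 0 T, 0 ≤ c t ∧ c t ≤ T') →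
      ∀ m p, MemX M s T m p → ∀ x : ℝ≥0,
          timeLinfSq T (fun t => pairSum M (s - 1) (c t) (m t) (p t)) ≤ x →
          timeL2Sq T (fun t => gammaSq M s (c t) (opH H m p t)) +
              timeL2Sq T (fun t => gammaSqVec M s (c t) (opJ H m p t)) ≤
            ENNReal.ofReal ((1 + T') ^ (2 * s)) * F x *
              (ENNReal.ofReal T + timeL2Sq T (fun t => pairSum M s (c t) (m t) (p t))) := by
    intro c T' hc hc0 m p h x hx
    refine lintegral_le_of_bound (ENNReal.mul_ne_top ENNReal.ofReal_ne_top ENNReal.coe_ne_top) ?_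
    filter_upwards [h.pairMem.memHs, ENNReal.ae_le_essSup
      (fun t => pairSum M (s - 1) (c t) (m t) (p t)), ae_restrict_mem measurableSet_Icc]
      with t h1 h2 ht
    obtain ⟨h3, h4⟩ := hc0 t ht
    refine (((hpt T H hH t ht).1 (m t) (p t) h1.1 h1.2).2.2 (c t) x h3 (h2.trans hx)).trans ?_
    gcongr
  refine ⟨fun m p h => ?_, fun c T' hc hc0 => ⟨hest c T' hc hc0,
    fun m₁ p₁ m₂ p₂ h₁ h₂ x hx₁ hx₂ => ?_⟩⟩
  · have hc0 : ∀ t ∈ Icc 0 T, (0 : ℝ) ≤ 0 ∧ (0 : ℝ) ≤ 0 := fun _ _ => ⟨le_rfl, le_rfl⟩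
    have hx := h.linf_bound (c := fun _ => 0) hc0
    have h1 := hest (fun _ => 0) 0 continuous_const hc0 m p h _
      (ENNReal.coe_toNNReal hx.ne).ge
    have h2 := timeL2Sq_mono_left h1
    have h3 : ENNReal.ofReal ((1 + 0) ^ (2 * s)) *
        (F (timeLinfSq T (fun t => pairSum M (s - 1) 0 (m t) (p t))).toNNReal : ℝ≥0∞) *
        (ENNReal.ofReal T + timeL2Sq T (fun t => pairSum M s 0 (m t) (p t))) < ⊤ :=
      ENNReal.mul_lt_top (ENNReal.mul_lt_top ENNReal.ofReal_lt_top ENNReal.coe_lt_top)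
        (ENNReal.add_lt_top.2 ⟨ENNReal.ofReal_lt_top, h.l2_finite⟩)
    have hP := h.pairMem
    have hae : ∀ᵐ t ∂(volume.restrict (Icc 0 T)), MemHs M s (opH H m p t) ∧
        ∀ i, MemHs M s (fun z => opJ H m p t z i) := by
      filter_upwards [hP.memHs, ae_restrict_mem measurableSet_Icc] with t h4 ht
      have := (hpt T H hH t ht).1 (m t) (p t) h4.1 h4.2
      exact ⟨this.1, this.2.1⟩
    refine ⟨⟨isMeasFun_opH hH hT.le hP.meas hP.measVec, hae.mono fun t ht => ht.1, ?_⟩, fun i =>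
      ⟨isMeasFun_opJ hH hT.le hP.meas hP.measVec i, hae.mono fun t ht => ht.2 i, ?_⟩⟩
    · have := h2.1.trans_lt h3
      simpa only [gammaSq_time_zero] using this
    · refine lt_of_le_of_lt (lintegral_mono fun t => ?_) (h2.2.trans_lt h3)
      rw [gammaSqVec_eq]
      simp only [gammaSq_time_zero]
      exact Finset.single_le_sum (f := fun i => hsSq M s (fun z => opJ H m p t z i))
        (fun _ _ => zero_le) (Finset.mem_univ i)
  · have hP₁ := h₁.pairMem
    have hP₂ := h₂.pairMem
    have hc' : ∀ t ∈ Icc 0 T, 0 ≤ c t := fun t ht => (hc0 t ht).1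
    refine lintegral_le_of_bound_sub
      (ENNReal.mul_ne_top ENNReal.ofReal_ne_top ENNReal.coe_ne_top)
      ((hP₁.sub hP₂).aemeasurable_pairSum le_rfl hc hc')
      (hP₁.aemeasurable_pairSum le_rfl hc hc') (hP₂.aemeasurable_pairSum le_rfl hc hc')
      (ENNReal.ae_le_essSup
        (fun t => pairSum M (s - 1) (c t) ((m₁ - m₂) t) ((p₁ - p₂) t))) ?_
    filter_upwards [hP₁.memHs, hP₂.memHs,
      ENNReal.ae_le_essSup (fun t => pairSum M (s - 1) (c t) (m₁ t) (p₁ t)),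
      ENNReal.ae_le_essSup (fun t => pairSum M (s - 1) (c t) (m₂ t) (p₂ t)),
      ae_restrict_mem measurableSet_Icc] with t h3 h4 h5 h6 ht
    obtain ⟨h7, h8⟩ := hc0 t ht
    refine ((hpt T H hH t ht).2 (m₁ t) (m₂ t) (p₁ t) (p₂ t) h3.1 h4.1 h3.2 h4.2 (c t) x h7
      (h5.trans hx₁) (h6.trans hx₂)).trans ?_
    simp only [Pi.sub_apply]
    gcongr

/-- The estimates for the terminal coupling. -/
theorem terminal_estimates (d : ℕ) (M : SpatialDomain) (s : ℕ) (hs : d + 2 ≤ s)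
    {Φ : ℝ≥0 → ℝ≥0} (hΦ : Monotone Φ) : ∃ G : ℝ≥0 → ℝ≥0, Monotone G ∧
      ∀ g : Phase d → ℝ → ℝ, TerminalAssumption M s Φ g →
        (∀ μ, MemHs M s μ → MemHs M s (opG g μ)) ∧ ∀ τ : ℝ, 0 ≤ τ →
        (∀ μ, MemHs M s μ → ∀ x : ℝ≥0, gammaSq M s τ μ ≤ x →
          gammaSq M s τ (opG g μ) ≤ ENNReal.ofReal ((1 + τ) ^ (2 * s)) * G x) ∧
        (∀ μ₁ μ₂, MemHs M s μ₁ → MemHs M s μ₂ → ∀ x : ℝ≥0, gammaSq M s τ μ₁ ≤ x →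
          gammaSq M s τ μ₂ ≤ x → gammaSq M s τ (opG g μ₁ - opG g μ₂) ≤
            ENNReal.ofReal ((1 + τ) ^ (2 * s)) * G x * gammaSq M s τ (μ₁ - μ₂)) := by
  have hΨ : Monotone fun r => Φ (r + 1) := fun x y h => hΦ (add_le_add_left h 1)
  obtain ⟨F, hF, h1⟩ := exists_monotone_bound d M s hs
    (ContinuousLinearMap.proj (R := ℝ) (φ := fun _ : Unit => ℝ) ()) hΨ
  obtain ⟨C, hC⟩ := hsSq_le_hsSq d M s
  -- The comparison of `Γ^{s-1}` with `Γ^s` has a constant independent of `τ`, because it is made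
  -- after shearing.
  have hlow : ∀ τ, 0 ≤ τ → ∀ f : Phase d → ℝ, MemHs M s f →
      gammaSq M (s - 1) τ f ≤ C * gammaSq M s τ f := fun τ hτ f hf => by
    rw [gammaSq_eq hf.isFunOn, gammaSq_eq hf.isFunOn]
    exact hC (s - 1) (Nat.sub_le s 1) _ (hf.comp_shear hτ).1
  -- The summand `1 + x` serves the bound, and `1 + C * (x + x)` the Lipschitz estimate once the
  -- lower norm of the difference is absorbed.
  refine ⟨fun x => F (C * x) * (1 + x + C * (x + x)), fun x y h => ?_, fun g hg => ?_⟩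
  · have := hF (mul_le_mul' (le_refl C) h)
    dsimp only
    gcongr
  have h2 := h1 _ hg.nonlinFamily
  have hx' : ∀ τ, 0 ≤ τ → ∀ f : Phase d → ℝ, MemHs M s f → ∀ x : ℝ≥0, gammaSq M s τ f ≤ x →
      ∑ _i : Unit, gammaSq M (s - 1) τ f ≤ ((C * x : ℝ≥0) : ℝ≥0∞) := fun τ hτ f hf x hx => by
    rw [Finset.univ_unique, Finset.sum_singleton]
    push_cast
    exact (hlow τ hτ f hf).trans (mul_le_mul' le_rfl hx)
  refine ⟨fun μ hμ => ?_, fun τ hτ => ⟨fun μ hμ x hx => ?_, fun μ₁ μ₂ hμ₁ hμ₂ x hx₁ hx₂ => ?_⟩⟩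
  · have := ((h2 0 le_rfl).1 (fun z _ => μ z) _ (fun _ => hμ) (hx' 0 le_rfl μ hμ _
      (ENNReal.coe_toNNReal (hμ.gammaSq_lt_top le_rfl le_rfl).ne).ge)).1
    simp only [shear_zero_apply] at this
    exact this
  · have := ((h2 τ hτ).1 (fun z _ => μ z) _ (fun _ => hμ) (hx' τ hτ μ hμ x hx)).2
    simp only [Finset.univ_unique, Finset.sum_singleton] at this
    refine this.trans ?_
    rw [mul_assoc]
    refine mul_le_mul' le_rfl ?_
    push_cast
    refine mul_le_mul' le_rfl ((add_le_add le_rfl hx).trans le_self_add)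
  · have := (h2 τ hτ).2 (fun z _ => μ₁ z) (fun z _ => μ₂ z) _ (fun _ => hμ₁) (fun _ => hμ₂)
      (hx' τ hτ μ₁ hμ₁ x hx₁) (hx' τ hτ μ₂ hμ₂ x hx₂)
    simp only [Finset.univ_unique, Finset.sum_singleton] at this
    refine this.trans ?_
    have h3 := hlow τ hτ (μ₁ - μ₂) (hμ₁.sub hμ₂)
    change ENNReal.ofReal ((1 + τ) ^ (2 * s)) * F (C * x) * (gammaSq M s τ (μ₁ - μ₂) +
      gammaSq M (s - 1) τ (μ₁ - μ₂) * (gammaSq M s τ μ₁ + gammaSq M s τ μ₂)) ≤ _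
    set D := gammaSq M s τ (μ₁ - μ₂)
    push_cast
    calc _ ≤ ENNReal.ofReal ((1 + τ) ^ (2 * s)) * F (C * x) * (D + C * D * (x + x)) := by gcongr
      _ = ENNReal.ofReal ((1 + τ) ^ (2 * s)) * (F (C * x) * (1 + C * (x + x))) * D := by ring
      _ ≤ _ := by
          gcongr
          exact le_self_add

end
end KineticMFG

/-! ### Assembly of the theorem. -/

open KineticMFG in
theorem proposition2p5 (d : ℕ) (hd : 1 ≤ d) (M : SpatialDomain) (s : ℕ)
    (hs : sCrit d + 1 ≤ s) :
    -- (i)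
    (∀ Φ : ℝ≥0 → ℝ≥0, Monotone Φ → ∃ F : ℝ≥0 → ℝ≥0, Monotone F ∧
      ∀ T : ℝ, 0 < T → ∀ H : ℝ → Phase d → ℝ → Vel d → ℝ, HamiltonianAssumption M s T Φ H →
        -- the operators are well defined
        (∀ m p, MemX M s T m p →
          MemL2Hs M s T (opH H m p) ∧ MemL2HsVec M s T (opJ H m p)) ∧
        -- they are bounded on bounded sets
        (∀ R : ℝ≥0, ∃ C : ℝ≥0, ∀ m p, MemX M s T m p → normX M s T m p ≤ R →
          timeL2Sq T (fun t => hsSq M s (opH H m p t)) ^ (1 / 2 : ℝ) ≤ C ∧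
          timeL2Sq T (fun t => hsSqVec M s (opJ H m p t)) ^ (1 / 2 : ℝ) ≤ C) ∧
        -- they are Lipschitz continuous on bounded sets
        (∀ R : ℝ≥0, ∃ C : ℝ≥0, ∀ m₁ p₁ m₂ p₂, MemX M s T m₁ p₁ → MemX M s T m₂ p₂ →
          normX M s T m₁ p₁ ≤ R → normX M s T m₂ p₂ ≤ R →
          timeL2Sq T (fun t => hsSq M s (opH H m₁ p₁ t - opH H m₂ p₂ t)) ^ (1 / 2 : ℝ) ≤
            C * normX M s T (m₁ - m₂) (p₁ - p₂) ∧
          timeL2Sq T (fun t => hsSqVec M s (opJ H m₁ p₁ t - opJ H m₂ p₂ t)) ^ (1 / 2 : ℝ) ≤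
            C * normX M s T (m₁ - m₂) (p₁ - p₂)) ∧
        -- the quantitative bound
        (∀ m p, MemX M s T m p →
          timeL2Sq T (fun t => gammaSq M s t (opH H m p t)) +
              timeL2Sq T (fun t => gammaSqVec M s t (opJ H m p t)) ≤
            (ENNReal.ofReal T + pairL2GammaSq M s T m p) * ENNReal.ofReal ((1 + T) ^ (2 * s)) *
              F (pairLinfGammaSq M (s - 1) T m p).toNNReal) ∧
        -- the quantitative Lipschitz estimate
        (∀ m₁ p₁ m₂ p₂, MemX M s T m₁ p₁ → MemX M s T m₂ p₂ →
          timeL2Sq T (fun t => gammaSq M s t (opH H m₁ p₁ t - opH H m₂ p₂ t)) +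
              timeL2Sq T (fun t => gammaSqVec M s t (opJ H m₁ p₁ t - opJ H m₂ p₂ t)) ≤
            ENNReal.ofReal ((1 + T) ^ (2 * s)) *
              F (max (pairLinfGammaSq M (s - 1) T m₁ p₁)
                (pairLinfGammaSq M (s - 1) T m₂ p₂)).toNNReal *
              (pairL2GammaSq M s T (m₁ - m₂) (p₁ - p₂) +
                pairLinfGammaSq M (s - 1) T (m₁ - m₂) (p₁ - p₂) *
                  (ENNReal.ofReal T +
                    max (pairL2GammaSq M s T m₁ p₁) (pairL2GammaSq M s T m₂ p₂))))) ∧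
    -- (ii)
    (∀ Φ : ℝ≥0 → ℝ≥0, Monotone Φ → ∃ G : ℝ≥0 → ℝ≥0, Monotone G ∧
      ∀ g : Phase d → ℝ → ℝ, TerminalAssumption M s Φ g →
        -- the operator is well defined
        (∀ μ, MemHs M s μ → MemHs M s (opG g μ)) ∧
        -- it is bounded on bounded sets
        (∀ R : ℝ≥0, ∃ C : ℝ≥0, ∀ μ, MemHs M s μ → hsSq M s μ ^ (1 / 2 : ℝ) ≤ R →
          hsSq M s (opG g μ) ^ (1 / 2 : ℝ) ≤ C) ∧
        -- it is Lipschitz continuous on bounded sets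
        (∀ R : ℝ≥0, ∃ C : ℝ≥0, ∀ μ₁ μ₂, MemHs M s μ₁ → MemHs M s μ₂ →
          hsSq M s μ₁ ^ (1 / 2 : ℝ) ≤ R → hsSq M s μ₂ ^ (1 / 2 : ℝ) ≤ R →
          hsSq M s (opG g μ₁ - opG g μ₂) ^ (1 / 2 : ℝ) ≤
            C * hsSq M s (μ₁ - μ₂) ^ (1 / 2 : ℝ)) ∧
        ∀ T : ℝ, 0 < T →
          -- the quantitative bound
          (∀ μ, MemHs M s μ →
            gammaSq M s T (opG g μ) ≤
              ENNReal.ofReal ((1 + T) ^ (2 * s)) * G (gammaSq M s T μ).toNNReal) ∧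
          -- the quantitative Lipschitz estimate
          (∀ μ₁ μ₂, MemHs M s μ₁ → MemHs M s μ₂ →
            gammaSq M s T (opG g μ₁ - opG g μ₂) ≤
              ENNReal.ofReal ((1 + T) ^ (2 * s)) *
                G (max (gammaSq M s T μ₁) (gammaSq M s T μ₂)).toNNReal *
                gammaSq M s T (μ₁ - μ₂))) := by
  refine ⟨fun Φ hΦ => ?_, fun Φ hΦ => ?_⟩
  · obtain ⟨F, hF, h⟩ := hamiltonian_estimates d M s hs hΦ
    -- The factor two pays for replacing the sum of the two `L²_t Γ^s` norms by twice their maximum.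
    refine ⟨fun x => 2 * F x, fun x y hxy => mul_le_mul' le_rfl (hF hxy), fun T hT H hH => ?_⟩
    obtain ⟨hmem, hest⟩ := h T hT H hH
    have hc0 : ∀ t ∈ Icc 0 T, (0 : ℝ) ≤ 0 ∧ (0 : ℝ) ≤ 0 := fun _ _ => ⟨le_rfl, le_rfl⟩
    have hcT : ∀ t ∈ Icc 0 T, (0 : ℝ) ≤ t ∧ t ≤ T := fun t ht => ht
    -- Zero shear turns the estimates into statements about `H^s`; the identity parameter below
    -- gives `Γ^s` at time `t`.
    obtain ⟨hb0, hl0⟩ := hest (fun _ => 0) 0 continuous_const hc0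
    obtain ⟨hbT, hlT⟩ := hest (fun t => t) T continuous_id hcT
    simp only [pairSum_time_zero, gammaSq_time_zero, gammaSqVec_time_zero, add_zero, one_pow,
      ENNReal.ofReal_one, one_mul] at hb0 hl0
    have hnorm : ∀ {R : ℝ≥0} {m : ℝ → Phase d → ℝ} {p : ℝ → Phase d → Vel d}, normX M s T m p ≤ R →
        timeL2Sq T (fun t => hsSq M s (m t) + hsSqVec M s (p t)) ≤ ((R ^ 2 : ℝ≥0) : ℝ≥0∞) ∧
        timeLinfSq T (fun t => hsSq M (s - 1) (m t) + hsSqVec M (s - 1) (p t)) ≤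
          ((R ^ 2 : ℝ≥0) : ℝ≥0∞) := fun hR =>
      ⟨le_sq_of_rpow_half_le (le_self_add.trans hR), le_sq_of_rpow_half_le (le_add_self.trans hR)⟩
    refine ⟨hmem, fun R => ?_, fun R => ?_, fun m p hmp => ?_, fun m₁ p₁ m₂ p₂ h₁ h₂ => ?_⟩
    · refine ⟨(F (R ^ 2) * (T.toNNReal + R ^ 2)) ^ (1 / 2 : ℝ), fun m p hmp hR => ?_⟩
      obtain ⟨h1, h2⟩ := hnorm hR
      have h3 := timeL2Sq_mono_left ((hb0 m p hmp _ h2).trans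
        (show _ ≤ ((F (R ^ 2) * (T.toNNReal + R ^ 2) : ℝ≥0) : ℝ≥0∞) by
          push_cast
          push_cast at h1
          exact mul_le_mul' le_rfl (add_le_add le_rfl h1)))
      exact ⟨rpow_half_le_of_le h3.1, rpow_half_le_of_le h3.2⟩
    · refine ⟨(F (R ^ 2) * (1 + (R ^ 2 + R ^ 2))) ^ (1 / 2 : ℝ),
        fun m₁ p₁ m₂ p₂ h₁ h₂ hR₁ hR₂ => ?_⟩
      obtain ⟨h3, h4⟩ := hnorm hR₁
      obtain ⟨h5, h6⟩ := hnorm hR₂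
      have h7 := hl0 m₁ p₁ m₂ p₂ h₁ h₂ _ h4 h6
      set a := timeL2Sq T (fun t => hsSq M s ((m₁ - m₂) t) + hsSqVec M s ((p₁ - p₂) t)) with ha
      set b := timeLinfSq T (fun t => hsSq M (s - 1) ((m₁ - m₂) t) +
        hsSqVec M (s - 1) ((p₁ - p₂) t)) with hb
      have h8 := timeL2Sq_mono_left (h7.trans
        (show _ ≤ ((F (R ^ 2) * (1 + (R ^ 2 + R ^ 2)) : ℝ≥0) : ℝ≥0∞) * (a + b) by
          rw [ENNReal.coe_mul, mul_assoc]
          refine mul_le_mul' le_rfl ?_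
          refine (add_le_add le_rfl (mul_le_mul' le_rfl (add_le_add h3 h5))).trans ?_
          rw [ENNReal.coe_add, ENNReal.coe_one, ENNReal.coe_add, mul_add _ a b, mul_comm b]
          exact add_le_add (le_mul_of_one_le_left zero_le le_self_add)
            (mul_le_mul' le_add_self le_rfl)))
      have h9 : ∀ y : ℝ≥0∞, y ≤ ((F (R ^ 2) * (1 + (R ^ 2 + R ^ 2)) : ℝ≥0) : ℝ≥0∞) * (a + b) →
          y ^ (1 / 2 : ℝ) ≤ (((F (R ^ 2) * (1 + (R ^ 2 + R ^ 2))) ^ (1 / 2 : ℝ) : ℝ≥0) : ℝ≥0∞) *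
            normX M s T (m₁ - m₂) (p₁ - p₂) := by
        intro y hy
        refine (ENNReal.rpow_le_rpow hy (by norm_num)).trans ?_
        rw [ENNReal.mul_rpow_of_nonneg _ _ (by norm_num),
          ← ENNReal.coe_rpow_of_nonneg _ (by norm_num)]
        -- Subadditivity of the square root passes from the sum of squared norms to the intersection
        -- norm, which is a sum of norms.
        exact mul_le_mul' le_rfl (ENNReal.rpow_add_le_add_rpow a b (by norm_num) (by norm_num))
      exact ⟨h9 _ h8.1, h9 _ h8.2⟩
    · have hfin := hmp.linf_bound hcT
      have h1 := hbT m p hmp _ (ENNReal.coe_toNNReal hfin.ne).ge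
      refine h1.trans ?_
      change ENNReal.ofReal ((1 + T) ^ (2 * s)) * (F (pairLinfGammaSq M (s - 1) T m p).toNNReal) *
        (ENNReal.ofReal T + pairL2GammaSq M s T m p) ≤ _
      calc _ = (ENNReal.ofReal T + pairL2GammaSq M s T m p) *
            ENNReal.ofReal ((1 + T) ^ (2 * s)) *
              F (pairLinfGammaSq M (s - 1) T m p).toNNReal := by ring
        _ ≤ _ := by
            gcongr
            exact le_mul_of_one_le_left zero_le (by norm_num)
    · have hfin : max (pairLinfGammaSq M (s - 1) T m₁ p₁) (pairLinfGammaSq M (s - 1) T m₂ p₂) < ⊤ :=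
        max_lt (h₁.linf_bound hcT) (h₂.linf_bound hcT)
      have hx := (ENNReal.coe_toNNReal hfin.ne).ge
      have h1 := hlT m₁ p₁ m₂ p₂ h₁ h₂ _ ((le_max_left _ _).trans hx) ((le_max_right _ _).trans hx)
      refine h1.trans ?_
      set x := (max (pairLinfGammaSq M (s - 1) T m₁ p₁)
        (pairLinfGammaSq M (s - 1) T m₂ p₂)).toNNReal
      change ENNReal.ofReal ((1 + T) ^ (2 * s)) * F x *
        (pairL2GammaSq M s T (m₁ - m₂) (p₁ - p₂) + pairLinfGammaSq M (s - 1) T (m₁ - m₂) (p₁ - p₂) *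
          (pairL2GammaSq M s T m₁ p₁ + pairL2GammaSq M s T m₂ p₂)) ≤ _
      set P := max (pairL2GammaSq M s T m₁ p₁) (pairL2GammaSq M s T m₂ p₂)
      set A := pairL2GammaSq M s T (m₁ - m₂) (p₁ - p₂)
      set L := pairLinfGammaSq M (s - 1) T (m₁ - m₂) (p₁ - p₂)
      push_cast
      -- Doubling `A` as well lets the factor two be taken out in common; the summand `T` in the
      -- target is slack.
      calc _ ≤ ENNReal.ofReal ((1 + T) ^ (2 * s)) * F x * (2 * A + L * (P + P)) := by
            gcongr
            · exact le_mul_of_one_le_left zero_le (by norm_num)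
            · exact le_max_left _ _
            · exact le_max_right _ _
        _ = ENNReal.ofReal ((1 + T) ^ (2 * s)) * (2 * F x) * (A + L * P) := by ring
        _ ≤ _ := by
            gcongr
            exact le_add_self
  · obtain ⟨G, hG, h⟩ := terminal_estimates d M s hs hΦ
    refine ⟨G, hG, fun g hg => ?_⟩
    obtain ⟨hmem, hest⟩ := h g hg
    obtain ⟨hb0, hl0⟩ := hest 0 le_rfl
    simp only [gammaSq_time_zero, add_zero, one_pow, ENNReal.ofReal_one, one_mul] at hb0 hl0
    refine ⟨hmem, fun R => ⟨G (R ^ 2) ^ (1 / 2 : ℝ), fun μ hμ hR => ?_⟩,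
      fun R => ⟨G (R ^ 2) ^ (1 / 2 : ℝ), fun μ₁ μ₂ hμ₁ hμ₂ hR₁ hR₂ => ?_⟩, fun T hT =>
      ⟨fun μ hμ => ?_, fun μ₁ μ₂ hμ₁ hμ₂ => ?_⟩⟩
    · exact rpow_half_le_of_le (hb0 μ hμ _ (le_sq_of_rpow_half_le hR))
    · refine (ENNReal.rpow_le_rpow (hl0 μ₁ μ₂ hμ₁ hμ₂ _ (le_sq_of_rpow_half_le hR₁)
        (le_sq_of_rpow_half_le hR₂)) (by norm_num)).trans (le_of_eq ?_)
      rw [ENNReal.mul_rpow_of_nonneg _ _ (by norm_num),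
        ENNReal.coe_rpow_of_nonneg _ (by norm_num)]
    · exact (hest T hT.le).1 μ hμ _
        (ENNReal.coe_toNNReal (hμ.gammaSq_lt_top le_rfl hT.le).ne).ge
    · have hfin : max (gammaSq M s T μ₁) (gammaSq M s T μ₂) < ⊤ :=
        max_lt (hμ₁.gammaSq_lt_top le_rfl hT.le) (hμ₂.gammaSq_lt_top le_rfl hT.le)
      have hx := (ENNReal.coe_toNNReal hfin.ne).ge
      exact (hest T hT.le).2 μ₁ μ₂ hμ₁ hμ₂ _ ((le_max_left _ _).trans hx)
        ((le_max_right _ _).trans hx)
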